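/- Let $D\ge 2$ be an integer and let $\mathrm{Rat}_D$ be the space of rational maps $f:\widehat{\mathbb C}\to\widehat{\mathbb C}$ of degree $D$, topologized as the open subset of $\mathbb P^{2D+1}(\mathbb C)$ of classes $[P:Q]$ of pairs of coprime polynomials $P,Q$ with $\max(\deg P,\deg Q)=D$, where $f=P/Q$. A map $f\in\mathrm{Rat}_D$ is a \emph{Lattès map} if there are a lattice $\Lambda\subset\mathbb C$ of rank $2$, an affine map $L:\mathbb C/\Lambda\to\mathbb C/\Lambda$, $L(\tau)=\alpha\tau+\beta$ with $\alpha,\beta\in\mathbb C$ and $\alpha\Lambda\subset\Lambda$, and a finite-to-one holomorphic map $\Theta:\mathbb C/\Lambda\to\widehat{\mathbb C}$ such that $f\circ\Theta=\Theta\circ L$. It is a \emph{flexible Lattès map} if this holds with $L(\tau)=a\tau+b$, where $a\in\mathbb Z$, $a^2=D$ and $2b\in\Lambda$, and with $\Theta$ two-to-one and ramified exactly at the points of $\tfrac12\Lambda/\Lambda$. A map $f\in\mathrm{Rat}_D$ is \emph{strictly postcritically finite} if the forward orbit of each critical point of $f$ meets a repelling cycle of $f$. **Theorem.** For every $D\ge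 2$ and every flexible Lattès map $f\in\mathrm{Rat}_D$ there is a sequence $(g_k)$ in $\mathrm{Rat}_D$ that converges to $f$, such that each $g_k$ is strictly postcritically finite and is not a Lattès map. -/

import Mathlib

open Filter Topology Polynomial
open scoped OnePoint

noncomputable section

namespace LattesMaps

/-! ### The Riemann sphere `OnePoint ℂ` and its two standard charts -/

/-- The standard coordinate on the Riemann sphere centred near `x`: it is `y ↦ y` if `x` is finite
and `y ↦ 1 / y` (with `∞ ↦ 0`) if `x = ∞`. The value `0` at the one point outside
the domain of the chart (`∞`, respectively `0`) is a junk value. -/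
def coord (x : OnePoint ℂ) (y : OnePoint ℂ) : ℂ :=
  x.elim (y.elim 0 fun w => w⁻¹) fun _ => y.elim 0 fun w => w

/-- The inverse of `coord x`: it is `z ↦ z` if `x` is finite and `z ↦ 1 / z` (with `0 ↦ ∞`)
if `x = ∞`. -/
def param (x : OnePoint ℂ) (z : ℂ) : OnePoint ℂ :=
  x.elim (if z = 0 then ∞ else ((z⁻¹ : ℂ) : OnePoint ℂ)) fun _ => (z : OnePoint ℂ)

/-- The derivative at `x` of a self-map of the sphere, read in the standard charts at `x` and
at `f x`. Its vanishing does not depend on the charts; if `f x = x`, then it is the multiplier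
of `f` at the fixed point `x`. -/
def sphereDeriv (f : OnePoint ℂ → OnePoint ℂ) (x : OnePoint ℂ) : ℂ :=
  deriv (fun z => coord (f x) (f (param x z))) (coord x x)

/-- A map from the plane to the Riemann sphere is holomorphic if it is continuous and analytic
in the standard charts of the sphere. -/
def HolomorphicToSphere (h : ℂ → OnePoint ℂ) : Prop :=
  Continuous h ∧ ∀ z, AnalyticAt ℂ (fun w => coord (h z) (h w)) z

/-! ### The space of rational maps of degree `D` -/

/-- The polynomial `c 0 + c 1 X + ⋯ + c D X ^ D`. -/
def toPoly {D : ℕ} (c : Fin (D + 1) → ℂ) : ℂ[X] :=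
  ∑ i : Fin (D + 1), C (c i) * X ^ (i : ℕ)

/-- The pairs of coefficient vectors of polynomials `P`, `Q` without common factor such that the
maximum of the degrees of `P` and `Q` is `D`, that is, such that `P / Q` is a rational
map of degree `D`. It carries the topology induced from `ℂ ^ (D + 1) × ℂ ^ (D + 1)`. -/
abbrev RatPair (D : ℕ) : Type :=
  {c : (Fin (D + 1) → ℂ) × (Fin (D + 1) → ℂ) //
    IsCoprime (toPoly c.1) (toPoly c.2) ∧ (c.1 (Fin.last D) ≠ 0 ∨ c.2 (Fin.last D) ≠ 0)}

/-- Two pairs define the same rational map if they are proportional. -/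
def ratSetoid (D : ℕ) : Setoid (RatPair D) where
  r c d := ∃ t : ℂ, t ≠ 0 ∧ d.1 = t • c.1
  iseqv :=
    { refl := fun c => ⟨1, one_ne_zero, (one_smul ℂ c.1).symm⟩
      symm := by
        rintro c d ⟨t, ht, h⟩
        exact ⟨t⁻¹, inv_ne_zero ht, by rw [h, smul_smul, inv_mul_cancel₀ ht, one_smul]⟩
      trans := by
        rintro c d e ⟨t, ht, h⟩ ⟨s, hs, h'⟩
        exact ⟨s * t, mul_ne_zero hs ht, by rw [h', h, smul_smul]⟩ }

/-- The space of rational maps of degree `D`: the open subset of the projective space of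
dimension `2 D + 1` given by the classes `[P : Q]` of pairs as above, up to scaling. -/
def RatSpace (D : ℕ) : Type := Quotient (ratSetoid D)

/-- The usual topology, that is, convergence of suitably normalized coefficients. -/
instance (D : ℕ) : TopologicalSpace (RatSpace D) :=
  inferInstanceAs (TopologicalSpace (Quotient (ratSetoid D)))

/-- The self-map `P / Q` of the Riemann sphere defined by a pair. -/
def RatPair.toFun {D : ℕ} (c : RatPair D) (x : OnePoint ℂ) : OnePoint ℂ :=
  x.elim
    (if c.1.2 (Fin.last D) = 0 then ∞
      else ((c.1.1 (Fin.last D) / c.1.2 (Fin.last D) : ℂ) : OnePoint ℂ))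
    fun z =>
      if (toPoly c.1.2).eval z = 0 then ∞
        else (((toPoly c.1.1).eval z / (toPoly c.1.2).eval z : ℂ) : OnePoint ℂ)

theorem toPoly_smul {D : ℕ} (t : ℂ) (c : Fin (D + 1) → ℂ) : toPoly (t • c) = C t * toPoly c := by
  simp only [toPoly, Finset.mul_sum, Pi.smul_apply, smul_eq_mul, C_mul, mul_assoc]

theorem RatPair.toFun_congr {D : ℕ} (c d : RatPair D) (h : (ratSetoid D).r c d) :
    c.toFun = d.toFun := by
  obtain ⟨t, ht, h⟩ := h
  funext x
  induction x using OnePoint.rec with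
  | infty =>
    simp only [RatPair.toFun, OnePoint.elim_infty, h, Prod.smul_fst, Prod.smul_snd, Pi.smul_apply,
      smul_eq_mul, mul_eq_zero, ht, false_or, mul_div_mul_left _ _ ht]
  | coe z =>
    simp only [RatPair.toFun, OnePoint.elim_some, h, Prod.smul_fst, Prod.smul_snd, toPoly_smul,
      eval_mul, eval_C, mul_eq_zero, ht, false_or, mul_div_mul_left _ _ ht]

/-- The self-map of the Riemann sphere given by a rational map. -/
def RatSpace.toFun {D : ℕ} (f : RatSpace D) : OnePoint ℂ → OnePoint ℂ :=
  Quotient.lift RatPair.toFun RatPair.toFun_congr f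

/-! ### Dynamical notions -/

/-- `x` is a critical point of `f`. -/
def IsCriticalPoint (f : OnePoint ℂ → OnePoint ℂ) (x : OnePoint ℂ) : Prop :=
  sphereDeriv f x = 0

/-- `x` lies on a repelling cycle of `f`: it is periodic, with multiplier of modulus `> 1`. -/
def IsRepellingPeriodic (f : OnePoint ℂ → OnePoint ℂ) (x : OnePoint ℂ) : Prop :=
  ∃ n : ℕ, 0 < n ∧ Function.IsPeriodicPt f n x ∧ 1 < ‖sphereDeriv f^[n] x‖

/-- The orbit of each critical point meets a repelling cycle. -/
def IsStrictlyPostcriticallyFinite {D : ℕ} (f : RatSpace D) : Prop :=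
  ∀ x, IsCriticalPoint f.toFun x → ∃ n : ℕ, IsRepellingPeriodic f.toFun (f.toFun^[n] x)

/-- A map from a complex torus to the Riemann sphere is holomorphic if its lift to `ℂ` is. -/
def HolomorphicOnTorus (Λ : PeriodPair) (Θ : ℂ ⧸ Λ.lattice → OnePoint ℂ) : Prop :=
  HolomorphicToSphere fun z => Θ (Submodule.Quotient.mk z)

/-- A rational map `f` is a Lattès map if there are a lattice `Λ` of rank two, an affine map
`L : z ↦ α z + β` of the torus `ℂ / Λ` and a finite-to-one holomorphic map `Θ` from `ℂ / Λ` to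
the Riemann sphere such that `f ∘ Θ = Θ ∘ L`. -/
def IsLattes {D : ℕ} (f : RatSpace D) : Prop :=
  ∃ (Λ : PeriodPair) (α β : ℂ) (Θ : ℂ ⧸ Λ.lattice → OnePoint ℂ),
    (∀ l ∈ Λ.lattice, α * l ∈ Λ.lattice) ∧
    HolomorphicOnTorus Λ Θ ∧
    (∀ y, (Θ ⁻¹' {y}).Finite) ∧
    ∀ z : ℂ, f.toFun (Θ (Submodule.Quotient.mk z)) = Θ (Submodule.Quotient.mk (α * z + β))

/-- A rational map `f` of degree `D` is a flexible Lattès map if there are a lattice `Λ` of rank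
two, an affine map `L : τ ↦ a τ + b` of the torus `ℂ / Λ` with `a` an integer, `a ^ 2 = D` and
`2 b ∈ Λ`, and a two-to-one holomorphic map `Θ` from `ℂ / Λ` to the Riemann sphere, ramified
exactly at the points of `(1/2) Λ`, such that `f ∘ Θ = Θ ∘ L`. The fibre of `Θ` through `τ` thus
has one point if `2 τ = 0` in the torus and two points otherwise. -/
def IsFlexibleLattes {D : ℕ} (f : RatSpace D) : Prop :=
  ∃ (Λ : PeriodPair) (a : ℤ) (b : ℂ) (Θ : ℂ ⧸ Λ.lattice → OnePoint ℂ),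
    a ^ 2 = (D : ℤ) ∧
    2 * b ∈ Λ.lattice ∧
    HolomorphicOnTorus Λ Θ ∧
    (∀ τ, 2 • τ = 0 → (Θ ⁻¹' {Θ τ}).ncard = 1) ∧
    (∀ τ, 2 • τ ≠ 0 → (Θ ⁻¹' {Θ τ}).ncard = 2) ∧
    ∀ z : ℂ, f.toFun (Θ (Submodule.Quotient.mk z)) = Θ (Submodule.Quotient.mk ((a : ℂ) * z + b))

end LattesMaps

end

/-!
# Approximation of flexible Lattès maps by strictly postcritically finite maps

In suitable coordinates a flexible Lattès map of degree `D = a ^ 2` is the map induced by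
`z ↦ a z + b`, with `2 b` an integer, on the quotient of `ℂ / (ℤ + ℤ τ₀)` by `z ↦ -z`
(`IsFlexibleLattes.exists_normal_form`). The quotient map `proj τ` is a ratio of squares of theta
functions, normalized so that its four critical values are `∞`, `0` (over `0` and `1 / 2`) and two
further points `A τ`, `B τ` (over `τ / 2` and `τ / 2 + 1 / 2`).

The approximating maps are sought in the two-parameter family `F = e ^ m f_τ`, where `f_τ` is the
Lattès map with parameter `τ`, i.e. `F (proj τ z) = e ^ m proj τ (a z + b)`; the parameters
`(τ₀, 0)` give the original map (`exists_family`). The critical points of `F` are mapped to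
`0`, `∞`, `e ^ m A τ` or `e ^ m B τ`. The set `{0, ∞}` is fixed by multiplication by `e ^ m`, hence
mapped into itself by `F`, and its cycles are repelling, with multiplier close to a power of `D`. Thus `F` is strictly
postcritically finite as soon as the orbits of the two moving critical values hit `{0, ∞}`
(`IsPerturbed.strictlyPCF`). If, in addition, one of these orbits
passes through a critical point of `F` on its way, then `F` is not a Lattès map: a
semiconjugacy `Θ` to an affine map of a torus would have local degree at least `4` over some
point of a cycle in `{0, ∞}`, which would force the multiplier of that cycle to be much larger
than it is (`IsPerturbed.not_isTorusSemiconj`).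

Parameters arbitrarily close to `(τ₀, 0)` with these properties are found by
renormalization (`exists_parameters`). Near a half-period `ω` the function `proj τ (ω + v)` is a
local coordinate in `s = v ^ 2`, and in this coordinate `F` is multiplication by `D` up to a
perturbation of order `m`, which to first order does not move `∞` and `0` and moves the two other
critical values in opposite directions. For `m` of order `D ^ (-N)` the two orbits are
therefore found, after about `N` steps, at positions close to `w` and `-w`, where `w` is
a rescaled parameter (`exists_renormalized_orbit`). Hitting the prescribed targets
`σ τ ^ 2` and `σ' τ ^ 2`, with `a σ`, `a σ'` suitable half-periods, amounts in the limit to the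
system `w = σ τ ^ 2`, `-w = σ' τ ^ 2`. It has nondegenerate solutions for a dense set of `τ`, namely where
`σ' τ = i σ τ` (`exists_targetPt_eq_I_mul`), and these persist for large `N`
by Hurwitz' theorem in two variables (`exists_zero_of_nondegenerate`).
-/

noncomputable section

namespace LattesMaps


/-! ### Separately holomorphic functions of two variables -/

/-- A function on an open subset of `ℂ × ℂ` that is locally bounded and holomorphic in each
variable separately. -/
structure SepHolOn (f : ℂ × ℂ → ℂ) (U : Set (ℂ × ℂ)) : Prop where
  isOpen : IsOpen U
  bdd : ∀ p ∈ U, ∃ M : ℝ, ∀ᶠ x in 𝓝 p, ‖f x‖ ≤ M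
  fst : ∀ p ∈ U, DifferentiableAt ℂ (fun x => f (x, p.2)) p.1
  snd : ∀ p ∈ U, DifferentiableAt ℂ (fun y => f (p.1, y)) p.2

theorem SepHolOn.swap {f : ℂ × ℂ → ℂ} {U : Set (ℂ × ℂ)} (h : SepHolOn f U) :
    SepHolOn (f ∘ Prod.swap) (Prod.swap ⁻¹' U) where
  isOpen := h.isOpen.preimage continuous_swap
  bdd p hp := by
    obtain ⟨M, hM⟩ := h.bdd _ hp
    exact ⟨M, continuous_swap.continuousAt.eventually hM⟩
  fst p hp := h.snd _ hp
  snd p hp := h.fst _ hp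

/-- Cauchy's estimate in the form of a Lipschitz bound. -/
theorem norm_sub_le_of_bounded {φ : ℂ → ℂ} {c : ℂ} {r M : ℝ} (hr : 0 < r)
    (hd : DifferentiableOn ℂ φ (Metric.ball c (3 * r)))
    (hb : ∀ x ∈ Metric.ball c (3 * r), ‖φ x‖ ≤ M) :
    (∀ x ∈ Metric.ball c (2 * r), ‖deriv φ x‖ ≤ M / (r / 2)) ∧
    ∀ x ∈ Metric.ball c (2 * r), ∀ y ∈ Metric.ball c (2 * r),
      ‖φ y - φ x‖ ≤ M / (r / 2) * ‖y - x‖ := by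
  have hder : ∀ x ∈ Metric.ball c (2 * r), ‖deriv φ x‖ ≤ M / (r / 2) := by
    intro x hx
    have hsub : Metric.closedBall x (r / 2) ⊆ Metric.ball c (3 * r) := by
      intro y hy
      simp only [Metric.mem_ball, Metric.mem_closedBall] at *
      linarith [dist_triangle y x c]
    apply Complex.norm_deriv_le_of_forall_mem_sphere_norm_le (by positivity)
    · refine (hd.mono hsub).diffContOnCl_ball subset_rfl
    · exact fun z hz => hb z (hsub (Metric.sphere_subset_closedBall hz))
  refine ⟨hder, fun x hx y hy => ?_⟩
  refine (convex_ball c (2 * r)).norm_image_sub_le_of_norm_deriv_le (fun z hz => ?_) hder hx hy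
  refine hd.differentiableAt (Metric.isOpen_ball.mem_nhds ?_)
  simp only [Metric.mem_ball] at *
  linarith

/-- The first-order Taylor remainder of a bounded holomorphic function is quadratic. -/
theorem norm_sub_sub_le_of_bounded {φ : ℂ → ℂ} {c : ℂ} {r M : ℝ} (hr : 0 < r)
    (hd : DifferentiableOn ℂ φ (Metric.ball c (3 * r)))
    (hb : ∀ x ∈ Metric.ball c (3 * r), ‖φ x‖ ≤ M) :
    ∀ y ∈ Metric.ball c r, ‖φ y - φ c - (y - c) * deriv φ c‖ ≤
      M / (r / 2) / (r / 3) * ‖y - c‖ ^ 2 := by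
  intro y hy
  have h1 := norm_sub_le_of_bounded hr hd hb
  have hd' : DifferentiableOn ℂ (deriv φ) (Metric.ball c (3 * r)) :=
    hd.deriv Metric.isOpen_ball
  have h2 := (norm_sub_le_of_bounded (φ := deriv φ) (c := c) (r := 2 * r / 3)
    (M := M / (r / 2)) (by positivity)
    (hd'.mono (Metric.ball_subset_ball (by linarith)))
    (fun x hx => h1.1 x (Metric.ball_subset_ball (by linarith) hx))).2
  have hcy : 0 < r := hr
  set δ := ‖y - c‖ with hδ
  have hδr : δ < r := by simpa [hδ, dist_eq_norm] using hy
  have key := (convex_closedBall c δ).norm_image_sub_le_of_norm_deriv_le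
    (f := fun z => φ z - (z - c) * deriv φ c) (C := M / (r / 2) / (r / 3) * δ) (x := c) (y := y)
    (fun z hz => ?_) (fun z hz => ?_) (by simp [hδ]) (by simp [hδ, dist_eq_norm])
  · simp only [sub_self, zero_mul, sub_zero] at key
    calc _ = ‖φ y - (y - c) * deriv φ c - φ c‖ := by ring_nf
      _ ≤ _ := key
      _ = _ := by ring
  · have hz' : z ∈ Metric.ball c (3 * r) := by
      simp only [Metric.mem_ball, Metric.mem_closedBall] at *; linarith
    have := hd.differentiableAt (Metric.isOpen_ball.mem_nhds hz')
    fun_prop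
  · have hz' : z ∈ Metric.ball c (3 * r) := by
      simp only [Metric.mem_ball, Metric.mem_closedBall] at *; linarith
    have hφ := hd.differentiableAt (Metric.isOpen_ball.mem_nhds hz')
    have : deriv (fun z => φ z - (z - c) * deriv φ c) z = deriv φ z - deriv φ c := by
      have h3 : HasDerivAt (fun z : ℂ => (z - c) * deriv φ c) (1 * deriv φ c) z :=
        ((hasDerivAt_id z).sub_const c).mul_const _
      rw [(hφ.hasDerivAt.fun_sub h3).deriv, one_mul]
    rw [this]
    have h4 := h2 c (Metric.mem_ball_self (by positivity)) z
      (by simp only [Metric.mem_ball, Metric.mem_closedBall] at *; linarith)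
    have hz2 : ‖z - c‖ ≤ δ := by simpa [dist_eq_norm] using hz
    have hM : 0 ≤ M := (norm_nonneg _).trans (hb c (Metric.mem_ball_self (by positivity)))
    calc _ ≤ _ := h4
      _ = M / (r / 2) / (r / 3) * ‖z - c‖ := by congr 2; ring
      _ ≤ _ := by gcongr

/-- A bidisc with a uniform bound around each point. -/
theorem SepHolOn.exists_bidisc {f : ℂ × ℂ → ℂ} {U : Set (ℂ × ℂ)} (h : SepHolOn f U) {p : ℂ × ℂ}
    (hp : p ∈ U) : ∃ r > 0, ∃ M : ℝ, ∀ x ∈ Metric.ball p.1 (6 * r), ∀ y ∈ Metric.ball p.2 (6 * r),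
      (x, y) ∈ U ∧ ‖f (x, y)‖ ≤ M := by
  obtain ⟨M, hM⟩ := h.bdd p hp
  obtain ⟨ε, hε, hb⟩ := Metric.mem_nhds_iff.1 (inter_mem (h.isOpen.mem_nhds hp) hM)
  refine ⟨ε / 6, by positivity, M, fun x hx y hy => hb ?_⟩
  rw [← ball_prod_same]
  exact ⟨Metric.ball_subset_ball (by linarith) hx, Metric.ball_subset_ball (by linarith) hy⟩

theorem SepHolOn.continuousOn {f : ℂ × ℂ → ℂ} {U : Set (ℂ × ℂ)} (h : SepHolOn f U) :
    ContinuousOn f U := by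
  intro p hp
  refine ContinuousAt.continuousWithinAt ?_
  obtain ⟨r, hr, M, hM⟩ := h.exists_bidisc hp
  have hbound : ∀ᶠ x in 𝓝 p, ‖f x - f p‖ ≤ M / (r / 2) * ‖x.1 - p.1‖ + M / (r / 2) * ‖x.2 - p.2‖ := by
    have : Metric.ball p.1 (2 * r) ×ˢ Metric.ball p.2 (2 * r) ∈ 𝓝 p :=
      prod_mem_nhds (Metric.ball_mem_nhds _ (by positivity)) (Metric.ball_mem_nhds _ (by positivity))
    filter_upwards [this] with x hx
    have e1 := (norm_sub_le_of_bounded (φ := fun z => f (z, x.2)) (c := p.1) (M := M) hr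
      (fun z hz => (h.fst (z, x.2) (hM z (Metric.ball_subset_ball (by linarith) hz) x.2
        (Metric.ball_subset_ball (by linarith) hx.2)).1).differentiableWithinAt)
      (fun z hz => (hM z (Metric.ball_subset_ball (by linarith) hz) x.2
        (Metric.ball_subset_ball (by linarith) hx.2)).2)).2 p.1
        (Metric.mem_ball_self (by positivity)) x.1 hx.1
    have e2 := (norm_sub_le_of_bounded (φ := fun z => f (p.1, z)) (c := p.2) (M := M) hr
      (fun z hz => (h.snd (p.1, z) (hM p.1 (Metric.mem_ball_self (by positivity)) z
        (Metric.ball_subset_ball (by linarith) hz)).1).differentiableWithinAt)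
      (fun z hz => (hM p.1 (Metric.mem_ball_self (by positivity)) z
        (Metric.ball_subset_ball (by linarith) hz)).2)).2 p.2
        (Metric.mem_ball_self (by positivity)) x.2 hx.2
    calc ‖f x - f p‖ = ‖(f (x.1, x.2) - f (p.1, x.2)) + (f (p.1, x.2) - f (p.1, p.2))‖ := by
          congr 1; simp
      _ ≤ _ := (norm_add_le _ _).trans (add_le_add e1 e2)
  rw [ContinuousAt, tendsto_iff_norm_sub_tendsto_zero]
  refine squeeze_zero' (Eventually.of_forall fun _ => norm_nonneg _) hbound ?_
  have : ContinuousAt (fun x : ℂ × ℂ =>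
    M / (r / 2) * ‖x.1 - p.1‖ + M / (r / 2) * ‖x.2 - p.2‖) p := by fun_prop
  simpa [ContinuousAt] using this

theorem SepHolOn.deriv_fst {f : ℂ × ℂ → ℂ} {U : Set (ℂ × ℂ)} (h : SepHolOn f U) :
    SepHolOn (fun p => deriv (fun x => f (x, p.2)) p.1) U where
  isOpen := h.isOpen
  bdd p hp := by
    obtain ⟨r, hr, M, hM⟩ := h.exists_bidisc hp
    refine ⟨M / (r / 2), ?_⟩
    have : Metric.ball p.1 (2 * r) ×ˢ Metric.ball p.2 (2 * r) ∈ 𝓝 p :=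
      prod_mem_nhds (Metric.ball_mem_nhds _ (by positivity)) (Metric.ball_mem_nhds _ (by positivity))
    filter_upwards [this] with x hx
    exact (norm_sub_le_of_bounded (φ := fun z => f (z, x.2)) (c := p.1) (M := M) hr
      (fun z hz => (h.fst (z, x.2) (hM z (Metric.ball_subset_ball (by linarith) hz) x.2
        (Metric.ball_subset_ball (by linarith) hx.2)).1).differentiableWithinAt)
      (fun z hz => (hM z (Metric.ball_subset_ball (by linarith) hz) x.2
        (Metric.ball_subset_ball (by linarith) hx.2)).2)).1 x.1 hx.1
  fst p hp := by
    have hV : IsOpen {x : ℂ | (x, p.2) ∈ U} := h.isOpen.preimage (by fun_prop)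
    have hd : DifferentiableOn ℂ (fun x => f (x, p.2)) {x : ℂ | (x, p.2) ∈ U} :=
      fun x hx => (h.fst (x, p.2) hx).differentiableWithinAt
    exact (hd.deriv hV).differentiableAt (hV.mem_nhds hp)
  snd p hp := by
    obtain ⟨r, hr, M, hM⟩ := h.exists_bidisc hp
    -- The difference quotients converge uniformly, so that the limit is holomorphic.
    have hunif : TendstoUniformlyOn (fun (n : ℂ) (y : ℂ) => (f (p.1 + n, y) - f (p.1, y)) / n)
        (fun y => deriv (fun x => f (x, y)) p.1) (𝓝[≠] 0) (Metric.ball p.2 r) := by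
      rw [Metric.tendstoUniformlyOn_iff]
      intro ε hε
      have hM0 : 0 ≤ M := (norm_nonneg _).trans (hM p.1 (Metric.mem_ball_self (by positivity)) p.2
        (Metric.mem_ball_self (by positivity))).2
      have h1 : ∀ᶠ n : ℂ in 𝓝[≠] 0, ‖n‖ < r ∧ M / (r / 2) / (r / 3) * ‖n‖ < ε := by
        refine nhdsWithin_le_nhds ?_
        have c1 : ContinuousAt (fun n : ℂ => ‖n‖) 0 := by fun_prop
        have c2 : ContinuousAt (fun n : ℂ => M / (r / 2) / (r / 3) * ‖n‖) 0 := by fun_prop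
        exact (c1.eventually_lt_const (by simpa using hr)).and
          (c2.eventually_lt_const (by simpa using hε))
      filter_upwards [h1, self_mem_nhdsWithin] with n hn hn0 y hy
      have hn0' : n ≠ 0 := hn0
      have key := norm_sub_sub_le_of_bounded (φ := fun z => f (z, y)) (c := p.1) (M := M) hr
        (fun z hz => (h.fst (z, y) (hM z (Metric.ball_subset_ball (by linarith) hz) y
          (Metric.ball_subset_ball (by linarith) hy)).1).differentiableWithinAt)
        (fun z hz => (hM z (Metric.ball_subset_ball (by linarith) hz) y
          (Metric.ball_subset_ball (by linarith) hy)).2) (p.1 + n) (by simpa using hn.1)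
      simp only [add_sub_cancel_left] at key
      rw [dist_comm, dist_eq_norm]
      have : (f (p.1 + n, y) - f (p.1, y)) / n - deriv (fun x => f (x, y)) p.1
          = (f (p.1 + n, y) - f (p.1, y) - n * deriv (fun x => f (x, y)) p.1) / n := by
        field_simp
      rw [this, norm_div, div_lt_iff₀ (norm_pos_iff.2 hn0')]
      refine key.trans_lt ?_
      have : 0 < ‖n‖ := norm_pos_iff.2 hn0'
      nlinarith [hn.2]
    have hdiff : ∀ᶠ n : ℂ in 𝓝[≠] 0, DifferentiableOn ℂ
        (fun y => (f (p.1 + n, y) - f (p.1, y)) / n) (Metric.ball p.2 r) := by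
      have h1 : ∀ᶠ n : ℂ in 𝓝[≠] 0, ‖n‖ < r := by
        refine nhdsWithin_le_nhds ?_
        have c1 : ContinuousAt (fun n : ℂ => ‖n‖) 0 := by fun_prop
        exact c1.eventually_lt_const (by simpa using hr)
      filter_upwards [h1] with n hn y hy
      have a1 := h.snd (p.1 + n, y) (hM (p.1 + n) (by simp; linarith) y
        (Metric.ball_subset_ball (by linarith) hy)).1
      have a2 := h.snd (p.1, y) (hM p.1 (Metric.mem_ball_self (by positivity)) y
        (Metric.ball_subset_ball (by linarith) hy)).1
      exact ((a1.fun_sub a2).div_const n).differentiableWithinAt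
    exact (hunif.tendstoLocallyUniformlyOn.differentiableOn hdiff Metric.isOpen_ball).differentiableAt
      (Metric.ball_mem_nhds _ hr)

theorem SepHolOn.deriv_snd {f : ℂ × ℂ → ℂ} {U : Set (ℂ × ℂ)} (h : SepHolOn f U) :
    SepHolOn (fun p => deriv (fun y => f (p.1, y)) p.2) U := by
  have := h.swap.deriv_fst.swap
  exact this

/-- **Osgood's lemma**: locally bounded separately holomorphic functions are smooth. -/
theorem SepHolOn.contDiffOn (n : ℕ) {f : ℂ × ℂ → ℂ} {U : Set (ℂ × ℂ)} (h : SepHolOn f U) :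
    ContDiffOn ℂ n f U := by
  induction n generalizing f with
  | zero => simpa [contDiffOn_zero] using h.continuousOn
  | succ n ih =>
    have hs : ∀ p ∈ U, HasFDerivAt f
        ((deriv (fun x => f (x, p.2)) p.1 • ContinuousLinearMap.fst ℂ ℂ ℂ) +
          deriv (fun y => f (p.1, y)) p.2 • ContinuousLinearMap.snd ℂ ℂ ℂ) p := by
      intro p hp
      have c1 := h.deriv_fst.continuousOn.continuousAt (h.isOpen.mem_nhds hp)
      have c2 := h.deriv_snd.continuousOn.continuousAt (h.isOpen.mem_nhds hp)
      have key := hasStrictFDerivAt_uncurry_coprod (𝕜 := ℂ) (u := p) (f := fun x y => f (x, y))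
        (f₁ := fun x y => ContinuousLinearMap.toSpanSingleton ℂ (deriv (fun x => f (x, y)) x))
        (f₂ := fun x y => ContinuousLinearMap.toSpanSingleton ℂ (deriv (fun y => f (x, y)) y))
        (by filter_upwards [h.isOpen.mem_nhds hp] with v hv
            exact (h.fst v hv).hasDerivAt.hasFDerivAt)
        (by filter_upwards [h.isOpen.mem_nhds hp] with v hv
            exact (h.snd v hv).hasDerivAt.hasFDerivAt)
        ((ContinuousLinearMap.toSpanSingletonCLE (𝕜 := ℂ) (E := ℂ)).continuous.continuousAt.comp c1)
        ((ContinuousLinearMap.toSpanSingletonCLE (𝕜 := ℂ) (E := ℂ)).continuous.continuousAt.comp c2)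
      refine key.hasFDerivAt.congr_fderiv ?_
      ext <;> simp [Function.HasUncurry.uncurry]
    push_cast
    rw [contDiffOn_succ_iff_fderiv_of_isOpen h.isOpen]
    refine ⟨fun p hp => (hs p hp).differentiableAt.differentiableWithinAt, by simp, ?_⟩
    refine ContDiffOn.congr ?_ (fun p hp => (hs p hp).fderiv)
    exact ((ih h.deriv_fst).smul contDiffOn_const).add ((ih h.deriv_snd).smul contDiffOn_const)


/-! ### Persistence of nondegenerate zeros -/

/-- Cauchy's estimate on a bidisc: a small separately holomorphic function has a small Lipschitz
constant on a smaller bidisc. -/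
theorem SepHolOn.norm_sub_le {f : ℂ × ℂ → ℂ} {p : ℂ × ℂ} {r δ : ℝ} (hr : 0 < r)
    (h : SepHolOn f (Metric.ball p (3 * r))) (hb : ∀ x ∈ Metric.ball p (3 * r), ‖f x‖ ≤ δ)
    {x y : ℂ × ℂ} (hx : x ∈ Metric.ball p r) (hy : y ∈ Metric.ball p r) :
    ‖f x - f y‖ ≤ 2 * (δ / (r / 2)) * ‖x - y‖ := by
  have hδ : 0 ≤ δ := (norm_nonneg _).trans (hb p (Metric.mem_ball_self (by positivity)))
  have hmem : ∀ z w : ℂ, z ∈ Metric.ball p.1 (3 * r) → w ∈ Metric.ball p.2 (3 * r) →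
      (z, w) ∈ Metric.ball p (3 * r) := fun z w hz hw => by
    rw [← ball_prod_same]; exact ⟨hz, hw⟩
  rw [← ball_prod_same] at hx hy
  have e1 := (norm_sub_le_of_bounded (φ := fun z => f (z, x.2)) (c := p.1) (M := δ) hr
      (fun z hz => (h.fst (z, x.2) (hmem z x.2 hz
        (Metric.ball_subset_ball (by linarith) hx.2))).differentiableWithinAt)
      (fun z hz => hb _ (hmem z x.2 hz (Metric.ball_subset_ball (by linarith) hx.2)))).2 y.1
        (Metric.ball_subset_ball (by linarith) hy.1) x.1
        (Metric.ball_subset_ball (by linarith) hx.1)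
  have e2 := (norm_sub_le_of_bounded (φ := fun z => f (y.1, z)) (c := p.2) (M := δ) hr
      (fun z hz => (h.snd (y.1, z) (hmem y.1 z
        (Metric.ball_subset_ball (by linarith) hy.1) hz)).differentiableWithinAt)
      (fun z hz => hb _ (hmem y.1 z (Metric.ball_subset_ball (by linarith) hy.1) hz))).2 y.2
        (Metric.ball_subset_ball (by linarith) hy.2) x.2
        (Metric.ball_subset_ball (by linarith) hx.2)
  have n1 : ‖x.1 - y.1‖ ≤ ‖x - y‖ := norm_fst_le (x - y)
  have n2 : ‖x.2 - y.2‖ ≤ ‖x - y‖ := norm_snd_le (x - y)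
  calc ‖f x - f y‖ = ‖(f (x.1, x.2) - f (y.1, x.2)) + (f (y.1, x.2) - f (y.1, y.2))‖ := by
        congr 1; simp
    _ ≤ δ / (r / 2) * ‖x.1 - y.1‖ + δ / (r / 2) * ‖x.2 - y.2‖ :=
        (norm_add_le _ _).trans (add_le_add e1 e2)
    _ ≤ δ / (r / 2) * ‖x - y‖ + δ / (r / 2) * ‖x - y‖ := by gcongr
    _ = _ := by ring

/-- A form of Hurwitz' theorem in two variables: a nondegenerate zero of a map `F` persists
under perturbations `g n` with holomorphic components that tend to zero uniformly. -/
theorem exists_zero_of_nondegenerate {F : ℂ × ℂ → ℂ × ℂ} {A : (ℂ × ℂ) ≃L[ℂ] (ℂ × ℂ)}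
    {p : ℂ × ℂ} (hF : HasStrictFDerivAt F (A : (ℂ × ℂ) →L[ℂ] (ℂ × ℂ)) p) (hp : F p = 0)
    {g₁ g₂ : ℕ → ℂ × ℂ → ℂ} {ρ : ℝ} (hρ : 0 < ρ)
    (h₁ : ∀ᶠ n in atTop, SepHolOn (g₁ n) (Metric.ball p ρ))
    (h₂ : ∀ᶠ n in atTop, SepHolOn (g₂ n) (Metric.ball p ρ))
    (l₁ : ∀ δ > 0, ∀ᶠ n in atTop, ∀ x ∈ Metric.ball p ρ, ‖g₁ n x‖ ≤ δ)
    (l₂ : ∀ δ > 0, ∀ᶠ n in atTop, ∀ x ∈ Metric.ball p ρ, ‖g₂ n x‖ ≤ δ) {ε : ℝ} (hε : 0 < ε) :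
    ∀ᶠ n in atTop, ∃ x ∈ Metric.ball p ε, F x + (g₁ n x, g₂ n x) = 0 := by
  set N := ‖(A.symm : (ℂ × ℂ) →L[ℂ] (ℂ × ℂ))‖₊ with hN
  have hNpos : 0 < N := by
    rw [hN]
    rcases A.subsingleton_or_nnnorm_symm_pos with h | h
    · exact absurd (h.elim ((1 : ℂ), (0 : ℂ)) 0) (by simp)
    · exact h
  set c : NNReal := N⁻¹ / 4 with hc
  have hcpos : 0 < c := by positivity
  obtain ⟨s, hs, hap⟩ := hF.approximates_deriv_on_nhds (c := c) (Or.inr hcpos)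
  obtain ⟨η, hη, hηs⟩ := Metric.mem_nhds_iff.1 hs
  -- A radius small enough for the linear approximation, for Cauchy's estimate and for the claim.
  set r : ℝ := min (min (η / 2) (ρ / 6)) (ε / 2) with hr
  have hrpos : 0 < r := by positivity
  have hr1 : r ≤ η / 2 := (min_le_left _ _).trans (min_le_left _ _)
  have hr2 : r ≤ ρ / 6 := (min_le_left _ _).trans (min_le_right _ _)
  have hr3 : r ≤ ε / 2 := min_le_right _ _
  set δ : ℝ := min (c * r / 4) (c * r) with hδ
  have hδpos : 0 < δ := by positivity
  have hδ1 : δ ≤ c * r / 4 := min_le_left _ _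
  filter_upwards [h₁, h₂, l₁ δ hδpos, l₂ δ hδpos] with n H₁ H₂ L₁ L₂
  have hsub : Metric.ball p (3 * (2 * r)) ⊆ Metric.ball p ρ :=
    Metric.ball_subset_ball (by linarith)
  have restr : ∀ {f : ℂ × ℂ → ℂ}, SepHolOn f (Metric.ball p ρ) →
      SepHolOn f (Metric.ball p (3 * (2 * r))) := fun h =>
    ⟨Metric.isOpen_ball, fun q hq => h.bdd q (hsub hq), fun q hq => h.fst q (hsub hq),
      fun q hq => h.snd q (hsub hq)⟩
  have hlip : ApproximatesLinearOn (fun x => F x + (g₁ n x, g₂ n x))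
      (A : (ℂ × ℂ) →L[ℂ] (ℂ × ℂ)) (Metric.closedBall p r) (c + c) := by
    intro x hx y hy
    have hx' : x ∈ Metric.ball p (2 * r) := Metric.closedBall_subset_ball (by linarith) hx
    have hy' : y ∈ Metric.ball p (2 * r) := Metric.closedBall_subset_ball (by linarith) hy
    have e0 := hap x (hηs (Metric.closedBall_subset_ball (by linarith) hx)) y
      (hηs (Metric.closedBall_subset_ball (by linarith) hy))
    have e1 := (restr H₁).norm_sub_le (by positivity) (fun z hz => L₁ z (hsub hz)) hx' hy'
    have e2 := (restr H₂).norm_sub_le (by positivity) (fun z hz => L₂ z (hsub hz)) hx' hy'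
    have hcoef : 2 * (δ / (2 * r / 2)) ≤ c := by
      rw [show 2 * r / 2 = r by ring, ← mul_div_assoc, div_le_iff₀ hrpos]
      nlinarith [mul_pos (NNReal.coe_pos.2 hcpos) hrpos]
    have e3 : ‖((g₁ n x - g₁ n y, g₂ n x - g₂ n y) : ℂ × ℂ)‖ ≤ c * ‖x - y‖ :=
      norm_prod_le_iff.2 ⟨e1.trans (by gcongr), e2.trans (by gcongr)⟩
    calc _ = ‖(F x - F y - A (x - y)) + (g₁ n x - g₁ n y, g₂ n x - g₂ n y)‖ := by
          congr 1
          ext <;> simp <;> ring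
      _ ≤ c * ‖x - y‖ + c * ‖x - y‖ := (norm_add_le _ _).trans (add_le_add e0 e3)
      _ = _ := by push_cast; ring
  have key := hlip.surjOn_closedBall_of_nonlinearRightInverse A.toNonlinearRightInverse
    hrpos.le subset_rfl
  have h0 : (0 : ℂ × ℂ) ∈ Metric.closedBall (F p + (g₁ n p, g₂ n p))
      (((A.toNonlinearRightInverse.nnnorm : ℝ)⁻¹ - ((c + c : NNReal) : ℝ)) * r) := by
    have hNN : (A.toNonlinearRightInverse.nnnorm : ℝ)⁻¹ = 4 * c := by
      have : (A.toNonlinearRightInverse.nnnorm : NNReal)⁻¹ = 4 * c := by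
        rw [hc, mul_div_cancel₀ _ (by norm_num)]
        rfl
      exact_mod_cast congrArg NNReal.toReal this
    rw [Metric.mem_closedBall, dist_eq_norm, hp, hNN, zero_add, zero_sub, norm_neg]
    have hpmem : p ∈ Metric.ball p ρ := Metric.mem_ball_self hρ
    refine (norm_prod_le_iff.2 ⟨L₁ p hpmem, L₂ p hpmem⟩).trans ?_
    push_cast
    have := mul_pos (NNReal.coe_pos.2 hcpos) hrpos
    nlinarith
  obtain ⟨x, hx, hx0⟩ := key h0
  exact ⟨x, Metric.closedBall_subset_ball (by linarith) hx, hx0⟩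

/-! ### Liouville's theorem for doubly periodic functions -/

/-- A doubly periodic function with vanishing order `≥ 0` everywhere is constant up to its values
on a discrete set. -/
theorem exists_const_of_meromorphic_of_periodic {τ : ℂ} (hτ : 0 < τ.im) {F : ℂ → ℂ}
    (hF : ∀ z, MeromorphicAt F z) (h1 : ∀ z, F (z + 1) = F z) (h2 : ∀ z, F (z + τ) = F z)
    (ho : ∀ z, 0 ≤ meromorphicOrderAt F z) : ∃ c, ∀ z, AnalyticAt ℂ F z → F z = c := by
  set G : ℂ → ℂ := fun z => limUnder (𝓝[≠] z) F with hG
  have hlim : ∀ z, Tendsto F (𝓝[≠] z) (𝓝 (G z)) := fun z =>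
    tendsto_nhds_limUnder ((tendsto_nhds_iff_meromorphicOrderAt_nonneg (hF z)).2 (ho z))
  have hGF : ∀ z, AnalyticAt ℂ F z → G z = F z := fun z hz =>
    tendsto_nhds_unique (hlim z) (hz.continuousAt.tendsto.mono_left nhdsWithin_le_nhds)
  have hGper : ∀ ω : ℂ, (∀ z, F (z + ω) = F z) → ∀ z, G (z + ω) = G z := by
    intro ω hω z
    refine tendsto_nhds_unique ?_ (hlim z)
    have : Tendsto (fun x => x + ω) (𝓝[≠] z) (𝓝[≠] (z + ω)) := by
      refine tendsto_nhdsWithin_iff.2 ⟨?_, ?_⟩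
      · exact ((continuous_add_const ω).tendsto z).mono_left nhdsWithin_le_nhds
      · filter_upwards [self_mem_nhdsWithin] with x hx
        simpa using hx
    exact ((hlim (z + ω)).comp this).congr fun x => hω x
  have hGd : Differentiable ℂ G := by
    intro z
    have h1 : G =ᶠ[𝓝[≠] z] F := by
      filter_upwards [(hF z).eventually_analyticAt] with x hx using hGF x hx
    have hc : ContinuousAt G z := by
      rw [continuousAt_iff_punctured_nhds]
      exact (hlim z).congr' h1.symm
    refine (Complex.analyticAt_of_differentiable_on_punctured_nhds_of_continuousAt ?_
      hc).differentiableAt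
    filter_upwards [(hF z).eventually_analyticAt] with x hx
    have : G =ᶠ[𝓝 x] F := hx.eventually_analyticAt.mono hGF
    exact this.differentiableAt_iff.2 hx.differentiableAt
  -- By periodicity `G` is bounded by its maximum on a compact parallelogram.
  have hbdd : Bornology.IsBounded (Set.range G) := by
    have hper1 : ∀ (n : ℤ) z, G (z + n) = G z := by
      intro n
      have hP : Function.Periodic G 1 := hGper 1 h1
      intro z
      simpa using hP.int_mul n z
    have hper2 : ∀ (n : ℤ) z, G (z + n * τ) = G z := by
      intro n z
      have hP : Function.Periodic G τ := hGper τ h2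
      exact hP.int_mul n z
    have hK : IsCompact ((fun p : ℝ × ℝ => (p.1 : ℂ) + p.2 * τ) ''
        (Set.Icc 0 1 ×ˢ Set.Icc 0 1)) :=
      (isCompact_Icc.prod isCompact_Icc).image (by fun_prop)
    refine ((hK.image hGd.continuous).isBounded).subset ?_
    rintro _ ⟨z, rfl⟩
    set y : ℝ := z.im / τ.im with hy
    set x : ℝ := z.re - y * τ.re with hx
    have hz : z = x + y * τ := by
      apply Complex.ext
      · simp [hx]
      · simp [hy]; field_simp
    refine ⟨(Int.fract x : ℝ) + (Int.fract y : ℝ) * τ, ⟨(Int.fract x, Int.fract y), ⟨⟨Int.fract_nonneg _,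
      (Int.fract_lt_one _).le⟩, ⟨Int.fract_nonneg _, (Int.fract_lt_one _).le⟩⟩, rfl⟩, ?_⟩
    rw [← hper1 ⌊x⌋, ← hper2 ⌊y⌋]
    congr 1
    have e1 : (x : ℂ) = ⌊x⌋ + (Int.fract x : ℝ) := by
      exact_mod_cast (Int.floor_add_fract x).symm
    have e2 : (y : ℂ) = ⌊y⌋ + (Int.fract y : ℝ) := by
      exact_mod_cast (Int.floor_add_fract y).symm
    rw [hz]
    conv_rhs => rw [e1, e2]
    ring
  exact ⟨G 0, fun z hz => by
    rw [← hGF z hz]; exact hGd.apply_eq_apply_of_bounded hbdd z 0⟩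


/-! ### The theta product -/

/-- The infinite product `∏ (1 - q ^ n * w)` over `n ≥ 0`. -/
def qprod (q w : ℂ) : ℂ := ∏' n : ℕ, (1 + -(q ^ n * w))

theorem summable_norm_qpow {q : ℂ} (hq : ‖q‖ < 1) (w : ℂ) :
    Summable fun n : ℕ => ‖-(q ^ n * w)‖ := by
  simpa [norm_mul, norm_pow] using (summable_geometric_of_lt_one (norm_nonneg q) hq).mul_right ‖w‖

theorem qprod_eq {q : ℂ} (hq : ‖q‖ < 1) (w : ℂ) : qprod q w = (1 - w) * qprod q (q * w) := by
  have hm : Multipliable fun n : ℕ => 1 + -(q ^ (n + 1) * w) := by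
    refine multipliable_one_add_of_summable ?_
    exact (summable_nat_add_iff 1).2 (summable_norm_qpow hq w)
  have h := tprod_eq_zero_mul' (f := fun n : ℕ => 1 + -(q ^ n * w)) hm
  simp only [pow_zero, one_mul] at h
  unfold qprod
  rw [h, ← sub_eq_add_neg]
  congr 1
  exact tprod_congr fun n => by rw [pow_succ, mul_assoc]

theorem qprod_ne_zero {q : ℂ} (hq : ‖q‖ < 1) {w : ℂ} (h : ∀ n : ℕ, q ^ n * w ≠ 1) :
    qprod q w ≠ 0 := by
  refine tprod_one_add_ne_zero_of_summable (fun n => ?_) (summable_norm_qpow hq w)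
  rw [← sub_eq_add_neg]
  exact sub_ne_zero.2 (h n).symm

theorem qprod_convergence {r R : ℝ} (hr : r < 1) :
    HasProdLocallyUniformlyOn (fun (n : ℕ) (p : ℂ × ℂ) => 1 + -(p.1 ^ n * p.2))
      (fun p => qprod p.1 p.2) (Metric.ball 0 r ×ˢ Metric.ball 0 R) := by
  rcases le_or_gt r 0 with hr0 | hr0
  · rw [Metric.ball_eq_empty.2 hr0, Set.empty_prod]
    rw [hasProdLocallyUniformlyOn_iff_tendstoLocallyUniformlyOn]
    exact fun _ _ _ h => h.elim
  refine Summable.hasProdLocallyUniformlyOn_nat_one_add (Metric.isOpen_ball.prod Metric.isOpen_ball)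
    (u := fun n => r ^ n * R) ((summable_geometric_of_lt_one hr0.le hr).mul_right R)
    (Eventually.of_forall fun n p hp => ?_) (fun n => by fun_prop)
  have h1 : ‖p.1‖ < r := by simpa using hp.1
  have h2 : ‖p.2‖ < R := by simpa using hp.2
  rw [norm_neg, norm_mul, norm_pow]
  gcongr

theorem sepHolOn_qprod :
    SepHolOn (fun p => qprod p.1 p.2) (Metric.ball (0 : ℂ) 1 ×ˢ Set.univ) := by
  have key : ∀ p ∈ Metric.ball (0 : ℂ) 1 ×ˢ (Set.univ : Set ℂ), ∃ r < (1 : ℝ), ∃ R : ℝ,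
      p ∈ Metric.ball (0 : ℂ) r ×ˢ Metric.ball (0 : ℂ) R := by
    intro p hp
    have h1 : ‖p.1‖ < 1 := by simpa using hp.1
    obtain ⟨r, hr1, hr2⟩ := exists_between h1
    exact ⟨r, hr2, ‖p.2‖ + 1, by simpa using hr1, by simp⟩
  refine ⟨Metric.isOpen_ball.prod isOpen_univ, fun p hp => ?_, fun p hp => ?_, fun p hp => ?_⟩
  · obtain ⟨r, hr, R, hpr⟩ := key p hp
    have hc : ContinuousOn (fun p : ℂ × ℂ => qprod p.1 p.2)
        (Metric.ball 0 r ×ˢ Metric.ball 0 R) := by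
      refine ((hasProdLocallyUniformlyOn_iff_tendstoLocallyUniformlyOn.1
        (qprod_convergence hr)).continuousOn (Frequently.of_forall fun s => ?_))
      fun_prop
    have := (hc.continuousAt ((Metric.isOpen_ball.prod Metric.isOpen_ball).mem_nhds hpr)).norm
    refine ⟨‖qprod p.1 p.2‖ + 1, ?_⟩
    filter_upwards [this.eventually_lt_const (lt_add_one _)] with x hx using hx.le
  · obtain ⟨r, hr, R, hpr⟩ := key p hp
    have h1 := (hasProdLocallyUniformlyOn_iff_tendstoLocallyUniformlyOn.1
      (qprod_convergence (R := R) hr)).comp (fun x : ℂ => (x, p.2))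
      (t := Metric.ball 0 r) (fun x hx => ⟨hx, hpr.2⟩) (by fun_prop)
    refine (h1.differentiableOn (Eventually.of_forall fun s => ?_)
      Metric.isOpen_ball).differentiableAt (Metric.isOpen_ball.mem_nhds hpr.1)
    simp only [Function.comp_def]
    fun_prop
  · obtain ⟨r, hr, R, hpr⟩ := key p hp
    have h1 := (hasProdLocallyUniformlyOn_iff_tendstoLocallyUniformlyOn.1
      (qprod_convergence (R := R) hr)).comp (fun x : ℂ => (p.1, x))
      (t := Metric.ball 0 R) (fun x hx => ⟨hpr.1, hx⟩) (by fun_prop)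
    refine (h1.differentiableOn (Eventually.of_forall fun s => ?_)
      Metric.isOpen_ball).differentiableAt (Metric.isOpen_ball.mem_nhds hpr.2)
    simp only [Function.comp_def]
    fun_prop

/-- The exponential `z ↦ exp (2 π i z)`. -/
def ex (z : ℂ) : ℂ := Complex.exp (2 * Real.pi * Complex.I * z)

theorem ex_add (z w : ℂ) : ex (z + w) = ex z * ex w := by
  rw [ex, ex, ex, ← Complex.exp_add]; ring_nf

theorem ex_ne_zero (z : ℂ) : ex z ≠ 0 := Complex.exp_ne_zero _

@[simp] theorem ex_zero : ex 0 = 1 := by simp [ex]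

theorem ex_neg (z : ℂ) : ex (-z) = (ex z)⁻¹ := by
  rw [ex, ex, ← Complex.exp_neg]; ring_nf

theorem ex_sub (z w : ℂ) : ex (z - w) = ex z / ex w := by
  rw [sub_eq_add_neg, ex_add, ex_neg, div_eq_mul_inv]

theorem ex_eq_one_iff {z : ℂ} : ex z = 1 ↔ ∃ n : ℤ, z = n := by
  rw [ex, Complex.exp_eq_one_iff]
  refine exists_congr fun n => ⟨fun h => ?_, fun h => by rw [h]; ring⟩
  have : (2 * Real.pi * Complex.I : ℂ) ≠ 0 := Complex.two_pi_I_ne_zero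
  exact mul_left_cancel₀ this (by rw [h]; ring)

@[simp] theorem ex_int (n : ℤ) : ex n = 1 := ex_eq_one_iff.2 ⟨n, rfl⟩

@[simp] theorem ex_one : ex 1 = 1 := by simpa using ex_int 1

@[fun_prop] theorem differentiable_ex : Differentiable ℂ ex := by
  unfold ex; fun_prop

theorem contDiff_ex {n : WithTop ℕ∞} : ContDiff ℂ n ex := by
  unfold ex; fun_prop

theorem ex_natCast_mul (n : ℕ) (z : ℂ) : ex (n * z) = ex z ^ n := by
  rw [ex, ex, ← Complex.exp_nat_mul]; ring_nf

theorem norm_ex (z : ℂ) : ‖ex z‖ = Real.exp (-2 * Real.pi * z.im) := by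
  rw [ex, Complex.norm_exp]; congr 1; simp

theorem norm_ex_lt_one {τ : ℂ} (hτ : 0 < τ.im) : ‖ex τ‖ < 1 := by
  rw [norm_ex, Real.exp_lt_one_iff]
  nlinarith [Real.pi_pos, mul_pos Real.pi_pos hτ]

theorem hasDerivAt_ex (z : ℂ) : HasDerivAt ex (2 * Real.pi * Complex.I * ex z) z := by
  have := ((hasDerivAt_id z).const_mul (2 * Real.pi * Complex.I : ℂ)).cexp
  refine this.congr_deriv ?_
  simp only [ex, id]
  ring

/-- The theta product, an entire function of `z` with simple zeros at the points
of the lattice `ℤ + ℤ τ`. -/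
def theta (τ z : ℂ) : ℂ := qprod (ex τ) (ex z) * qprod (ex τ) (ex τ * ex (-z))

theorem contDiffOn_theta (n : ℕ) :
    ContDiffOn ℂ n (fun p : ℂ × ℂ => theta p.1 p.2) {p | 0 < p.1.im} := by
  have h := sepHolOn_qprod.contDiffOn n
  have he : ∀ {f : ℂ × ℂ → ℂ}, ContDiff ℂ n f → ContDiff ℂ n fun p => ex (f p) :=
    fun hf => contDiff_ex.comp hf
  refine ContDiffOn.mul ?_ ?_
  · refine h.comp (g := fun p : ℂ × ℂ => qprod p.1 p.2)
      (f := fun p : ℂ × ℂ => (ex p.1, ex p.2)) ?_ ?_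
    · exact ((he contDiff_fst).prodMk (he contDiff_snd)).contDiffOn
    · intro p hp
      exact ⟨by simpa using norm_ex_lt_one hp, trivial⟩
  · refine h.comp (g := fun p : ℂ × ℂ => qprod p.1 p.2)
      (f := fun p : ℂ × ℂ => (ex p.1, ex p.1 * ex (-p.2))) ?_ ?_
    · exact ((he contDiff_fst).prodMk ((he contDiff_fst).mul (he contDiff_snd.neg))).contDiffOn
    · intro p hp
      exact ⟨by simpa using norm_ex_lt_one hp, trivial⟩

theorem isOpen_im_pos : IsOpen {p : ℂ × ℂ | 0 < p.1.im} :=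
  isOpen_lt continuous_const (by fun_prop)

theorem contDiffAt_theta (n : ℕ) {p : ℂ × ℂ} (hp : 0 < p.1.im) :
    ContDiffAt ℂ n (fun p : ℂ × ℂ => theta p.1 p.2) p :=
  (contDiffOn_theta n).contDiffAt (isOpen_im_pos.mem_nhds hp)

theorem contDiffAt_theta_comp {E : Type*} [NormedAddCommGroup E] [NormedSpace ℂ E] (n : ℕ)
    {f g : E → ℂ} {x : E} (hf : ContDiffAt ℂ n f x) (hg : ContDiffAt ℂ n g x)
    (hx : 0 < (f x).im) : ContDiffAt ℂ n (fun y => theta (f y) (g y)) x :=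
  (contDiffAt_theta n (p := (f x, g x)) hx).comp (f := fun y => (f y, g y)) x (hf.prodMk hg)

theorem continuousAt_theta_comp {E : Type*} [TopologicalSpace E]
    {f g : E → ℂ} {x : E} (hf : ContinuousAt f x) (hg : ContinuousAt g x)
    (hx : 0 < (f x).im) : ContinuousAt (fun y => theta (f y) (g y)) x :=
  ContinuousAt.comp (g := fun p : ℂ × ℂ => theta p.1 p.2) (f := fun y => (f y, g y))
    (contDiffAt_theta 0 (p := (f x, g x)) hx).continuousAt (hf.prodMk hg)

theorem differentiable_theta {τ : ℂ} (hτ : 0 < τ.im) : Differentiable ℂ (theta τ) := fun z =>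
  (contDiffAt_theta_comp 1 (f := fun _ : ℂ => τ) (g := fun z => z) contDiffAt_const contDiffAt_id
    hτ).differentiableAt (by simp)

theorem analyticAt_theta {τ : ℂ} (hτ : 0 < τ.im) (z : ℂ) : AnalyticAt ℂ (theta τ) z :=
  (differentiable_theta hτ).analyticAt z

theorem theta_add_one (τ z : ℂ) : theta τ (z + 1) = theta τ z := by
  rw [theta, theta, neg_add, ex_add, ex_add, ex_neg 1]; simp

/-- A factorization of the theta product that exhibits its zero at the origin. -/
theorem theta_eq {τ : ℂ} (hτ : 0 < τ.im) (z : ℂ) :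
    theta τ z = (1 - ex z) * (qprod (ex τ) (ex τ * ex z) * qprod (ex τ) (ex τ * ex (-z))) := by
  rw [theta, qprod_eq (norm_ex_lt_one hτ) (ex z)]; ring

theorem theta_neg {τ : ℂ} (hτ : 0 < τ.im) (z : ℂ) : theta τ (-z) = -ex (-z) * theta τ z := by
  rw [theta_eq hτ, theta_eq hτ z, neg_neg, ex_neg]
  have := ex_ne_zero z
  field_simp
  ring

theorem theta_add_tau {τ : ℂ} (hτ : 0 < τ.im) (z : ℂ) :
    theta τ (z + τ) = -ex (-z) * theta τ z := by
  have h1 := qprod_eq (norm_ex_lt_one hτ) (ex z)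
  have h2 := qprod_eq (norm_ex_lt_one hτ) (ex (-z))
  have e1 : ex (z + τ) = ex τ * ex z := by rw [ex_add, mul_comm]
  have e2 : ex τ * ex (-(z + τ)) = ex (-z) := by
    rw [neg_add, ex_add, ex_neg τ]; have := ex_ne_zero τ; field_simp
  rw [theta, theta, e1, e2, h1, h2, ex_neg]
  have := ex_ne_zero z
  field_simp
  ring

/-! ### The lattice `ℤ + ℤ τ` -/

/-- The lattice spanned by `1` and `τ`. -/
def lat (τ : ℂ) : AddSubgroup ℂ where
  carrier := {z | ∃ m n : ℤ, z = m + n * τ}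
  zero_mem' := ⟨0, 0, by simp⟩
  add_mem' := by
    rintro _ _ ⟨m, n, rfl⟩ ⟨m', n', rfl⟩
    exact ⟨m + m', n + n', by push_cast; ring⟩
  neg_mem' := by
    rintro _ ⟨m, n, rfl⟩
    exact ⟨-m, -n, by push_cast; ring⟩

theorem mem_lat {τ z : ℂ} : z ∈ lat τ ↔ ∃ m n : ℤ, z = m + n * τ := Iff.rfl

theorem one_mem_lat (τ : ℂ) : (1 : ℂ) ∈ lat τ := ⟨1, 0, by simp⟩

theorem int_mem_lat (τ : ℂ) (n : ℤ) : (n : ℂ) ∈ lat τ := ⟨n, 0, by simp⟩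

theorem tau_mem_lat (τ : ℂ) : τ ∈ lat τ := ⟨0, 1, by simp⟩

theorem intCast_mul_mem_lat {τ z : ℂ} (n : ℤ) (h : z ∈ lat τ) : (n : ℂ) * z ∈ lat τ := by
  simpa using (lat τ).zsmul_mem h n

theorem natCast_mul_mem_lat {τ z : ℂ} (n : ℕ) (h : z ∈ lat τ) : (n : ℂ) * z ∈ lat τ := by
  simpa using (lat τ).nsmul_mem h n

theorem two_mul_mem_lat {τ z : ℂ} (h : z ∈ lat τ) : 2 * z ∈ lat τ := by
  simpa using natCast_mul_mem_lat 2 h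

theorem real_combination_unique {τ : ℂ} (hτ : 0 < τ.im) {x y x' y' : ℝ}
    (h : (x : ℂ) + y * τ = x' + y' * τ) : x = x' ∧ y = y' := by
  have him := congrArg Complex.im h
  simp at him
  have hy : y = y' := by
    rcases him with h | h
    · exact h
    · exact absurd h hτ.ne'
  subst hy
  exact ⟨by simpa using h, rfl⟩

theorem real_mem_lat_iff {τ : ℂ} (hτ : 0 < τ.im) {x y : ℝ} :
    (x : ℂ) + y * τ ∈ lat τ ↔ (∃ m : ℤ, x = m) ∧ ∃ n : ℤ, y = n := by
  constructor
  · rintro ⟨m, n, h⟩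
    have := real_combination_unique hτ (x := x) (y := y) (x' := m) (y' := n) (by simpa using h)
    exact ⟨⟨m, this.1⟩, ⟨n, this.2⟩⟩
  · rintro ⟨⟨m, rfl⟩, ⟨n, rfl⟩⟩
    exact ⟨m, n, by simp⟩

/-- The distance of nonzero lattice points to the origin is bounded below. -/
theorem exists_lat_separation {τ : ℂ} (hτ : 0 < τ.im) :
    ∃ δ > 0, ∀ l ∈ lat τ, ‖l‖ < δ → l = 0 := by
  refine ⟨min τ.im 1, by positivity, ?_⟩
  rintro l ⟨m, n, rfl⟩ hl
  have h1 : ‖(m : ℂ) + n * τ‖ < τ.im := hl.trans_le (min_le_left _ _)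
  have h2 : ‖(m : ℂ) + n * τ‖ < 1 := hl.trans_le (min_le_right _ _)
  have him := (Complex.abs_im_le_norm ((m : ℂ) + n * τ)).trans_lt h1
  simp [abs_mul, abs_of_pos hτ] at him
  have hn : n = 0 := by
    have : |(n : ℝ)| < 1 := by nlinarith
    exact Int.abs_lt_one_iff.1 (by exact_mod_cast this)
  subst hn
  have hm : m = 0 := by
    have : ‖(m : ℂ)‖ < 1 := by simpa using h2
    rw [Complex.norm_intCast] at this
    exact Int.abs_lt_one_iff.1 (by exact_mod_cast this)
  simp [hm]

theorem theta_add_int {τ : ℂ} (z : ℂ) (n : ℤ) : theta τ (z + n) = theta τ z := by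
  have h : Function.Periodic (theta τ) 1 := theta_add_one τ
  simpa using h.int_mul n z

theorem theta_add_lat {τ : ℂ} (hτ : 0 < τ.im) {l : ℂ} (hl : l ∈ lat τ) :
    ∃ u : ℂ → ℂ, Differentiable ℂ u ∧ (∀ z, u z ≠ 0) ∧ ∀ z, theta τ (z + l) = u z * theta τ z := by
  obtain ⟨m, n, rfl⟩ := hl
  have hn : ∃ u : ℂ → ℂ, Differentiable ℂ u ∧ (∀ z, u z ≠ 0) ∧
      ∀ z, theta τ (z + n * τ) = u z * theta τ z := by
    induction n using Int.induction_on with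
    | zero => exact ⟨fun _ => 1, by fun_prop, by simp, by simp⟩
    | succ n ih =>
      obtain ⟨u, hu, hu0, h⟩ := ih
      refine ⟨fun z => -ex (-(z + n * τ)) * u z, by fun_prop, fun z => ?_, fun z => ?_⟩
      · exact mul_ne_zero (neg_ne_zero.2 (ex_ne_zero _)) (hu0 z)
      · rw [show z + ((n + 1 : ℤ) : ℂ) * τ = z + (n : ℤ) * τ + τ by push_cast; ring,
          theta_add_tau hτ, h]
        push_cast; ring
    | pred n ih =>
      obtain ⟨u, hu, hu0, h⟩ := ih
      refine ⟨fun z => -ex (z + (-n - 1) * τ) * u z, by fun_prop, fun z => ?_, fun z => ?_⟩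
      · exact mul_ne_zero (neg_ne_zero.2 (ex_ne_zero _)) (hu0 z)
      · have h2 := theta_add_tau hτ (z + ((-n - 1 : ℤ) : ℂ) * τ)
        rw [show z + ((-n - 1 : ℤ) : ℂ) * τ + τ = z + ((-n : ℤ) : ℂ) * τ by push_cast; ring,
          h] at h2
        simp only [neg_mul, mul_assoc]
        rw [h2, ex_neg]
        have := ex_ne_zero (z + ((-n - 1 : ℤ) : ℂ) * τ)
        push_cast at this ⊢
        field_simp
  obtain ⟨u, hu, hu0, h⟩ := hn
  refine ⟨u, hu, hu0, fun z => ?_⟩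
  rw [show z + (m + n * τ) = z + n * τ + m by ring, theta_add_int, h]

@[simp] theorem theta_zero {τ : ℂ} (hτ : 0 < τ.im) : theta τ 0 = 0 := by
  rw [theta_eq hτ]; simp

theorem ex_tau_pow_ne_one {τ : ℂ} (hτ : 0 < τ.im) {n : ℕ} (hn : n ≠ 0) : ex τ ^ n ≠ 1 := by
  intro h
  have : ‖ex τ‖ ^ n = 1 := by rw [← norm_pow, h, norm_one]
  exact (pow_lt_one₀ (norm_nonneg _) (norm_ex_lt_one hτ) hn).ne this

theorem theta_eq_zero_iff {τ : ℂ} (hτ : 0 < τ.im) {z : ℂ} : theta τ z = 0 ↔ z ∈ lat τ := by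
  constructor
  · intro h
    rcases mul_eq_zero.1 h with h | h
    · by_contra hz
      refine qprod_ne_zero (norm_ex_lt_one hτ) (fun n hn => hz ?_) h
      rw [← ex_natCast_mul, ← ex_add, ex_eq_one_iff] at hn
      obtain ⟨m, hm⟩ := hn
      exact ⟨m, -n, by push_cast; rw [← hm]; ring⟩
    · by_contra hz
      refine qprod_ne_zero (norm_ex_lt_one hτ) (fun n hn => hz ?_) h
      rw [← ex_natCast_mul, ← ex_add, ← ex_add, ex_eq_one_iff] at hn
      obtain ⟨m, hm⟩ := hn
      exact ⟨-m, n + 1, by push_cast; rw [← hm]; ring⟩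
  · intro h
    obtain ⟨u, -, -, hu⟩ := theta_add_lat hτ h
    simpa [hτ] using hu 0

theorem analyticOrderAt_theta_of_mem {τ : ℂ} (hτ : 0 < τ.im) {z : ℂ} (hz : z ∈ lat τ) :
    analyticOrderAt (theta τ) z = 1 := by
  have h0 : analyticOrderAt (theta τ) 0 = 1 := by
    have hfun : theta τ = (fun z => 1 - ex z) *
        fun z => qprod (ex τ) (ex τ * ex z) * qprod (ex τ) (ex τ * ex (-z)) :=
      funext fun z => theta_eq hτ z
    have hq : ∀ x, AnalyticAt ℂ (fun z => qprod (ex τ) z) x := fun x =>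
      (DifferentiableOn.analyticAt (s := Set.univ) (fun y _ =>
        (sepHolOn_qprod.snd (ex τ, y) ⟨by simpa using norm_ex_lt_one hτ,
          trivial⟩).differentiableWithinAt) univ_mem)
    have hg : AnalyticAt ℂ (fun z => qprod (ex τ) (ex τ * ex z) * qprod (ex τ) (ex τ * ex (-z))) 0 := by
      have e1 : AnalyticAt ℂ (fun z => ex τ * ex z) 0 :=
        (show Differentiable ℂ (fun z => ex τ * ex z) by fun_prop).analyticAt 0
      have e2 : AnalyticAt ℂ (fun z => ex τ * ex (-z)) 0 :=
        (show Differentiable ℂ (fun z => ex τ * ex (-z)) by fun_prop).analyticAt 0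
      exact ((hq _).fun_comp e1).mul ((hq _).fun_comp e2)
    have hf : AnalyticAt ℂ (fun z => 1 - ex z) 0 :=
      (show Differentiable ℂ (fun z => 1 - ex z) by fun_prop).analyticAt 0
    have hq0 : qprod (ex τ) (ex τ) ≠ 0 := qprod_ne_zero (norm_ex_lt_one hτ) fun n => by
      rw [← pow_succ]; exact ex_tau_pow_ne_one hτ n.succ_ne_zero
    rw [hfun, analyticOrderAt_mul hf hg, hg.analyticOrderAt_eq_zero.2 (by simpa using hq0),
      add_zero]
    refine hf.analyticOrderAt_eq_one_of_zero_deriv_ne_zero (by simp) ?_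
    rw [((hasDerivAt_ex 0).const_sub 1).deriv]
    simp [Real.pi_ne_zero]
  obtain ⟨u, hu, hu0, h⟩ := theta_add_lat hτ hz
  have hfun : theta τ = (fun w => u (w - z)) * (theta τ ∘ fun w => w - z) := by
    funext w
    have := h (w - z)
    simpa using this
  have hsub : AnalyticAt ℂ (fun w : ℂ => w - z) z := by fun_prop
  have hu' : AnalyticAt ℂ (fun w => u (w - z)) z :=
    (show Differentiable ℂ (fun w => u (w - z)) by fun_prop).analyticAt z
  have hth : AnalyticAt ℂ (theta τ ∘ fun w => w - z) z :=
    (show Differentiable ℂ (theta τ ∘ fun w => w - z) from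
      (differentiable_theta hτ).comp (by fun_prop)).analyticAt z
  rw [hfun, analyticOrderAt_mul hu' hth, hu'.analyticOrderAt_eq_zero.2 (hu0 _), zero_add,
    analyticOrderAt_comp_of_deriv_ne_zero hsub (by simp), sub_self, h0]

theorem analyticOrderAt_theta_of_notMem {τ : ℂ} (hτ : 0 < τ.im) {z : ℂ} (hz : z ∉ lat τ) :
    analyticOrderAt (theta τ) z = 0 :=
  (analyticAt_theta hτ z).analyticOrderAt_eq_zero.2 (mt (theta_eq_zero_iff hτ).1 hz)


/-! ### Identities between theta products -/

theorem lat_induction {τ : ℂ} {p : ℂ → Prop} (h1 : ∀ z, p z ↔ p (z + 1))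
    (h2 : ∀ z, p z ↔ p (z + τ)) {l : ℂ} (hl : l ∈ lat τ) (z : ℂ) : p z ↔ p (z + l) := by
  have key : ∀ ω : ℂ, (∀ z, p z ↔ p (z + ω)) → ∀ (n : ℤ) z, p z ↔ p (z + n * ω) := by
    intro ω hω n z
    have hP : Function.Periodic p ω := fun z => propext (hω z).symm
    exact (propext_iff.1 (hP.int_mul n z)).symm
  obtain ⟨m, n, rfl⟩ := hl
  rw [key 1 h1 m z, key τ h2 n (z + m * 1)]
  ring_nf

/-- A quotient form of Liouville's theorem: two entire functions with the same multipliers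
under the lattice are proportional if the zeros of the one are zeros of the other. -/
theorem exists_eq_const_mul {τ : ℂ} (hτ : 0 < τ.im) {A B : ℂ → ℂ} (hA : Differentiable ℂ A)
    (hB : Differentiable ℂ B) (hB0 : ∃ z, B z ≠ 0)
    (ho : ∀ z, analyticOrderAt B z ≤ analyticOrderAt A z)
    (h1 : ∀ z, ∃ u, u ≠ 0 ∧ A (z + 1) = u * A z ∧ B (z + 1) = u * B z)
    (h2 : ∀ z, ∃ u, u ≠ 0 ∧ A (z + τ) = u * A z ∧ B (z + τ) = u * B z) :
    ∃ c, ∀ z, A z = c * B z := by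
  have hAa : ∀ z, AnalyticAt ℂ A z := fun z => hA.analyticAt z
  have hBa : ∀ z, AnalyticAt ℂ B z := fun z => hB.analyticAt z
  have hBtop : ∀ z, analyticOrderAt B z ≠ ⊤ := by
    intro z hz
    obtain ⟨z₀, hz₀⟩ := hB0
    have := AnalyticOnNhd.eq_of_eventuallyEq (f := B) (g := 0) (fun z _ => hBa z)
      (fun z _ => analyticAt_const) (analyticOrderAt_eq_top.1 hz)
    exact hz₀ (congrFun this z₀)
  have hBne : ∀ z, ∀ᶠ w in 𝓝[≠] z, B w ≠ 0 := by
    intro z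
    rcases (hBa z).eventually_eq_zero_or_eventually_ne_zero with h | h
    · exact absurd (analyticOrderAt_eq_top.2 h) (hBtop z)
    · exact h
  obtain ⟨c, hc⟩ := exists_const_of_meromorphic_of_periodic hτ (F := fun z => A z / B z)
    (fun z => ((hAa z).meromorphicAt).fun_div (hBa z).meromorphicAt)
    (fun z => by
      obtain ⟨u, hu, e1, e2⟩ := h1 z
      simp only [e1, e2]; rw [mul_div_mul_left _ _ hu])
    (fun z => by
      obtain ⟨u, hu, e1, e2⟩ := h2 z
      simp only [e1, e2]; rw [mul_div_mul_left _ _ hu])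
    (fun z => by
      obtain ⟨n, hn⟩ := ENat.ne_top_iff_exists.1 (hBtop z)
      obtain ⟨h, hha, hh0, hh⟩ := ((hBa z).analyticOrderAt_eq_natCast).1 hn.symm
      obtain ⟨g, hga, hg⟩ := (natCast_le_analyticOrderAt (hAa z)).1 (hn ▸ ho z)
      have : (fun z => A z / B z) =ᶠ[𝓝[≠] z] fun w => g w / h w := by
        filter_upwards [nhdsWithin_le_nhds hh, nhdsWithin_le_nhds hg, self_mem_nhdsWithin]
          with w e1 e2 hw
        rw [e1, e2, smul_eq_mul, smul_eq_mul, mul_div_mul_left]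
        exact pow_ne_zero _ (sub_ne_zero.2 hw)
      rw [meromorphicOrderAt_congr this]
      exact (hga.fun_div hha hh0).meromorphicOrderAt_nonneg)
  refine ⟨c, fun z => ?_⟩
  have hev : ∀ᶠ w in 𝓝[≠] z, A w = c * B w := by
    filter_upwards [hBne z] with w hw
    have := hc w ((hAa w).fun_div (hBa w) hw)
    rw [← this, div_mul_cancel₀ _ hw]
  exact tendsto_nhds_unique_of_eventuallyEq
    (hA.continuous.continuousAt.tendsto.mono_left nhdsWithin_le_nhds)
    ((hB.continuous.continuousAt.tendsto.const_mul c).mono_left nhdsWithin_le_nhds) hev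

theorem analyticOrderAt_theta_add {τ : ℂ} (u z : ℂ) :
    analyticOrderAt (fun z => theta τ (z + u)) z = analyticOrderAt (theta τ) (z + u) := by
  have hsub : AnalyticAt ℂ (fun w : ℂ => w + u) z := by fun_prop
  exact analyticOrderAt_comp_of_deriv_ne_zero (f := theta τ) hsub (by simp)

theorem half_notMem_lat {τ : ℂ} (hτ : 0 < τ.im) : (1 / 2 : ℂ) ∉ lat τ := by
  rintro ⟨m, n, h⟩
  have := real_combination_unique hτ (x := 1 / 2) (y := 0) (x' := m) (y' := n)
    (by push_cast; simpa using h)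
  have h2 : (2 * m : ℝ) = 1 := by rw [← this.1]; norm_num
  have h3 : (2 * m : ℤ) = 1 := by exact_mod_cast h2
  omega

theorem theta_sub_one (τ z : ℂ) : theta τ (z - 1) = theta τ z := by
  have := theta_add_one τ (z - 1)
  rw [sub_add_cancel] at this
  exact this.symm

theorem lat_two_mul_isolated {τ : ℂ} (hτ : 0 < τ.im) (u : ℂ) :
    ∀ᶠ w in 𝓝[≠] u, 2 * w ∉ lat τ := by
  obtain ⟨δ, hδ, h⟩ := exists_lat_separation hτ
  by_cases hu : 2 * u ∈ lat τ
  · have : ∀ᶠ w in 𝓝[≠] u, ‖2 * w - 2 * u‖ < δ := by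
      refine nhdsWithin_le_nhds ?_
      have c1 : ContinuousAt (fun w : ℂ => ‖2 * w - 2 * u‖) u := by fun_prop
      exact c1.eventually_lt_const (by simpa using hδ)
    filter_upwards [this, self_mem_nhdsWithin] with w hw hwu hmem
    have := h _ (sub_mem hmem hu) hw
    exact hwu (mul_left_cancel₀ two_ne_zero (sub_eq_zero.1 this))
  · -- Away from the half-lattice, a nearby lattice point would be too close to another one.
    by_contra hcon
    have hfr : ∃ᶠ w in 𝓝[≠] u, 2 * w ∈ lat τ := hcon
    have hb : ∀ᶠ w in 𝓝[≠] u, ‖2 * w - 2 * u‖ < δ / 2 := by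
      refine nhdsWithin_le_nhds ?_
      have c1 : ContinuousAt (fun w : ℂ => ‖2 * w - 2 * u‖) u := by fun_prop
      exact c1.eventually_lt_const (by simpa only [sub_self, norm_zero] using half_pos hδ)
    obtain ⟨w, hw, hwb⟩ := (hfr.and_eventually hb).exists
    have hwu : 2 * w ≠ 2 * u := fun e => hu (e ▸ hw)
    have hb2 : ∀ᶠ v in 𝓝[≠] u, ‖2 * v - 2 * u‖ < min (δ / 2) ‖2 * w - 2 * u‖ := by
      refine nhdsWithin_le_nhds ?_
      have c1 : ContinuousAt (fun w : ℂ => ‖2 * w - 2 * u‖) u := by fun_prop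
      exact c1.eventually_lt_const (by
        simp only [sub_self, norm_zero]
        exact lt_min (by positivity) (norm_pos_iff.2 (sub_ne_zero.2 hwu)))
    obtain ⟨v, hv, hvb⟩ := (hfr.and_eventually hb2).exists
    have h0 : 2 * w - 2 * v = 0 := by
      refine h _ (sub_mem hw hv) ?_
      calc ‖2 * w - 2 * v‖ = ‖(2 * w - 2 * u) - (2 * v - 2 * u)‖ := by ring_nf
        _ ≤ ‖2 * w - 2 * u‖ + ‖2 * v - 2 * u‖ := norm_sub_le _ _
        _ < δ / 2 + δ / 2 := add_lt_add hwb (hvb.trans_le (min_le_left _ _))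
        _ = δ := by ring
    rw [sub_eq_zero.1 h0] at hvb
    exact (hvb.trans_le (min_le_right _ _)).false

/-- The fundamental identity for the quotient `(theta (z + 1/2) / theta z) ^ 2`. It shows that this
quotient takes the same value at `z` and `u` exactly when `z = ± u` modulo the lattice. -/
theorem theta_identity {τ : ℂ} (hτ : 0 < τ.im) (z u : ℂ) :
    theta τ (z + 1 / 2) ^ 2 * theta τ u ^ 2 - theta τ (u + 1 / 2) ^ 2 * theta τ z ^ 2 =
      -ex u * theta τ (1 / 2) ^ 2 * (theta τ (z + u) * theta τ (z - u)) := by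
  have hd := differentiable_theta hτ
  have main : ∀ u, 2 * u ∉ lat τ → ∀ z,
      theta τ (z + 1 / 2) ^ 2 * theta τ u ^ 2 - theta τ (u + 1 / 2) ^ 2 * theta τ z ^ 2 =
      -ex u * theta τ (1 / 2) ^ 2 * (theta τ (z + u) * theta τ (z - u)) := by
    intro u hu
    have hu' : u ∉ lat τ := fun h => hu (two_mul_mem_lat h)
    set A : ℂ → ℂ := fun z =>
      theta τ (z + 1 / 2) ^ 2 * theta τ u ^ 2 - theta τ (u + 1 / 2) ^ 2 * theta τ z ^ 2 with hA
    have hAd : Differentiable ℂ A := by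
      rw [hA]; fun_prop
    set B : ℂ → ℂ := fun z => theta τ (z + u) * theta τ (z + -u) with hB
    have hBd : Differentiable ℂ B := by
      rw [hB]; fun_prop
    have A1 : ∀ z, A (z + 1) = 1 * A z := fun z => by
      simp only [hA]
      rw [show z + 1 + 1 / 2 = z + 1 / 2 + 1 by ring, theta_add_one, theta_add_one, one_mul]
    have A2 : ∀ z, A (z + τ) = ex (-z) ^ 2 * A z := fun z => by
      simp only [hA]
      rw [show z + τ + 1 / 2 = z + 1 / 2 + τ by ring, theta_add_tau hτ, theta_add_tau hτ]
      have : ex (-(z + 1 / 2)) ^ 2 = ex (-z) ^ 2 := by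
        rw [neg_add, ex_add, mul_pow, sq (ex (-(1 / 2))), ← ex_add]
        rw [show (-(1 / 2) + -(1 / 2) : ℂ) = ((-1 : ℤ) : ℂ) by push_cast; ring, ex_int, mul_one]
      linear_combination theta τ (z + 1 / 2) ^ 2 * theta τ u ^ 2 * this
    have hAu : A u = 0 := by simp only [hA]; ring
    have hAnu : A (-u) = 0 := by
      simp only [hA]
      rw [show -u + 1 / 2 = -(u + 1 / 2 - 1) by ring, theta_neg hτ, theta_neg hτ u, theta_sub_one]
      have : ex (-(u + 1 / 2 - 1)) ^ 2 = ex (-u) ^ 2 := by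
        rw [show -(u + 1 / 2 - 1) = -u + 1 / 2 by ring, ex_add, mul_pow, sq (ex (1 / 2)), ← ex_add]
        rw [show (1 / 2 + 1 / 2 : ℂ) = ((1 : ℤ) : ℂ) by push_cast; ring, ex_int, mul_one]
      linear_combination theta τ (u + 1 / 2) ^ 2 * theta τ u ^ 2 * this
    have hAlat : ∀ l ∈ lat τ, ∀ z, A z = 0 ↔ A (z + l) = 0 := fun l hl =>
      lat_induction (p := fun z => A z = 0) (fun z => by simp [A1])
        (fun z => by simp [A2, ex_ne_zero]) hl
    obtain ⟨c, hc⟩ := exists_eq_const_mul hτ hAd hBd ⟨0, by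
        simp only [hB]
        refine mul_ne_zero ?_ ?_ <;> rw [Ne, theta_eq_zero_iff hτ] <;> simpa using hu'⟩
      (fun z => by
        have ha1 : AnalyticAt ℂ (fun z => theta τ (z + u)) z :=
          (show Differentiable ℂ fun z => theta τ (z + u) by fun_prop).analyticAt z
        have ha2 : AnalyticAt ℂ (fun z => theta τ (z + -u)) z :=
          (show Differentiable ℂ fun z => theta τ (z + -u) by fun_prop).analyticAt z
        have hBo : analyticOrderAt B z = analyticOrderAt (theta τ) (z + u) +
            analyticOrderAt (theta τ) (z + -u) := by
          rw [← analyticOrderAt_theta_add, ← analyticOrderAt_theta_add]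
          exact analyticOrderAt_mul ha1 ha2
        rw [hBo]
        by_cases m1 : z + u ∈ lat τ
        · have m2 : z + -u ∉ lat τ := fun h => hu (by
            have := sub_mem m1 h; ring_nf at this ⊢; exact this)
          rw [analyticOrderAt_theta_of_mem hτ m1, analyticOrderAt_theta_of_notMem hτ m2, add_zero,
            Order.one_le_iff_ne_zero, (hAd.analyticAt z).analyticOrderAt_ne_zero]
          have := (hAlat _ m1 (-u)).1 hAnu
          simpa using this
        · rw [analyticOrderAt_theta_of_notMem hτ m1, zero_add]
          by_cases m2 : z + -u ∈ lat τ
          · rw [analyticOrderAt_theta_of_mem hτ m2,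
              Order.one_le_iff_ne_zero, (hAd.analyticAt z).analyticOrderAt_ne_zero]
            have := (hAlat _ m2 u).1 hAu
            simpa using this
          · rw [analyticOrderAt_theta_of_notMem hτ m2]
            exact zero_le)
      (fun z => ⟨1, one_ne_zero, A1 z, by
        simp only [hB]
        rw [show z + 1 + u = z + u + 1 by ring, show z + 1 + -u = z + -u + 1 by ring,
          theta_add_one, theta_add_one, one_mul]⟩)
      (fun z => ⟨ex (-z) ^ 2, pow_ne_zero _ (ex_ne_zero _), A2 z, by
        simp only [hB]
        rw [show z + τ + u = z + u + τ by ring, show z + τ + -u = z + -u + τ by ring,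
          theta_add_tau hτ, theta_add_tau hτ]
        have : ex (-(z + u)) * ex (-(z + -u)) = ex (-z) ^ 2 := by
          rw [sq, ← ex_add, ← ex_add]; ring_nf
        linear_combination theta τ (z + u) * theta τ (z + -u) * this⟩)
    -- The constant is found at `z = 0`.
    have h0 := hc 0
    simp only [hA, hB, zero_add, theta_zero hτ, theta_neg hτ u] at h0
    have hθ : theta τ u ≠ 0 := mt (theta_eq_zero_iff hτ).1 hu'
    have hcv : c = -ex u * theta τ (1 / 2) ^ 2 := by
      have hex := ex_ne_zero u
      rw [ex_neg] at h0
      refine mul_left_cancel₀ (pow_ne_zero 2 hθ) ?_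
      field_simp at h0
      linear_combination h0
    intro z
    have := hc z
    simp only [hA, hB, ← sub_eq_add_neg] at this
    rw [this, hcv]
  have hev : ∀ᶠ v in 𝓝[≠] u, theta τ (z + 1 / 2) ^ 2 * theta τ v ^ 2 -
      theta τ (v + 1 / 2) ^ 2 * theta τ z ^ 2 =
      -ex v * theta τ (1 / 2) ^ 2 * (theta τ (z + v) * theta τ (z - v)) := by
    filter_upwards [lat_two_mul_isolated hτ u] with v hv using main v hv z
  have hc := hd.continuous
  have hce : Continuous ex := differentiable_ex.continuous
  refine tendsto_nhds_unique_of_eventuallyEq (l := 𝓝[≠] u)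
    (f := fun v => theta τ (z + 1 / 2) ^ 2 * theta τ v ^ 2 -
      theta τ (v + 1 / 2) ^ 2 * theta τ z ^ 2)
    (g := fun v => -ex v * theta τ (1 / 2) ^ 2 * (theta τ (z + v) * theta τ (z - v)))
    ?_ ?_ hev
  · exact (Continuous.tendsto (by fun_prop) u).mono_left nhdsWithin_le_nhds
  · exact (Continuous.tendsto (by fun_prop) u).mono_left nhdsWithin_le_nhds

theorem theta_add_nat_mul_tau {τ : ℂ} (hτ : 0 < τ.im) (k : ℕ) (z : ℂ) :
    theta τ (z + k * τ) = (-1) ^ k * ex (-(k * z) - k * (k - 1) / 2 * τ) * theta τ z := by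
  induction k with
  | zero => simp
  | succ k ih =>
    rw [show z + ((k + 1 : ℕ) : ℂ) * τ = z + k * τ + τ by push_cast; ring, theta_add_tau hτ, ih]
    rw [show -(((k + 1 : ℕ) : ℂ) * z) - ((k + 1 : ℕ) : ℂ) * (((k + 1 : ℕ) : ℂ) - 1) / 2 * τ =
      -(z + k * τ) + (-(k * z) - k * (k - 1) / 2 * τ) by push_cast; ring, ex_add]
    ring

/-- The `a ^ 2` solutions `u` of `a u = c` modulo the lattice. -/
def divPt (τ : ℂ) (a : ℕ) (c : ℂ) (p : Fin a × Fin a) : ℂ :=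
  (c + ((p.1 : ℕ) : ℂ) + ((p.2 : ℕ) : ℂ) * τ) / a

theorem sum_divPt (τ : ℂ) {a : ℕ} (ha : a ≠ 0) (c : ℂ) :
    ∑ p, divPt τ a c p = a * c + a * (a - 1) / 2 * (1 + τ) := by
  have ha' : (a : ℂ) ≠ 0 := Nat.cast_ne_zero.2 ha
  have hs : ∑ i : Fin a, ((i : ℕ) : ℂ) = a * (a - 1) / 2 := by
    rw [Fin.sum_univ_eq_sum_range (fun i => (i : ℂ)) a]
    induction a with
    | zero => simp
    | succ n ih =>
      rw [Finset.sum_range_succ]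
      by_cases hn : n = 0
      · subst hn; simp
      · rw [ih hn (Nat.cast_ne_zero.2 hn)]; push_cast; ring
  have : ∀ p : Fin a × Fin a, divPt τ a c p =
      c / a + ((p.1 : ℕ) : ℂ) * (1 / a) + ((p.2 : ℕ) : ℂ) * (τ / a) := fun p => by
    rw [divPt]; ring
  simp only [this, Finset.sum_add_distrib, ← Finset.sum_mul, Fintype.sum_prod_type,
    Finset.sum_const, Finset.card_univ, Fintype.card_fin, Fintype.card_prod, hs, nsmul_eq_mul, ← Finset.mul_sum]
  push_cast
  field_simp
  ring

theorem exists_sub_divPt_mem_lat {τ : ℂ} {a : ℕ} (ha : a ≠ 0) {c z : ℂ} (h : a * z - c ∈ lat τ) :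
    ∃ p, z - divPt τ a c p ∈ lat τ := by
  obtain ⟨m, n, hmn⟩ := h
  have ha' : (a : ℂ) ≠ 0 := Nat.cast_ne_zero.2 ha
  have haz : (0 : ℤ) < a := by positivity
  have hrem : ∀ k : ℤ, ∃ i : Fin a, ∃ q : ℤ, (k : ℂ) = (i : ℕ) + a * q := fun k => by
    refine ⟨⟨(k % a).toNat, ?_⟩, k / a, ?_⟩
    · have := Int.emod_lt_of_pos k haz
      have := Int.emod_nonneg k haz.ne'
      omega
    · have h0 := Int.emod_nonneg k haz.ne'
      have h1 : ((k % a).toNat : ℤ) + a * (k / a) = k := by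
        rw [Int.toNat_of_nonneg h0]; exact Int.emod_add_mul_ediv k a
      exact_mod_cast h1.symm
  obtain ⟨i, q, hi⟩ := hrem m
  obtain ⟨j, r, hj⟩ := hrem n
  refine ⟨(i, j), q, r, ?_⟩
  have hz : z = (c + m + n * τ) / a := by
    rw [eq_div_iff ha']; linear_combination hmn
  rw [hz, divPt, hi, hj]
  field_simp
  ring

/-- The distribution relation of the theta product. -/
theorem prod_theta_sub_divPt {τ : ℂ} (hτ : 0 < τ.im) {a : ℕ} (ha : a ≠ 0) (c : ℂ) :
    ∃ K, K ≠ 0 ∧ ∀ z, ∏ p, theta τ (z - divPt τ a c p) =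
      K * (ex ((a * (a - 1) : ℤ) * z) * theta τ (a * z - c)) := by
  have ha' : (a : ℂ) ≠ 0 := Nat.cast_ne_zero.2 ha
  have hd := differentiable_theta hτ
  set A : ℂ → ℂ := fun z => ∏ p, theta τ (z - divPt τ a c p) with hA
  set B : ℂ → ℂ := fun z => ex ((a * (a - 1) : ℤ) * z) * theta τ (a * z - c) with hB
  have hAd : Differentiable ℂ A := by rw [hA]; fun_prop
  have hBd : Differentiable ℂ B := by rw [hB]; fun_prop
  have hev : ∀ k : ℤ, ∃ m : ℤ, k * (k - 1) = 2 * m := fun k => by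
    have := Int.even_mul_pred_self k
    obtain ⟨m, hm⟩ := this
    exact ⟨m, by rw [hm]; ring⟩
  obtain ⟨m, hm⟩ := hev a
  have hmC : (a : ℂ) * (a - 1) = 2 * m := by exact_mod_cast hm
  have hex2 : ∀ z, z ∉ lat τ → theta τ z ≠ 0 := fun z => mt (theta_eq_zero_iff hτ).1
  have hBne : ∃ z, B z ≠ 0 := by
    refine ⟨(c + 1 / 2) / a, mul_ne_zero (ex_ne_zero _) (hex2 _ ?_)⟩
    rw [mul_div_cancel₀ _ ha', add_sub_cancel_left]
    rintro ⟨m, n, h⟩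
    have := real_combination_unique hτ (x := 1 / 2) (y := 0) (x' := m) (y' := n)
      (by push_cast; simpa using h)
    have h2 : (2 * m : ℝ) = 1 := by rw [← this.1]; norm_num
    have h3 : (2 * m : ℤ) = 1 := by exact_mod_cast h2
    omega
  have hprop : ∃ K, ∀ z, A z = K * B z := by
    refine exists_eq_const_mul hτ hAd hBd hBne (fun z => ?_) (fun z => ?_) (fun z => ?_)
    · have hBo : analyticOrderAt B z = analyticOrderAt (theta τ) (a * z - c) := by
        have h1 : AnalyticAt ℂ (fun z => ex ((a * (a - 1) : ℤ) * z)) z :=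
          (show Differentiable ℂ (fun z => ex ((a * (a - 1) : ℤ) * z)) by fun_prop).analyticAt z
        have h2 : AnalyticAt ℂ (fun z => theta τ (a * z - c)) z :=
          (show Differentiable ℂ (fun z => theta τ (a * z - c)) by fun_prop).analyticAt z
        have h3 : AnalyticAt ℂ (fun z : ℂ => a * z - c) z := by fun_prop
        have h4 : deriv (fun z : ℂ => a * z - c) z ≠ 0 := by
          have : HasDerivAt (fun z : ℂ => a * z - c) (a * 1) z :=
            ((hasDerivAt_id z).const_mul (a : ℂ)).sub_const c
          rw [this.deriv]; simpa using ha
        have e := analyticOrderAt_mul h1 h2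
        rw [h1.analyticOrderAt_eq_zero.2 (ex_ne_zero _), zero_add] at e
        exact e.trans (analyticOrderAt_comp_of_deriv_ne_zero (f := theta τ) h3 h4)
      rw [hBo]
      by_cases hz : a * z - c ∈ lat τ
      · rw [analyticOrderAt_theta_of_mem hτ hz, Order.one_le_iff_ne_zero,
          (hAd.analyticAt z).analyticOrderAt_ne_zero]
        obtain ⟨p, hp⟩ := exists_sub_divPt_mem_lat ha hz
        exact Finset.prod_eq_zero (Finset.mem_univ p) ((theta_eq_zero_iff hτ).2 hp)
      · rw [analyticOrderAt_theta_of_notMem hτ hz]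
        exact zero_le
    · refine ⟨1, one_ne_zero, ?_, ?_⟩
      · simp only [hA, one_mul]
        refine Finset.prod_congr rfl fun p _ => ?_
        rw [show z + 1 - divPt τ a c p = z - divPt τ a c p + 1 by ring, theta_add_one]
      · simp only [hB, one_mul, mul_add, mul_one, ex_add, ex_int]
        rw [show (a : ℂ) * z + a - c = a * z - c + (a : ℤ) by push_cast; ring, theta_add_int]
    · refine ⟨(-1) ^ (a * a) * ex (-(a * a * z) + ∑ p, divPt τ a c p),
        mul_ne_zero (pow_ne_zero _ (by norm_num)) (ex_ne_zero _), ?_, ?_⟩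
      · have : ∀ s : Finset (Fin a × Fin a), ∏ p ∈ s, theta τ (z + τ - divPt τ a c p) =
            (-1) ^ s.card * ex (-(s.card * z) + ∑ p ∈ s, divPt τ a c p) *
              ∏ p ∈ s, theta τ (z - divPt τ a c p) := by
          intro s
          induction s using Finset.induction_on with
          | empty => simp
          | insert p s hp ih =>
            rw [Finset.prod_insert hp, Finset.prod_insert hp, Finset.sum_insert hp,
              Finset.card_insert_of_notMem hp, ih,
              show z + τ - divPt τ a c p = z - divPt τ a c p + τ by ring, theta_add_tau hτ,
              show -(((s.card + 1 : ℕ) : ℂ) * z) + (divPt τ a c p + ∑ p ∈ s, divPt τ a c p) =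
                -(z - divPt τ a c p) + (-(s.card * z) + ∑ p ∈ s, divPt τ a c p) by push_cast; ring,
              ex_add (-(z - divPt τ a c p))]
            ring
        simp only [hA]
        rw [this]
        simp
      · simp only [hB]
        rw [show (a : ℂ) * (z + τ) - c = a * z - c + a * τ by ring, theta_add_nat_mul_tau hτ,
          sum_divPt τ ha, mul_add ((a * (a - 1) : ℤ) : ℂ), ex_add]
        have hsign : (-1 : ℂ) ^ (a * a) = (-1) ^ a := by
          rcases Nat.even_or_odd a with h | h
          · rw [h.neg_one_pow, (h.mul_right a).neg_one_pow]
          · rw [h.neg_one_pow, (h.mul h).neg_one_pow]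
        rw [hsign]
        have hexp : ex (((a * (a - 1) : ℤ) : ℂ) * τ) * ex (-(a * (a * z - c)) - a * (a - 1) / 2 * τ) =
            ex (-(a * a * z) + (a * c + a * (a - 1) / 2 * (1 + τ))) := by
          rw [← ex_add]
          have : -((a : ℂ) * a * z) + (a * c + a * (a - 1) / 2 * (1 + τ)) =
              (((a * (a - 1) : ℤ) : ℂ) * τ + (-(a * (a * z - c)) - a * (a - 1) / 2 * τ)) + (m : ℤ) := by
            push_cast
            linear_combination hmC / 2
          rw [this, ex_add _ ((m : ℤ) : ℂ), ex_int, mul_one]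
        rw [← hexp]
        ring
  obtain ⟨K, hK⟩ := hprop
  refine ⟨K, ?_, hK⟩
  rintro rfl
  -- The product does not vanish identically because its zeros are isolated.
  have h0 : ∀ z, ∃ p, z - divPt τ a c p ∈ lat τ := fun z => by
    have := hK z
    rw [zero_mul, hA, Finset.prod_eq_zero_iff] at this
    obtain ⟨p, -, hp⟩ := this
    exact ⟨p, (theta_eq_zero_iff hτ).1 hp⟩
  obtain ⟨p, m, n, h⟩ := h0 ((c + 1 / 2) / a)
  rw [divPt] at h
  have h' : ((1 / 2 - (p.1 : ℕ) : ℝ) : ℂ) + ((-(p.2 : ℕ) : ℝ) : ℂ) * τ =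
      ((a * m : ℝ) : ℂ) + ((a * n : ℝ) : ℂ) * τ := by
    push_cast
    field_simp at h ⊢
    linear_combination h
  have := (real_combination_unique hτ h').1
  have h3 : (1 : ℤ) - 2 * (p.1 : ℕ) = 2 * (a * m) := by
    have : (1 : ℝ) - 2 * (p.1 : ℕ) = 2 * (a * m) := by rw [← this]; ring
    exact_mod_cast this
  omega

/-- The multiplication formula: the binary form whose zeros are the images of the solutions of
`a u = c` is carried by the theta coordinates to a product of two translates. -/
theorem prod_theta_form {τ : ℂ} (hτ : 0 < τ.im) {a : ℕ} (ha : a ≠ 0) (c : ℂ) :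
    ∃ K, K ≠ 0 ∧ ∀ z, ∏ p, (theta τ (z + 1 / 2) ^ 2 * theta τ (divPt τ a c p) ^ 2 -
        theta τ (divPt τ a c p + 1 / 2) ^ 2 * theta τ z ^ 2) =
      K * ex ((a * a - a : ℤ) * z) * (theta τ (a * z + c) * theta τ (a * z - c)) := by
  obtain ⟨K, hK, h⟩ := prod_theta_sub_divPt hτ ha c
  have hhalf : theta τ (1 / 2) ≠ 0 := mt (theta_eq_zero_iff hτ).1 (half_notMem_lat hτ)
  set S := ∑ p, divPt τ a c p with hS
  refine ⟨(∏ p, (-ex (divPt τ a c p) * theta τ (1 / 2) ^ 2)) * ((-1) ^ (a * a) * ex S) * K * K *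
    (-ex (-c)), ?_, fun z => ?_⟩
  · refine mul_ne_zero (mul_ne_zero (mul_ne_zero (mul_ne_zero (Finset.prod_ne_zero_iff.2
      fun p _ => mul_ne_zero (neg_ne_zero.2 (ex_ne_zero _)) (pow_ne_zero _ hhalf))
      (mul_ne_zero (pow_ne_zero _ (by norm_num)) (ex_ne_zero _))) hK) hK)
      (neg_ne_zero.2 (ex_ne_zero _))
  · simp only [theta_identity hτ, Finset.prod_mul_distrib]
    rw [h z]
    have hplus : ∏ p, theta τ (z + divPt τ a c p) =
        ((-1) ^ (a * a) * ex (a * a * z + S)) * ∏ p, theta τ (-z - divPt τ a c p) := by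
      have : ∀ s : Finset (Fin a × Fin a), ∏ p ∈ s, theta τ (z + divPt τ a c p) =
          (-1) ^ s.card * ex (s.card * z + ∑ p ∈ s, divPt τ a c p) *
            ∏ p ∈ s, theta τ (-z - divPt τ a c p) := by
        intro s
        induction s using Finset.induction_on with
        | empty => simp
        | insert p s hp ih =>
          rw [Finset.prod_insert hp, Finset.prod_insert hp, Finset.sum_insert hp,
            Finset.card_insert_of_notMem hp, ih,
            show z + divPt τ a c p = -(-z - divPt τ a c p) by ring, theta_neg hτ,
            show (((s.card + 1 : ℕ) : ℂ) * z) + (divPt τ a c p + ∑ p ∈ s, divPt τ a c p) =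
              -(-z - divPt τ a c p) + (s.card * z + ∑ p ∈ s, divPt τ a c p) by push_cast; ring,
            ex_add (-(-z - divPt τ a c p))]
          ring
      rw [this]
      simp [hS]
    rw [hplus, h (-z), show (a : ℂ) * -z - c = -(a * z + c) by ring, theta_neg hτ,
      ex_add (a * a * z) S, neg_add, ex_add _ (-c)]
    have e1 : ex (((a * (a - 1) : ℤ) : ℂ) * z) * ex (((a * (a - 1) : ℤ) : ℂ) * -z) = 1 := by
      rw [← ex_add]; simp
    have e2 : ex (a * a * z) * ex (-(a * z)) = ex (((a * a - a : ℤ) : ℂ) * z) := by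
      rw [← ex_add]; push_cast; ring_nf
    simp only [Finset.prod_const, Finset.prod_neg]
    rw [← e2]
    linear_combination (((-1) ^ (Finset.univ : Finset (Fin a × Fin a)).card *
        ∏ p, ex (divPt τ a c p)) * (theta τ (1 / 2) ^ 2) ^ (Finset.univ : Finset (Fin a × Fin a)).card *
        ((-1) ^ (a * a) * ex S) * K * K * -ex (-c) * (ex (a * a * z) * ex (-(a * z))) *
        (theta τ (a * z + c) * theta τ (a * z - c))) * e1


/-! ### Homogeneous coordinates on the sphere -/

/-- The point of the Riemann sphere with homogeneous coordinates `[x : y]`. The value `∞` at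
`(0, 0)` is a junk value. -/
def pt (x y : ℂ) : OnePoint ℂ := if y = 0 then ∞ else ((x / y : ℂ) : OnePoint ℂ)

@[simp] theorem pt_zero_right (x : ℂ) : pt x 0 = ∞ := if_pos rfl

theorem pt_of_ne {x y : ℂ} (hy : y ≠ 0) : pt x y = ((x / y : ℂ) : OnePoint ℂ) := if_neg hy

@[simp] theorem pt_one_right (x : ℂ) : pt x 1 = (x : OnePoint ℂ) := by
  rw [pt_of_ne one_ne_zero, div_one]

theorem pt_mul_left {c : ℂ} (hc : c ≠ 0) (x y : ℂ) : pt (c * x) (c * y) = pt x y := by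
  simp only [pt, mul_eq_zero, hc, false_or, mul_div_mul_left _ _ hc]

theorem pt_eq_pt_iff {x y x' y' : ℂ} (h : x ≠ 0 ∨ y ≠ 0) (h' : x' ≠ 0 ∨ y' ≠ 0) :
    pt x y = pt x' y' ↔ x * y' = x' * y := by
  by_cases hy : y = 0
  · subst hy
    have hx : x ≠ 0 := by simpa using h
    by_cases hy' : y' = 0
    · simp [hy']
    · simp [pt_of_ne hy', hx, hy']
  · by_cases hy' : y' = 0
    · subst hy'
      have hx : x' ≠ 0 := by simpa using h'
      simp [pt_of_ne hy, hx, hy]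
    · rw [pt_of_ne hy, pt_of_ne hy', OnePoint.coe_eq_coe, div_eq_div_iff hy hy']

theorem exists_eq_pt (P : OnePoint ℂ) : ∃ x y : ℂ, (x ≠ 0 ∨ y ≠ 0) ∧ P = pt x y := by
  induction P using OnePoint.rec with
  | infty => exact ⟨1, 0, by simp, by simp⟩
  | coe z => exact ⟨z, 1, by simp, by simp⟩

theorem continuousAt_pt_one_zero : ContinuousAt (pt 1) 0 := by
  rw [continuousAt_iff_punctured_nhds, pt_zero_right]
  have h1 : Tendsto (fun z : ℂ => ((z⁻¹ : ℂ) : OnePoint ℂ)) (𝓝[≠] 0) (𝓝 ∞) := by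
    refine Tendsto.comp (g := ((↑) : ℂ → OnePoint ℂ)) ?_ (tendsto_inv₀_nhdsNE_zero (α := ℂ))
    rw [Metric.cobounded_eq_cocompact, ← coclosedCompact_eq_cocompact]
    exact OnePoint.tendsto_coe_infty
  refine h1.congr' ?_
  filter_upwards [self_mem_nhdsWithin] with z hz
  rw [pt_of_ne hz, one_div]

theorem continuousAt_pt {p : ℂ × ℂ} (h : p.1 ≠ 0 ∨ p.2 ≠ 0) :
    ContinuousAt (fun p : ℂ × ℂ => pt p.1 p.2) p := by
  by_cases hy : p.2 = 0
  · have hx : p.1 ≠ 0 := by simpa [hy] using h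
    have h1 : (fun p : ℂ × ℂ => pt p.1 p.2) =ᶠ[𝓝 p] fun p => pt 1 (p.2 / p.1) := by
      have : ∀ᶠ q : ℂ × ℂ in 𝓝 p, q.1 ≠ 0 := continuousAt_fst.eventually_ne hx
      filter_upwards [this] with q hq
      rw [← pt_mul_left hq 1, mul_one, mul_div_cancel₀ _ hq]
    refine ContinuousAt.congr ?_ h1.symm
    refine ContinuousAt.comp (g := pt 1) (f := fun p : ℂ × ℂ => p.2 / p.1) ?_
      (continuousAt_snd.div continuousAt_fst hx)
    simpa [hy] using continuousAt_pt_one_zero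
  · have h1 : (fun p : ℂ × ℂ => pt p.1 p.2) =ᶠ[𝓝 p]
        fun p => ((p.1 / p.2 : ℂ) : OnePoint ℂ) := by
      have : ∀ᶠ q : ℂ × ℂ in 𝓝 p, q.2 ≠ 0 := continuousAt_snd.eventually_ne hy
      filter_upwards [this] with q hq using pt_of_ne hq
    refine ContinuousAt.congr ?_ h1.symm
    exact OnePoint.continuous_coe.continuousAt.comp (continuousAt_fst.div continuousAt_snd hy)

theorem coord_infty_pt (x y : ℂ) : coord ∞ (pt x y) = y / x := by
  by_cases hy : y = 0
  · simp [hy, coord]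
  · simp [pt_of_ne hy, coord]

theorem coord_coe_pt (c x y : ℂ) : coord (c : OnePoint ℂ) (pt x y) = x / y := by
  by_cases hy : y = 0
  · simp [hy, coord]
  · simp [pt_of_ne hy, coord]

theorem param_infty (z : ℂ) : param ∞ z = pt 1 z := by
  by_cases hz : z = 0
  · simp [hz, param]
  · simp [pt_of_ne hz, param, hz]

theorem param_coe (c z : ℂ) : param (c : OnePoint ℂ) z = pt z 1 := by
  simp [param]

@[simp] theorem param_coord_self (x : OnePoint ℂ) : param x (coord x x) = x := by
  induction x using OnePoint.rec with
  | infty => simp [param, coord]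
  | coe z => simp [param, coord]

@[simp] theorem coord_param (x : OnePoint ℂ) (z : ℂ) : coord x (param x z) = z := by
  induction x using OnePoint.rec with
  | infty => simp [param_infty, coord_infty_pt]
  | coe c => rw [param_coe, coord_coe_pt, div_one]

theorem eventually_param_coord (x : OnePoint ℂ) : ∀ᶠ y in 𝓝 x, param x (coord x y) = y := by
  induction x using OnePoint.rec with
  | infty =>
    have : ∀ᶠ y : OnePoint ℂ in 𝓝 ∞, y ≠ ((0 : ℂ) : OnePoint ℂ) :=
      isOpen_ne.mem_nhds (OnePoint.infty_ne_coe 0)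
    filter_upwards [this] with y hy
    induction y using OnePoint.rec with
    | infty => simp
    | coe z =>
      have hz : z ≠ 0 := fun h => hy (by rw [h])
      simp [coord, param, hz]
  | coe c =>
    have : ∀ᶠ y : OnePoint ℂ in 𝓝 (c : OnePoint ℂ), y ≠ ∞ :=
      isOpen_ne.mem_nhds (OnePoint.coe_ne_infty c)
    filter_upwards [this] with y hy
    induction y using OnePoint.rec with
    | infty => exact absurd rfl hy
    | coe z => simp [coord, param]

theorem continuousAt_coord (x : OnePoint ℂ) : ContinuousAt (coord x) x := by
  induction x using OnePoint.rec with
  | infty =>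
    rw [OnePoint.continuousAt_infty']
    have h1 : coord ∞ ∘ ((↑) : ℂ → OnePoint ℂ) = fun w => w⁻¹ := by
      funext w; simp [coord]
    rw [h1]
    have : coord ∞ ∞ = 0 := by simp [coord]
    rw [this, coclosedCompact_eq_cocompact, ← Metric.cobounded_eq_cocompact]
    exact tendsto_inv₀_cobounded
  | coe c =>
    rw [OnePoint.continuousAt_coe]
    have h1 : coord (c : OnePoint ℂ) ∘ ((↑) : ℂ → OnePoint ℂ) = id := by
      funext w; simp [coord]
    rw [h1]
    exact continuousAt_id

/-! ### Holomorphic germs to the sphere -/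

/-- A map from the plane to the sphere that near `z` has holomorphic homogeneous coordinates
without common zero. -/
def HolSph (h : ℂ → OnePoint ℂ) (z : ℂ) : Prop :=
  ∃ x y : ℂ → ℂ, AnalyticAt ℂ x z ∧ AnalyticAt ℂ y z ∧ (x z ≠ 0 ∨ y z ≠ 0) ∧
    h =ᶠ[𝓝 z] fun w => pt (x w) (y w)

theorem HolSph.continuousAt {h : ℂ → OnePoint ℂ} {z : ℂ} (hh : HolSph h z) : ContinuousAt h z := by
  obtain ⟨x, y, hx, hy, h0, he⟩ := hh
  refine ContinuousAt.congr ?_ he.symm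
  exact (continuousAt_pt (p := (x z, y z)) h0).comp (f := fun w => (x w, y w))
    (hx.continuousAt.prodMk hy.continuousAt)

theorem HolSph.analyticAt_coord {h : ℂ → OnePoint ℂ} {z : ℂ} (hh : HolSph h z) :
    AnalyticAt ℂ (fun w => coord (h z) (h w)) z := by
  obtain ⟨x, y, hx, hy, h0, he⟩ := hh
  by_cases hyz : y z = 0
  · have hz : h z = ∞ := by
      have := he.self_of_nhds
      simpa [hyz] using this
    have hxz : x z ≠ 0 := by simpa [hyz] using h0
    refine (hy.fun_div hx hxz).congr ?_
    filter_upwards [he] with w hw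
    rw [hz, hw, coord_infty_pt]
  · have hz : h z = ((x z / y z : ℂ) : OnePoint ℂ) := by
      have := he.self_of_nhds
      simpa [pt_of_ne hyz] using this
    refine (hx.fun_div hy hyz).congr ?_
    filter_upwards [he] with w hw
    rw [hz, hw, coord_coe_pt]

theorem holSph_of_coord {h : ℂ → OnePoint ℂ} {z : ℂ} (hc : ContinuousAt h z)
    (ha : AnalyticAt ℂ (fun w => coord (h z) (h w)) z) : HolSph h z := by
  have h1 : ∀ᶠ w in 𝓝 z, param (h z) (coord (h z) (h w)) = h w :=
    hc.eventually (eventually_param_coord (h z))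
  by_cases hx : h z = ∞
  · refine ⟨fun _ => 1, fun w => coord (h z) (h w), analyticAt_const, ha, Or.inl one_ne_zero, ?_⟩
    filter_upwards [h1] with w hw
    rw [← param_infty]
    nth_rw 1 [← hw]
    rw [hx]
  · obtain ⟨c, hx⟩ := OnePoint.ne_infty_iff_exists.1 hx
    refine ⟨fun w => coord (h z) (h w), fun _ => 1, ha, analyticAt_const, Or.inr one_ne_zero, ?_⟩
    filter_upwards [h1] with w hw
    rw [← param_coe c]
    nth_rw 1 [← hw]
    rw [← hx]

theorem holomorphicToSphere_iff {h : ℂ → OnePoint ℂ} :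
    HolomorphicToSphere h ↔ ∀ z, HolSph h z :=
  ⟨fun hh z => holSph_of_coord hh.1.continuousAt (hh.2 z),
    fun hh => ⟨continuous_iff_continuousAt.2 fun z => (hh z).continuousAt,
      fun z => (hh z).analyticAt_coord⟩⟩

theorem HolSph.congr {h h' : ℂ → OnePoint ℂ} {z : ℂ} (hh : HolSph h z) (he : h' =ᶠ[𝓝 z] h) :
    HolSph h' z := by
  obtain ⟨x, y, hx, hy, h0, e⟩ := hh
  exact ⟨x, y, hx, hy, h0, he.trans e⟩

theorem HolSph.comp_analytic {h : ℂ → OnePoint ℂ} {g : ℂ → ℂ} {z : ℂ} (hh : HolSph h (g z))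
    (hg : AnalyticAt ℂ g z) : HolSph (fun w => h (g w)) z := by
  obtain ⟨x, y, hx, hy, h0, he⟩ := hh
  exact ⟨fun w => x (g w), fun w => y (g w), hx.fun_comp hg, hy.fun_comp hg, h0,
    hg.continuousAt.eventually he⟩

theorem holSph_param (x : OnePoint ℂ) (z : ℂ) : HolSph (param x) z := by
  induction x using OnePoint.rec with
  | infty =>
    exact ⟨fun _ => 1, fun w => w, analyticAt_const, analyticAt_id, Or.inl one_ne_zero,
      Eventually.of_forall param_infty⟩
  | coe c =>
    exact ⟨fun w => w, fun _ => 1, analyticAt_id, analyticAt_const, Or.inr one_ne_zero,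
      Eventually.of_forall (param_coe c)⟩

/-- The local degree of a germ of a map to the sphere at `z`: the vanishing order at `z` of the map
minus its value. -/
def sphOrder (h : ℂ → OnePoint ℂ) (z : ℂ) : ℕ∞ :=
  analyticOrderAt (fun w => coord (h z) (h w) - coord (h z) (h z)) z

/-- A self-map of the sphere that is holomorphic near `x`. -/
def SphHol (G : OnePoint ℂ → OnePoint ℂ) (x : OnePoint ℂ) : Prop :=
  HolSph (fun z => G (param x z)) (coord x x)

/-- The local degree of a self-map of the sphere. -/
def sphDegree (G : OnePoint ℂ → OnePoint ℂ) (x : OnePoint ℂ) : ℕ∞ :=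
  sphOrder (fun z => G (param x z)) (coord x x)

section Germs

variable {G G₁ G₂ : OnePoint ℂ → OnePoint ℂ} {h : ℂ → OnePoint ℂ} {x : OnePoint ℂ} {z : ℂ}

theorem SphHol.comp_holSph (hG : SphHol G (h z)) (hh : HolSph h z) :
    HolSph (fun w => G (h w)) z := by
  have h1 : HolSph (fun w => G (param (h z) (coord (h z) (h w)))) z :=
    HolSph.comp_analytic (h := fun u => G (param (h z) u)) (g := fun w => coord (h z) (h w)) hG
      hh.analyticAt_coord
  refine h1.congr ?_
  filter_upwards [hh.continuousAt.eventually (eventually_param_coord (h z))] with w hw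
  rw [hw]

/-- The map `G` read in the standard charts at `x` and `G x`. -/
def inCharts (G : OnePoint ℂ → OnePoint ℂ) (x : OnePoint ℂ) (z : ℂ) : ℂ :=
  coord (G x) (G (param x z))

theorem sphereDeriv_eq (G : OnePoint ℂ → OnePoint ℂ) (x : OnePoint ℂ) :
    sphereDeriv G x = deriv (inCharts G x) (coord x x) := rfl

theorem SphHol.analyticAt_inCharts (hG : SphHol G x) :
    AnalyticAt ℂ (inCharts G x) (coord x x) := by
  have := HolSph.analyticAt_coord hG
  simpa only [param_coord_self] using! this

theorem eventually_coord_comp (hh : HolSph h z) :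
    (fun w => coord (G (h z)) (G (h w))) =ᶠ[𝓝 z]
      fun w => inCharts G (h z) (coord (h z) (h w)) := by
  filter_upwards [hh.continuousAt.eventually (eventually_param_coord (h z))] with w hw
  rw [inCharts, hw]

/-- The chain rule for the derivative along a germ. -/
theorem deriv_coord_comp (hG : SphHol G (h z)) (hh : HolSph h z) :
    deriv (fun w => coord (G (h z)) (G (h w))) z =
      sphereDeriv G (h z) * deriv (fun w => coord (h z) (h w)) z := by
  rw [(eventually_coord_comp hh).deriv_eq, sphereDeriv_eq]
  exact deriv_comp (h₂ := inCharts G (h z)) (h := fun w => coord (h z) (h w)) z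
    hG.analyticAt_inCharts.differentiableAt hh.analyticAt_coord.differentiableAt

theorem SphHol.comp (h₂ : SphHol G₂ (G₁ x)) (h₁ : SphHol G₁ x) :
    SphHol (fun y => G₂ (G₁ y)) x := by
  refine SphHol.comp_holSph (G := G₂) (h := fun z => G₁ (param x z)) ?_ h₁
  simpa using h₂

theorem sphereDeriv_comp (h₂ : SphHol G₂ (G₁ x)) (h₁ : SphHol G₁ x) :
    sphereDeriv (fun y => G₂ (G₁ y)) x = sphereDeriv G₂ (G₁ x) * sphereDeriv G₁ x := by
  have := deriv_coord_comp (G := G₂) (h := fun z => G₁ (param x z)) (z := coord x x)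
    (by simpa using h₂) h₁
  simpa only [param_coord_self] using! this

theorem sphHol_iterate (hG : ∀ x, SphHol G x) (n : ℕ) (x : OnePoint ℂ) : SphHol G^[n] x := by
  induction n with
  | zero => exact holSph_param x _
  | succ n ih =>
    have : G^[n + 1] = fun y => G (G^[n] y) := funext fun y => Function.iterate_succ_apply' G n y
    rw [this]
    exact (hG _).comp ih

theorem sphereDeriv_id (x : OnePoint ℂ) : sphereDeriv (fun y => y) x = 1 := by
  have : inCharts (fun y => y) x = id := funext fun z => by simp [inCharts]
  rw [sphereDeriv_eq, this, deriv_id]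

theorem sphereDeriv_iterate (hG : ∀ x, SphHol G x) (n : ℕ) (x : OnePoint ℂ) :
    sphereDeriv G^[n] x = ∏ i ∈ Finset.range n, sphereDeriv G (G^[i] x) := by
  induction n with
  | zero => exact sphereDeriv_id x
  | succ n ih =>
    have : G^[n + 1] = fun y => G (G^[n] y) := funext fun y => Function.iterate_succ_apply' G n y
    rw [this, sphereDeriv_comp (hG _) (sphHol_iterate hG n x), ih, Finset.prod_range_succ, mul_comm]

theorem sphOrder_comp (hG : SphHol G (h z)) (hh : HolSph h z) :
    sphOrder (fun w => G (h w)) z = sphDegree G (h z) * sphOrder h z := by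
  have h1 := (eventually_coord_comp (G := G) hh)
  have ha : AnalyticAt ℂ (fun u => inCharts G (h z) u - coord (G (h z)) (G (h z)))
      ((fun w => coord (h z) (h w)) z) :=
    hG.analyticAt_inCharts.fun_sub analyticAt_const
  have key := ha.analyticOrderAt_comp hh.analyticAt_coord
  have e1 : sphOrder (fun w => G (h w)) z =
      analyticOrderAt ((fun u => inCharts G (h z) u - coord (G (h z)) (G (h z))) ∘
        fun w => coord (h z) (h w)) z := by
    refine analyticOrderAt_congr ?_
    filter_upwards [h1] with w hw
    simp only [Function.comp, ← hw]
  rw [e1, key]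
  congr 1
  simp only [sphDegree, sphOrder, inCharts, param_coord_self]

theorem sphOrder_ne_zero (hh : HolSph h z) : sphOrder h z ≠ 0 := by
  rw [sphOrder, (hh.analyticAt_coord.fun_sub analyticAt_const).analyticOrderAt_ne_zero, sub_self]

theorem sphDegree_ne_zero (hG : SphHol G x) : sphDegree G x ≠ 0 := sphOrder_ne_zero hG

theorem two_le_sphDegree (hG : SphHol G x) (h0 : sphereDeriv G x = 0) : 2 ≤ sphDegree G x := by
  have ha := HolSph.analyticAt_coord hG
  have ha' : AnalyticAt ℂ (fun w => coord (G (param x (coord x x))) (G (param x w)) -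
      coord (G (param x (coord x x))) (G (param x (coord x x)))) (coord x x) :=
    ha.fun_sub analyticAt_const
  have hd : deriv (fun w => coord (G (param x (coord x x))) (G (param x w)) -
      coord (G (param x (coord x x))) (G (param x (coord x x)))) (coord x x) = 0 := by
    rw [deriv_sub_const]
    simpa only [param_coord_self] using! h0
  have h1 := ha'.analyticOrderAt_deriv_add_one
  rw [sphDegree, sphOrder]
  simp only [sub_self, sub_zero] at h1
  rw [← h1]
  have : analyticOrderAt (deriv (fun w => coord (G (param x (coord x x))) (G (param x w)) -
      coord (G (param x (coord x x))) (G (param x (coord x x))))) (coord x x) ≠ 0 :=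
    (ha'.deriv.analyticOrderAt_ne_zero).2 hd
  calc (2 : ℕ∞) = 1 + 1 := by norm_num
    _ ≤ _ := by gcongr; exact Order.one_le_iff_ne_zero.2 this

/-- If a germ of order `e` semiconjugates a germ with multiplier `l` to a map that fixes its value,
then the multiplier of the latter is `l ^ e`. -/
theorem sphereDeriv_eq_pow (hG : SphHol G (h z)) (hh : HolSph h z) (hfix : G (h z) = h z) {l : ℂ}
    (hsemi : ∀ᶠ w in 𝓝 z, G (h w) = h (z + l * (w - z))) {e : ℕ} (he : sphOrder h z = e) :
    sphereDeriv G (h z) = l ^ e := by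
  have hua : AnalyticAt ℂ (fun w => coord (h z) (h w) - coord (h z) (h z)) z :=
    hh.analyticAt_coord.fun_sub analyticAt_const
  obtain ⟨g, hga, hg0, hg⟩ := (hua.analyticOrderAt_eq_natCast).1 he
  have hlin : ContinuousAt (fun w => z + l * (w - z)) z := by fun_prop
  have hlin0 : (fun w => z + l * (w - z)) z = z := by simp
  have hg' : ∀ᶠ w in 𝓝 z, coord (h z) (h (z + l * (w - z))) - coord (h z) (h z) =
      (l * (w - z)) ^ e * g (z + l * (w - z)) := by
    have := hlin.eventually (p := fun w => coord (h z) (h w) - coord (h z) (h z) =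
      (w - z) ^ e • g w) (by simpa using hg)
    filter_upwards [this] with w hw
    rw [hw, add_sub_cancel_left, smul_eq_mul]
  have hd := hG.analyticAt_inCharts.differentiableAt.hasDerivAt
  rw [← sphereDeriv_eq, hasDerivAt_iff_tendsto_slope] at hd
  have hne : ∀ᶠ w in 𝓝[≠] z, coord (h z) (h w) ≠ coord (h z) (h z) := by
    have : ∀ᶠ w in 𝓝 z, g w ≠ 0 := hga.continuousAt.eventually_ne hg0
    filter_upwards [nhdsWithin_le_nhds this, nhdsWithin_le_nhds hg, self_mem_nhdsWithin]
      with w h1 h2 h3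
    rw [← sub_ne_zero, h2, smul_eq_mul]
    exact mul_ne_zero (pow_ne_zero _ (sub_ne_zero.2 h3)) h1
  have ht : Tendsto (fun w => coord (h z) (h w)) (𝓝[≠] z) (𝓝[≠] (coord (h z) (h z))) :=
    tendsto_nhdsWithin_iff.2 ⟨hh.analyticAt_coord.continuousAt.tendsto.mono_left nhdsWithin_le_nhds,
      hne⟩
  have h1 := hd.comp ht
  have h2 : Tendsto (fun w => l ^ e * (g (z + l * (w - z)) / g w)) (𝓝[≠] z) (𝓝 (l ^ e)) := by
    have c1 : ContinuousAt (fun w => l ^ e * (g (z + l * (w - z)) / g w)) z := by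
      have : ContinuousAt (fun w => g (z + l * (w - z))) z :=
        ContinuousAt.comp (g := g) (f := fun w => z + l * (w - z))
          (by simpa using hga.continuousAt) hlin
      exact continuousAt_const.mul (this.div hga.continuousAt hg0)
    have := c1.tendsto.mono_left (nhdsWithin_le_nhds (s := {z}ᶜ))
    simpa [hg0] using this
  refine tendsto_nhds_unique_of_eventuallyEq h1 h2 ?_
  have hgne : ∀ᶠ w in 𝓝 z, g w ≠ 0 := hga.continuousAt.eventually_ne hg0
  filter_upwards [nhdsWithin_le_nhds hg, nhdsWithin_le_nhds hg', nhdsWithin_le_nhds hsemi,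
    nhdsWithin_le_nhds (eventually_coord_comp (G := G) hh), self_mem_nhdsWithin,
    nhdsWithin_le_nhds hgne] with w e1 e2 e3 e4 e5 e6
  have hwz : w - z ≠ 0 := sub_ne_zero.2 e5
  have e7 : inCharts G (h z) (coord (h z) (h z)) = coord (h z) (h z) := by
    rw [inCharts, param_coord_self, hfix]
  simp only [Function.comp, slope_def_field]
  rw [e7, ← e4, e3, hfix, e2, e1, smul_eq_mul, mul_pow]
  field_simp

end Germs


/-! ### Möbius transformations -/

theorem smul_pt (A : GL (Fin 2) ℂ) {x y : ℂ} (h : x ≠ 0 ∨ y ≠ 0) :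
    A • pt x y = pt (A 0 0 * x + A 0 1 * y) (A 1 0 * x + A 1 1 * y) := by
  by_cases hy : y = 0
  · subst hy
    have hx : x ≠ 0 := by simpa using h
    rw [pt_zero_right, OnePoint.smul_infty_eq_ite, mul_zero, mul_zero, add_zero, add_zero,
      mul_comm _ x, mul_comm _ x, pt_mul_left hx]
    rfl
  · rw [pt_of_ne hy, OnePoint.smul_some_eq_ite,
      ← pt_mul_left (inv_ne_zero hy) (A 0 0 * x + A 0 1 * y)]
    simp only [pt]
    have e1 : y⁻¹ * (A 0 0 * x + A 0 1 * y) = A 0 0 * (x / y) + A 0 1 := by field_simp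
    have e2 : y⁻¹ * (A 1 0 * x + A 1 1 * y) = A 1 0 * (x / y) + A 1 1 := by field_simp
    rw [e1, e2]

/-- Homogeneous coordinates stay nonzero under an invertible matrix. -/
theorem gl_ne_zero (A : GL (Fin 2) ℂ) {x y : ℂ} (h : x ≠ 0 ∨ y ≠ 0) :
    A 0 0 * x + A 0 1 * y ≠ 0 ∨ A 1 0 * x + A 1 1 * y ≠ 0 := by
  by_contra! hc
  have hd : A 0 0 * A 1 1 - A 0 1 * A 1 0 ≠ 0 := by
    have := A.det_ne_zero
    rwa [Matrix.det_fin_two] at this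
  have hx : (A 0 0 * A 1 1 - A 0 1 * A 1 0) * x = 0 := by
    linear_combination A 1 1 * hc.1 - A 0 1 * hc.2
  have hy : (A 0 0 * A 1 1 - A 0 1 * A 1 0) * y = 0 := by
    linear_combination A 0 0 * hc.2 - A 1 0 * hc.1
  simp [hd] at hx hy
  simp [hx, hy] at h

theorem HolSph.gl_smul {h : ℂ → OnePoint ℂ} {z : ℂ} (hh : HolSph h z) (A : GL (Fin 2) ℂ) :
    HolSph (fun w => A • h w) z := by
  obtain ⟨x, y, hx, hy, h0, he⟩ := hh
  refine ⟨fun w => A 0 0 * x w + A 0 1 * y w, fun w => A 1 0 * x w + A 1 1 * y w, by fun_prop,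
    by fun_prop, gl_ne_zero A h0, ?_⟩
  have h0' : ∀ᶠ w in 𝓝 z, x w ≠ 0 ∨ y w ≠ 0 := by
    rcases h0 with h0 | h0
    · exact (hx.continuousAt.eventually_ne h0).mono fun _ => Or.inl
    · exact (hy.continuousAt.eventually_ne h0).mono fun _ => Or.inr
  filter_upwards [he, h0'] with w hw hw0
  rw [hw, smul_pt A hw0]

theorem sphHol_gl_smul (A : GL (Fin 2) ℂ) (x : OnePoint ℂ) : SphHol (fun y => A • y) x :=
  HolSph.gl_smul (holSph_param x _) A

theorem sphereDeriv_gl_smul_ne_zero (A : GL (Fin 2) ℂ) (x : OnePoint ℂ) :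
    sphereDeriv (fun y => A • y) x ≠ 0 := by
  have h := sphereDeriv_comp (x := x) (sphHol_gl_smul A⁻¹ (A • x)) (sphHol_gl_smul A x)
  simp only [inv_smul_smul, sphereDeriv_id] at h
  intro h0
  simp [h0] at h

theorem SphHol.conj {G : OnePoint ℂ → OnePoint ℂ} {x : OnePoint ℂ} (A : GL (Fin 2) ℂ)
    (hG : SphHol G (A⁻¹ • x)) : SphHol (fun y => A • G (A⁻¹ • y)) x :=
  (sphHol_gl_smul A _).comp (SphHol.comp (G₂ := G) hG (sphHol_gl_smul A⁻¹ x))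

theorem sphereDeriv_conj {G : OnePoint ℂ → OnePoint ℂ} {x : OnePoint ℂ} (A : GL (Fin 2) ℂ)
    (hG : SphHol G (A⁻¹ • x)) : sphereDeriv (fun y => A • G (A⁻¹ • y)) x =
      sphereDeriv (fun y => A • y) (G (A⁻¹ • x)) * sphereDeriv G (A⁻¹ • x) *
        sphereDeriv (fun y => A⁻¹ • y) x := by
  rw [sphereDeriv_comp (G₂ := fun y => A • y) (G₁ := fun y => G (A⁻¹ • y)) (sphHol_gl_smul A _)
    (SphHol.comp (G₂ := G) hG (sphHol_gl_smul A⁻¹ x)),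
    sphereDeriv_comp (G₂ := G) (G₁ := fun y => A⁻¹ • y) hG (sphHol_gl_smul A⁻¹ x), mul_assoc]

/-- The multiplier at a fixed point is invariant under conjugation. -/
theorem sphereDeriv_conj_of_fixed {G : OnePoint ℂ → OnePoint ℂ} {x : OnePoint ℂ}
    (A : GL (Fin 2) ℂ) (hG : SphHol G x) (hx : G x = x) :
    sphereDeriv (fun y => A • G (A⁻¹ • y)) (A • x) = sphereDeriv G x := by
  have h := sphereDeriv_comp (x := x) (sphHol_gl_smul A⁻¹ (A • x)) (sphHol_gl_smul A x)
  simp only [inv_smul_smul, sphereDeriv_id] at h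
  rw [sphereDeriv_conj A (by simpa using hG), inv_smul_smul, hx]
  linear_combination -sphereDeriv G x * h

theorem iterate_conj (G : OnePoint ℂ → OnePoint ℂ) (A : GL (Fin 2) ℂ) (n : ℕ) (x : OnePoint ℂ) :
    (fun y => A • G (A⁻¹ • y))^[n] x = A • G^[n] (A⁻¹ • x) := by
  induction n with
  | zero => simp
  | succ n ih => rw [Function.iterate_succ_apply', Function.iterate_succ_apply', ih, inv_smul_smul]

/-- The condition of strict postcritical finiteness for a self-map of the sphere. -/
def StrictlyPCF (G : OnePoint ℂ → OnePoint ℂ) : Prop :=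
  ∀ x, IsCriticalPoint G x → ∃ n : ℕ, IsRepellingPeriodic G (G^[n] x)

theorem StrictlyPCF.conj {G : OnePoint ℂ → OnePoint ℂ} (hG : ∀ x, SphHol G x) (h : StrictlyPCF G)
    (A : GL (Fin 2) ℂ) : StrictlyPCF fun y => A • G (A⁻¹ • y) := by
  intro x hx
  rw [IsCriticalPoint, sphereDeriv_conj A (hG _)] at hx
  have hc : sphereDeriv G (A⁻¹ • x) = 0 := by
    simpa [sphereDeriv_gl_smul_ne_zero] using hx
  obtain ⟨n, k, hk, hp, hr⟩ := h _ hc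
  refine ⟨n, k, hk, ?_, ?_⟩
  · rw [Function.IsPeriodicPt, Function.IsFixedPt, iterate_conj, iterate_conj, inv_smul_smul]
    exact congrArg _ hp
  · rw [iterate_conj, show (fun y => A • G (A⁻¹ • y))^[k] = fun y => A • G^[k] (A⁻¹ • y) from
      funext fun y => iterate_conj G A k y,
      sphereDeriv_conj_of_fixed A (sphHol_iterate hG k _) hp]
    exact hr

/-! ### Surjectivity of holomorphic maps from tori to the sphere -/

theorem HolSph.range_mem_nhds {h : ℂ → OnePoint ℂ} {z : ℂ} (hh : HolSph h z)
    (hnc : ¬ ∀ᶠ w in 𝓝 z, h w = h z) : Set.range h ∈ 𝓝 (h z) := by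
  have hp := hh.continuousAt.eventually (eventually_param_coord (h z))
  rcases hh.analyticAt_coord.eventually_constant_or_nhds_le_map_nhds with h1 | h1
  · refine absurd ?_ hnc
    filter_upwards [h1, hp] with w e1 e2
    rw [← e2, e1, param_coord_self]
  · have h2 : ∀ᶠ u in 𝓝 (coord (h z) (h z)), param (h z) u ∈ Set.range h := by
      refine h1 ?_
      rw [mem_map]
      filter_upwards [hp] with w hw
      exact ⟨w, hw.symm⟩
    filter_upwards [(continuousAt_coord (h z)).eventually h2, eventually_param_coord (h z)]
      with y e1 e2
    rwa [e2] at e1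

/-- A holomorphic map to the sphere that is nowhere locally constant and whose values are all taken
on a compact set is onto. -/
theorem surjective_of_holSph {h : ℂ → OnePoint ℂ} (hh : ∀ z, HolSph h z) {K : Set ℂ}
    (hK : IsCompact K) (hper : ∀ z, ∃ w ∈ K, h w = h z) (hnc : ∀ z, ¬ ∀ᶠ w in 𝓝 z, h w = h z) :
    Function.Surjective h := by
  have hc : Continuous h := continuous_iff_continuousAt.2 fun z => (hh z).continuousAt
  have hr : Set.range h = h '' K := by
    refine subset_antisymm ?_ (Set.image_subset_range h K)
    rintro _ ⟨z, rfl⟩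
    obtain ⟨w, hw, e⟩ := hper z
    exact ⟨w, hw, e⟩
  have hcl : IsClosed (Set.range h) := hr ▸ (hK.image hc).isClosed
  have hop : IsOpen (Set.range h) := isOpen_iff_mem_nhds.2 <| by
    rintro _ ⟨z, rfl⟩
    exact (hh z).range_mem_nhds (hnc z)
  exact Set.range_eq_univ.1 (IsClopen.eq_univ ⟨hcl, hop⟩ (Set.range_nonempty h))

/-! ### The projection of the torus to the sphere given by the theta product -/

/-- The even elliptic function with a double zero at `1 / 2` and a double pole at `0`, as a quotient
of theta products. -/
def ell (τ z : ℂ) : ℂ := theta τ (z + 1 / 2) ^ 2 / theta τ z ^ 2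

/-- The two-to-one projection `ℂ / (ℤ + ℤ τ) → ℂ ∪ {∞}` given by `ell τ`. -/
def proj (τ z : ℂ) : OnePoint ℂ := pt (theta τ (z + 1 / 2) ^ 2) (theta τ z ^ 2)

section Proj

variable {τ : ℂ} (hτ : 0 < τ.im)
include hτ

theorem theta_ne_zero {z : ℂ} (hz : z ∉ lat τ) : theta τ z ≠ 0 := mt (theta_eq_zero_iff hτ).1 hz

theorem theta_pair_ne_zero (z : ℂ) : theta τ (z + 1 / 2) ^ 2 ≠ 0 ∨ theta τ z ^ 2 ≠ 0 := by
  by_cases h : z ∈ lat τ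
  · refine Or.inl (pow_ne_zero 2 (theta_ne_zero hτ fun h' => half_notMem_lat hτ ?_))
    simpa using sub_mem h' h
  · exact Or.inr (pow_ne_zero 2 (theta_ne_zero hτ h))

theorem holSph_proj (z : ℂ) : HolSph (proj τ) z := by
  have hd := differentiable_theta hτ
  refine ⟨fun z => theta τ (z + 1 / 2) ^ 2, fun z => theta τ z ^ 2, ?_, ?_,
    theta_pair_ne_zero hτ z, Eventually.of_forall fun w => rfl⟩
  · exact (show Differentiable ℂ fun z => theta τ (z + 1 / 2) ^ 2 by fun_prop).analyticAt z
  · exact (show Differentiable ℂ fun z => theta τ z ^ 2 by fun_prop).analyticAt z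

theorem proj_eq_iff {z u : ℂ} : proj τ z = proj τ u ↔ z + u ∈ lat τ ∨ z - u ∈ lat τ := by
  rw [proj, proj, pt_eq_pt_iff (theta_pair_ne_zero hτ z) (theta_pair_ne_zero hτ u), ← sub_eq_zero,
    theta_identity hτ]
  have := half_notMem_lat hτ
  simp only [neg_mul, neg_eq_zero, mul_eq_zero, ex_ne_zero, false_or, 
    theta_eq_zero_iff hτ, this, ne_eq, OfNat.ofNat_ne_zero, not_false_eq_true, pow_eq_zero_iff]

theorem proj_eq_infty_iff {z : ℂ} : proj τ z = ∞ ↔ z ∈ lat τ := by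
  rw [← theta_eq_zero_iff hτ, proj, pt]
  simp

theorem proj_of_notMem {z : ℂ} (hz : z ∉ lat τ) : proj τ z = (ell τ z : ℂ) :=
  pt_of_ne (pow_ne_zero 2 (theta_ne_zero hτ hz))

theorem proj_zero : proj τ 0 = ∞ := (proj_eq_infty_iff hτ).2 (zero_mem _)

theorem proj_half : proj τ (1 / 2) = ((0 : ℂ) : OnePoint ℂ) := by
  rw [proj_of_notMem hτ (half_notMem_lat hτ), ell,
    show (1 / 2 + 1 / 2 : ℂ) = 0 + 1 by norm_num, theta_add_one, theta_zero hτ]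
  simp

theorem proj_congr {z u : ℂ} (h : z - u ∈ lat τ) : proj τ z = proj τ u :=
  (proj_eq_iff hτ).2 (Or.inr h)

omit hτ in
theorem proj_add_half (z : ℂ) :
    proj τ (z + 1 / 2) = pt (theta τ z ^ 2) (theta τ (z + 1 / 2) ^ 2) := by
  rw [proj, show z + 1 / 2 + 1 / 2 = z + 1 by ring, theta_add_one]

theorem ell_eq_iff {z u : ℂ} (hz : z ∉ lat τ) (hu : u ∉ lat τ) :
    ell τ z = ell τ u ↔ z + u ∈ lat τ ∨ z - u ∈ lat τ := by
  rw [← proj_eq_iff hτ, proj_of_notMem hτ hz, proj_of_notMem hτ hu, OnePoint.coe_eq_coe]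

theorem exists_hasDerivAt_theta_zero : ∃ d, d ≠ 0 ∧ HasDerivAt (theta τ) d 0 := by
  have ha := analyticAt_theta hτ 0
  refine ⟨deriv (theta τ) 0, ?_, ha.differentiableAt.hasDerivAt⟩
  have h1 := ha.analyticOrderAt_deriv_add_one
  simp only [theta_zero hτ, sub_zero] at h1
  rw [analyticOrderAt_theta_of_mem hτ (zero_mem _)] at h1
  rw [← ha.deriv.analyticOrderAt_eq_zero]
  have : analyticOrderAt (deriv (theta τ)) 0 + 1 = 0 + 1 := by simpa using h1
  exact ENat.add_left_injective_of_ne_top (n := 1) (by simp) this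

theorem ell_sub_ell {z u : ℂ} (hz : z ∉ lat τ) (hu : u ∉ lat τ) :
    ell τ z - ell τ u =
      -ex u * theta τ (1 / 2) ^ 2 / (theta τ z ^ 2 * theta τ u ^ 2) *
        (theta τ (z + u) * theta τ (z - u)) := by
  have h := theta_identity hτ z u
  have h1 := theta_ne_zero hτ hz
  have h2 := theta_ne_zero hτ hu
  rw [ell, ell, div_sub_div _ _ (pow_ne_zero 2 h1) (pow_ne_zero 2 h2), div_mul_eq_mul_div, ← h]
  ring

/-- The projection is an immersion away from the half-periods. -/
theorem exists_hasDerivAt_ell {u : ℂ} (hu : 2 * u ∉ lat τ) :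
    ∃ d, d ≠ 0 ∧ HasDerivAt (ell τ) d u := by
  have hu' : u ∉ lat τ := fun h => hu (two_mul_mem_lat h)
  obtain ⟨d, hd, hD⟩ := exists_hasDerivAt_theta_zero hτ
  have hθ := differentiable_theta hτ
  have h1 := theta_ne_zero hτ hu'
  have h2 : theta τ (u + u) ≠ 0 := theta_ne_zero hτ (by rwa [← two_mul])
  have h3 : HasDerivAt (fun z => theta τ (z - u)) d u := by
    have : HasDerivAt (theta τ) d (u - u) := by simpa using hD
    simpa using this.comp_sub_const u u
  set k : ℂ → ℂ := fun z => -ex u * theta τ (1 / 2) ^ 2 / (theta τ z ^ 2 * theta τ u ^ 2) *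
    theta τ (z + u) with hk
  have hkd : DifferentiableAt ℂ k u := by
    refine DifferentiableAt.mul (DifferentiableAt.div (by fun_prop) (by fun_prop) ?_) (by fun_prop)
    exact mul_ne_zero (pow_ne_zero 2 h1) (pow_ne_zero 2 h1)
  have hk0 : k u ≠ 0 := by
    refine mul_ne_zero (div_ne_zero (mul_ne_zero (neg_ne_zero.2 (ex_ne_zero u))
      (pow_ne_zero 2 (theta_ne_zero hτ (half_notMem_lat hτ)))) ?_) h2
    exact mul_ne_zero (pow_ne_zero 2 h1) (pow_ne_zero 2 h1)
  have h4 := (hkd.hasDerivAt.mul h3).const_add (ell τ u)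
  refine ⟨k u * d, mul_ne_zero hk0 hd, ?_⟩
  have h5 : deriv k u * theta τ (u - u) + k u * d = k u * d := by simp [theta_zero hτ]
  rw [← h5]
  refine h4.congr_of_eventuallyEq ?_
  have : ∀ᶠ z in 𝓝 u, theta τ z ≠ 0 := hθ.continuous.continuousAt.eventually_ne h1
  filter_upwards [this] with z hz
  have := ell_sub_ell hτ (fun h => hz ((theta_eq_zero_iff hτ).2 h)) hu'
  simp only [hk, Pi.mul_apply, ← sub_eq_iff_eq_add', this]
  ring

theorem deriv_coord_proj_ne_zero {u : ℂ} (hu : 2 * u ∉ lat τ) :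
    deriv (fun w => coord (proj τ u) (proj τ w)) u ≠ 0 := by
  obtain ⟨d, hd, hD⟩ := exists_hasDerivAt_ell hτ hu
  have : (fun w => coord (proj τ u) (proj τ w)) = ell τ := by
    funext w
    rw [proj_of_notMem hτ fun h => hu (two_mul_mem_lat h), proj, coord_coe_pt, ell]
  rwa [this, hD.deriv]

theorem deriv_coord_proj_eq_zero {u : ℂ} (hu : 2 * u ∈ lat τ) :
    deriv (fun w => coord (proj τ u) (proj τ w)) u = 0 := by
  set k := fun w => coord (proj τ u) (proj τ w) with hk
  have h1 : (fun v => k (u - v)) = fun v => k (u + v) := by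
    funext v
    simp only [hk]
    rw [(proj_eq_iff hτ (z := u - v) (u := u + v)).2 (Or.inl (by ring_nf; rwa [mul_comm]))]
  have h2 : deriv (fun v => k (u - v)) 0 = -deriv k u := by
    rw [deriv_comp_const_sub]; simp
  have h3 : deriv (fun v => k (u + v)) 0 = deriv k u := by
    rw [deriv_comp_const_add]; simp
  rw [h1, h3] at h2
  linear_combination h2 / 2

theorem exists_compact_reduction :
    ∃ K : Set ℂ, IsCompact K ∧ ∀ z, ∃ w ∈ K, w - z ∈ lat τ := by
  refine ⟨(fun p : ℝ × ℝ => (p.1 : ℂ) + p.2 * τ) '' (Set.Icc 0 1 ×ˢ Set.Icc 0 1),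
    (isCompact_Icc.prod isCompact_Icc).image (by fun_prop), fun z => ?_⟩
  have hz : z = ((z.re - z.im / τ.im * τ.re : ℝ) : ℂ) + ((z.im / τ.im : ℝ) : ℂ) * τ := by
    apply Complex.ext
    · simp
    · simp [div_mul_cancel₀ _ hτ.ne']
  set x := z.re - z.im / τ.im * τ.re
  set y := z.im / τ.im
  refine ⟨_, ⟨(Int.fract x, Int.fract y), ⟨⟨Int.fract_nonneg x, (Int.fract_lt_one x).le⟩,
    ⟨Int.fract_nonneg y, (Int.fract_lt_one y).le⟩⟩, rfl⟩, -⌊x⌋, -⌊y⌋, ?_⟩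
  have hx : (x : ℂ) = (⌊x⌋ : ℂ) + (Int.fract x : ℝ) := by exact_mod_cast (Int.floor_add_fract x).symm
  have hy : (y : ℂ) = (⌊y⌋ : ℂ) + (Int.fract y : ℝ) := by exact_mod_cast (Int.floor_add_fract y).symm
  rw [hz]
  push_cast
  rw [hx, hy]
  ring

theorem proj_surjective : Function.Surjective (proj τ) := by
  obtain ⟨K, hK, hred⟩ := exists_compact_reduction hτ
  refine surjective_of_holSph (holSph_proj hτ) hK (fun z => ?_) fun z hz => ?_
  · obtain ⟨w, hw, h⟩ := hred z
    exact ⟨w, hw, proj_congr hτ h⟩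
  · -- Near `z` the fibre of `z` is discrete.
    have h1 : ∀ᶠ w in 𝓝[≠] z, 2 * w ∉ lat τ := lat_two_mul_isolated hτ z
    obtain ⟨u, hu1, hu2⟩ := ((hz.eventually_nhds.filter_mono nhdsWithin_le_nhds).and h1).exists
    refine deriv_coord_proj_ne_zero hτ hu2 ?_
    have : (fun w => coord (proj τ u) (proj τ w)) =ᶠ[𝓝 u] fun _ => coord (proj τ u) (proj τ z) := by
      filter_upwards [hu1] with w hw
      rw [hw]
    rw [this.deriv_eq, deriv_const]

end Proj


/-! ### Rational maps in homogeneous coordinates -/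

/-- The binary form of degree `D` with coefficients `c`. -/
def homEval {D : ℕ} (c : Fin (D + 1) → ℂ) (x y : ℂ) : ℂ :=
  ∑ i : Fin (D + 1), c i * x ^ (i : ℕ) * y ^ (D - i)

theorem homEval_of_ne {D : ℕ} (c : Fin (D + 1) → ℂ) (x : ℂ) {y : ℂ} (hy : y ≠ 0) :
    homEval c x y = y ^ D * (toPoly c).eval (x / y) := by
  rw [homEval, toPoly, eval_finsetSum, Finset.mul_sum]
  refine Finset.sum_congr rfl fun i _ => ?_
  have : y ^ D = y ^ (i : ℕ) * y ^ (D - i) := by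
    rw [← pow_add]; congr 1; omega
  simp only [eval_mul, eval_C, eval_pow, eval_X]
  rw [this, div_pow]
  field_simp

theorem homEval_zero {D : ℕ} (c : Fin (D + 1) → ℂ) (x : ℂ) :
    homEval c x 0 = x ^ D * c (Fin.last D) := by
  rw [homEval, Finset.sum_eq_single (Fin.last D)]
  · simp [mul_comm]
  · intro i _ hi
    have : (i : ℕ) < D := Fin.val_lt_last hi
    rw [zero_pow (by omega), mul_zero]
  · simp

theorem homEval_smul_add {D : ℕ} (r s : ℂ) (c d : Fin (D + 1) → ℂ) (x y : ℂ) :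
    homEval (r • c + s • d) x y = r * homEval c x y + s * homEval d x y := by
  simp only [homEval, Finset.mul_sum, ← Finset.sum_add_distrib]
  refine Finset.sum_congr rfl fun i _ => ?_
  simp only [Pi.add_apply, Pi.smul_apply, smul_eq_mul]
  ring

theorem RatPair.toFun_pt {D : ℕ} (c : RatPair D) {x y : ℂ} (h : x ≠ 0 ∨ y ≠ 0) :
    c.toFun (pt x y) = pt (homEval c.1.1 x y) (homEval c.1.2 x y) := by
  by_cases hy : y = 0
  · subst hy
    have hx : x ≠ 0 := by simpa using h
    rw [homEval_zero, homEval_zero, pt_mul_left (pow_ne_zero D hx), pt_zero_right]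
    rfl
  · rw [homEval_of_ne _ _ hy, homEval_of_ne _ _ hy, pt_mul_left (pow_ne_zero D hy), pt_of_ne hy]
    rfl

theorem RatPair.homEval_ne_zero {D : ℕ} (c : RatPair D) {x y : ℂ} (h : x ≠ 0 ∨ y ≠ 0) :
    homEval c.1.1 x y ≠ 0 ∨ homEval c.1.2 x y ≠ 0 := by
  by_cases hy : y = 0
  · subst hy
    have hx : x ≠ 0 := by simpa using h
    rw [homEval_zero, homEval_zero]
    exact c.2.2.imp (mul_ne_zero (pow_ne_zero D hx)) (mul_ne_zero (pow_ne_zero D hx))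
  · rw [homEval_of_ne _ _ hy, homEval_of_ne _ _ hy]
    by_contra! hc
    simp only [mul_eq_zero, pow_eq_zero_iff', hy, false_and, false_or] at hc
    obtain ⟨u, v, huv⟩ := c.2.1
    have := congrArg (eval (x / y)) huv
    simp [hc.1, hc.2] at this

theorem ratPair_condition {D : ℕ} {P Q : Fin (D + 1) → ℂ}
    (h : ∀ x y : ℂ, (x ≠ 0 ∨ y ≠ 0) → homEval P x y ≠ 0 ∨ homEval Q x y ≠ 0) :
    IsCoprime (toPoly P) (toPoly Q) ∧ (P (Fin.last D) ≠ 0 ∨ Q (Fin.last D) ≠ 0) := by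
  refine ⟨?_, ?_⟩
  · rw [Polynomial.isCoprime_iff_aeval_ne_zero_of_isAlgClosed ℂ ℂ]
    intro z
    have := h z 1 (Or.inr one_ne_zero)
    simpa [homEval_of_ne _ _ one_ne_zero, coe_aeval_eq_eval] using this
  · have := h 1 0 (Or.inl one_ne_zero)
    simpa [homEval_zero] using this

theorem RatPair.sphHol {D : ℕ} (c : RatPair D) (P : OnePoint ℂ) : SphHol c.toFun P := by
  obtain ⟨x, y, hx, hy, h0, he⟩ := holSph_param P (coord P P)
  refine ⟨fun w => homEval c.1.1 (x w) (y w), fun w => homEval c.1.2 (x w) (y w), ?_, ?_,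
    c.homEval_ne_zero h0, ?_⟩
  · unfold homEval; fun_prop
  · unfold homEval; fun_prop
  · have h0' : ∀ᶠ w in 𝓝 (coord P P), x w ≠ 0 ∨ y w ≠ 0 := by
      rcases h0 with h0 | h0
      · exact (hx.continuousAt.eventually_ne h0).mono fun _ => Or.inl
      · exact (hy.continuousAt.eventually_ne h0).mono fun _ => Or.inr
    filter_upwards [he, h0'] with w hw hw0
    rw [hw, c.toFun_pt hw0]

theorem RatSpace.sphHol {D : ℕ} (f : RatSpace D) (P : OnePoint ℂ) : SphHol f.toFun P := by
  induction f using Quotient.inductionOn with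
  | h c => exact c.sphHol P

/-- A rational map is determined by the self-map of the sphere that it defines. -/
theorem RatSpace.toFun_injective {D : ℕ} : Function.Injective (RatSpace.toFun (D := D)) := by
  intro f g hfg
  induction f using Quotient.inductionOn with
  | h c =>
  induction g using Quotient.inductionOn with
  | h d =>
  have hfun : c.toFun = d.toFun := hfg
  have hpoly : toPoly c.1.1 * toPoly d.1.2 = toPoly d.1.1 * toPoly c.1.2 := by
    refine Polynomial.funext fun z => ?_
    have hz : (z : ℂ) ≠ 0 ∨ (1 : ℂ) ≠ 0 := Or.inr one_ne_zero
    have h1 := congrFun hfun (pt z 1)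
    rw [c.toFun_pt hz, d.toFun_pt hz,
      pt_eq_pt_iff (c.homEval_ne_zero hz) (d.homEval_ne_zero hz)] at h1
    simpa [homEval_of_ne _ _ one_ne_zero] using h1
  have hc := c.2.1
  have hd := d.2.1
  have a1 : Associated (toPoly c.1.1) (toPoly d.1.1) :=
    associated_of_dvd_dvd (hc.dvd_of_dvd_mul_right (Dvd.intro _ hpoly))
      (hd.dvd_of_dvd_mul_right (Dvd.intro _ hpoly.symm))
  have a2 : Associated (toPoly c.1.2) (toPoly d.1.2) :=
    associated_of_dvd_dvd (hc.symm.dvd_of_dvd_mul_left (Dvd.intro_left _ hpoly.symm))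
      (hd.symm.dvd_of_dvd_mul_left (Dvd.intro_left _ hpoly))
  have key : ∀ {p q : ℂ[X]}, Associated p q → ∃ t : ℂ, t ≠ 0 ∧ q = C t * p := by
    rintro p q ⟨u, rfl⟩
    obtain ⟨t, ht, e⟩ := Polynomial.isUnit_iff.1 u.isUnit
    exact ⟨t, ht.ne_zero, by rw [e, mul_comm]⟩
  obtain ⟨t, ht, e1⟩ := key a1
  obtain ⟨s, hs, e2⟩ := key a2
  have hex : ∃ r : ℂ, r ≠ 0 ∧ toPoly d.1.1 = C r * toPoly c.1.1 ∧
      toPoly d.1.2 = C r * toPoly c.1.2 := by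
    by_cases h1 : toPoly c.1.1 = 0
    · exact ⟨s, hs, by rw [e1, h1, mul_zero, mul_zero], e2⟩
    by_cases h2 : toPoly c.1.2 = 0
    · exact ⟨t, ht, e1, by rw [e2, h2, mul_zero, mul_zero]⟩
    have : C t = (C s : ℂ[X]) := by
      rw [e1, e2] at hpoly
      refine mul_right_cancel₀ (mul_ne_zero h1 h2) ?_
      linear_combination -hpoly
    exact ⟨t, ht, e1, by rw [e2, this]⟩
  obtain ⟨r, hr, r1, r2⟩ := hex
  have hcoeff : ∀ v w : Fin (D + 1) → ℂ, toPoly w = C r * toPoly v → w = r • v := by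
    intro v w h
    have hco : ∀ (v : Fin (D + 1) → ℂ) (i : Fin (D + 1)), (toPoly v).coeff i = v i := by
      intro v i
      rw [toPoly, finsetSum_coeff, Finset.sum_eq_single i]
      · simp
      · intro j _ hj
        simp only [coeff_C_mul, coeff_X_pow]
        rw [if_neg fun h => hj (Fin.ext h.symm), mul_zero]
      · simp
    funext i
    rw [← hco w i, h, coeff_C_mul, hco]; rfl
  exact Quotient.sound ⟨r, hr, Prod.ext (hcoeff _ _ r1) (hcoeff _ _ r2)⟩

/-! ### Products of linear forms -/

/-- The coefficients of the product of the linear forms with zeros at the points `[v i]`. -/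
def linProd {ι : Type*} [Fintype ι] (D : ℕ) (v : ι → ℂ × ℂ) (i : Fin (D + 1)) : ℂ :=
  (∏ j, (C (v j).2 * X - C (v j).1)).coeff i

theorem continuous_linProd {ι : Type*} [Fintype ι] (D : ℕ) :
    Continuous fun v : ι → ℂ × ℂ => linProd D v := by
  classical
  have key : ∀ (s : Finset ι) (n : ℕ), Continuous fun v : ι → ℂ × ℂ =>
      (∏ j ∈ s, (C (v j).2 * X - C (v j).1)).coeff n := by
    intro s
    induction s using Finset.induction_on with
    | empty => intro n; simpa using continuous_const
    | insert j s hj ih =>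
      intro n
      simp only [Finset.prod_insert hj, coeff_mul]
      refine continuous_finsetSum _ fun p _ => Continuous.mul ?_ (ih _)
      simp only [coeff_sub, coeff_C_mul, coeff_C]
      split_ifs <;> fun_prop
  exact continuous_pi fun i => key _ _

theorem natDegree_linear_le (c d : ℂ) : (C c * X - C d).natDegree ≤ 1 := by
  compute_degree

theorem homEval_linProd {ι : Type*} [Fintype ι] {D : ℕ} (hD : Fintype.card ι = D)
    (v : ι → ℂ × ℂ) (x y : ℂ) :
    homEval (linProd D v) x y = ∏ j, (x * (v j).2 - (v j).1 * y) := by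
  set p := ∏ j, (C (v j).2 * X - C (v j).1) with hp
  have hdeg : p.natDegree ≤ D := by
    refine (natDegree_prod_le _ _).trans ?_
    refine (Finset.sum_le_card_nsmul _ _ 1 fun j _ => natDegree_linear_le _ _).trans ?_
    simp [hD]
  have htp : toPoly (linProd D v) = p := by
    conv_rhs => rw [p.as_sum_range_C_mul_X_pow' (n := D + 1) (by omega)]
    exact Fin.sum_univ_eq_sum_range (fun i => C (p.coeff i) * X ^ i) (D + 1)
  by_cases hy : y = 0
  · subst hy
    have h1 := coeff_prod_of_natDegree_le (s := Finset.univ)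
      (fun j => C (v j).2 * X - C (v j).1) 1 fun j _ => natDegree_linear_le _ _
    have h2 : linProd D v (Fin.last D) = ∏ j, (v j).2 := by
      rw [linProd, Fin.val_last, ← hD, ← Finset.card_univ, ← mul_one (Finset.card _)]
      refine h1.trans (Finset.prod_congr rfl fun j _ => ?_)
      simp [coeff_C]
    rw [homEval_zero, h2]
    simp only [mul_zero, sub_zero, Finset.prod_mul_distrib, Finset.prod_const, Finset.card_univ, hD]
  · rw [homEval_of_ne _ _ hy, htp, hp, eval_prod, ← hD, ← Finset.card_univ, ← Finset.prod_const,
      ← Finset.prod_mul_distrib]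
    refine Finset.prod_congr rfl fun j _ => ?_
    simp only [eval_sub, eval_mul, eval_C, eval_X]
    field_simp


/-! ### A family of perturbations of flexible Lattès maps -/

theorem exists_scale_of_pt_eq {x y x' y' : ℂ} (h : x ≠ 0 ∨ y ≠ 0) (h' : x' ≠ 0 ∨ y' ≠ 0)
    (e : pt x y = pt x' y') : ∃ t : ℂ, t ≠ 0 ∧ x = t * x' ∧ y = t * y' := by
  rw [pt_eq_pt_iff h h'] at e
  by_cases hy : y' = 0
  · subst hy
    have hx' : x' ≠ 0 := by simpa using h'
    have hy0 : y = 0 := by simpa [hx'] using e.symm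
    subst hy0
    have hx : x ≠ 0 := by simpa using h
    exact ⟨x / x', div_ne_zero hx hx', by field_simp, by simp⟩
  · have hy0 : y ≠ 0 := by
      rintro rfl
      have hx : x ≠ 0 := by simpa using h
      simp [hx, hy] at e
    exact ⟨y / y', div_ne_zero hy0 hy, by field_simp; linear_combination e, by field_simp⟩

theorem homEval_mul {D : ℕ} (c : Fin (D + 1) → ℂ) (t x y : ℂ) :
    homEval c (t * x) (t * y) = t ^ D * homEval c x y := by
  simp only [homEval, Finset.mul_sum]
  refine Finset.sum_congr rfl fun i _ => ?_
  have : t ^ D = t ^ (i : ℕ) * t ^ (D - i) := by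
    rw [← pow_add]; congr 1; omega
  rw [this]
  ring

/-- The Möbius transformation `x ↦ e ^ m x`. -/
def expGL (m : ℂ) : GL (Fin 2) ℂ :=
  Matrix.GeneralLinearGroup.mkOfDetNeZero !![Complex.exp m, 0; 0, 1]
    (by simp [Matrix.det_fin_two, Complex.exp_ne_zero])

theorem expGL_smul_pt (m : ℂ) {x y : ℂ} (h : x ≠ 0 ∨ y ≠ 0) :
    expGL m • pt x y = pt (Complex.exp m * x) y := by
  rw [smul_pt _ h]
  simp [expGL, Matrix.GeneralLinearGroup.mkOfDetNeZero]

theorem expGL_smul_coe (m x : ℂ) :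
    expGL m • (x : OnePoint ℂ) = ((Complex.exp m * x : ℂ) : OnePoint ℂ) := by
  rw [← pt_one_right, expGL_smul_pt m (Or.inr one_ne_zero), pt_one_right]

theorem expGL_smul_infty (m : ℂ) : expGL m • (∞ : OnePoint ℂ) = ∞ := by
  rw [← pt_zero_right 1, expGL_smul_pt m (Or.inl one_ne_zero), pt_zero_right,
    pt_zero_right]

theorem expGL_zero_smul (x : OnePoint ℂ) : expGL 0 • x = x := by
  induction x using OnePoint.rec with
  | infty => exact expGL_smul_infty 0
  | coe z => rw [expGL_smul_coe, Complex.exp_zero, one_mul]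

/-- The product of the linear forms in `proj τ z` that vanish at the points `u` with `a u = c`. -/
def divForm (a : ℕ) (c τ z : ℂ) : ℂ :=
  ∏ p, (theta τ (z + 1 / 2) ^ 2 * theta τ (divPt τ a c p) ^ 2 -
    theta τ (divPt τ a c p + 1 / 2) ^ 2 * theta τ z ^ 2)

/-- The ratio of the leading constants of the two products in the formula for a Lattès map, read off
at the point `z` with `a z + b = 1 / 4`. -/
def divConst (a : ℕ) (b τ : ℂ) : ℂ :=
  divForm a (-b) τ ((1 / 4 - b) / a) * theta τ (1 / 4 + 1 / 2) ^ 2 /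
    (divForm a (1 / 2 - b) τ ((1 / 4 - b) / a) * theta τ (1 / 4) ^ 2)

theorem quarter_notMem_lat {τ : ℂ} (hτ : 0 < τ.im) : (1 / 4 : ℂ) ∉ lat τ := fun h => by
  have := two_mul_mem_lat h
  exact half_notMem_lat hτ (by convert! this using 1; norm_num)

theorem three_quarter_notMem_lat {τ : ℂ} (hτ : 0 < τ.im) : (1 / 4 + 1 / 2 : ℂ) ∉ lat τ := fun h => by
  have := sub_mem (two_mul_mem_lat h) (one_mem_lat τ)
  exact half_notMem_lat hτ (by convert! this using 1; norm_num)

/-- The multiplication formula: the map induced by `z ↦ a z + b` on the sphere is a quotient of two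
products of linear forms. -/
theorem exists_divForm_eq {τ : ℂ} (hτ : 0 < τ.im) {a : ℕ} (ha : a ≠ 0) {b : ℂ}
    (hb : ∃ k : ℤ, 2 * b = k) : divConst a b τ ≠ 0 ∧ ∀ z, ∃ t, t ≠ 0 ∧
      divConst a b τ * divForm a (1 / 2 - b) τ z = t * theta τ (a * z + b + 1 / 2) ^ 2 ∧
      divForm a (-b) τ z = t * theta τ (a * z + b) ^ 2 := by
  obtain ⟨k, hk⟩ := hb
  have ha' : (a : ℂ) ≠ 0 := Nat.cast_ne_zero.2 ha
  obtain ⟨K, hK, h1⟩ := prod_theta_form hτ ha (1 / 2 - b)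
  obtain ⟨K', hK', h2⟩ := prod_theta_form hτ ha (-b)
  have e1 : ∀ z, divForm a (1 / 2 - b) τ z =
      K * ex ((a * a - a : ℤ) * z) * theta τ (a * z + b + 1 / 2) ^ 2 := by
    intro z
    rw [divForm, h1, show (a : ℂ) * z + (1 / 2 - b) = a * z + b + 1 / 2 + (-k : ℤ) by
      push_cast; linear_combination -hk, theta_add_int,
      show (a : ℂ) * z - (1 / 2 - b) = a * z + b + 1 / 2 - 1 by ring, theta_sub_one]
    ring
  have e2 : ∀ z, divForm a (-b) τ z =
      K' * ex ((a * a - a : ℤ) * z) * theta τ (a * z + b) ^ 2 := by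
    intro z
    rw [divForm, h2, show (a : ℂ) * z + -b = a * z + b + (-k : ℤ) by
      push_cast; linear_combination -hk, theta_add_int, sub_neg_eq_add]
    ring
  have q1 := theta_ne_zero hτ (quarter_notMem_lat hτ)
  have q2 := theta_ne_zero hτ (three_quarter_notMem_lat hτ)
  have hC : divConst a b τ = K' / K := by
    rw [divConst, e1, e2, mul_div_cancel₀ _ ha', sub_add_cancel]
    have := ex_ne_zero ((a * a - a : ℤ) * ((1 / 4 - b) / a))
    generalize ex ((a * a - a : ℤ) * ((1 / 4 - b) / a)) = E at this
    generalize theta τ (1 / 4 + 1 / 2) = T at q2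
    field_simp
  rw [hC]
  refine ⟨div_ne_zero hK' hK, fun z => ⟨K' * ex ((a * a - a : ℤ) * z),
    mul_ne_zero hK' (ex_ne_zero _), ?_, e2 z⟩⟩
  rw [e1]
  field_simp

/-- Homogeneous coordinates of `A • proj τ z`. -/
def projVec (A : GL (Fin 2) ℂ) (τ z : ℂ) : ℂ × ℂ :=
  (A 0 0 * theta τ (z + 1 / 2) ^ 2 + A 0 1 * theta τ z ^ 2,
    A 1 0 * theta τ (z + 1 / 2) ^ 2 + A 1 1 * theta τ z ^ 2)

theorem projVec_ne_zero (A : GL (Fin 2) ℂ) {τ : ℂ} (hτ : 0 < τ.im) (z : ℂ) :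
    (projVec A τ z).1 ≠ 0 ∨ (projVec A τ z).2 ≠ 0 := gl_ne_zero A (theta_pair_ne_zero hτ z)

theorem pt_projVec (A : GL (Fin 2) ℂ) {τ : ℂ} (hτ : 0 < τ.im) (z : ℂ) :
    pt (projVec A τ z).1 (projVec A τ z).2 = A • proj τ z :=
  (smul_pt A (theta_pair_ne_zero hτ z)).symm

/-- The coefficients of the product of the linear forms with zeros at the points `A • proj τ u` with
`a u = c`. -/
def divVec (A : GL (Fin 2) ℂ) (a : ℕ) (c τ : ℂ) : Fin (a * a + 1) → ℂ :=
  linProd (a * a) fun p => projVec A τ (divPt τ a c p)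

theorem homEval_divVec (A : GL (Fin 2) ℂ) (a : ℕ) (c τ z : ℂ) :
    homEval (divVec A a c τ) (projVec A τ z).1 (projVec A τ z).2 =
      A.det.val ^ (a * a) * divForm a c τ z := by
  have hcard : Fintype.card (Fin a × Fin a) = a * a := by simp
  have hdet : A.det.val ^ (a * a) = ∏ _p : Fin a × Fin a, A.det.val := by simp
  rw [divVec, homEval_linProd hcard, divForm, hdet, ← Finset.prod_mul_distrib]
  refine Finset.prod_congr rfl fun p _ => ?_
  rw [Matrix.GeneralLinearGroup.val_det_apply, Matrix.det_fin_two]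
  simp only [projVec]
  ring

/-- The coefficients of the map induced by `z ↦ a z + b` on the sphere, multiplied by `e ^ m` and
conjugated by `A`. -/
def famVec (A : GL (Fin 2) ℂ) (a : ℕ) (b : ℂ) (q : ℂ × ℂ) :
    (Fin (a * a + 1) → ℂ) × (Fin (a * a + 1) → ℂ) :=
  ((A 0 0 * (Complex.exp q.2 * divConst a b q.1)) • divVec A a (1 / 2 - b) q.1 +
      A 0 1 • divVec A a (-b) q.1,
    (A 1 0 * (Complex.exp q.2 * divConst a b q.1)) • divVec A a (1 / 2 - b) q.1 +
      A 1 1 • divVec A a (-b) q.1)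

theorem exists_homEval_famVec (A : GL (Fin 2) ℂ) {a : ℕ} (ha : a ≠ 0) {b : ℂ}
    (hb : ∃ k : ℤ, 2 * b = k) {τ : ℂ} (hτ : 0 < τ.im) (m z : ℂ) :
    ∃ t, t ≠ 0 ∧
      homEval (famVec A a b (τ, m)).1 (projVec A τ z).1 (projVec A τ z).2 =
        t * (A 0 0 * (Complex.exp m * theta τ (a * z + b + 1 / 2) ^ 2) +
          A 0 1 * theta τ (a * z + b) ^ 2) ∧
      homEval (famVec A a b (τ, m)).2 (projVec A τ z).1 (projVec A τ z).2 =
        t * (A 1 0 * (Complex.exp m * theta τ (a * z + b + 1 / 2) ^ 2) +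
          A 1 1 * theta τ (a * z + b) ^ 2) := by
  obtain ⟨-, h⟩ := exists_divForm_eq hτ ha hb
  obtain ⟨t, ht, h1, h2⟩ := h z
  refine ⟨A.det.val ^ (a * a) * t, mul_ne_zero (pow_ne_zero _ A.det.ne_zero) ht, ?_, ?_⟩
  · rw [famVec, homEval_smul_add, homEval_divVec, homEval_divVec]
    linear_combination A.det.val ^ (a * a) * A 0 0 * Complex.exp m * h1 +
      A.det.val ^ (a * a) * A 0 1 * h2
  · rw [famVec, homEval_smul_add, homEval_divVec, homEval_divVec]
    linear_combination A.det.val ^ (a * a) * A 1 0 * Complex.exp m * h1 +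
      A.det.val ^ (a * a) * A 1 1 * h2

theorem exp_mul_pair_ne_zero (m : ℂ) {x y : ℂ} (h : x ≠ 0 ∨ y ≠ 0) :
    Complex.exp m * x ≠ 0 ∨ y ≠ 0 := h.imp_left (mul_ne_zero (Complex.exp_ne_zero m))

theorem famVec_condition (A : GL (Fin 2) ℂ) {a : ℕ} (ha : a ≠ 0) {b : ℂ}
    (hb : ∃ k : ℤ, 2 * b = k) {τ : ℂ} (hτ : 0 < τ.im) (m : ℂ) :
    IsCoprime (toPoly (famVec A a b (τ, m)).1) (toPoly (famVec A a b (τ, m)).2) ∧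
      ((famVec A a b (τ, m)).1 (Fin.last _) ≠ 0 ∨ (famVec A a b (τ, m)).2 (Fin.last _) ≠ 0) := by
  refine ratPair_condition fun x y h => ?_
  obtain ⟨z, hz⟩ := proj_surjective hτ (A⁻¹ • pt x y)
  have h1 : pt x y = pt (projVec A τ z).1 (projVec A τ z).2 := by
    rw [pt_projVec A hτ, hz, smul_inv_smul]
  obtain ⟨s, hs, rx, ry⟩ := exists_scale_of_pt_eq h (projVec_ne_zero A hτ z) h1
  rw [rx, ry, homEval_mul, homEval_mul]
  obtain ⟨t, ht, e1, e2⟩ := exists_homEval_famVec A ha hb hτ m z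
  rw [e1, e2]
  have := gl_ne_zero A (exp_mul_pair_ne_zero m (theta_pair_ne_zero hτ (a * z + b)))
  exact this.imp (fun h => mul_ne_zero (pow_ne_zero _ hs) (mul_ne_zero ht h))
    (fun h => mul_ne_zero (pow_ne_zero _ hs) (mul_ne_zero ht h))

theorem toFun_famVec (A : GL (Fin 2) ℂ) {a : ℕ} (ha : a ≠ 0) {b : ℂ}
    (hb : ∃ k : ℤ, 2 * b = k) {τ : ℂ} (hτ : 0 < τ.im) (m z : ℂ) :
    RatPair.toFun ⟨famVec A a b (τ, m), famVec_condition A ha hb hτ m⟩ (A • proj τ z) =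
      A • expGL m • proj τ (a * z + b) := by
  rw [← pt_projVec A hτ, RatPair.toFun_pt _ (projVec_ne_zero A hτ z)]
  obtain ⟨t, ht, e1, e2⟩ := exists_homEval_famVec A ha hb hτ m z
  simp only [e1, e2]
  rw [pt_mul_left ht, proj, expGL_smul_pt m (theta_pair_ne_zero hτ _),
    smul_pt A (exp_mul_pair_ne_zero m (theta_pair_ne_zero hτ _))]

theorem continuousAt_famVec (A : GL (Fin 2) ℂ) {a : ℕ} (ha : a ≠ 0) {b : ℂ}
    (hb : ∃ k : ℤ, 2 * b = k) {q : ℂ × ℂ} (hq : 0 < q.1.im) :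
    ContinuousAt (famVec A a b) q := by
  have hdp : ∀ (c : ℂ) (p), ContinuousAt (fun q : ℂ × ℂ => divPt q.1 a c p) q := fun c p => by
    unfold divPt; fun_prop
  have hθ : ∀ {g : ℂ × ℂ → ℂ}, ContinuousAt g q →
      ContinuousAt (fun q : ℂ × ℂ => theta q.1 (g q)) q := fun {g} hg =>
    continuousAt_theta_comp continuousAt_fst hg hq
  have hpv : ∀ {g : ℂ × ℂ → ℂ}, ContinuousAt g q →
      ContinuousAt (fun q : ℂ × ℂ => projVec A q.1 (g q)) q := fun {g} hg => by
    have h1 := hθ hg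
    have h2 := hθ (hg.add (continuousAt_const (y := (1 / 2 : ℂ))))
    exact (((h2.pow 2).const_mul (A 0 0)).add ((h1.pow 2).const_mul (A 0 1))).prodMk
      (((h2.pow 2).const_mul (A 1 0)).add ((h1.pow 2).const_mul (A 1 1)))
  have hdv : ∀ c, ContinuousAt (fun q : ℂ × ℂ => divVec A a c q.1) q := fun c =>
    ContinuousAt.comp (g := fun v : Fin a × Fin a → ℂ × ℂ => linProd (a * a) v)
      (f := fun q : ℂ × ℂ => fun p => projVec A q.1 (divPt q.1 a c p))
      (continuous_linProd (a * a)).continuousAt (continuousAt_pi.2 fun p => hpv (hdp c p))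
  have hdf : ∀ c z, ContinuousAt (fun q : ℂ × ℂ => divForm a c q.1 z) q := fun c z => by
    unfold divForm
    refine tendsto_finsetProd _ fun p _ => ?_
    have h1 := hθ (hdp c p)
    have h2 := hθ ((hdp c p).add (continuousAt_const (y := (1 / 2 : ℂ))))
    have h3 := hθ (continuousAt_const (y := z))
    have h4 := hθ (continuousAt_const (y := z + 1 / 2))
    exact ((h4.pow 2).mul (h1.pow 2)).sub ((h2.pow 2).mul (h3.pow 2))
  have hdc : ContinuousAt (fun q : ℂ × ℂ => divConst a b q.1) q := by
    have hne := (exists_divForm_eq hq ha hb).1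
    unfold divConst at hne ⊢
    refine ContinuousAt.div ?_ ?_ ?_
    · exact (hdf _ _).mul ((hθ continuousAt_const).pow 2)
    · exact (hdf _ _).mul ((hθ continuousAt_const).pow 2)
    · exact fun h => hne (by rw [h, div_zero])
  have h1 := hdv (1 / 2 - b)
  have h2 := hdv (-b)
  have h3 : ContinuousAt (fun q : ℂ × ℂ => Complex.exp q.2 * divConst a b q.1) q :=
    (Complex.continuous_exp.continuousAt.comp continuousAt_snd).mul hdc
  exact (((h3.const_mul (A 0 0)).smul h1).add (h2.const_smul (A 0 1))).prodMk
    (((h3.const_mul (A 1 0)).smul h1).add (h2.const_smul (A 1 1)))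

/-- The perturbations of the Lattès map induced by `z ↦ a z + b`: they depend continuously on the
modulus `τ` and on the parameter `m`. -/
theorem exists_family (A : GL (Fin 2) ℂ) {a : ℕ} (ha : a ≠ 0) {b : ℂ}
    (hb : ∃ k : ℤ, 2 * b = k) {τ₀ : ℂ} (hτ₀ : 0 < τ₀.im) :
    ∃ G : ℂ × ℂ → RatSpace (a * a), ContinuousAt G (τ₀, 0) ∧
      ∀ q : ℂ × ℂ, 0 < q.1.im → ∀ z, (G q).toFun (A • proj q.1 z) =
        A • expGL q.2 • proj q.1 (a * z + b) := by
  classical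
  set g : ℂ × ℂ → RatPair (a * a) := fun q =>
    if h : 0 < q.1.im then ⟨famVec A a b q, famVec_condition A ha hb h q.2⟩
    else ⟨famVec A a b (τ₀, 0), famVec_condition A ha hb hτ₀ 0⟩ with hg
  have hgq : ∀ q : ℂ × ℂ, ∀ h : 0 < q.1.im,
      g q = ⟨famVec A a b q, famVec_condition A ha hb h q.2⟩ := fun q h => dif_pos h
  refine ⟨fun q => Quotient.mk (ratSetoid _) (g q), ?_, fun q hq z => ?_⟩
  · refine ContinuousAt.comp (g := fun c : RatPair (a * a) => (Quotient.mk (ratSetoid _) c))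
      continuous_quotient_mk'.continuousAt ?_
    refine Topology.IsInducing.subtypeVal.continuousAt_iff.2 ?_
    refine (continuousAt_famVec A ha hb (q := (τ₀, 0)) hτ₀).congr ?_
    have : ∀ᶠ q : ℂ × ℂ in 𝓝 (τ₀, 0), 0 < q.1.im := isOpen_im_pos.mem_nhds hτ₀
    filter_upwards [this] with q hq
    rw [Function.comp, hgq q hq]
  · change (g q).toFun _ = _
    rw [hgq q hq]
    exact toFun_famVec A ha hb hq q.2 z


/-! ### Dynamics of the perturbed maps -/

/-- `F` is the composition of the map induced by `z ↦ a z + b` on the sphere with the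
multiplication by `e ^ m`. -/
structure IsPerturbed (F : OnePoint ℂ → OnePoint ℂ) (τ : ℂ) (a : ℕ) (b m : ℂ) : Prop where
  im_pos : 0 < τ.im
  two_le : 2 ≤ a
  two_mul_b : ∃ k : ℤ, 2 * b = k
  sphHol : ∀ x, SphHol F x
  semiconj : ∀ z, F (proj τ z) = expGL m • proj τ (a * z + b)
  norm_exp_le : ‖Complex.exp m‖ ≤ 2
  norm_exp_neg_le : ‖Complex.exp (-m)‖ ≤ 2

theorem proj_int_half {τ : ℂ} (hτ : 0 < τ.im) (k : ℤ) :
    proj τ (k / 2) = ∞ ∨ proj τ (k / 2) = ((0 : ℂ) : OnePoint ℂ) := by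
  rcases Int.even_or_odd' k with ⟨j, rfl | rfl⟩
  · left
    rw [proj_eq_infty_iff hτ]
    convert! int_mem_lat τ j using 1
    push_cast; ring
  · right
    rw [← proj_half hτ]
    refine proj_congr hτ ?_
    convert! int_mem_lat τ j using 1
    push_cast; ring

/-- The four values of `proj τ` at the half-periods. -/
theorem proj_of_two_mul_mem {τ z : ℂ} (hτ : 0 < τ.im) (hz : 2 * z ∈ lat τ) :
    proj τ z = ∞ ∨ proj τ z = ((0 : ℂ) : OnePoint ℂ) ∨ proj τ z = proj τ (τ / 2) ∨
      proj τ z = proj τ (τ / 2 + 1 / 2) := by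
  obtain ⟨k, l, h⟩ := hz
  have hz : z = (k : ℂ) / 2 + l * τ / 2 := by linear_combination h / 2
  rcases Int.even_or_odd' l with ⟨j, rfl | rfl⟩
  · have : proj τ z = proj τ (k / 2) := by
      refine proj_congr hτ ?_
      convert! intCast_mul_mem_lat j (tau_mem_lat τ) using 1
      rw [hz]; push_cast; ring
    rw [this, ← or_assoc]
    exact Or.inl (proj_int_half hτ k)
  · right; right
    rcases Int.even_or_odd' k with ⟨i, rfl | rfl⟩
    · left
      refine proj_congr hτ ⟨i, j, ?_⟩
      rw [hz]; push_cast; ring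
    · right
      refine proj_congr hτ ⟨i, j, ?_⟩
      rw [hz]; push_cast; ring

/-- The local coordinate of the sphere at the half-periods `0` and `1 / 2`. -/
theorem coord_proj_int_half {τ : ℂ} (hτ : 0 < τ.im) (k : ℤ) (v : ℂ) :
    coord (proj τ (k / 2)) (proj τ (k / 2 + v)) = (ell τ v)⁻¹ := by
  rcases Int.even_or_odd' k with ⟨j, rfl | rfl⟩
  · have h1 : proj τ (((2 * j : ℤ) : ℂ) / 2) = ∞ := by
      rw [proj_eq_infty_iff hτ]
      convert! int_mem_lat τ j using 1
      push_cast; ring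
    have h2 : proj τ (((2 * j : ℤ) : ℂ) / 2 + v) = proj τ v := by
      refine proj_congr hτ ?_
      convert! int_mem_lat τ j using 1
      push_cast; ring
    rw [h1, h2, proj, coord_infty_pt, ell, inv_div]
  · have h1 : proj τ (((2 * j + 1 : ℤ) : ℂ) / 2) = ((0 : ℂ) : OnePoint ℂ) := by
      rw [← proj_half hτ]
      refine proj_congr hτ ?_
      convert! int_mem_lat τ j using 1
      push_cast; ring
    have h2 : proj τ (((2 * j + 1 : ℤ) : ℂ) / 2 + v) = proj τ (v + 1 / 2) := by
      refine proj_congr hτ ?_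
      convert! int_mem_lat τ j using 1
      push_cast; ring
    rw [h1, h2, proj_add_half, coord_coe_pt, ell, inv_div]

theorem coord_expGL_smul {x : OnePoint ℂ} (hx : x = ∞ ∨ x = ((0 : ℂ) : OnePoint ℂ)) (m : ℂ) :
    ∃ c, (c = Complex.exp m ∨ c = Complex.exp (-m)) ∧
      ∀ y, coord (expGL m • x) (expGL m • y) = c * coord x y := by
  rcases hx with rfl | rfl
  · refine ⟨Complex.exp (-m), Or.inr rfl, fun y => ?_⟩
    obtain ⟨u, v, h, rfl⟩ := exists_eq_pt y
    rw [expGL_smul_infty, expGL_smul_pt m h, coord_infty_pt, coord_infty_pt, Complex.exp_neg]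
    have := Complex.exp_ne_zero m
    by_cases hu : u = 0
    · simp [hu]
    · field_simp
  · refine ⟨Complex.exp m, Or.inl rfl, fun y => ?_⟩
    obtain ⟨u, v, h, rfl⟩ := exists_eq_pt y
    rw [expGL_smul_coe, mul_zero, expGL_smul_pt m h, coord_coe_pt, coord_coe_pt, mul_div_assoc]

theorem analyticAt_dslope {f : ℂ → ℂ} {z : ℂ} (hf : AnalyticAt ℂ f z) :
    AnalyticAt ℂ (dslope f z) z := by
  obtain ⟨p, hp⟩ := hf
  exact ⟨_, hp.has_fpower_series_dslope_fslope⟩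

/-- The inverse of `ell τ` vanishes to second order at the origin. -/
theorem exists_inv_ell_eq {τ : ℂ} (hτ : 0 < τ.im) : ∃ g : ℂ → ℂ, AnalyticAt ℂ g 0 ∧ g 0 ≠ 0 ∧
    ∀ v, (ell τ v)⁻¹ = v ^ 2 * g v := by
  obtain ⟨d, hd, hD⟩ := exists_hasDerivAt_theta_zero hτ
  have hθ : AnalyticAt ℂ (fun v => theta τ (v + 1 / 2)) 0 :=
    (analyticAt_theta hτ _).fun_comp (g := theta τ) (f := fun v : ℂ => v + 1 / 2) (by fun_prop)
  have h2 := theta_ne_zero hτ (half_notMem_lat hτ)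
  refine ⟨fun v => dslope (theta τ) 0 v ^ 2 / theta τ (v + 1 / 2) ^ 2, ?_, ?_, fun v => ?_⟩
  · exact ((analyticAt_dslope (analyticAt_theta hτ 0)).pow 2).fun_div (hθ.fun_pow 2)
      (by simpa using h2)
  · simp only [dslope_same, hD.deriv, zero_add]
    exact div_ne_zero (pow_ne_zero 2 hd) (pow_ne_zero 2 h2)
  · have := sub_smul_dslope (theta τ) 0 v
    rw [sub_zero, smul_eq_mul, theta_zero hτ, sub_zero] at this
    rw [ell, inv_div, ← this]
    ring

namespace IsPerturbed

variable {F : OnePoint ℂ → OnePoint ℂ} {τ : ℂ} {a : ℕ} {b m : ℂ}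

theorem deriv_eq (h : IsPerturbed F τ a b m) (z : ℂ) :
    sphereDeriv F (proj τ z) * deriv (fun w => coord (proj τ z) (proj τ w)) z =
      sphereDeriv (fun y => expGL m • y) (proj τ (a * z + b)) *
        (deriv (fun w => coord (proj τ (a * z + b)) (proj τ w)) (a * z + b) * a) := by
  have hτ := h.im_pos
  have h1 := deriv_coord_comp (h.sphHol (proj τ z)) (holSph_proj hτ z)
  have hl : HasDerivAt (fun w : ℂ => a * w + b) (a * 1) z :=
    ((hasDerivAt_id z).const_mul (a : ℂ)).add_const b
  have hh : HolSph (fun w => proj τ (a * w + b)) z :=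
    (holSph_proj hτ (a * z + b)).comp_analytic (g := fun w : ℂ => a * w + b) (by fun_prop)
  have h2 := deriv_coord_comp (h := fun w => proj τ (a * w + b))
    (sphHol_gl_smul (expGL m) (proj τ (a * z + b))) hh
  have h3 : deriv (fun w => coord (proj τ (a * z + b)) (proj τ (a * w + b))) z =
      deriv (fun w => coord (proj τ (a * z + b)) (proj τ w)) (a * z + b) * a := by
    have := (HolSph.analyticAt_coord (holSph_proj hτ (a * z + b))).differentiableAt.hasDerivAt
    have := HasDerivAt.comp z (h := fun w : ℂ => a * w + b)
      (h₂ := fun w => coord (proj τ (a * z + b)) (proj τ w)) this hl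
    rw [mul_one] at this
    exact this.deriv
  rw [← h3, ← h2, ← h1]
  simp only [h.semiconj]

theorem cast_ne_zero (h : IsPerturbed F τ a b m) : (a : ℂ) ≠ 0 := by
  have := h.two_le
  exact Nat.cast_ne_zero.2 (by omega)

theorem two_mul_mem_of_critical (h : IsPerturbed F τ a b m) {z : ℂ}
    (hz : sphereDeriv F (proj τ z) = 0) : 2 * (a * z + b) ∈ lat τ := by
  by_contra hc
  have h1 := h.deriv_eq z
  rw [hz, zero_mul] at h1
  exact mul_ne_zero (sphereDeriv_gl_smul_ne_zero _ _)
    (mul_ne_zero (deriv_coord_proj_ne_zero h.im_pos hc) h.cast_ne_zero) h1.symm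

theorem critical_of_two_mul_mem (h : IsPerturbed F τ a b m) {z : ℂ} (hz : 2 * z ∉ lat τ)
    (hz' : 2 * (a * z + b) ∈ lat τ) : sphereDeriv F (proj τ z) = 0 := by
  have h1 := h.deriv_eq z
  rw [deriv_coord_proj_eq_zero h.im_pos hz', zero_mul, mul_zero] at h1
  exact (mul_eq_zero.1 h1).resolve_right (deriv_coord_proj_ne_zero h.im_pos hz)

theorem exists_eq_proj_int_half (h : IsPerturbed F τ a b m) {x : OnePoint ℂ}
    (hx : x = ∞ ∨ x = ((0 : ℂ) : OnePoint ℂ)) : ∃ k : ℤ, x = proj τ (k / 2) := by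
  rcases hx with rfl | rfl
  · exact ⟨0, by simp [proj_zero h.im_pos]⟩
  · exact ⟨1, by rw [Int.cast_one, proj_half h.im_pos]⟩

theorem exists_semiconj_int_half (h : IsPerturbed F τ a b m) (k : ℤ) :
    ∃ j : ℤ, ∀ v, F (proj τ (k / 2 + v)) = expGL m • proj τ (j / 2 + a * v) := by
  obtain ⟨l, hl⟩ := h.two_mul_b
  refine ⟨a * k + l, fun v => ?_⟩
  rw [h.semiconj]
  congr 2
  push_cast
  linear_combination hl / 2

theorem map_zero_infty (h : IsPerturbed F τ a b m) {x : OnePoint ℂ}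
    (hx : x = ∞ ∨ x = ((0 : ℂ) : OnePoint ℂ)) : F x = ∞ ∨ F x = ((0 : ℂ) : OnePoint ℂ) := by
  obtain ⟨k, rfl⟩ := h.exists_eq_proj_int_half hx
  obtain ⟨j, hj⟩ := h.exists_semiconj_int_half k
  have := hj 0
  rw [add_zero, mul_zero, add_zero] at this
  rw [this]
  rcases proj_int_half h.im_pos j with e | e
  · left; rw [e, expGL_smul_infty]
  · right; rw [e, expGL_smul_coe, mul_zero]

theorem iterate_zero_infty (h : IsPerturbed F τ a b m) {x : OnePoint ℂ}
    (hx : x = ∞ ∨ x = ((0 : ℂ) : OnePoint ℂ)) (n : ℕ) :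
    F^[n] x = ∞ ∨ F^[n] x = ((0 : ℂ) : OnePoint ℂ) := by
  induction n with
  | zero => exact hx
  | succ n ih => rw [Function.iterate_succ_apply']; exact h.map_zero_infty ih

/-- The derivative at the images of the half-periods `0` and `1 / 2`. -/
theorem exists_sphereDeriv_eq (h : IsPerturbed F τ a b m) {x : OnePoint ℂ}
    (hx : x = ∞ ∨ x = ((0 : ℂ) : OnePoint ℂ)) :
    ∃ c, (c = Complex.exp m ∨ c = Complex.exp (-m)) ∧ sphereDeriv F x = c * a ^ 2 := by
  have hτ := h.im_pos
  obtain ⟨k, rfl⟩ := h.exists_eq_proj_int_half hx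
  obtain ⟨j, hj⟩ := h.exists_semiconj_int_half k
  obtain ⟨c, hc, hcc⟩ := coord_expGL_smul (proj_int_half hτ j) m
  refine ⟨c, hc, ?_⟩
  obtain ⟨g, hga, hg0, hge⟩ := exists_inv_ell_eq hτ
  have hg := hga.continuousAt
  have hF0 : F (proj τ (k / 2)) = expGL m • proj τ (j / 2) := by simpa using hj 0
  set u0 := coord (proj τ (k / 2)) (proj τ (k / 2)) with hu0
  have hu00 : u0 = 0 := by
    have := coord_proj_int_half hτ k 0
    rw [add_zero, hge] at this
    rw [hu0, this]; simp
  -- The map in charts satisfies `φ (κ v) = c κ (a v)` with `κ = 1 / ell τ`.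
  have hφ : ∀ᶠ v in 𝓝 (0 : ℂ), inCharts F (proj τ (k / 2)) ((ell τ v)⁻¹) =
      c * (ell τ (a * v))⁻¹ := by
    have hc0 : ContinuousAt (fun v => proj τ (k / 2 + v)) 0 := by
      refine ContinuousAt.comp (g := proj τ) (f := fun v => (k : ℂ) / 2 + v)
        (holSph_proj hτ _).continuousAt (by fun_prop)
    have := hc0.eventually (p := fun y => param (proj τ (k / 2)) (coord (proj τ (k / 2)) y) = y)
      (by simpa using eventually_param_coord (proj τ (k / 2)))
    filter_upwards [this] with v hv
    rw [coord_proj_int_half hτ] at hv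
    rw [inCharts, hv, hj, hF0, hcc, coord_proj_int_half hτ]
  have hd := (h.sphHol (proj τ (k / 2))).analyticAt_inCharts.differentiableAt.hasDerivAt
  rw [← sphereDeriv_eq, hasDerivAt_iff_tendsto_slope, ← hu0, hu00] at hd
  have hgne : ∀ᶠ v in 𝓝 (0 : ℂ), g v ≠ 0 := hg.eventually_ne hg0
  have ht : Tendsto (fun v => (ell τ v)⁻¹) (𝓝[≠] 0) (𝓝[≠] (0 : ℂ)) := by
    refine tendsto_nhdsWithin_iff.2 ⟨?_, ?_⟩
    · have : ContinuousAt (fun v : ℂ => v ^ 2 * g v) 0 := (continuousAt_id.pow 2).mul hg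
      have := this.tendsto.mono_left (nhdsWithin_le_nhds (s := {(0 : ℂ)}ᶜ))
      simpa [hge] using this
    · filter_upwards [nhdsWithin_le_nhds hgne, self_mem_nhdsWithin] with v h1 h2
      rw [hge]
      exact mul_ne_zero (pow_ne_zero 2 h2) h1
  have h1 := hd.comp ht
  have h2 : Tendsto (fun v => c * a ^ 2 * (g (a * v) / g v)) (𝓝[≠] 0) (𝓝 (c * a ^ 2)) := by
    have c1 : ContinuousAt (fun v => g (a * v)) 0 :=
      ContinuousAt.comp (g := g) (f := fun v : ℂ => a * v) (by simpa using hg) (by fun_prop)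
    have c2 : ContinuousAt (fun v => c * a ^ 2 * (g (a * v) / g v)) 0 :=
      continuousAt_const.mul (c1.div hg hg0)
    have := c2.tendsto.mono_left (nhdsWithin_le_nhds (s := {(0 : ℂ)}ᶜ))
    simpa [hg0] using this
  refine tendsto_nhds_unique_of_eventuallyEq h1 h2 ?_
  have e0 : inCharts F (proj τ (k / 2)) 0 = 0 := by
    have := hφ.self_of_nhds
    simpa [hge] using this
  filter_upwards [nhdsWithin_le_nhds hφ, nhdsWithin_le_nhds hgne, self_mem_nhdsWithin] with v h1 h2 h3
  have h3' : v ≠ 0 := h3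
  simp only [Function.comp, slope_def_field]
  rw [h1, e0, hge, hge]
  field_simp
  ring

theorem norm_sphereDeriv_mem (h : IsPerturbed F τ a b m) {x : OnePoint ℂ}
    (hx : x = ∞ ∨ x = ((0 : ℂ) : OnePoint ℂ)) :
    (a : ℝ) ^ 2 / 2 ≤ ‖sphereDeriv F x‖ ∧ ‖sphereDeriv F x‖ ≤ 2 * (a : ℝ) ^ 2 := by
  obtain ⟨c, hc, e⟩ := h.exists_sphereDeriv_eq hx
  have h1 := h.norm_exp_le
  have h2 := h.norm_exp_neg_le
  have h3 : ‖Complex.exp m‖ * ‖Complex.exp (-m)‖ = 1 := by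
    rw [← norm_mul, ← Complex.exp_add, add_neg_cancel, Complex.exp_zero, norm_one]
  have hc2 : 1 / 2 ≤ ‖c‖ ∧ ‖c‖ ≤ 2 := by
    have p1 := norm_nonneg (Complex.exp m)
    have p2 := norm_nonneg (Complex.exp (-m))
    rcases hc with rfl | rfl
    · exact ⟨by nlinarith, h1⟩
    · exact ⟨by nlinarith, h2⟩
  rw [e, norm_mul, norm_pow, Complex.norm_natCast]
  have := sq_nonneg (a : ℝ)
  constructor <;> nlinarith

theorem norm_sphereDeriv_iterate_le (h : IsPerturbed F τ a b m) {x : OnePoint ℂ}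
    (hx : x = ∞ ∨ x = ((0 : ℂ) : OnePoint ℂ)) (n : ℕ) :
    ‖sphereDeriv F^[n] x‖ ≤ (2 * (a : ℝ) ^ 2) ^ n := by
  rw [sphereDeriv_iterate h.sphHol, norm_prod]
  refine (Finset.prod_le_prod (g := fun _ => 2 * (a : ℝ) ^ 2) (fun _ _ => norm_nonneg _) fun i _ =>
    (h.norm_sphereDeriv_mem (h.iterate_zero_infty hx i)).2).trans_eq (by simp)

theorem one_lt_norm_sphereDeriv_iterate (h : IsPerturbed F τ a b m) {x : OnePoint ℂ}
    (hx : x = ∞ ∨ x = ((0 : ℂ) : OnePoint ℂ)) {n : ℕ} (hn : 0 < n) :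
    1 < ‖sphereDeriv F^[n] x‖ := by
  rw [sphereDeriv_iterate h.sphHol, norm_prod]
  have ha : (2 : ℝ) ≤ a := by exact_mod_cast h.two_le
  calc (1 : ℝ) < 2 ^ n := one_lt_pow₀ (by norm_num) hn.ne'
    _ = ∏ i ∈ Finset.range n, (2 : ℝ) := by simp
    _ ≤ _ := by
      refine Finset.prod_le_prod (fun _ _ => by norm_num) fun i _ => ?_
      have := (h.norm_sphereDeriv_mem (h.iterate_zero_infty hx i)).1
      nlinarith

theorem exists_repelling (h : IsPerturbed F τ a b m) {x : OnePoint ℂ}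
    (hx : x = ∞ ∨ x = ((0 : ℂ) : OnePoint ℂ)) : ∃ n, IsRepellingPeriodic F (F^[n] x) := by
  have h1 := h.map_zero_infty hx
  have h2 := h.map_zero_infty h1
  by_cases e : F (F x) = F x
  · exact ⟨1, 1, one_pos, e, h.one_lt_norm_sphereDeriv_iterate h1 one_pos⟩
  · -- `F` interchanges the two points.
    have e2 : F (F x) = x := by
      rcases hx with rfl | rfl <;> rcases h1 with h1 | h1 <;> rcases h2 with h2 | h2 <;>
        simp_all
    exact ⟨0, 2, two_pos, e2, h.one_lt_norm_sphereDeriv_iterate hx two_pos⟩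

theorem critical_value (h : IsPerturbed F τ a b m) {x : OnePoint ℂ} (hx : IsCriticalPoint F x) :
    F x = ∞ ∨ F x = ((0 : ℂ) : OnePoint ℂ) ∨ F x = expGL m • proj τ (τ / 2) ∨
      F x = expGL m • proj τ (τ / 2 + 1 / 2) := by
  obtain ⟨z, rfl⟩ := proj_surjective h.im_pos x
  rw [h.semiconj]
  rcases proj_of_two_mul_mem h.im_pos (h.two_mul_mem_of_critical hx) with e | e | e | e <;> rw [e]
  · left; rw [expGL_smul_infty]
  · right; left; rw [expGL_smul_coe, mul_zero]
  · right; right; left; rfl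
  · right; right; right; rfl

theorem strictlyPCF (h : IsPerturbed F τ a b m)
    (h3 : ∃ n, F^[n] (expGL m • proj τ (τ / 2)) = ∞ ∨
      F^[n] (expGL m • proj τ (τ / 2)) = ((0 : ℂ) : OnePoint ℂ))
    (h4 : ∃ n, F^[n] (expGL m • proj τ (τ / 2 + 1 / 2)) = ∞ ∨
      F^[n] (expGL m • proj τ (τ / 2 + 1 / 2)) = ((0 : ℂ) : OnePoint ℂ)) : StrictlyPCF F := by
  intro x hx
  have key : ∃ n, F^[n] x = ∞ ∨ F^[n] x = ((0 : ℂ) : OnePoint ℂ) := by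
    rcases h.critical_value hx with e | e | e | e
    · exact ⟨1, Or.inl e⟩
    · exact ⟨1, Or.inr e⟩
    · obtain ⟨n, hn⟩ := h3
      exact ⟨n + 1, by rwa [Function.iterate_succ_apply, e]⟩
    · obtain ⟨n, hn⟩ := h4
      exact ⟨n + 1, by rwa [Function.iterate_succ_apply, e]⟩
  obtain ⟨n, hn⟩ := key
  obtain ⟨k, hk⟩ := h.exists_repelling hn
  exact ⟨k + n, by rwa [Function.iterate_add_apply]⟩

end IsPerturbed


/-! ### Endomorphisms of complex tori -/

section Torus

variable {Λ : PeriodPair} {α : ℂ}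

theorem periodPair_area_ne_zero (Λ : PeriodPair) :
    Λ.ω₁.re * Λ.ω₂.im - Λ.ω₂.re * Λ.ω₁.im ≠ 0 := by
  intro h
  have hi := LinearIndependent.pair_iff.1 Λ.indep
  have h1 := hi Λ.ω₂.im (-Λ.ω₁.im) (by
    apply Complex.ext
    · simp; linear_combination h
    · simp; ring)
  have h2 := hi Λ.ω₂.re (-Λ.ω₁.re) (by
    apply Complex.ext
    · simp; ring
    · simp; linear_combination -h)
  have h3 : Λ.ω₁ = 0 := Complex.ext (by simpa using h2.2) (by simpa using h1.2)
  have := hi 1 0 (by simp [h3])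
  exact one_ne_zero this.1

/-- The endomorphism of a lattice given by multiplication with a complex number. -/
def latticeMul (hα : ∀ l ∈ Λ.lattice, α * l ∈ Λ.lattice) : Λ.lattice →ₗ[ℤ] Λ.lattice :=
  (LinearMap.mulLeft ℤ α).restrict hα

theorem coe_latticeMul (hα : ∀ l ∈ Λ.lattice, α * l ∈ Λ.lattice) (l : Λ.lattice) :
    (latticeMul hα l : ℂ) = α * l := rfl

/-- The determinant of the multiplication with `α` on a lattice is `|α| ^ 2`. -/
theorem det_latticeMul (hα : ∀ l ∈ Λ.lattice, α * l ∈ Λ.lattice) :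
    ((LinearMap.det (latticeMul hα) : ℤ) : ℝ) = ‖α‖ ^ 2 := by
  set B := Λ.latticeBasis
  set M := LinearMap.toMatrix B B (latticeMul hα) with hM
  have hB : ∀ j, α * (B j : ℂ) = M 0 j * Λ.ω₁ + M 1 j * Λ.ω₂ := by
    intro j
    have h1 := B.sum_repr (latticeMul hα (B j))
    rw [Fin.sum_univ_two] at h1
    have h2 := congrArg (Subtype.val) h1
    rw [coe_latticeMul] at h2
    rw [← h2]
    simp [hM, LinearMap.toMatrix_apply, B]
  have h0 := hB 0
  have h1 := hB 1
  simp only [B, PeriodPair.latticeBasis_zero, PeriodPair.latticeBasis_one] at h0 h1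
  rw [← LinearMap.det_toMatrix B, Matrix.det_fin_two, ← Complex.normSq_eq_norm_sq,
    Complex.normSq_apply]
  have e1 := congrArg Complex.re h0
  have e2 := congrArg Complex.im h0
  have e3 := congrArg Complex.re h1
  have e4 := congrArg Complex.im h1
  simp at e1 e2 e3 e4
  refine mul_right_cancel₀ (periodPair_area_ne_zero Λ) ?_
  have : (α.re * α.re + α.im * α.im) * (Λ.ω₁.re * Λ.ω₂.im - Λ.ω₂.re * Λ.ω₁.im) =
      (α.re * Λ.ω₁.re - α.im * Λ.ω₁.im) * (α.re * Λ.ω₂.im + α.im * Λ.ω₂.re) -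
      (α.re * Λ.ω₂.re - α.im * Λ.ω₂.im) * (α.re * Λ.ω₁.im + α.im * Λ.ω₁.re) := by ring
  rw [this, e1, e2, e3, e4]
  push_cast
  ring

/-- The endomorphism of a torus given by multiplication with a complex number. -/
def torusMul (hα : ∀ l ∈ Λ.lattice, α * l ∈ Λ.lattice) : ℂ ⧸ Λ.lattice →ₗ[ℤ] ℂ ⧸ Λ.lattice :=
  Submodule.mapQ Λ.lattice Λ.lattice (LinearMap.mulLeft ℤ α) hα

theorem torusMul_mk (hα : ∀ l ∈ Λ.lattice, α * l ∈ Λ.lattice) (z : ℂ) :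
    torusMul hα (Submodule.Quotient.mk z) = Submodule.Quotient.mk (α * z) := rfl

/-- The fibres of the multiplication with `α ≠ 0` on a torus have at most `|α| ^ 2` points. -/
theorem card_le_of_torusMul_eq (hα : ∀ l ∈ Λ.lattice, α * l ∈ Λ.lattice) (hα0 : α ≠ 0)
    {U : Finset (ℂ ⧸ Λ.lattice)} (hU : ∀ u ∈ U, ∀ v ∈ U, torusMul hα u = torusMul hα v) :
    (U.card : ℝ) ≤ ‖α‖ ^ 2 := by
  classical
  rcases U.eq_empty_or_nonempty with rfl | ⟨u₀, hu₀⟩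
  · simp
  have hinj : Function.Injective (latticeMul hα) := by
    intro l l' h
    have := congrArg Subtype.val h
    rw [coe_latticeMul, coe_latticeMul] at this
    exact Subtype.ext (mul_left_cancel₀ hα0 this)
  set N := LinearMap.range (latticeMul hα)
  have hcard := Submodule.natAbs_det_equiv N (LinearEquiv.ofInjective _ hinj)
  have hdet : (N.subtype ∘ₗ AddMonoidHom.toIntLinearMap
      (LinearEquiv.ofInjective _ hinj : Λ.lattice →+ N)) = latticeMul hα := rfl
  rw [hdet] at hcard
  have hreal : ((Nat.card (Λ.lattice ⧸ N) : ℕ) : ℝ) = ‖α‖ ^ 2 := by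
    rw [← hcard, Nat.cast_natAbs, Int.cast_abs, det_latticeMul, abs_of_nonneg (by positivity)]
  have hfin : Finite (Λ.lattice ⧸ N) := by
    refine Nat.finite_of_card_ne_zero fun h => ?_
    rw [h] at hreal
    have : ‖α‖ ^ 2 = 0 := by simpa using hreal.symm
    exact hα0 (by simpa using this)
  have hmem : ∀ u : U, α * (Quotient.out (u : ℂ ⧸ Λ.lattice) - Quotient.out u₀) ∈ Λ.lattice := by
    intro u
    have h1 := hU u u.2 u₀ hu₀
    have e : ∀ v : ℂ ⧸ Λ.lattice, v = Submodule.Quotient.mk (Quotient.out v) :=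
      fun v => (Quotient.out_eq v).symm
    rw [e u, e u₀, torusMul_mk, torusMul_mk, Submodule.Quotient.eq, ← mul_sub] at h1
    exact h1
  have hle := Nat.card_le_card_of_injective
    (fun u : U => (Submodule.Quotient.mk ⟨_, hmem u⟩ : Λ.lattice ⧸ N)) (by
      intro u v huv
      rw [Submodule.Quotient.eq] at huv
      obtain ⟨l, hl⟩ := huv
      have h2 := congrArg Subtype.val hl
      rw [coe_latticeMul] at h2
      have h3 : α * (l : ℂ) =
          α * (Quotient.out (u : ℂ ⧸ Λ.lattice) - Quotient.out (v : ℂ ⧸ Λ.lattice)) := by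
        rw [h2]
        change α * (_ - _) - α * (_ - _) = _
        ring
      have h4 := mul_left_cancel₀ hα0 h3
      have h5 : Quotient.out (u : ℂ ⧸ Λ.lattice) - Quotient.out (v : ℂ ⧸ Λ.lattice) ∈ Λ.lattice := by
        rw [← h4]; exact l.2
      refine Subtype.ext ?_
      rw [← Quotient.out_eq (u : ℂ ⧸ Λ.lattice), ← Quotient.out_eq (v : ℂ ⧸ Λ.lattice)]
      exact (Submodule.Quotient.eq _).2 h5)
  rw [← hreal]
  rw [Nat.card_eq_fintype_card, Fintype.card_coe] at hle
  exact_mod_cast hle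

/-- If the fibres of `f` have at most `N` points, then those of `f^[n]` have at most `N ^ n`. -/
theorem card_le_of_iterate_mem {X : Type*} [DecidableEq X] {f : X → X} {N : ℝ} (hN : 0 ≤ N)
    (hf : ∀ U : Finset X, (∀ u ∈ U, ∀ v ∈ U, f u = f v) → (U.card : ℝ) ≤ N) (S : Finset X)
    (n : ℕ) (T : Finset X) (hT : ∀ t ∈ T, f^[n] t ∈ S) : (T.card : ℝ) ≤ N ^ n * S.card := by
  induction n generalizing T with
  | zero =>
    rw [pow_zero, one_mul]
    exact_mod_cast Finset.card_le_card hT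
  | succ n ih =>
    have h1 := ih (T.image f) (by
      intro t ht
      obtain ⟨s, hs, rfl⟩ := Finset.mem_image.1 ht
      exact hT s hs)
    have h2 : (T.card : ℝ) ≤ N * (T.image f).card := by
      rw [Finset.card_eq_sum_card_image f T]
      push_cast
      rw [mul_comm, ← nsmul_eq_mul]
      refine Finset.sum_le_card_nsmul _ _ _ fun y _ => hf _ fun u hu v hv => ?_
      rw [(Finset.mem_filter.1 hu).2, (Finset.mem_filter.1 hv).2]
    calc (T.card : ℝ) ≤ N * (T.image f).card := h2
      _ ≤ N * (N ^ n * S.card) := by gcongr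
      _ = N ^ (n + 1) * S.card := by ring

theorem exists_compact_reduction_periodPair (Λ : PeriodPair) :
    ∃ K : Set ℂ, IsCompact K ∧ ∀ z, ∃ w ∈ K, w - z ∈ Λ.lattice := by
  refine ⟨(fun p : ℝ × ℝ => (p.1 : ℂ) * Λ.ω₁ + p.2 * Λ.ω₂) '' (Set.Icc 0 1 ×ˢ Set.Icc 0 1),
    (isCompact_Icc.prod isCompact_Icc).image (by fun_prop), fun z => ?_⟩
  have hz := Λ.basis.sum_repr z
  simp only [Fin.sum_univ_two, PeriodPair.basis_zero, PeriodPair.basis_one,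
    Complex.real_smul] at hz
  set x := Λ.basis.repr z 0
  set y := Λ.basis.repr z 1
  refine ⟨_, ⟨(Int.fract x, Int.fract y), ⟨⟨Int.fract_nonneg x, (Int.fract_lt_one x).le⟩,
    ⟨Int.fract_nonneg y, (Int.fract_lt_one y).le⟩⟩, rfl⟩, ?_⟩
  rw [PeriodPair.mem_lattice]
  refine ⟨-⌊x⌋, -⌊y⌋, ?_⟩
  have hx : (x : ℂ) = (⌊x⌋ : ℂ) + (Int.fract x : ℝ) := by exact_mod_cast (Int.floor_add_fract x).symm
  have hy : (y : ℂ) = (⌊y⌋ : ℂ) + (Int.fract y : ℝ) := by exact_mod_cast (Int.floor_add_fract y).symm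
  rw [← hz]
  push_cast
  rw [hx, hy]
  ring

theorem countable_lattice (Λ : PeriodPair) : (Λ.lattice : Set ℂ).Countable := by
  have : Countable Λ.lattice := Λ.latticeEquivProd.toEquiv.countable_iff.2 inferInstance
  exact Set.to_countable _

end Torus


/-! ### The perturbed maps are not Lattès maps -/

/-- A semiconjugacy from an affine map of a complex torus to a self-map of the sphere. -/
structure IsTorusSemiconj (G : OnePoint ℂ → OnePoint ℂ) (Λ : PeriodPair) (α β : ℂ)
    (Θ : ℂ ⧸ Λ.lattice → OnePoint ℂ) : Prop where
  mul_mem : ∀ l ∈ Λ.lattice, α * l ∈ Λ.lattice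
  holSph : ∀ z, HolSph (fun z => Θ (Submodule.Quotient.mk z)) z
  finite : ∀ y, (Θ ⁻¹' {y}).Finite
  semiconj : ∀ z : ℂ, G (Θ (Submodule.Quotient.mk z)) = Θ (Submodule.Quotient.mk (α * z + β))

namespace IsTorusSemiconj

variable {G : OnePoint ℂ → OnePoint ℂ} {Λ : PeriodPair} {α β : ℂ} {Θ : ℂ ⧸ Λ.lattice → OnePoint ℂ}

theorem not_eventually_const (h : IsTorusSemiconj G Λ α β Θ) (z : ℂ) :
    ¬ ∀ᶠ w in 𝓝 z, Θ (Submodule.Quotient.mk w) = Θ (Submodule.Quotient.mk z) := by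
  intro hc
  have hcount : {w : ℂ | Θ (Submodule.Quotient.mk w) = Θ (Submodule.Quotient.mk z)}.Countable := by
    have : {w : ℂ | Θ (Submodule.Quotient.mk w) = Θ (Submodule.Quotient.mk z)} ⊆
        ⋃ s ∈ Θ ⁻¹' {Θ (Submodule.Quotient.mk z)},
          (fun l => Quotient.out s + l) '' (Λ.lattice : Set ℂ) := by
      intro w hw
      refine Set.mem_iUnion₂.2 ⟨Submodule.Quotient.mk w, hw,
        w - Quotient.out (Submodule.Quotient.mk w : ℂ ⧸ Λ.lattice), ?_, by simp⟩
      refine (Submodule.Quotient.eq _).1 ?_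
      exact (Quotient.out_eq (Submodule.Quotient.mk w : ℂ ⧸ Λ.lattice)).symm
    refine Set.Countable.mono this ((h.finite _).countable.biUnion fun s _ => ?_)
    exact (countable_lattice Λ).image _
  obtain ⟨w, hw1, hw2⟩ := (hcount.dense_compl ℂ).inter_nhds_nonempty hc
  exact hw1 hw2

theorem surjective (h : IsTorusSemiconj G Λ α β Θ) :
    Function.Surjective fun z : ℂ => Θ (Submodule.Quotient.mk z) := by
  obtain ⟨K, hK, hred⟩ := exists_compact_reduction_periodPair Λ
  refine surjective_of_holSph h.holSph hK (fun z => ?_) h.not_eventually_const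
  obtain ⟨w, hw, e⟩ := hred z
  exact ⟨w, hw, congrArg Θ ((Submodule.Quotient.eq _).2 e)⟩

theorem sphOrder_ne_top (h : IsTorusSemiconj G Λ α β Θ) (z : ℂ) :
    sphOrder (fun z => Θ (Submodule.Quotient.mk z)) z ≠ ⊤ := by
  intro ht
  rw [sphOrder, analyticOrderAt_eq_top] at ht
  refine h.not_eventually_const z ?_
  filter_upwards [ht, (h.holSph z).continuousAt.eventually (eventually_param_coord _)]
    with w h1 h2
  rw [← h2, sub_eq_zero.1 h1, param_coord_self]

theorem α_ne_zero (h : IsTorusSemiconj G Λ α β Θ) {x : OnePoint ℂ} (hx : sphereDeriv G x ≠ 0) :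
    α ≠ 0 := by
  rintro rfl
  refine hx ?_
  have hconst : ∀ y, G y = Θ (Submodule.Quotient.mk β) := by
    intro y
    obtain ⟨z, rfl⟩ := h.surjective y
    simpa using h.semiconj z
  rw [sphereDeriv]
  simp only [hconst, deriv_const]

/-- The local degree of the projection grows along orbits by the local degree of `G`. -/
theorem sphOrder_eq (h : IsTorusSemiconj G Λ α β Θ) (hα : α ≠ 0) (hG : ∀ x, SphHol G x) (z : ℂ) :
    sphOrder (fun z => Θ (Submodule.Quotient.mk z)) (α * z + β) =
      sphDegree G (Θ (Submodule.Quotient.mk z)) *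
        sphOrder (fun z => Θ (Submodule.Quotient.mk z)) z := by
  have h1 := sphOrder_comp (h := fun z => Θ (Submodule.Quotient.mk z)) (hG _) (h.holSph z)
  rw [← h1]
  simp only [h.semiconj, sphOrder]
  have hl : HasDerivAt (fun w : ℂ => α * w + β) (α * 1) z :=
    ((hasDerivAt_id z).const_mul α).add_const β
  exact (analyticOrderAt_comp_of_deriv_ne_zero (g := fun w : ℂ => α * w + β)
    (f := fun u => coord (Θ (Submodule.Quotient.mk (α * z + β))) (Θ (Submodule.Quotient.mk u)) -
      coord (Θ (Submodule.Quotient.mk (α * z + β))) (Θ (Submodule.Quotient.mk (α * z + β))))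
    (by fun_prop) (by rw [hl.deriv, mul_one]; exact hα)).symm

theorem iterate_semiconj (h : IsTorusSemiconj G Λ α β Θ) (n : ℕ) (z : ℂ) :
    G^[n] (Θ (Submodule.Quotient.mk z)) =
      Θ (Submodule.Quotient.mk ((fun w => α * w + β)^[n] z)) := by
  induction n with
  | zero => rfl
  | succ n ih => rw [Function.iterate_succ_apply', Function.iterate_succ_apply', ih, h.semiconj]

theorem affine_iterate (α β z t : ℂ) (n : ℕ) :
    (fun w => α * w + β)^[n] z = (fun w => α * w + β)^[n] t + α ^ n * (z - t) := by
  induction n with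
  | zero => simp
  | succ n ih => rw [Function.iterate_succ_apply', Function.iterate_succ_apply', ih]; ring

/-- If `G` has at least `D` preimages of every point outside a set that contains the forward orbits
of the exceptional points, then the affine map of the torus has degree at least `D`. -/
theorem le_norm_sq (h : IsTorusSemiconj G Λ α β Θ) (hα : α ≠ 0) {E : Set (OnePoint ℂ)}
    (hE : E.Countable) (hEG : ∀ x ∈ E, G x ∈ E) {D : ℕ}
    (hpre : ∀ y ∉ E, ∃ S : Finset (OnePoint ℂ), S.card = D ∧ ∀ x ∈ S, G x = y) :
    (D : ℝ) ≤ ‖α‖ ^ 2 := by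
  classical
  have hy : ∃ y, y ∉ E := by
    obtain ⟨z, hz⟩ := ((hE.preimage (f := ((↑) : ℂ → OnePoint ℂ))
      OnePoint.coe_injective).dense_compl ℂ).nonempty
    exact ⟨z, hz⟩
  obtain ⟨y, hy⟩ := hy
  have hT : ∀ n, ∃ T : Finset (OnePoint ℂ), T.card = D ^ n ∧ ∀ x ∈ T, G^[n] x = y ∧ x ∉ E := by
    intro n
    induction n with
    | zero => exact ⟨{y}, by simp, by simp [hy]⟩
    | succ n ih =>
      obtain ⟨T, hTc, hTm⟩ := ih
      choose! S hSc hS using hpre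
      refine ⟨T.biUnion S, ?_, ?_⟩
      · rw [Finset.card_biUnion, Finset.sum_congr rfl fun x hx => hSc x (hTm x hx).2,
          Finset.sum_const, hTc, smul_eq_mul, pow_succ]
        intro x hx x' hx' hne
        rw [Function.onFun, Finset.disjoint_left]
        intro u hu hu'
        exact hne (by rw [← hS x (hTm x hx).2 u hu, hS x' (hTm x' hx').2 u hu'])
      · intro u hu
        obtain ⟨x, hx, hux⟩ := Finset.mem_biUnion.1 hu
        have hGu := hS x (hTm x hx).2 u hux
        refine ⟨by rw [Function.iterate_succ_apply, hGu, (hTm x hx).1], fun hc => ?_⟩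
        exact (hTm x hx).2 (hGu ▸ hEG u hc)
  set f : ℂ ⧸ Λ.lattice → ℂ ⧸ Λ.lattice := fun u =>
    torusMul h.mul_mem u + Submodule.Quotient.mk β with hf
  have hfG : ∀ u, G (Θ u) = Θ (f u) := by
    intro u
    obtain ⟨z, rfl⟩ := Submodule.Quotient.mk_surjective _ u
    exact h.semiconj z
  have hfGn : ∀ n u, G^[n] (Θ u) = Θ (f^[n] u) := by
    intro n u
    induction n with
    | zero => rfl
    | succ n ih => rw [Function.iterate_succ_apply', Function.iterate_succ_apply', ih, hfG]
  have hcard := card_le_of_iterate_mem (f := f) (N := ‖α‖ ^ 2) (by positivity)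
    (fun U hU => card_le_of_torusMul_eq h.mul_mem hα fun u hu v hv => by
      simpa [hf] using hU u hu v hv) (h.finite y).toFinset
  set M : ℝ := Nat.cast (h.finite y).toFinset.card
  have hle : ∀ n : ℕ, ((D : ℝ) ^ n) ≤ (‖α‖ ^ 2) ^ n * M := by
    intro n
    obtain ⟨T, hTc, hTm⟩ := hT n
    have hΘ : ∀ x : OnePoint ℂ, ∃ u, Θ u = x := fun x => by
      obtain ⟨z, hz⟩ := h.surjective x
      exact ⟨_, hz⟩
    choose r hr using hΘ
    have h1 := hcard n (T.image r) (by
      intro u hu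
      obtain ⟨x, hx, rfl⟩ := Finset.mem_image.1 hu
      rw [Set.Finite.mem_toFinset, Set.mem_preimage, ← hfGn, hr, (hTm x hx).1]
      rfl)
    rw [Finset.card_image_of_injective _ (Function.LeftInverse.injective hr), hTc] at h1
    exact_mod_cast h1
  by_contra! hlt
  have hpos : 0 < ‖α‖ ^ 2 := by positivity
  have h1 : 1 < (D : ℝ) / ‖α‖ ^ 2 := (one_lt_div hpos).2 hlt
  obtain ⟨n, hn⟩ := pow_unbounded_of_one_lt M h1
  rw [div_pow, lt_div_iff₀ (by positivity)] at hn
  linarith [hle n]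

end IsTorusSemiconj

namespace IsPerturbed

variable {F : OnePoint ℂ → OnePoint ℂ} {τ : ℂ} {a : ℕ} {b m : ℂ}

theorem div_mem_lat {τ : ℂ} (hτ : 0 < τ.im) {a : ℕ} (ha : a ≠ 0) {k l : ℤ}
    (h : ((k : ℂ) + l * τ) / a ∈ lat τ) : (a : ℤ) ∣ k ∧ (a : ℤ) ∣ l := by
  have ha' : (a : ℝ) ≠ 0 := Nat.cast_ne_zero.2 ha
  have e : ((k : ℂ) + l * τ) / a = ((k / a : ℝ) : ℂ) + ((l / a : ℝ) : ℂ) * τ := by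
    push_cast; ring
  rw [e, real_mem_lat_iff hτ] at h
  obtain ⟨⟨i, hi⟩, ⟨j, hj⟩⟩ := h
  rw [div_eq_iff ha'] at hi hj
  exact ⟨⟨i, by rw [mul_comm]; exact_mod_cast hi⟩, ⟨j, by rw [mul_comm]; exact_mod_cast hj⟩⟩

/-- Every point that is not the image of a half-period has `a ^ 2` preimages. -/
theorem exists_preimages (h : IsPerturbed F τ a b m) {c : ℂ} (hc : 2 * c ∉ lat τ) :
    ∃ S : Finset (OnePoint ℂ), S.card = a * a ∧ ∀ x ∈ S, F x = expGL m • proj τ c := by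
  classical
  have hτ := h.im_pos
  have ha0 : a ≠ 0 := by have := h.two_le; omega
  have ha := h.cast_ne_zero
  have hdiv : ∀ p, a * divPt τ a (c - b) p = c - b + (p.1 : ℕ) + (p.2 : ℕ) * τ := fun p => by
    rw [divPt, mul_div_cancel₀ _ ha]
  have hinj : Function.Injective fun p : Fin a × Fin a => proj τ (divPt τ a (c - b) p) := by
    intro p q hpq
    rcases (proj_eq_iff hτ).1 hpq with e | e
    · refine absurd ?_ hc
      obtain ⟨k, hk⟩ := h.two_mul_b
      have h1 := natCast_mul_mem_lat a e
      rw [mul_add, hdiv, hdiv] at h1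
      have h2 : ((k : ℤ) : ℂ) - ((p.1 : ℕ) : ℤ) - ((q.1 : ℕ) : ℤ) +
          (-((p.2 : ℕ) : ℤ) - ((q.2 : ℕ) : ℤ)) * τ ∈ lat τ :=
        ⟨k - (p.1 : ℕ) - (q.1 : ℕ), -(p.2 : ℕ) - (q.2 : ℕ), by push_cast; ring⟩
      have h3 := add_mem h1 h2
      convert! h3 using 1
      push_cast
      linear_combination hk
    · have e2 : divPt τ a (c - b) p - divPt τ a (c - b) q =
          (((((p.1 : ℕ) : ℤ) - ((q.1 : ℕ) : ℤ) : ℤ) : ℂ) +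
            ((((p.2 : ℕ) : ℤ) - ((q.2 : ℕ) : ℤ) : ℤ) : ℂ) * τ) / a := by
        rw [divPt, divPt]; push_cast; ring
      rw [e2] at e
      obtain ⟨d1, d2⟩ := div_mem_lat hτ ha0 e
      have key : ∀ i j : Fin a, (a : ℤ) ∣ ((i : ℕ) : ℤ) - ((j : ℕ) : ℤ) → i = j := by
        intro i j hd
        have h1 := i.2
        have h2 := j.2
        have := Int.eq_zero_of_abs_lt_dvd hd (by rw [abs_lt]; omega)
        exact Fin.ext (by omega)
      exact Prod.ext (key _ _ d1) (key _ _ d2)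
  refine ⟨Finset.univ.image fun p : Fin a × Fin a => proj τ (divPt τ a (c - b) p), ?_, ?_⟩
  · rw [Finset.card_image_of_injective _ hinj]; simp
  · intro x hx
    obtain ⟨p, -, rfl⟩ := Finset.mem_image.1 hx
    rw [h.semiconj, hdiv]
    congr 1
    refine proj_congr hτ ⟨(p.1 : ℕ), (p.2 : ℕ), ?_⟩
    push_cast; ring

/-- A semiconjugacy from an affine map of a torus is excluded if the orbit of a critical value
passes through another critical point before it reaches `{0, ∞}`. -/
theorem not_isTorusSemiconj (h : IsPerturbed F τ a b m) {n : ℕ} {z₃ : ℂ}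
    (hn : F^[n] (expGL m • proj τ (τ / 2)) = proj τ z₃) (hz : 2 * z₃ ∉ lat τ) {k : ℤ}
    (hz' : a * z₃ + b - k / 2 ∈ lat τ) {Λ : PeriodPair} {α β : ℂ} {Θ : ℂ ⧸ Λ.lattice → OnePoint ℂ}
    (hL : IsTorusSemiconj F Λ α β Θ) : False := by
  have hτ := h.im_pos
  have ha := h.cast_ne_zero
  have ha2 := h.two_le
  have ha0 : a ≠ 0 := by omega
  have ha2' : (2 : ℝ) ≤ a := by exact_mod_cast ha2
  have hα : α ≠ 0 := by
    refine hL.α_ne_zero (x := ∞) fun h0 => ?_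
    have := (h.norm_sphereDeriv_mem (Or.inl rfl)).1
    rw [h0, norm_zero] at this
    nlinarith
  -- The degree of the affine map is at least `a ^ 2`.
  have hdeg : (a : ℝ) ^ 2 ≤ ‖α‖ ^ 2 := by
    set E₀ : Set (OnePoint ℂ) := {∞, ((0 : ℂ) : OnePoint ℂ), expGL m • proj τ (τ / 2),
      expGL m • proj τ (τ / 2 + 1 / 2)} with hE₀
    have h1 := hL.le_norm_sq hα (E := ⋃ n, F^[n] '' E₀) (D := a * a)
      (Set.countable_iUnion fun n => ((Set.toFinite E₀).image _).countable) (by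
        intro x hx
        obtain ⟨n, y, hy, rfl⟩ := Set.mem_iUnion.1 hx
        exact Set.mem_iUnion.2 ⟨n + 1, y, hy, Function.iterate_succ_apply' F n y⟩) (by
        intro y hy
        have hyE : y ∉ E₀ := fun h' => hy (Set.mem_iUnion.2 ⟨0, y, h', rfl⟩)
        obtain ⟨c, hc⟩ := proj_surjective hτ ((expGL m)⁻¹ • y)
        have hyc : y = expGL m • proj τ c := by rw [hc, smul_inv_smul]
        rw [hyc]
        refine h.exists_preimages fun h2 => hyE ?_
        rw [hyc, hE₀]
        rcases proj_of_two_mul_mem hτ h2 with e | e | e | e <;> rw [e]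
        · rw [expGL_smul_infty]; simp
        · rw [expGL_smul_coe, mul_zero]; simp
        · simp
        · simp)
    push_cast at h1
    nlinarith
  have hαa : (a : ℝ) ≤ ‖α‖ := le_of_sq_le_sq hdeg (norm_nonneg _)
  -- A critical point over the critical value.
  set z₀ : ℂ := (τ / 2 - b) / a with hz₀
  have haz₀ : a * z₀ + b = τ / 2 := by rw [hz₀, mul_div_cancel₀ _ ha, sub_add_cancel]
  have hcrit₀ : sphereDeriv F (proj τ z₀) = 0 := by
    refine h.critical_of_two_mul_mem (fun hmem => ?_) ?_
    · obtain ⟨k, hk⟩ := h.two_mul_b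
      have e : 2 * z₀ = (((-k : ℤ) : ℂ) + ((1 : ℤ) : ℂ) * τ) / a := by
        rw [hz₀]; field_simp; push_cast; linear_combination -hk
      rw [e] at hmem
      have := Int.le_of_dvd one_pos (div_mem_lat hτ ha0 hmem).2
      omega
    · rw [haz₀, mul_div_cancel₀ _ (two_ne_zero)]
      exact tau_mem_lat τ
  have hcrit₃ : sphereDeriv F (proj τ z₃) = 0 := by
    refine h.critical_of_two_mul_mem hz ?_
    have := add_mem (two_mul_mem_lat hz') (int_mem_lat τ k)
    convert! this using 1
    ring
  obtain ⟨ζ, hζ⟩ := hL.surjective (proj τ z₀)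
  set L : ℂ → ℂ := fun w => α * w + β with hLdef
  set H : ℂ → OnePoint ℂ := fun z => Θ (Submodule.Quotient.mk z) with hH
  have hiter : ∀ n, F^[n] (proj τ z₀) = H (L^[n] ζ) := fun n => by
    rw [← hζ]; exact hL.iterate_semiconj n ζ
  have hF1 : F (proj τ z₀) = expGL m • proj τ (τ / 2) := by rw [h.semiconj, haz₀]
  have hord : ∀ n, sphOrder H (L^[n + 1] ζ) = sphDegree F (F^[n] (proj τ z₀)) *
      sphOrder H (L^[n] ζ) := by
    intro n
    rw [hiter, Function.iterate_succ_apply']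
    exact hL.sphOrder_eq hα h.sphHol _
  have hmono : ∀ i j, sphOrder H (L^[i] ζ) ≤ sphOrder H (L^[i + j] ζ) := by
    intro i j
    induction j with
    | zero => exact le_rfl
    | succ j ih =>
      rw [← add_assoc, hord]
      refine ih.trans ?_
      exact le_mul_of_one_le_left zero_le
        (Order.one_le_iff_ne_zero.2 (sphDegree_ne_zero (h.sphHol _)))
  have hord1 : 2 ≤ sphOrder H (L^[1] ζ) := by
    rw [hord 0]
    calc (2 : ℕ∞) = 2 * 1 := by norm_num
      _ ≤ _ := by
        gcongr
        · exact two_le_sphDegree (h.sphHol _) hcrit₀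
        · exact Order.one_le_iff_ne_zero.2 (sphOrder_ne_zero (hL.holSph _))
  have hit3 : F^[n + 1] (proj τ z₀) = proj τ z₃ := by
    rw [Function.iterate_succ_apply, hF1, hn]
  have hord4 : 4 ≤ sphOrder H (L^[n + 2] ζ) := by
    rw [hord (n + 1), hit3]
    have h1 : 2 ≤ sphOrder H (L^[n + 1] ζ) := hord1.trans (add_comm 1 n ▸ hmono 1 n)
    calc (4 : ℕ∞) = 2 * 2 := by norm_num
      _ ≤ _ := by
        gcongr
        exact two_le_sphDegree (h.sphHol _) hcrit₃
  have hbase : ∀ k, H (L^[n + 2 + k] ζ) = ∞ ∨ H (L^[n + 2 + k] ζ) = ((0 : ℂ) : OnePoint ℂ) := by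
    intro j
    rw [← hiter, add_comm, Function.iterate_add_apply]
    refine h.iterate_zero_infty ?_ j
    rw [Function.iterate_succ_apply', hit3, h.semiconj, proj_congr hτ hz']
    rcases proj_int_half hτ k with e | e
    · left; rw [e, expGL_smul_infty]
    · right; rw [e, expGL_smul_coe, mul_zero]
  -- The orbit is eventually periodic in the torus.
  obtain ⟨i, j, hij, heq⟩ : ∃ i j : ℕ, i < j ∧
      (Submodule.Quotient.mk (L^[n + 2 + i] ζ) : ℂ ⧸ Λ.lattice) =
        Submodule.Quotient.mk (L^[n + 2 + j] ζ) := by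
    obtain ⟨i, -, j, -, hne, e⟩ := Set.infinite_univ.exists_ne_map_eq_of_mapsTo
      (f := fun k : ℕ => (Submodule.Quotient.mk (L^[n + 2 + k] ζ) : ℂ ⧸ Λ.lattice))
      (t := Θ ⁻¹' {∞} ∪ Θ ⁻¹' {((0 : ℂ) : OnePoint ℂ)}) (fun k _ => hbase k)
      ((hL.finite _).union (hL.finite _))
    rcases lt_or_gt_of_ne hne with hlt | hlt
    · exact ⟨i, j, hlt, e⟩
    · exact ⟨j, i, hlt, e.symm⟩
  obtain ⟨p, hp, rfl⟩ : ∃ p, 0 < p ∧ j = i + p := ⟨j - i, by omega, by omega⟩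
  set t := L^[n + 2 + i] ζ with ht
  have htp : L^[n + 2 + (i + p)] ζ = L^[p] t := by
    rw [ht, ← Function.iterate_add_apply]; congr 1; omega
  rw [htp] at heq
  have hper : L^[p] t - t ∈ Λ.lattice := (Submodule.Quotient.eq _).1 heq.symm
  have hsemi : ∀ w, F^[p] (H w) = H (t + α ^ p * (w - t)) := by
    intro w
    have h1 : F^[p] (H w) = H (L^[p] w) := hL.iterate_semiconj p w
    rw [h1, hLdef, IsTorusSemiconj.affine_iterate α β w t p, ← hLdef]
    refine congrArg Θ ((Submodule.Quotient.eq _).2 ?_)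
    simpa using hper
  have hfix : F^[p] (H t) = H t := by simpa using hsemi t
  obtain ⟨e, he⟩ := ENat.ne_top_iff_exists.1 (hL.sphOrder_ne_top t)
  have he4 : 4 ≤ e := by
    have h1 := hord4.trans (hmono (n + 2) i)
    have h2 : ((4 : ℕ) : ℕ∞) ≤ (e : ℕ∞) := by rw [he]; exact_mod_cast h1
    exact_mod_cast h2
  have hmult := sphereDeriv_eq_pow (sphHol_iterate h.sphHol p (H t)) (hL.holSph t) hfix
    (Eventually.of_forall hsemi) he.symm
  have hup := h.norm_sphereDeriv_iterate_le (hbase i) p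
  rw [← ht, hmult, norm_pow, norm_pow, ← pow_mul, mul_comm p e, pow_mul] at hup
  have hlow : (2 * (a : ℝ) ^ 2) < ‖α‖ ^ e := by
    have ha4 : (4 : ℝ) ≤ (a : ℝ) ^ 2 := by nlinarith
    calc (2 * (a : ℝ) ^ 2) < (a : ℝ) ^ 2 * (a : ℝ) ^ 2 := by nlinarith
      _ = (a : ℝ) ^ 4 := by ring
      _ ≤ ‖α‖ ^ 4 := by gcongr
      _ ≤ ‖α‖ ^ e := pow_le_pow_right₀ (by linarith) he4
  exact absurd hup (not_le.2 (pow_lt_pow_left₀ hlow (by positivity) hp.ne'))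

end IsPerturbed

/-- The Lattès property, formulated for a conjugate of the map. -/
theorem exists_isTorusSemiconj_of_isLattes {D : ℕ} {f : RatSpace D} (hf : IsLattes f)
    {A : GL (Fin 2) ℂ} {F : OnePoint ℂ → OnePoint ℂ} (hfF : ∀ x, f.toFun (A • x) = A • F x) :
    ∃ (Λ : PeriodPair) (α β : ℂ) (Θ : ℂ ⧸ Λ.lattice → OnePoint ℂ), IsTorusSemiconj F Λ α β Θ := by
  obtain ⟨Λ, α, β, Θ, h1, h2, h3, h4⟩ := hf
  refine ⟨Λ, α, β, fun u => A⁻¹ • Θ u, h1, fun z => ?_, fun y => ?_, fun z => ?_⟩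
  · exact HolSph.gl_smul (holomorphicToSphere_iff.1 h2 z) A⁻¹
  · convert! h3 (A • y) using 1
    ext u
    simp [inv_smul_eq_iff]
  · have := hfF (A⁻¹ • Θ (Submodule.Quotient.mk z))
    rw [smul_inv_smul, h4] at this
    rw [this, inv_smul_smul]


/-! ### Identification of flexible Lattès maps -/

/-- A germ of order `e ≥ 3` takes some value at three different points. -/
theorem exists_three_preimages {u : ℂ → ℂ} (hu : AnalyticAt ℂ u 0) {e : ℕ} (he : 3 ≤ e)
    (ho : analyticOrderAt u 0 = e) {W : Set ℂ} (hW : W ∈ 𝓝 (0 : ℂ)) :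
    ∃ z : Fin 3 → ℂ, Function.Injective z ∧ (∀ i, z i ∈ W) ∧ ∀ i, u (z i) = u (z 0) := by
  obtain ⟨g, hg, hg0, hug⟩ := hu.analyticOrderAt_eq_natCast.1 ho
  have he0 : (e : ℂ) ≠ 0 := Nat.cast_ne_zero.2 (by omega)
  -- `ζ w = w r w` with `r ^ e = g / g 0` is a local coordinate in which the germ is a power.
  set r : ℂ → ℂ := fun w => Complex.exp (Complex.log (g w / g 0) / e) with hr
  have hra : AnalyticAt ℂ r 0 := by
    have h1 : AnalyticAt ℂ (fun w => g w / g 0) 0 := hg.fun_div analyticAt_const hg0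
    have h2 : AnalyticAt ℂ (fun w => Complex.log (g w / g 0)) 0 :=
      h1.clog (by simp [hg0])
    exact (h2.fun_div analyticAt_const he0).cexp
  have hr0 : r 0 = 1 := by simp [hr, hg0]
  set ζ : ℂ → ℂ := fun w => w * r w with hζ
  have hζa : AnalyticAt ℂ ζ 0 := analyticAt_id.fun_mul hra
  have hζd : HasStrictDerivAt ζ 1 0 := by
    have h1 := hζa.hasStrictDerivAt
    have h2 : HasDerivAt ζ (1 * r 0 + 0 * deriv r 0) 0 :=
      (hasDerivAt_id (0 : ℂ)).mul hra.differentiableAt.hasDerivAt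
    rw [h2.deriv, hr0] at h1
    simpa using h1
  have hre : ∀ᶠ w in 𝓝 (0 : ℂ), u w = g 0 * ζ w ^ e := by
    have : ∀ᶠ w in 𝓝 (0 : ℂ), g w ≠ 0 := hg.continuousAt.eventually_ne hg0
    filter_upwards [hug, this] with w h1 h2
    rw [h1, hζ, hr, mul_pow, ← Complex.exp_nat_mul, mul_div_cancel₀ _ he0,
      Complex.exp_log (div_ne_zero h2 hg0), sub_zero, smul_eq_mul]
    field_simp
  have hopen := hζd.map_nhds_eq one_ne_zero
  have hζ0 : ζ 0 = 0 := by simp [hζ]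
  rw [hζ0] at hopen
  have himg : ζ '' (W ∩ {w | u w = g 0 * ζ w ^ e}) ∈ 𝓝 (0 : ℂ) := by
    rw [← hopen]
    exact image_mem_map (inter_mem hW hre)
  obtain ⟨ε, hε, hball⟩ := Metric.mem_nhds_iff.1 himg
  set ξ := Complex.exp (2 * Real.pi * Complex.I / e)
  have hξ : IsPrimitiveRoot ξ e := Complex.isPrimitiveRoot_exp e (by omega)
  have hξn : ‖ξ‖ = 1 := hξ.norm'_eq_one (by omega)
  have hmem : ∀ i : Fin 3, ((ε / 2 : ℝ) : ℂ) * ξ ^ (i : ℕ) ∈ Metric.ball (0 : ℂ) ε := by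
    intro i
    rw [mem_ball_zero_iff, norm_mul, norm_pow, hξn, one_pow, mul_one, Complex.norm_real,
      Real.norm_of_nonneg (by positivity)]
    linarith
  choose z hz1 hz2 using fun i => hball (hmem i)
  have hε' : ((ε / 2 : ℝ) : ℂ) ≠ 0 := by
    rw [Ne, Complex.ofReal_eq_zero]; positivity
  refine ⟨z, fun i j hij => ?_, fun i => (hz1 i).1, fun i => ?_⟩
  · have h1 := (hz2 i).symm.trans ((congrArg ζ hij).trans (hz2 j))
    have h2 := hξ.pow_inj (by omega) (by omega) (mul_left_cancel₀ hε' h1)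
    exact Fin.ext h2
  · rw [(hz1 i).2, (hz1 0).2, hz2, hz2, mul_pow, mul_pow, ← pow_mul, ← pow_mul, mul_comm _ e,
      mul_comm _ e, pow_mul, pow_mul, hξ.pow_eq_one, one_pow, one_pow]

/-- A lattice has a basis for which a given point of order two is half of the first period. -/
theorem exists_adapted_basis (Λ : PeriodPair) {b : ℂ} (hb : 2 * b ∈ Λ.lattice) :
    ∃ ω τ : ℂ, 0 < τ.im ∧ (∀ z, ω * z ∈ Λ.lattice ↔ z ∈ lat τ) ∧
      ∃ k : ℤ, b - ω * (k / 2) ∈ Λ.lattice := by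
  have hflip : ∀ v w : ℂ, v.re * w.im - w.re * v.im ≠ 0 →
      (∀ z, z ∈ Λ.lattice ↔ ∃ i j : ℤ, i * v + j * w = z) →
      (∃ k : ℤ, b - v * (k / 2) ∈ Λ.lattice) →
      ∃ ω τ : ℂ, 0 < τ.im ∧ (∀ z, ω * z ∈ Λ.lattice ↔ z ∈ lat τ) ∧
        ∃ k : ℤ, b - ω * (k / 2) ∈ Λ.lattice := by
    intro v w harea hgen hk
    have hv : v ≠ 0 := by
      rintro rfl; simp at harea
    have him : (w / v).im ≠ 0 := by
      rw [Complex.div_im, ← sub_div]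
      refine div_ne_zero ?_ (Complex.normSq_pos.2 hv).ne'
      contrapose! harea
      linear_combination harea
    rcases lt_or_gt_of_ne him with hneg | hpos
    · refine ⟨v, -(w / v), by simpa using hneg, fun z => ?_, hk⟩
      rw [hgen, mem_lat]
      constructor
      · rintro ⟨i, j, h⟩
        refine ⟨i, -j, mul_left_cancel₀ hv ?_⟩
        rw [← h]; push_cast; field_simp
      · rintro ⟨i, j, rfl⟩
        refine ⟨i, -j, ?_⟩
        push_cast; field_simp
    · refine ⟨v, w / v, hpos, fun z => ?_, hk⟩
      rw [hgen, mem_lat]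
      constructor
      · rintro ⟨i, j, h⟩
        refine ⟨i, j, mul_left_cancel₀ hv ?_⟩
        rw [← h]; field_simp
      · rintro ⟨i, j, rfl⟩
        refine ⟨i, j, ?_⟩
        field_simp
  have harea := periodPair_area_ne_zero Λ
  obtain ⟨m, n, hmn⟩ := PeriodPair.mem_lattice.1 hb
  rcases Int.even_or_odd' n with ⟨n', rfl | rfl⟩
  · refine hflip Λ.ω₁ Λ.ω₂ harea (fun z => PeriodPair.mem_lattice)
      ⟨m, PeriodPair.mem_lattice.2 ⟨0, n', ?_⟩⟩
    push_cast at hmn ⊢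
    linear_combination hmn / 2
  rcases Int.even_or_odd' m with ⟨m', rfl | rfl⟩
  · refine hflip Λ.ω₂ Λ.ω₁ (fun h => harea (by linear_combination -h)) (fun z => ?_)
      ⟨2 * n' + 1, PeriodPair.mem_lattice.2 ⟨m', 0, ?_⟩⟩
    · rw [PeriodPair.mem_lattice]
      exact ⟨fun ⟨i, j, h⟩ => ⟨j, i, by rw [← h]; ring⟩, fun ⟨i, j, h⟩ => ⟨j, i, by rw [← h]; ring⟩⟩
    · push_cast at hmn ⊢
      linear_combination hmn / 2
  · refine hflip (Λ.ω₁ + Λ.ω₂) Λ.ω₂ (fun h => harea ?_) (fun z => ?_)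
      ⟨1, PeriodPair.mem_lattice.2 ⟨m', n', ?_⟩⟩
    · simp only [Complex.add_re, Complex.add_im] at h
      linear_combination h
    · rw [PeriodPair.mem_lattice]
      refine ⟨fun ⟨i, j, h⟩ => ⟨i, j - i, by rw [← h]; push_cast; ring⟩,
        fun ⟨i, j, h⟩ => ⟨i, i + j, by rw [← h]; push_cast; ring⟩⟩
    · push_cast at hmn ⊢
      linear_combination hmn / 2

theorem exists_gl_smul_eq_infty (x : OnePoint ℂ) : ∃ M : GL (Fin 2) ℂ, M • x = ∞ := by
  induction x using OnePoint.rec with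
  | infty => exact ⟨1, one_smul _ _⟩
  | coe c =>
    refine ⟨Matrix.GeneralLinearGroup.mkOfDetNeZero !![0, 1; 1, -c] (by simp [Matrix.det_fin_two]), ?_⟩
    rw [← pt_one_right, smul_pt _ (Or.inr one_ne_zero)]
    simp [Matrix.GeneralLinearGroup.mkOfDetNeZero]


theorem ex_half : ex (1 / 2) = -1 := by
  rw [ex, show 2 * (Real.pi : ℂ) * Complex.I * (1 / 2) = Real.pi * Complex.I by ring,
    Complex.exp_pi_mul_I]

theorem ell_add_one (τ z : ℂ) : ell τ (z + 1) = ell τ z := by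
  rw [ell, ell, show z + 1 + 1 / 2 = z + 1 / 2 + 1 by ring, theta_add_one, theta_add_one]

theorem theta_add_half_add_tau {τ : ℂ} (hτ : 0 < τ.im) (z : ℂ) :
    theta τ (z + τ + 1 / 2) = ex (-z) * theta τ (z + 1 / 2) := by
  rw [show z + τ + 1 / 2 = z + 1 / 2 + τ by ring, theta_add_tau hτ,
    show -(z + 1 / 2) = -z - 1 / 2 by ring, ex_sub, ex_half]
  ring

theorem ell_add_tau {τ : ℂ} (hτ : 0 < τ.im) (z : ℂ) : ell τ (z + τ) = ell τ z := by
  have := ex_ne_zero (-z)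
  rw [ell, ell, theta_add_half_add_tau hτ, theta_add_tau hτ, mul_pow, mul_pow, neg_sq,
    mul_div_mul_left _ _ (pow_ne_zero 2 this)]

/-- The existence of a limit is preserved by translations that multiply the function by a sign. -/
theorem exists_tendsto_add {f : ℂ → ℂ} {s l : ℂ} (hf : ∀ z, f (z + l) = s * f z) {z : ℂ}
    (h : ∃ c, Tendsto f (𝓝[≠] z) (𝓝 c)) : ∃ c, Tendsto f (𝓝[≠] (z + l)) (𝓝 c) := by
  obtain ⟨c, hc⟩ := h
  have ht : Tendsto (fun w => w - l) (𝓝[≠] (z + l)) (𝓝[≠] z) := by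
    refine tendsto_nhdsWithin_iff.2 ⟨?_, ?_⟩
    · have : ContinuousAt (fun w => w - l) (z + l) := by fun_prop
      have := this.tendsto.mono_left (nhdsWithin_le_nhds (s := {z + l}ᶜ))
      simpa using this
    · filter_upwards [self_mem_nhdsWithin] with w hw
      exact fun h => hw (sub_eq_iff_eq_add.1 h)
  refine ⟨s * c, ((hc.comp ht).const_mul s).congr fun w => ?_⟩
  rw [Function.comp, ← hf, sub_add_cancel]

/-- An elliptic function with at most a double pole at the lattice points and no other poles is an
affine function of `ell τ`. -/
theorem exists_eq_gl_smul_proj {τ : ℂ} (hτ : 0 < τ.im) {H : ℂ → OnePoint ℂ}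
    (hH : ∀ z, HolSph H z) (hper : ∀ z, ∀ l ∈ lat τ, H (z + l) = H z)
    (hpole : ∀ z, H z = ∞ ↔ z ∈ lat τ) {e : ℕ} (he : sphOrder H 0 = e) (he2 : e ≤ 2) :
    ∃ B : GL (Fin 2) ℂ, ∀ z, H z = B • proj τ z := by
  have hθ := differentiable_theta hτ
  have hθc := hθ.continuous
  have hθhalf := theta_ne_zero hτ (half_notMem_lat hτ)
  have hH0 : H 0 = ∞ := (hpole 0).2 (zero_mem _)
  set u : ℂ → ℂ := fun w => coord ∞ (H w) with hu
  have hu0 : u 0 = 0 := by simp [hu, hH0, coord]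
  have hua : AnalyticAt ℂ u 0 := by
    have := (hH 0).analyticAt_coord
    rwa [hH0] at this
  have huo : analyticOrderAt u 0 = e := by
    rw [← he, sphOrder, hH0]
    simp [hu, coord]
  set v : ℂ → ℂ := fun w => coord ((0 : ℂ) : OnePoint ℂ) (H w) with hv
  have hvu : ∀ w, v w = (u w)⁻¹ := by
    intro w
    simp only [hv, hu]
    induction H w using OnePoint.rec <;> simp [coord]
  have hHv : ∀ w, w ∉ lat τ → H w = (v w : OnePoint ℂ) := by
    intro w hw
    obtain ⟨c, hc⟩ := OnePoint.ne_infty_iff_exists.1 (mt (hpole w).1 hw)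
    simp [hv, ← hc, coord]
  have hva : ∀ w, w ∉ lat τ → AnalyticAt ℂ v w := by
    intro w hw
    have := (hH w).analyticAt_coord
    rw [hHv w hw] at this
    exact this
  have hvm : ∀ w, MeromorphicAt v w := by
    intro w
    obtain ⟨x, y, hx, hy, -, hxy⟩ := hH w
    refine (hx.meromorphicAt.div hy.meromorphicAt).congr ?_
    filter_upwards [nhdsWithin_le_nhds hxy] with s hs
    simp only [hv, hs, coord_coe_pt, Pi.div_apply]
  obtain ⟨gu, hgu, hgu0, hugu⟩ := hua.analyticOrderAt_eq_natCast.1 huo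
  obtain ⟨g, hg, hg0, hellg⟩ := exists_inv_ell_eq hτ
  -- The constants remove the double pole at `0` and create a zero at `1 / 2`.
  set c : ℂ := (0 : ℂ) ^ (2 - e) * (gu 0)⁻¹ * g 0 with hc
  set d : ℂ := v (1 / 2) with hd
  set n : ℂ → ℂ := fun w => w ^ (2 - e) * (gu w)⁻¹ - c * (g w)⁻¹ with hn
  have hna : AnalyticAt ℂ n 0 :=
    ((analyticAt_id.fun_pow _).fun_mul (hgu.fun_inv hgu0)).fun_sub
      (analyticAt_const.fun_mul (hg.fun_inv hg0))
  have hn0 : n 0 = 0 := by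
    simp only [hn, hc]; field_simp; simp
  have hnv : ∀ᶠ w in 𝓝[≠] (0 : ℂ), v w - c * ell τ w = n w / w ^ 2 := by
    filter_upwards [nhdsWithin_le_nhds hugu, self_mem_nhdsWithin,
      nhdsWithin_le_nhds (hgu.continuousAt.eventually_ne hgu0),
      nhdsWithin_le_nhds (hg.continuousAt.eventually_ne hg0)] with w h1 h2 h3 h4
    have hw : w ≠ 0 := h2
    have : w ^ 2 = w ^ e * w ^ (2 - e) := by rw [← pow_add]; congr 1; omega
    rw [hvu, h1, ← inv_inv (ell τ w), hellg, sub_zero, smul_eq_mul]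
    simp only [hn]
    rw [this]
    have hA := pow_ne_zero e hw
    have hB := pow_ne_zero (2 - e) hw
    generalize w ^ e = A at *
    generalize w ^ (2 - e) = B at *
    field_simp
  set f : ℂ → ℂ := fun z => (v z - c * ell τ z - d) * (theta τ z / theta τ (z + 1 / 2)) with hf
  have hf1 : ∀ z, f (z + 1) = 1 * f z := by
    intro z
    simp only [hf, hv]
    rw [hper z 1 (one_mem_lat τ), ell_add_one, theta_add_one,
      show z + 1 + 1 / 2 = z + 1 / 2 + 1 by ring, theta_add_one, one_mul]
  have hfτ : ∀ z, f (z + τ) = -1 * f z := by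
    intro z
    have := ex_ne_zero (-z)
    simp only [hf, hv]
    rw [hper z τ (tau_mem_lat τ), ell_add_tau hτ, theta_add_half_add_tau hτ, theta_add_tau hτ,
      neg_mul, neg_div, mul_div_mul_left _ _ this]
    ring
  have hella : ∀ z, z ∉ lat τ → AnalyticAt ℂ (ell τ) z := by
    intro z hz
    refine AnalyticAt.div ?_ ?_ (pow_ne_zero 2 (theta_ne_zero hτ hz))
    · exact (show Differentiable ℂ fun z => theta τ (z + 1 / 2) ^ 2 by fun_prop).analyticAt z
    · exact (show Differentiable ℂ fun z => theta τ z ^ 2 by fun_prop).analyticAt z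
  have hka : ∀ z, z ∉ lat τ → AnalyticAt ℂ (fun z => v z - c * ell τ z - d) z := fun z hz =>
    ((hva z hz).fun_sub (analyticAt_const.fun_mul (hella z hz))).fun_sub analyticAt_const
  have hfa : ∀ z, z ∉ lat τ → z + 1 / 2 ∉ lat τ → AnalyticAt ℂ f z := by
    intro z hz hz'
    refine (hka z hz).fun_mul (AnalyticAt.fun_div (hθ.analyticAt z) ?_ (theta_ne_zero hτ hz'))
    exact (show Differentiable ℂ fun z => theta τ (z + 1 / 2) by fun_prop).analyticAt z
  have hlatp : ∀ l ∈ lat τ, ∀ z, (∃ a, Tendsto f (𝓝[≠] z) (𝓝 a)) ↔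
      ∃ a, Tendsto f (𝓝[≠] (z + l)) (𝓝 a) := by
    have hback : ∀ {s l : ℂ}, s * s = 1 → (∀ z, f (z + l) = s * f z) →
        ∀ z, (∃ a, Tendsto f (𝓝[≠] z) (𝓝 a)) ↔ ∃ a, Tendsto f (𝓝[≠] (z + l)) (𝓝 a) := by
      intro s l hs hfl z
      refine ⟨exists_tendsto_add hfl, fun h => ?_⟩
      have := exists_tendsto_add (l := -l) (s := s) (fun z => ?_) h
      · simpa using this
      · have := hfl (z + -l)
        rw [neg_add_cancel_right] at this
        rw [this, ← mul_assoc, hs, one_mul]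
    intro l hl z
    exact lat_induction (p := fun z => ∃ a, Tendsto f (𝓝[≠] z) (𝓝 a))
      (hback (by norm_num) hf1) (hback (by norm_num) hfτ) hl z
  have hlim : ∀ z, ∃ a, Tendsto f (𝓝[≠] z) (𝓝 a) := by
    have h0 : ∃ a, Tendsto f (𝓝[≠] 0) (𝓝 a) := by
      set q : ℂ → ℂ := fun w => dslope n 0 w * dslope (theta τ) 0 w / theta τ (w + 1 / 2) -
        d * theta τ w / theta τ (w + 1 / 2) with hq
      have hqc : ContinuousAt q 0 := by
        have c1 := (analyticAt_dslope hna).continuousAt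
        have c2 := (analyticAt_dslope (analyticAt_theta hτ 0)).continuousAt
        have c3 : ContinuousAt (fun w => theta τ (w + 1 / 2)) 0 :=
          (show Continuous fun w => theta τ (w + 1 / 2) by fun_prop).continuousAt
        have c4 : ContinuousAt (fun w => d * theta τ w) 0 :=
          (show Continuous fun w => d * theta τ w by fun_prop).continuousAt
        have hne : theta τ (0 + 1 / 2) ≠ 0 := by simpa using hθhalf
        exact ((c1.mul c2).div c3 hne).sub (c4.div c3 hne)
      refine ⟨q 0, (hqc.tendsto.mono_left nhdsWithin_le_nhds).congr' ?_⟩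
      filter_upwards [hnv, self_mem_nhdsWithin] with w h1 h2
      have hw : w ≠ 0 := h2
      have e1 := sub_smul_dslope n 0 w
      have e2 := sub_smul_dslope (theta τ) 0 w
      rw [sub_zero, smul_eq_mul, hn0, sub_zero] at e1
      rw [sub_zero, smul_eq_mul, theta_zero hτ, sub_zero] at e2
      simp only [hf, hq]
      rw [h1, ← e1]
      rw [← e2]
      field_simp
    have hhalf : ∃ a, Tendsto f (𝓝[≠] (1 / 2)) (𝓝 a) := by
      set k : ℂ → ℂ := fun z => v z - c * ell τ z - d with hk
      have hk0 : k (1 / 2) = 0 := by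
        have : ell τ (1 / 2) = 0 := by
          rw [ell, show (1 / 2 + 1 / 2 : ℂ) = 0 + 1 by norm_num, theta_add_one, theta_zero hτ]
          simp
        simp only [hk, this, hd]; ring
      have hka' := hka _ (half_notMem_lat hτ)
      obtain ⟨δ, hδ, hD⟩ := exists_hasDerivAt_theta_zero hτ
      set q : ℂ → ℂ := fun z => dslope k (1 / 2) z * theta τ z /
        dslope (theta τ) 0 (z - 1 / 2) with hq
      have hqc : ContinuousAt q (1 / 2) := by
        have c1 := (analyticAt_dslope hka').continuousAt
        have c2 := (analyticAt_dslope (analyticAt_theta hτ 0)).continuousAt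
        have c3 : ContinuousAt (fun z : ℂ => dslope (theta τ) 0 (z - 1 / 2)) (1 / 2) :=
          ContinuousAt.comp (g := dslope (theta τ) 0) (f := fun z : ℂ => z - 1 / 2)
            (by simpa using c2) (by fun_prop)
        refine (c1.mul hθ.continuous.continuousAt).div c3 ?_
        simpa [hD.deriv] using hδ
      refine ⟨q (1 / 2), (hqc.tendsto.mono_left nhdsWithin_le_nhds).congr' ?_⟩
      filter_upwards [self_mem_nhdsWithin] with z hz
      have hz' : z - 1 / 2 ≠ 0 := sub_ne_zero.2 hz
      have e1 := sub_smul_dslope k (1 / 2) z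
      have e2 := sub_smul_dslope (theta τ) 0 (z - 1 / 2)
      rw [smul_eq_mul, hk0, sub_zero] at e1
      rw [sub_zero, smul_eq_mul, theta_zero hτ, sub_zero] at e2
      have e3 : theta τ (z + 1 / 2) = theta τ (z - 1 / 2) := by
        rw [show z + 1 / 2 = z - 1 / 2 + 1 by ring, theta_add_one]
      change _ = k z * (theta τ z / theta τ (z + 1 / 2))
      rw [e3, ← e1, ← e2]
      simp only [hq]
      generalize dslope (theta τ) 0 (z - 1 / 2) = B
      generalize z - 1 / 2 = t at hz'
      rw [← mul_div_assoc, mul_assoc, mul_div_mul_left _ _ hz']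
    intro z
    by_cases hz : z ∈ lat τ
    · simpa using (hlatp z hz 0).1 h0
    by_cases hz' : z + 1 / 2 ∈ lat τ
    · have h1 := (hlatp _ (sub_mem hz' (one_mem_lat τ)) (1 / 2)).1 hhalf
      rwa [show 1 / 2 + (z + 1 / 2 - 1) = z by ring] at h1
    · exact ⟨f z, (hfa z hz hz').continuousAt.tendsto.mono_left nhdsWithin_le_nhds⟩
  have hfm : ∀ z, MeromorphicAt f z := by
    intro z
    have hθ1 : AnalyticAt ℂ (fun z => theta τ (z + 1 / 2)) z :=
      (show Differentiable ℂ fun z => theta τ (z + 1 / 2) by fun_prop).analyticAt z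
    have hθ0 := (hθ.analyticAt z).meromorphicAt
    have hem : MeromorphicAt (ell τ) z := (hθ1.fun_pow 2).meromorphicAt.div (hθ0.pow 2)
    exact (((hvm z).sub ((MeromorphicAt.const c z).mul hem)).sub (MeromorphicAt.const d z)).mul
      (hθ0.div hθ1.meromorphicAt)
  obtain ⟨K, hK⟩ := exists_const_of_meromorphic_of_periodic (τ := 2 * τ) (by simpa using hτ) hfm
    (fun z => by rw [hf1, one_mul])
    (fun z => by rw [two_mul, ← add_assoc, hfτ, hfτ]; ring)
    (fun z => (tendsto_nhds_iff_meromorphicOrderAt_nonneg (hfm z)).1 (hlim z))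
  have hK0 : K = 0 := by
    have h4 := quarter_notMem_lat hτ
    have h34 := three_quarter_notMem_lat hτ
    have e1 := hK _ (hfa _ h4 h34)
    have e2 := hK (1 / 4 + τ) (hfa _
      (fun h => h4 (by simpa using sub_mem h (tau_mem_lat τ)))
      (fun h => h34 (by
        have := sub_mem h (tau_mem_lat τ)
        convert! this using 1; ring)))
    rw [hfτ, e1] at e2
    linear_combination -e2 / 2
  have hvell : ∀ z, z ∉ lat τ → v z = c * ell τ z + d := by
    intro z hz
    by_cases hz' : z + 1 / 2 ∈ lat τ
    · have h1 : H z = H (1 / 2) := by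
        have := hper (1 / 2) (z + 1 / 2 - 1) (sub_mem hz' (one_mem_lat τ))
        rwa [show 1 / 2 + (z + 1 / 2 - 1) = z by ring] at this
      have h2 : ell τ z = 0 := by
        rw [ell, (theta_eq_zero_iff hτ).2 hz']; simp
      rw [h2, mul_zero, zero_add]
      simp only [hv, hd, h1]
    · have h1 := hK z (hfa z hz hz')
      rw [hK0] at h1
      have h2 := (mul_eq_zero.1 h1).resolve_right
        (div_ne_zero (theta_ne_zero hτ hz) (theta_ne_zero hτ hz'))
      linear_combination h2
  have hc0 : c ≠ 0 := by
    intro hc0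
    have hcst : ∀ᶠ w in 𝓝[≠] (0 : ℂ), u w = d⁻¹ := by
      have h1 : ∀ᶠ w in 𝓝[≠] (0 : ℂ), w ∉ lat τ :=
        (lat_two_mul_isolated hτ 0).mono fun w hw h => hw (two_mul_mem_lat h)
      filter_upwards [h1] with w hw
      rw [← inv_inv (u w), ← hvu, hvell w hw, hc0, zero_mul, zero_add]
    have hlim0 : d⁻¹ = 0 := by
      have h1 := hua.continuousAt.tendsto.mono_left (nhdsWithin_le_nhds (s := {(0 : ℂ)}ᶜ))
      rw [hu0] at h1
      exact tendsto_nhds_unique_of_eventuallyEq (tendsto_const_nhds) h1 (hcst.mono fun w h => h.symm)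
    have htop : analyticOrderAt u 0 = ⊤ := by
      rw [analyticOrderAt_eq_top]
      refine eventually_nhdsWithin_iff.1 hcst |>.mono fun w hw => ?_
      by_cases h : w = 0
      · rw [h, hu0]
      · rw [hw h, hlim0]
    rw [htop] at huo
    exact ENat.top_ne_natCast e huo
  refine ⟨Matrix.GeneralLinearGroup.mkOfDetNeZero !![c, d; 0, 1] (by simpa [Matrix.det_fin_two]),
    fun z => ?_⟩
  by_cases hz : z ∈ lat τ
  · rw [(hpole z).2 hz, (proj_eq_infty_iff hτ).2 hz, ← pt_zero_right 1,
      smul_pt _ (Or.inl one_ne_zero)]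
    simp [Matrix.GeneralLinearGroup.mkOfDetNeZero]
  · rw [hHv z hz, proj_of_notMem hτ hz, ← pt_one_right (ell τ z), smul_pt _ (Or.inr one_ne_zero),
      hvell z hz]
    simp [Matrix.GeneralLinearGroup.mkOfDetNeZero]


/-- Every flexible Lattès map is, up to a Möbius conjugation, the map induced on the sphere by
`z ↦ a z + b` with a positive integer `a` and `b ∈ {0, 1 / 2}`. -/
theorem IsFlexibleLattes.exists_normal_form {D : ℕ} (hD : 2 ≤ D) {f : RatSpace D}
    (hf : IsFlexibleLattes f) : ∃ (a : ℕ) (b τ : ℂ) (A : GL (Fin 2) ℂ), 2 ≤ a ∧ D = a * a ∧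
      (b = 0 ∨ b = 1 / 2) ∧ 0 < τ.im ∧
      ∀ z, f.toFun (A • proj τ z) = A • proj τ (a * z + b) := by
  classical
  obtain ⟨Λ, a₀, b₀, Θ, ha, hb, hhol, h1, h2, hsemi⟩ := hf
  have hncard : ∀ q, (Θ ⁻¹' {Θ q}).Finite ∧ (Θ ⁻¹' {Θ q}).ncard ≤ 2 := by
    intro q
    by_cases hq : 2 • q = 0
    · have := h1 q hq
      exact ⟨Set.finite_of_ncard_ne_zero (by omega), by omega⟩
    · have := h2 q hq
      exact ⟨Set.finite_of_ncard_ne_zero (by omega), by omega⟩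
  have hHol := holomorphicToSphere_iff.1 hhol
  obtain ⟨ω, τ, hτ, hω, k, hk⟩ := exists_adapted_basis Λ hb
  set h₀ : ℂ → OnePoint ℂ := fun z => Θ (Submodule.Quotient.mk (ω * z)) with hh₀
  have hmk : ∀ z w, (Submodule.Quotient.mk (ω * z) : ℂ ⧸ Λ.lattice) =
      Submodule.Quotient.mk (ω * w) ↔ z - w ∈ lat τ := by
    intro z w
    rw [Submodule.Quotient.eq, ← mul_sub, hω]
  obtain ⟨M, hM⟩ := exists_gl_smul_eq_infty (h₀ 0)
  set H : ℂ → OnePoint ℂ := fun z => M • h₀ z with hH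
  have hHs : ∀ z, HolSph H z := fun z =>
    HolSph.gl_smul (HolSph.comp_analytic (g := fun z => ω * z) (hHol (ω * z)) (by fun_prop)) M
  have hHeq : ∀ z w, H z = H w ↔ h₀ z = h₀ w := fun z w => (MulAction.injective M).eq_iff
  have hper : ∀ z, ∀ l ∈ lat τ, H (z + l) = H z := by
    intro z l hl
    rw [hHeq]
    exact congrArg Θ ((hmk _ _).2 (by simpa using hl))
  have hpole : ∀ z, H z = ∞ ↔ z ∈ lat τ := by
    intro z
    rw [← hM, show M • h₀ 0 = H 0 from rfl, hHeq]
    constructor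
    · intro h
      obtain ⟨x, hx⟩ := Set.ncard_eq_one.1 (h1 (Submodule.Quotient.mk (ω * 0)) (by simp))
      have m1 : (Submodule.Quotient.mk (ω * z) : ℂ ⧸ Λ.lattice) ∈ ({x} : Set _) := hx ▸ h
      have m2 : (Submodule.Quotient.mk (ω * 0) : ℂ ⧸ Λ.lattice) ∈ ({x} : Set _) := hx ▸ rfl
      have := (hmk z 0).1 (m1.trans m2.symm)
      simpa using this
    · intro h
      exact congrArg Θ ((hmk z 0).2 (by simpa using h))
  have hH0 : H 0 = ∞ := hM
  have hparam := (hHs 0).continuousAt.eventually (eventually_param_coord (H 0))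
  have htop : sphOrder H 0 ≠ ⊤ := by
    intro ht
    rw [sphOrder, analyticOrderAt_eq_top] at ht
    have h3 : ∀ᶠ w in 𝓝[≠] (0 : ℂ), 2 * w ∉ lat τ := lat_two_mul_isolated hτ 0
    obtain ⟨w, ⟨hw1, hw2⟩, hw3⟩ :=
      (((ht.and hparam).filter_mono nhdsWithin_le_nhds).and h3).exists
    refine hw3 (two_mul_mem_lat ((hpole w).1 ?_))
    rw [← hw2, sub_eq_zero.1 hw1, param_coord_self, hH0]
  obtain ⟨e, he⟩ := ENat.ne_top_iff_exists.1 htop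
  -- The fibres have at most two points, so the local degree is at most two.
  have he2 : e ≤ 2 := by
    by_contra! hlt
    obtain ⟨δ, hδ, hsep⟩ := exists_lat_separation hτ
    obtain ⟨z, hinj, hzW, hzu⟩ := exists_three_preimages
      (u := fun w => coord (H 0) (H w) - coord (H 0) (H 0))
      ((hHs 0).analyticAt_coord.fun_sub analyticAt_const) (e := e) hlt (by rw [he]; rfl)
      (W := Metric.ball 0 (δ / 2) ∩ {w | param (H 0) (coord (H 0) (H w)) = H w})
      (inter_mem (Metric.ball_mem_nhds 0 (by positivity)) hparam)
    have hHz : ∀ i, h₀ (z i) = h₀ (z 0) := by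
      intro i
      rw [← hHeq, ← (hzW i).2, ← (hzW 0).2, sub_left_inj.1 (hzu i)]
    set q : Fin 3 → ℂ ⧸ Λ.lattice := fun i => Submodule.Quotient.mk (ω * z i) with hq
    have hqinj : Function.Injective q := by
      intro i j hij
      have hm := (hmk _ _).1 hij
      refine hinj (sub_eq_zero.1 (hsep _ hm ?_))
      have b1 := mem_ball_zero_iff.1 (hzW i).1
      have b2 := mem_ball_zero_iff.1 (hzW j).1
      linarith [norm_sub_le (z i) (z j)]
    have hsub : Set.range q ⊆ Θ ⁻¹' {Θ (q 0)} := by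
      rintro _ ⟨i, rfl⟩
      exact hHz i
    have hcard : (Set.range q).ncard = 3 := by
      rw [← Nat.card_coe_set_eq, Nat.card_range_of_injective hqinj, Nat.card_fin]
    have := Set.ncard_le_ncard hsub (hncard (q 0)).1
    have := (hncard (q 0)).2
    omega
  obtain ⟨B, hB⟩ := exists_eq_gl_smul_proj hτ hHs hper hpole he.symm he2
  have hA : ∀ z, (M⁻¹ * B) • proj τ z = h₀ z := by
    intro z
    rw [mul_smul, ← hB, hH, inv_smul_smul]
  have haD : a₀.natAbs * a₀.natAbs = D := by
    have := Int.natAbs_mul_natAbs_eq (a := a₀) (b := a₀) (c := D) (by rw [← ha]; ring)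
    simpa using this
  have ha2 : 2 ≤ a₀.natAbs := by
    by_contra! hlt
    have : a₀.natAbs * a₀.natAbs ≤ 1 * 1 := Nat.mul_le_mul (by omega) (by omega)
    omega
  have hfun : ∀ z, f.toFun ((M⁻¹ * B) • proj τ z) =
      (M⁻¹ * B) • proj τ ((a₀ : ℂ) * z + k / 2) := by
    intro z
    rw [hA, hA, hh₀, hsemi]
    refine congrArg Θ ((Submodule.Quotient.eq _).2 ?_)
    convert! hk using 1
    ring
  have hb' : ∃ b : ℂ, (b = 0 ∨ b = 1 / 2) ∧ ∃ j : ℤ, (k : ℂ) / 2 = b + j := by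
    rcases Int.even_or_odd' k with ⟨j, rfl | rfl⟩
    · exact ⟨0, Or.inl rfl, j, by push_cast; ring⟩
    · exact ⟨1 / 2, Or.inr rfl, j, by push_cast; ring⟩
  obtain ⟨b, hbb, j, hj⟩ := hb'
  refine ⟨a₀.natAbs, b, τ, M⁻¹ * B, ha2, haD.symm, hbb, hτ, fun z => ?_⟩
  rw [hfun]
  congr 1
  rw [proj_eq_iff hτ, hj]
  rcases Int.natAbs_eq a₀ with e1 | e1
  · right
    have : (a₀ : ℂ) = (a₀.natAbs : ℂ) :=
      (congrArg (Int.cast (R := ℂ)) e1).trans (Int.cast_natCast _)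
    rw [this]
    convert! int_mem_lat τ j using 1
    ring
  · left
    have : (a₀ : ℂ) = -(a₀.natAbs : ℂ) :=
      (congrArg (Int.cast (R := ℂ)) e1).trans (by rw [Int.cast_neg, Int.cast_natCast])
    rw [this]
    rcases hbb with rfl | rfl
    · convert! int_mem_lat τ j using 1
      ring
    · convert! int_mem_lat τ (j + 1) using 1
      push_cast; ring


/-! ### Even functions as functions of the square -/

/-- An even function `R τ` of `v`, read as a function of `s = v ^ 2`. The branch of the square
root is irrelevant because of the evenness. -/
def descend (R : ℂ × ℂ → ℂ) (q : ℂ × ℂ) : ℂ := R (q.1, q.2 ^ (1 / 2 : ℂ))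

theorem cpow_half_sq (s : ℂ) : (s ^ (1 / 2 : ℂ)) ^ 2 = s := by
  simp

section Descend

variable {R : ℂ × ℂ → ℂ} (hR : ∀ τ v, R (τ, -v) = R (τ, v))
include hR

theorem descend_sq {τ v s : ℂ} (h : v ^ 2 = s) : descend R (τ, s) = R (τ, v) := by
  have h1 : (s ^ (1 / 2 : ℂ)) ^ 2 = v ^ 2 := by rw [cpow_half_sq, h]
  rcases sq_eq_sq_iff_eq_or_eq_neg.1 h1 with h2 | h2 <;> simp only [descend, h2, hR]

/-- Away from `s = 0` a branch of the square root may be used. -/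
theorem contDiffAt_descend_of_ne (n : ℕ) {τ v : ℂ} (hv : v ≠ 0) (h : ContDiffAt ℂ n R (τ, v)) :
    ContDiffAt ℂ n (descend R) (τ, v ^ 2) := by
  have e : descend R = fun q => R (q.1, v * (q.2 / v ^ 2) ^ (1 / 2 : ℂ)) := by
    funext q
    refine descend_sq hR (τ := q.1) ?_
    rw [mul_pow, cpow_half_sq]
    field_simp
  have h1 : (v ^ 2 / v ^ 2 : ℂ) = 1 := div_self (pow_ne_zero 2 hv)
  have hc : ContDiffAt ℂ n (fun z : ℂ => z ^ (1 / 2 : ℂ)) (v ^ 2 / v ^ 2) := by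
    rw [h1]
    have : AnalyticAt ℂ (fun z : ℂ => z ^ (1 / 2 : ℂ)) 1 :=
      analyticAt_id.cpow analyticAt_const (by simp)
    exact this.contDiffAt
  rw [e]
  have h2 : ContDiffAt ℂ n (fun q : ℂ × ℂ => (q.1, v * (q.2 / v ^ 2) ^ (1 / 2 : ℂ)))
      (τ, v ^ 2) := by
    refine contDiffAt_fst.prodMk (contDiffAt_const.mul ?_)
    exact ContDiffAt.comp (g := fun z : ℂ => z ^ (1 / 2 : ℂ)) (f := fun q : ℂ × ℂ => q.2 / v ^ 2)
      (τ, v ^ 2) hc (contDiffAt_snd.div_const _)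
  refine ContDiffAt.comp (g := R) (τ, v ^ 2) ?_ h2
  simpa [h1] using h

/-- At `s = 0` separate holomorphy is enough, by Osgood's lemma. -/
theorem contDiffAt_descend_zero (n : ℕ) {τ : ℂ} (h : ∀ᶠ q in 𝓝 (τ, (0 : ℂ)), ContDiffAt ℂ 1 R q) :
    ContDiffAt ℂ n (descend R) (τ, 0) := by
  have hb : ∀ᶠ q in 𝓝 (τ, (0 : ℂ)), ‖R q‖ < ‖R (τ, 0)‖ + 1 :=
    h.self_of_nhds.continuousAt.norm.eventually_lt continuousAt_const (lt_add_one _)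
  obtain ⟨ρ, hρ, hU⟩ := Metric.eventually_nhds_iff_ball.1 (h.and hb)
  set U : Set (ℂ × ℂ) := Metric.ball τ ρ ×ˢ Metric.ball 0 (ρ ^ 2) with hUdef
  have hUo : IsOpen U := Metric.isOpen_ball.prod Metric.isOpen_ball
  have hin : ∀ {t v : ℂ}, (t, v ^ 2) ∈ U → (t, v) ∈ Metric.ball (τ, (0 : ℂ)) ρ := by
    intro t v hq
    simp only [hUdef, Set.mem_prod, Metric.mem_ball, dist_zero_right, norm_pow] at hq
    rw [Metric.mem_ball, Prod.dist_eq, max_lt_iff]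
    exact ⟨hq.1, by simpa using lt_of_pow_lt_pow_left₀ 2 hρ.le hq.2⟩
  have hne : ∀ q ∈ U, q.2 ≠ 0 → DifferentiableAt ℂ (descend R) q := by
    intro q hq h0
    have h1 := cpow_half_sq q.2
    rw [← Prod.mk.eta (p := q), ← h1] at hq ⊢
    refine (contDiffAt_descend_of_ne hR 1 ?_ (hU _ (hin hq)).1).differentiableAt (by simp)
    intro h; rw [h] at h1; exact h0 (by simpa using h1.symm)
  have hcont : ∀ t ∈ Metric.ball τ ρ, ContinuousAt (fun s => descend R (t, s)) 0 := by
    intro t ht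
    have hR0 : ContinuousAt R (t, 0) := by
      refine (hU (t, 0) (hin ?_)).1.continuousAt
      simp only [hUdef, Set.mem_prod, ht, true_and]; simpa using pow_pos hρ 2
    have h2 : ContinuousAt (fun s : ℂ => (t, s ^ (1 / 2 : ℂ))) 0 := by
      refine continuousAt_const.prodMk ?_
      have : Tendsto (fun s : ℂ => ‖s‖ ^ (1 / 2 : ℝ)) (𝓝 0) (𝓝 0) := by
        have := (continuous_norm (E := ℂ)).continuousAt (x := 0) |>.rpow_const (p := (1 / 2 : ℝ))
          (Or.inr (by norm_num))
        simpa [ContinuousAt] using this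
      rw [ContinuousAt, Complex.zero_cpow (by norm_num)]
      refine squeeze_zero_norm (fun s => le_of_eq ?_) this
      have h3 := congrArg norm (cpow_half_sq s)
      rw [norm_pow] at h3
      rw [← h3, ← Real.sqrt_eq_rpow, Real.sqrt_sq (norm_nonneg _)]
    refine ContinuousAt.comp (g := R) (f := fun s : ℂ => (t, s ^ (1 / 2 : ℂ))) ?_ h2
    simpa using hR0
  have hS : SepHolOn (descend R) U := by
    refine ⟨hUo, fun p hp => ⟨‖R (τ, 0)‖ + 1, ?_⟩, fun p hp => ?_, fun p hp => ?_⟩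
    · filter_upwards [hUo.mem_nhds hp] with x hx
      refine (hU (x.1, x.2 ^ (1 / 2 : ℂ)) (hin ?_)).2.le
      rwa [cpow_half_sq]
    · have h1 : DifferentiableAt ℂ R (p.1, p.2 ^ (1 / 2 : ℂ)) := by
        refine (hU _ (hin ?_)).1.differentiableAt (by simp)
        rwa [cpow_half_sq]
      exact DifferentiableAt.comp (g := R) (f := fun x => (x, p.2 ^ (1 / 2 : ℂ))) p.1 h1
        (differentiableAt_id.prodMk (differentiableAt_const _))
    · have hoff : ∀ s ∈ Metric.ball (0 : ℂ) (ρ ^ 2), s ≠ 0 →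
          DifferentiableAt ℂ (fun y => descend R (p.1, y)) s := fun s hs h0 =>
        DifferentiableAt.comp (g := descend R) (f := fun y => (p.1, y)) s
          (hne (p.1, s) ⟨hp.1, hs⟩ h0) ((differentiableAt_const _).prodMk differentiableAt_id)
      by_cases h0 : p.2 = 0
      · rw [h0]
        refine (Complex.analyticAt_of_differentiable_on_punctured_nhds_of_continuousAt ?_
          (hcont p.1 hp.1)).differentiableAt
        filter_upwards [self_mem_nhdsWithin,
          mem_nhdsWithin_of_mem_nhds (Metric.ball_mem_nhds (0 : ℂ) (pow_pos hρ 2))] with s h1 h2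
        exact hoff s h2 h1
      · exact hoff p.2 hp.2 h0
  exact (hS.contDiffOn n).contDiffAt (hUo.mem_nhds ⟨by simpa using hρ, by simpa using pow_pos hρ 2⟩)

end Descend

/-! ### Implicit functions -/

/-- The solution `t = Ψ (τ, s, m)` of `X (τ, t) = e ^ m X (τ, s)` with `t = s` for `m = 0`. -/
theorem exists_implicit {X : ℂ × ℂ → ℂ} {τ s d : ℂ} (hX : ContDiffAt ℂ 2 X (τ, s))
    (hd : HasDerivAt (fun t => X (τ, t)) d s) (hd0 : d ≠ 0) :
    ∃ Ψ : ℂ × ℂ × ℂ → ℂ, ContDiffAt ℂ 2 Ψ (τ, s, 0) ∧ Ψ (τ, s, 0) = s ∧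
      (∀ᶠ x in 𝓝 (τ, s, (0 : ℂ)), X (x.1, Ψ x) = Complex.exp x.2.2 * X (x.1, x.2.1)) ∧
      (X (τ, s) ≠ 0 → fderiv ℂ Ψ (τ, s, 0) (0, 0, 1) ≠ 0) ∧
      ∀ᶠ v in 𝓝 ((τ, s, (0 : ℂ)), s), X (v.1.1, v.2) = Complex.exp v.1.2.2 * X (v.1.1, v.1.2.1) →
        Ψ v.1 = v.2 := by
  set f : (ℂ × ℂ × ℂ) × ℂ → ℂ := fun v =>
    X (v.1.1, v.2) - Complex.exp v.1.2.2 * X (v.1.1, v.1.2.1) with hf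
  have hf0 : f ((τ, s, 0), s) = 0 := by simp [hf]
  have hfc : ContDiffAt ℂ 2 f ((τ, s, 0), s) := by
    have h1 : ContDiffAt ℂ 2 (fun v : (ℂ × ℂ × ℂ) × ℂ => X (v.1.1, v.2)) ((τ, s, 0), s) :=
      ContDiffAt.comp (g := X) (f := fun v : (ℂ × ℂ × ℂ) × ℂ => (v.1.1, v.2)) _ hX (by fun_prop)
    have h2 : ContDiffAt ℂ 2 (fun v : (ℂ × ℂ × ℂ) × ℂ => X (v.1.1, v.1.2.1)) ((τ, s, 0), s) :=
      ContDiffAt.comp (g := X) (f := fun v : (ℂ × ℂ × ℂ) × ℂ => (v.1.1, v.1.2.1)) _ hX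
        (by fun_prop)
    exact h1.sub (ContDiffAt.mul (by fun_prop) h2)
  have hinv : (fderiv ℂ f ((τ, s, 0), s) ∘L .inr ℂ (ℂ × ℂ × ℂ) ℂ).IsInvertible := by
    have h1 : HasDerivAt (fun t => f ((τ, s, 0), t)) d s := by
      simpa [hf] using hd.sub_const (X (τ, s))
    have h2 : HasFDerivAt (fun t => f ((τ, s, 0), t))
        (fderiv ℂ f ((τ, s, 0), s) ∘L .inr ℂ (ℂ × ℂ × ℂ) ℂ) s :=
      HasFDerivAt.comp (g := f) (f := fun t : ℂ => ((τ, s, (0 : ℂ)), t)) s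
        (hfc.differentiableAt (by simp)).hasFDerivAt (hasFDerivAt_prodMk_right (τ, s, (0 : ℂ)) s)
    rw [h2.unique h1.hasFDerivAt]
    refine ⟨ContinuousLinearEquiv.unitsEquivAut ℂ (Units.mk0 d hd0), ?_⟩
    ext
    simp
  have hev : ∀ᶠ x in 𝓝 (τ, s, (0 : ℂ)), X (x.1, hfc.implicitFunction (by simp) hinv x) =
      Complex.exp x.2.2 * X (x.1, x.2.1) := by
    filter_upwards [hfc.eventually_apply_implicitFunction (by simp) hinv] with x hx
    rw [hf0] at hx
    exact sub_eq_zero.1 hx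
  have hc := hfc.contDiffAt_implicitFunction (by simp) hinv
  have hself : hfc.implicitFunction (by simp) hinv (τ, s, 0) = s :=
    hfc.implicitFunction_apply_self (by simp) hinv
  refine ⟨hfc.implicitFunction (by simp) hinv, hc, hself, hev, fun hX0 h => hX0 ?_, ?_⟩
  · set Ψ := hfc.implicitFunction (by simp) hinv
    have hl : HasDerivAt (fun m : ℂ => (τ, s, m)) ((0 : ℂ), (0 : ℂ), (1 : ℂ)) 0 :=
      (hasDerivAt_const _ τ).prodMk ((hasDerivAt_const _ s).prodMk (hasDerivAt_id 0))
    have h1 : HasDerivAt (fun m : ℂ => Ψ (τ, s, m)) 0 0 := by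
      have := HasFDerivAt.comp_hasDerivAt (l := Ψ) (f := fun m : ℂ => (τ, s, m)) 0
        (hc.differentiableAt (by simp)).hasFDerivAt hl
      rwa [h] at this
    have h2 : HasDerivAt (fun m : ℂ => X (τ, Ψ (τ, s, m))) (d * 0) 0 :=
      HasDerivAt.comp (h₂ := fun t => X (τ, t)) (h := fun m : ℂ => Ψ (τ, s, m)) 0
        (by rwa [hself]) h1
    have h3 : HasDerivAt (fun m : ℂ => Complex.exp m * X (τ, s)) (Complex.exp 0 * X (τ, s)) 0 :=
      (Complex.hasDerivAt_exp 0).mul_const _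
    have h4 : (fun m : ℂ => X (τ, Ψ (τ, s, m))) =ᶠ[𝓝 0] fun m => Complex.exp m * X (τ, s) :=
      (show Tendsto (fun m : ℂ => (τ, s, m)) (𝓝 0) (𝓝 (τ, s, 0)) from
        hl.continuousAt).eventually hev
    simpa using ((h3.congr_of_eventuallyEq h4).unique h2)
  · filter_upwards [hfc.eventually_apply_eq_iff_implicitFunction (by simp) hinv] with v hv h
    rw [hf0] at hv
    exact hv.1 (sub_eq_zero.2 h)

/-- The Taylor expansion at `m = 0` of a family of maps `s ↦ Ψ (τ, s, m)` that is the identity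
for `m = 0`. -/
theorem exists_norm_sub_le_of_contDiffAt {Ψ : ℂ × ℂ × ℂ → ℂ} {τ : ℂ}
    (hΨ : ContDiffAt ℂ 2 Ψ (τ, 0, 0))
    (h0 : ∀ᶠ x in 𝓝 (τ, (0 : ℂ), (0 : ℂ)), Ψ (x.1, x.2.1, 0) = x.2.1) :
    ∃ C : ℝ, 0 ≤ C ∧ ∀ᶠ x in 𝓝 (τ, (0 : ℂ), (0 : ℂ)),
      ‖Ψ x - x.2.1 - fderiv ℂ Ψ (x.1, 0, 0) (0, 0, 1) * x.2.2‖ ≤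
        C * (‖x.2.2‖ * (‖x.2.1‖ + ‖x.2.2‖)) := by
  have h1 : ContDiffAt ℂ 1 (fderiv ℂ Ψ) (τ, 0, 0) := hΨ.fderiv_right (by norm_num)
  obtain ⟨K, t, ht, hK⟩ := h1.exists_lipschitzOnWith
  have hd : ∀ᶠ x in 𝓝 (τ, (0 : ℂ), (0 : ℂ)), DifferentiableAt ℂ Ψ x := by
    filter_upwards [hΨ.eventually (by simp)] with x hx using hx.differentiableAt (by simp)
  obtain ⟨r, hr, hb⟩ := Metric.eventually_nhds_iff_ball.1 ((hd.and h0).and ht)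
  refine ⟨K, K.2, ?_⟩
  filter_upwards [Metric.ball_mem_nhds _ hr] with x hx
  have hx' : dist x.1 τ < r ∧ ‖x.2.1‖ < r ∧ ‖x.2.2‖ < r := by
    simpa [Prod.dist_eq] using hx
  have hin : ∀ y ∈ Metric.closedBall (0 : ℂ) ‖x.2.2‖,
      (x.1, x.2.1, y) ∈ Metric.ball (τ, (0 : ℂ), (0 : ℂ)) r := by
    intro y hy
    have : ‖y‖ < r := lt_of_le_of_lt (by simpa using hy) hx'.2.2
    simp [Prod.dist_eq, hx'.1, hx'.2.1, this]
  have h00 : (x.1, (0 : ℂ), (0 : ℂ)) ∈ Metric.ball (τ, (0 : ℂ), (0 : ℂ)) r := by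
    simp [Prod.dist_eq, hx'.1]
  set κ := fderiv ℂ Ψ (x.1, 0, 0) (0, 0, 1)
  have hder : ∀ y ∈ Metric.closedBall (0 : ℂ) ‖x.2.2‖,
      HasDerivWithinAt (fun y => Ψ (x.1, x.2.1, y) - κ * y)
        (fderiv ℂ Ψ (x.1, x.2.1, y) (0, 0, 1) - κ) (Metric.closedBall (0 : ℂ) ‖x.2.2‖) y := by
    intro y hy
    have h2 : HasDerivAt (fun y => Ψ (x.1, x.2.1, y)) (fderiv ℂ Ψ (x.1, x.2.1, y) (0, 0, 1)) y :=
      HasFDerivAt.comp_hasDerivAt (l := Ψ) (f := fun y : ℂ => (x.1, x.2.1, y)) y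
        (hb _ (hin y hy)).1.1.hasFDerivAt
        ((hasDerivAt_const y x.1).prodMk ((hasDerivAt_const y x.2.1).prodMk (hasDerivAt_id y)))
    have h3 := (hasDerivAt_id y).const_mul κ
    simp only [id, mul_one] at h3
    exact (h2.fun_sub h3).hasDerivWithinAt
  have hbd : ∀ y ∈ Metric.closedBall (0 : ℂ) ‖x.2.2‖,
      ‖fderiv ℂ Ψ (x.1, x.2.1, y) (0, 0, 1) - κ‖ ≤ K * (‖x.2.1‖ + ‖x.2.2‖) := by
    intro y hy
    have h2 := hK.dist_le_mul _ (hb _ (hin y hy)).2 _ (hb _ h00).2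
    rw [dist_eq_norm] at h2
    have h3 := (fderiv ℂ Ψ (x.1, x.2.1, y) - fderiv ℂ Ψ (x.1, 0, 0)).le_opNorm
      ((0 : ℂ), (0 : ℂ), (1 : ℂ))
    have h4 : ‖((0 : ℂ), (0 : ℂ), (1 : ℂ))‖ = 1 := by simp [Prod.norm_def]
    rw [h4, mul_one] at h3
    refine h3.trans (h2.trans ?_)
    gcongr
    have : ‖y‖ ≤ ‖x.2.2‖ := by simpa using hy
    simp only [Prod.dist_eq, dist_self, dist_zero_right]
    refine max_le (by positivity) (max_le (by linarith [norm_nonneg x.2.2]) ?_)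
    linarith [norm_nonneg x.2.1]
  have hmv := (convex_closedBall (0 : ℂ) ‖x.2.2‖).norm_image_sub_le_of_norm_hasDerivWithin_le
    hder hbd (x := 0) (y := x.2.2) (by simp) (by simp)
  have hs : Ψ (x.1, x.2.1, 0) = x.2.1 := (hb x hx).1.2
  simp only [hs, mul_zero, sub_zero, Prod.mk.eta] at hmv
  calc _ = ‖Ψ x - κ * x.2.2 - x.2.1‖ := by congr 1; ring
    _ ≤ _ := hmv
    _ = _ := by ring


/-! ### The coordinate `s = v ^ 2` at the half-periods -/

/-- Multiplication of `ell` by `exp m` at `z` corresponds to multiplication by `exp (-m)` at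
`z + 1 / 2`. -/
theorem expGL_smul_proj {τ : ℂ} (hτ : 0 < τ.im) {z z' m : ℂ} (hz : z ∉ lat τ) (hz' : z' ∉ lat τ)
    (h : ell τ z' = Complex.exp m * ell τ z) :
    expGL m • proj τ z = proj τ z' ∧ expGL (-m) • proj τ (z + 1 / 2) = proj τ (z' + 1 / 2) := by
  have h1 : theta τ z ^ 2 ≠ 0 := pow_ne_zero 2 (theta_ne_zero hτ hz)
  have h2 : theta τ z' ^ 2 ≠ 0 := pow_ne_zero 2 (theta_ne_zero hτ hz')
  refine ⟨by rw [proj_of_notMem hτ hz, proj_of_notMem hτ hz', expGL_smul_coe, h], ?_⟩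
  rw [proj_add_half, proj_add_half, expGL_smul_pt _ (Or.inl h1),
    pt_eq_pt_iff (Or.inl (mul_ne_zero (Complex.exp_ne_zero _) h1)) (Or.inl h2), Complex.exp_neg]
  have h3 := Complex.exp_ne_zero m
  rw [ell, ell, div_eq_iff h2] at h
  have h4 := theta_ne_zero hτ hz
  rw [h]
  generalize theta τ z = x, theta τ z' = y, theta τ (z + 1 / 2) = w at *
  field_simp

/-- A half-period of `ℤ + ℤ τ` that depends holomorphically on `τ`. -/
structure IsHalfPeriod (ω : ℂ → ℂ) : Prop where
  contDiff : ContDiff ℂ 2 ω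
  two_mul_mem : ∀ τ, 2 * ω τ ∈ lat τ
  notMem : ∀ τ : ℂ, 0 < τ.im → ω τ ∉ lat τ

namespace IsHalfPeriod

variable {ω : ℂ → ℂ} (hω : IsHalfPeriod ω) {τ : ℂ} (hτ : 0 < τ.im)
include hω

theorem sub_mem_iff (τ v : ℂ) : ω τ - v ∈ lat τ ↔ ω τ + v ∈ lat τ := by
  have h := hω.two_mul_mem τ
  constructor <;> intro h'
  · have := sub_mem h h'; ring_nf at this ⊢; exact this
  · have := sub_mem h h'; ring_nf at this ⊢; exact this

include hτ

theorem ell_add_neg (v : ℂ) : ell τ (ω τ + -v) = ell τ (ω τ + v) := by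
  rw [← sub_eq_add_neg]
  by_cases h : ω τ + v ∈ lat τ
  · rw [ell, ell, (theta_eq_zero_iff hτ).2 h, (theta_eq_zero_iff hτ).2 ((hω.sub_mem_iff τ v).2 h)]
    simp
  · refine (ell_eq_iff hτ (fun h' => h ((hω.sub_mem_iff τ v).1 h')) h).2 (Or.inl ?_)
    have := hω.two_mul_mem τ
    ring_nf at this ⊢
    exact this

theorem add_notMem {v : ℂ} (hv : v = 0 ∨ 2 * v ∉ lat τ) : ω τ + v ∉ lat τ := by
  rcases hv with rfl | hv
  · simpa using hω.notMem τ hτ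
  · intro h
    apply hv
    have := sub_mem (add_mem h h) (hω.two_mul_mem τ)
    ring_nf at this ⊢
    exact this

/-- The points `ω τ + v` stay outside the lattice when `v ^ 2` and `τ` vary a little. -/
theorem eventually_add_notMem {v : ℂ} (hv : v = 0 ∨ 2 * v ∉ lat τ) :
    ∀ᶠ q in 𝓝 (τ, v ^ 2), 0 < q.1.im ∧ ∀ u, u ^ 2 = q.2 → ω q.1 + u ∉ lat q.1 := by
  set R : ℂ × ℂ → ℂ := fun q => theta q.1 (ω q.1 + q.2) * theta q.1 (ω q.1 + -q.2) with hRdef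
  have hR : ∀ τ v, R (τ, -v) = R (τ, v) := fun τ v => by simp only [hRdef, neg_neg]; ring
  have hRc : ∀ q : ℂ × ℂ, 0 < q.1.im → ContDiffAt ℂ 1 R q := by
    intro q hq
    have h1 : ContDiffAt ℂ 1 (fun q : ℂ × ℂ => ω q.1) q :=
      (hω.contDiff.of_le (by norm_num)).contDiffAt.comp q contDiffAt_fst
    exact (contDiffAt_theta_comp 1 contDiffAt_fst (h1.add contDiffAt_snd) hq).mul
      (contDiffAt_theta_comp 1 contDiffAt_fst (h1.add contDiffAt_snd.neg) hq)
  have hX : ContinuousAt (descend R) (τ, v ^ 2) := by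
    by_cases h0 : v = 0
    · subst h0
      simpa using (contDiffAt_descend_zero hR 1
        ((isOpen_im_pos.eventually_mem (x := (τ, (0 : ℂ))) hτ).mono hRc)).continuousAt
    · exact (contDiffAt_descend_of_ne hR 1 h0 (hRc _ hτ)).continuousAt
  have hv' := hω.add_notMem hτ hv
  have h0 : descend R (τ, v ^ 2) ≠ 0 := by
    rw [descend_sq hR rfl]
    refine mul_ne_zero (theta_ne_zero hτ hv') (theta_ne_zero hτ fun h => hv' ?_)
    rw [← sub_eq_add_neg] at h
    exact (hω.sub_mem_iff τ v).1 h
  filter_upwards [hX.eventually_ne h0, isOpen_im_pos.eventually_mem (x := (τ, v ^ 2)) hτ]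
    with q hq hq' 
  refine ⟨hq', fun u hu h => hq ?_⟩
  rw [← Prod.mk.eta (p := q), descend_sq hR hu]
  simp only [hRdef, (theta_eq_zero_iff hq').2 h, zero_mul]

omit hω in
theorem contDiffAt_ell_add (hω : ContDiff ℂ 2 ω) {v : ℂ} (hv : ω τ + v ∉ lat τ) :
    ContDiffAt ℂ 2 (fun q : ℂ × ℂ => ell q.1 (ω q.1 + q.2)) (τ, v) := by
  have h1 : ContDiffAt ℂ 2 (fun q : ℂ × ℂ => ω q.1 + q.2) (τ, v) :=
    (hω.contDiffAt.comp (τ, v) contDiffAt_fst).add contDiffAt_snd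
  exact ((contDiffAt_theta_comp 2 contDiffAt_fst (h1.add contDiffAt_const) hτ).pow 2).div
    ((contDiffAt_theta_comp 2 contDiffAt_fst h1 hτ).pow 2) (pow_ne_zero 2 (theta_ne_zero hτ hv))

/-- `ell` has nonvanishing derivative with respect to the square of the distance to a
half-period. -/
theorem deriv_ne_zero {v : ℂ} (hv : v = 0 ∨ 2 * v ∉ lat τ) {f : ℂ → ℂ}
    (hf : DifferentiableAt ℂ f (v ^ 2)) (h : ∀ u, f (u ^ 2) = ell τ (ω τ + u)) :
    deriv f (v ^ 2) ≠ 0 := by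
  rcases hv with rfl | hv
  · intro hd
    have h2ω := hω.two_mul_mem τ
    obtain ⟨d, hd0, hθ⟩ := exists_hasDerivAt_theta_zero hτ
    obtain ⟨k, hk, hk0, hkθ⟩ := theta_add_lat hτ h2ω
    have hfd : HasDerivAt f 0 0 := by
      have := hf.hasDerivAt
      rw [hd] at this
      simpa using this
    set c := -ex (ω τ) * theta τ (1 / 2) ^ 2 / theta τ (ω τ) ^ 2 with hc
    have hω0 := hω.notMem τ hτ
    have hc0 : c ≠ 0 := by
      refine div_ne_zero (mul_ne_zero (neg_ne_zero.2 (ex_ne_zero _))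
        (pow_ne_zero 2 (theta_ne_zero hτ (half_notMem_lat hτ))))
        (pow_ne_zero 2 (theta_ne_zero hτ hω0))
    have hcont : Continuous (theta τ) := (differentiable_theta hτ).continuous
    -- The difference quotients of `f` at `0` along squares, computed from the key identity
    have h1 : Tendsto (fun u => (f (u ^ 2) - f 0) / u ^ 2) (𝓝[≠] 0)
        (𝓝 (c / theta τ (ω τ) ^ 2 * (k 0 * d * d))) := by
      have hsl : Tendsto (fun u => theta τ u / u) (𝓝[≠] 0) (𝓝 d) := by
        have := hθ.tendsto_slope_zero
        refine this.congr fun u => ?_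
        simp [theta_zero hτ, div_eq_inv_mul]
      have ht : Tendsto (fun u => c / theta τ (ω τ + u) ^ 2) (𝓝[≠] 0)
          (𝓝 (c / theta τ (ω τ) ^ 2)) := by
        have : ContinuousAt (fun u => c / theta τ (ω τ + u) ^ 2) 0 :=
          continuousAt_const.div (by fun_prop) (by simpa using theta_ne_zero hτ hω0)
        have := this.tendsto.mono_left (nhdsWithin_le_nhds (s := {0}ᶜ))
        simpa using this
      have hk' : Tendsto k (𝓝[≠] 0) (𝓝 (k 0)) :=
        hk.continuous.continuousAt.tendsto.mono_left nhdsWithin_le_nhds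
      refine (ht.mul ((hk'.mul hsl).mul hsl)).congr' ?_
      have hev : ∀ᶠ u in 𝓝[≠] (0 : ℂ), ω τ + u ∉ lat τ := by
        have h3 : ContinuousAt (fun u => theta τ (ω τ + u)) 0 := by fun_prop
        have h4 := h3.eventually_ne (by simpa using theta_ne_zero hτ hω0)
        exact (h4.filter_mono nhdsWithin_le_nhds).mono fun u hu h => hu
          ((theta_eq_zero_iff hτ).2 h)
      filter_upwards [hev, self_mem_nhdsWithin] with u hu hu0
      have hu0' : u ≠ 0 := hu0
      have e1 := h 0
      rw [add_zero, zero_pow two_ne_zero] at e1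
      rw [h, e1, ell_sub_ell hτ hu hω0, show ω τ + u + ω τ = u + 2 * ω τ by ring, hkθ,
        add_sub_cancel_left, hc]
      have := theta_ne_zero hτ hω0
      have := theta_ne_zero hτ hu
      field_simp
    have h2 : Tendsto (fun u => (f (u ^ 2) - f 0) / u ^ 2) (𝓝[≠] 0) (𝓝 0) := by
      have hs : Tendsto (fun u : ℂ => u ^ 2) (𝓝[≠] 0) (𝓝[≠] 0) := by
        refine tendsto_nhdsWithin_iff.2 ⟨?_, ?_⟩
        · have : ContinuousAt (fun u : ℂ => u ^ 2) 0 := by fun_prop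
          have := this.tendsto.mono_left (nhdsWithin_le_nhds (s := {0}ᶜ))
          simpa using this
        · filter_upwards [self_mem_nhdsWithin] with u hu
          exact pow_ne_zero 2 hu
      have := hfd.tendsto_slope_zero.comp hs
      refine this.congr fun u => ?_
      simp [div_eq_inv_mul]
    have h3 := tendsto_nhds_unique h2 h1
    have hω1 := theta_ne_zero hτ hω0
    have := hk0 0
    simp [hc0, hω1, hd0, this] at h3
  · intro hd
    have h2 : 2 * (ω τ + v) ∉ lat τ := fun h' => hv (by
      have := sub_mem h' (hω.two_mul_mem τ)
      ring_nf at this ⊢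
      exact this)
    obtain ⟨d, hd0, hD⟩ := exists_hasDerivAt_ell hτ h2
    have h3 : HasDerivAt (fun u => ell τ (ω τ + u)) d v := hD.comp_const_add (ω τ) v
    have h4 : HasDerivAt (fun u : ℂ => f (u ^ 2)) (0 * (2 * v)) v := by
      have h5 := hf.hasDerivAt
      rw [hd] at h5
      have := HasDerivAt.comp (h₂ := f) (h := fun u : ℂ => u ^ 2) v h5 (hasDerivAt_pow 2 v)
      simpa only [Nat.cast_ofNat, Nat.add_one_sub_one, pow_one] using! this
    rw [funext h] at h4
    exact hd0 (by simpa using h3.unique h4)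

/-- The multiplication by `exp m` on the sphere, lifted near a half-period to the
coordinate `s = v ^ 2`. -/
theorem exists_germ {v : ℂ} (hv : v = 0 ∨ 2 * v ∉ lat τ) :
    ∃ Ψ : ℂ × ℂ × ℂ → ℂ, ContDiffAt ℂ 2 Ψ (τ, v ^ 2, 0) ∧
      (∀ᶠ x in 𝓝 (τ, v ^ 2, (0 : ℂ)), Ψ (x.1, x.2.1, 0) = x.2.1) ∧
      (∀ᶠ x in 𝓝 (τ, v ^ 2, (0 : ℂ)), ∀ u u', u ^ 2 = x.2.1 → u' ^ 2 = Ψ x →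
        expGL x.2.2 • proj x.1 (ω x.1 + u) = proj x.1 (ω x.1 + u') ∧
        expGL (-x.2.2) • proj x.1 (ω x.1 + u + 1 / 2) = proj x.1 (ω x.1 + u' + 1 / 2)) ∧
      (ell τ (ω τ + v) ≠ 0 → fderiv ℂ Ψ (τ, v ^ 2, 0) (0, 0, 1) ≠ 0) ∧
      ((∀ τ, 0 < τ.im → ell τ (ω τ) = 0) → ∀ᶠ x in 𝓝 (τ, v ^ 2, (0 : ℂ)), x.2.1 = 0 → Ψ x = 0) := by
  set R : ℂ × ℂ → ℂ := fun q => if 0 < q.1.im then ell q.1 (ω q.1 + q.2) else 0 with hRdef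
  have hR : ∀ τ v, R (τ, -v) = R (τ, v) := by
    intro τ v
    simp only [hRdef]
    split_ifs with h
    · exact hω.ell_add_neg h v
    · rfl
  have hRc : ∀ q : ℂ × ℂ, 0 < q.1.im → ω q.1 + q.2 ∉ lat q.1 → ContDiffAt ℂ 2 R q := by
    intro q hq h
    refine (contDiffAt_ell_add hq hω.contDiff h).congr_of_eventuallyEq ?_
    filter_upwards [isOpen_im_pos.eventually_mem (x := q) hq] with q hq'
    exact if_pos hq'
  set X := descend R with hXdef
  have hX : ∀ {t s u : ℂ}, 0 < t.im → u ^ 2 = s → X (t, s) = ell t (ω t + u) := by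
    intro t s u ht hu
    rw [hXdef, descend_sq hR hu]
    exact if_pos ht
  have hXc : ContDiffAt ℂ 2 X (τ, v ^ 2) := by
    by_cases h0 : v = 0
    · subst h0
      have := hω.eventually_add_notMem hτ hv
      rw [zero_pow two_ne_zero]
      refine contDiffAt_descend_zero hR 2 ?_
      have hc : Tendsto (fun q : ℂ × ℂ => (q.1, q.2 ^ 2)) (𝓝 (τ, 0)) (𝓝 (τ, 0 ^ 2)) := by
        have : Continuous fun q : ℂ × ℂ => (q.1, q.2 ^ 2) := by fun_prop
        exact this.tendsto (τ, 0)
      filter_upwards [hc.eventually this] with q hq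
      exact (hRc q hq.1 (hq.2 q.2 rfl)).of_le (by norm_num)
    · exact contDiffAt_descend_of_ne hR 2 h0 (hRc _ hτ (hω.add_notMem hτ hv))
  have hXd : DifferentiableAt ℂ (fun t => X (τ, t)) (v ^ 2) :=
    DifferentiableAt.comp (g := X) (f := fun t : ℂ => (τ, t)) (v ^ 2)
      (hXc.differentiableAt (by simp))
      ((differentiableAt_const _).prodMk differentiableAt_id)
  obtain ⟨Ψ, hΨ, hΨ0, hΨ1, hΨ2, hΨ3⟩ := exists_implicit hXc hXd.hasDerivAt
    (hω.deriv_ne_zero hτ hv hXd fun u => hX hτ rfl)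
  have hnm := hω.eventually_add_notMem hτ hv
  have t1 : Tendsto (fun x : ℂ × ℂ × ℂ => (x.1, x.2.1)) (𝓝 (τ, v ^ 2, (0 : ℂ))) (𝓝 (τ, v ^ 2)) :=
    (continuous_fst.prodMk continuous_snd.fst).tendsto _
  have t2 : Tendsto (fun x : ℂ × ℂ × ℂ => (x.1, Ψ x)) (𝓝 (τ, v ^ 2, (0 : ℂ)))
      (𝓝 (τ, v ^ 2)) := by
    have := (continuousAt_fst (p := (τ, v ^ 2, (0 : ℂ)))).prodMk hΨ.continuousAt
    rw [ContinuousAt, hΨ0] at this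
    exact this
  refine ⟨Ψ, hΨ, ?_, ?_, fun h => hΨ2 ?_, fun h => ?_⟩
  · have t3 : Tendsto (fun x : ℂ × ℂ × ℂ => ((x.1, x.2.1, (0 : ℂ)), x.2.1)) (𝓝 (τ, v ^ 2, 0))
        (𝓝 ((τ, v ^ 2, 0), v ^ 2)) := by
      have : Continuous fun x : ℂ × ℂ × ℂ => ((x.1, x.2.1, (0 : ℂ)), x.2.1) := by fun_prop
      exact this.tendsto (τ, v ^ 2, 0)
    filter_upwards [t3.eventually hΨ3] with x hx
    exact hx (by simp)
  · filter_upwards [t1.eventually hnm, t2.eventually hnm, hΨ1] with x h1 h2 h3 u u' hu hu'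
    have h4 := expGL_smul_proj h1.1 (m := x.2.2) (h1.2 u hu) (h2.2 u' hu')
      (by rw [← hX h1.1 hu, ← hX h1.1 hu', h3])
    exact h4
  · rwa [hX hτ rfl]
  · have t3 : ∀ᶠ x in 𝓝 (τ, v ^ 2, (0 : ℂ)), v = 0 →
        X (x.1, 0) = Complex.exp x.2.2 * X (x.1, x.2.1) → Ψ x = 0 := by
      by_cases h0 : v = 0
      · subst h0
        have t4 : Tendsto (fun x : ℂ × ℂ × ℂ => (x, (0 : ℂ))) (𝓝 (τ, 0 ^ 2, 0))
            (𝓝 ((τ, 0 ^ 2, 0), 0 ^ 2)) := by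
          have : Continuous fun x : ℂ × ℂ × ℂ => (x, (0 : ℂ)) := by fun_prop
          have := this.tendsto (τ, (0 : ℂ) ^ 2, 0)
          simpa only [zero_pow two_ne_zero] using this
        filter_upwards [t4.eventually hΨ3] with x hx _ using hx
      · exact Eventually.of_forall fun x h => absurd h h0
    by_cases h0 : v = 0
    · filter_upwards [t3, t1.eventually hnm] with x hx h1 hs
      refine hx h0 ?_
      rw [hs, hX h1.1 (zero_pow two_ne_zero), add_zero, h _ h1.1, mul_zero]
    · have h1 : ContinuousAt (fun x : ℂ × ℂ × ℂ => x.2.1) (τ, v ^ 2, 0) := by fun_prop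
      filter_upwards [h1.eventually_ne (y := 0) (pow_ne_zero 2 h0)] with x hx hs
      exact absurd hs hx

end IsHalfPeriod

theorem isHalfPeriod_half : IsHalfPeriod fun _ => 1 / 2 :=
  ⟨contDiff_const, fun τ => ⟨1, 0, by norm_num⟩, fun _ h => half_notMem_lat h⟩

theorem half_mul_notMem_lat {τ : ℂ} (hτ : 0 < τ.im) {p q : ℤ} (h : Odd p ∨ Odd q) :
    ((p : ℂ) + q * τ) / 2 ∉ lat τ := by
  intro h'
  have e : ((p / 2 : ℝ) : ℂ) + ((q / 2 : ℝ) : ℂ) * τ = ((p : ℂ) + q * τ) / 2 := by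
    push_cast; ring
  rw [← e, real_mem_lat_iff hτ] at h'
  obtain ⟨⟨k, hk⟩, l, hl⟩ := h'
  have hk' : p = 2 * k := by
    have : (p : ℝ) = 2 * k := by linarith
    exact_mod_cast this
  have hl' : q = 2 * l := by
    have : (q : ℝ) = 2 * l := by linarith
    exact_mod_cast this
  rcases h with ⟨i, hi⟩ | ⟨i, hi⟩ <;> omega

theorem isHalfPeriod_tau : IsHalfPeriod fun τ => τ / 2 := by
  refine ⟨contDiff_id.div_const 2, fun τ => ⟨0, 1, by push_cast; ring⟩, fun τ h => ?_⟩
  have := half_mul_notMem_lat h (p := 0) (q := 1) (Or.inr (by decide))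
  simpa using this

/-- `Ψ` computes, in the coordinate `s = v ^ 2`, the multiplication by `exp m` on the sphere near
all half-periods `(p + q τ) / 2` with `q` of the given parity, at the point `x = (τ, s, m)`; near
the half-periods with `p` odd, the sign of `m` is reversed. The square roots `u` and `u'` may be
chosen arbitrarily. -/
def Lifts (q : ℤ) (Ψ : ℂ × ℂ × ℂ → ℂ) (x : ℂ × ℂ × ℂ) : Prop :=
  ∀ p q' : ℤ, Even (q' - q) → ∀ u u', u ^ 2 = x.2.1 → u' ^ 2 = Ψ x →
    expGL ((-1) ^ p * x.2.2) • proj x.1 ((p + q' * x.1) / 2 + u) =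
      proj x.1 ((p + q' * x.1) / 2 + u')

theorem proj_half_add {τ : ℂ} (hτ : 0 < τ.im) {p q p' q' : ℤ} (hp : Even (p - p'))
    (hq : Even (q - q')) (u : ℂ) :
    proj τ ((p + q * τ) / 2 + u) = proj τ ((p' + q' * τ) / 2 + u) := by
  obtain ⟨k, hk⟩ := hp
  obtain ⟨l, hl⟩ := hq
  have hk' : (p : ℂ) = p' + 2 * k := by
    have : p = p' + 2 * k := by omega
    exact_mod_cast this
  have hl' : (q : ℂ) = q' + 2 * l := by
    have : q = q' + 2 * l := by omega
    exact_mod_cast this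
  exact proj_congr hτ ⟨k, l, by rw [hk', hl']; ring⟩

theorem eventually_im_pos {τ : ℂ} (hτ : 0 < τ.im) (s m : ℂ) :
    ∀ᶠ x : ℂ × ℂ × ℂ in 𝓝 (τ, s, m), 0 < x.1.im :=
  (Complex.continuous_im.comp continuous_fst).continuousAt.eventually_const_lt hτ

theorem exists_lifts_of_odd {τ v : ℂ} (hτ : 0 < τ.im) (hv : v = 0 ∨ 2 * v ∉ lat τ) :
    ∃ Ψ : ℂ × ℂ × ℂ → ℂ, ContDiffAt ℂ 2 Ψ (τ, v ^ 2, 0) ∧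
      (∀ᶠ x in 𝓝 (τ, v ^ 2, (0 : ℂ)), Ψ (x.1, x.2.1, 0) = x.2.1) ∧
      (∀ᶠ x in 𝓝 (τ, v ^ 2, (0 : ℂ)), ∀ q, Odd q → Lifts q Ψ x) ∧
      (v = 0 → fderiv ℂ Ψ (τ, v ^ 2, 0) (0, 0, 1) ≠ 0) := by
  obtain ⟨Ψ, h1, h2, h3, h4, -⟩ := isHalfPeriod_tau.exists_germ hτ hv
  refine ⟨Ψ, h1, h2, ?_, fun h0 => h4 ?_⟩
  · have hpos := eventually_im_pos hτ (v ^ 2) 0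
    filter_upwards [h3, hpos] with x hx hx0 q hq p q' hqq u u' hu hu'
    have hodd : Even (q' - 1) := by
      have := hqq.add_odd hq
      rw [sub_add_cancel] at this
      exact this.sub_odd odd_one
    obtain ⟨g1, g2⟩ := hx u u' hu hu'
    rcases Int.even_or_odd p with hp | hp
    · rw [hp.neg_one_zpow, one_mul, proj_half_add hx0 (p' := 0) (by simpa using hp) hodd,
        proj_half_add hx0 (p' := 0) (by simpa using hp) hodd]
      simpa using g1
    · have e : ∀ u : ℂ, (((1 : ℤ) : ℂ) + ((1 : ℤ) : ℂ) * x.1) / 2 + u = x.1 / 2 + u + 1 / 2 :=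
        fun u => by push_cast; ring
      rw [hp.neg_one_zpow, neg_one_mul, proj_half_add hx0 (p' := 1) (hp.sub_odd odd_one) hodd,
        proj_half_add hx0 (p' := 1) (hp.sub_odd odd_one) hodd, e, e]
      exact g2
  · subst h0
    have h5 := half_mul_notMem_lat hτ (p := 1) (q := 1) (Or.inr (by decide))
    refine div_ne_zero (pow_ne_zero 2 (theta_ne_zero hτ ?_)) (pow_ne_zero 2 (theta_ne_zero hτ ?_))
    · rwa [show τ / 2 + 0 + 1 / 2 = (((1 : ℤ) : ℂ) + ((1 : ℤ) : ℂ) * τ) / 2 by push_cast; ring]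
    · simpa using isHalfPeriod_tau.notMem τ hτ

theorem exists_lifts_of_even {τ v : ℂ} (hτ : 0 < τ.im) (hv : v = 0 ∨ 2 * v ∉ lat τ) :
    ∃ Ψ : ℂ × ℂ × ℂ → ℂ, ContDiffAt ℂ 2 Ψ (τ, v ^ 2, 0) ∧
      (∀ᶠ x in 𝓝 (τ, v ^ 2, (0 : ℂ)), Ψ (x.1, x.2.1, 0) = x.2.1) ∧
      (∀ᶠ x in 𝓝 (τ, v ^ 2, (0 : ℂ)), ∀ q, Even q → Lifts q Ψ x) ∧
      (∀ᶠ x in 𝓝 (τ, v ^ 2, (0 : ℂ)), x.2.1 = 0 → Ψ x = 0) := by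
  obtain ⟨Ψ, h1, h2, h3, -, h5⟩ := isHalfPeriod_half.exists_germ hτ hv
  have hcont : Continuous fun x : ℂ × ℂ × ℂ => (x.1, x.2.1, -x.2.2) := by fun_prop
  have ht : Tendsto (fun x : ℂ × ℂ × ℂ => (x.1, x.2.1, -x.2.2)) (𝓝 (τ, v ^ 2, 0))
      (𝓝 (τ, v ^ 2, 0)) := by
    simpa using hcont.tendsto (τ, v ^ 2, 0)
  refine ⟨fun x => Ψ (x.1, x.2.1, -x.2.2), ?_, ?_, ?_, ?_⟩
  · refine ContDiffAt.comp (g := Ψ) (f := fun x : ℂ × ℂ × ℂ => (x.1, x.2.1, -x.2.2)) _ ?_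
      (by fun_prop)
    simpa using h1
  · simpa using h2
  · have hpos := eventually_im_pos hτ (v ^ 2) 0
    filter_upwards [ht.eventually h3, hpos] with x hx hx0 q hq p q' hqq u u' hu hu'
    have heven : Even (q' - 0) := by
      simpa using hqq.add hq
    obtain ⟨g1, g2⟩ := hx u u' hu hu'
    rcases Int.even_or_odd p with hp | hp
    · have e : ∀ u : ℂ, (((2 : ℤ) : ℂ) + ((0 : ℤ) : ℂ) * x.1) / 2 + u = 1 / 2 + u + 1 / 2 :=
        fun u => by push_cast; ring
      rw [hp.neg_one_zpow, one_mul,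
        proj_half_add hx0 (p' := 2) (hp.sub even_two) heven,
        proj_half_add hx0 (p' := 2) (hp.sub even_two) heven, e, e]
      rw [neg_neg] at g2
      exact g2
    · rw [hp.neg_one_zpow, neg_one_mul, proj_half_add hx0 (p' := 1) (hp.sub_odd odd_one) heven,
        proj_half_add hx0 (p' := 1) (hp.sub_odd odd_one) heven]
      simpa using g1
  · refine ht.eventually (h5 fun t ht => ?_)
    have h := proj_half ht
    rwa [proj_of_notMem ht (half_notMem_lat ht), OnePoint.coe_eq_coe] at h


/-! ### Renormalization of a perturbed expanding iteration -/

/-- The orbit of `0` under the alternating application of the maps `ψ j (τ, ·, m)` and of the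
multiplication by `D`. -/
def renorm (D : ℕ) (ψ : ℕ → ℂ × ℂ × ℂ → ℂ) (τ m : ℂ) : ℕ → ℂ
  | 0 => ψ 0 (τ, 0, m)
  | j + 1 => ψ (j + 1) (τ, D * renorm D ψ τ m j, m)

/-- The partial sums `D ^ j ∑ i ≤ j, c i / D ^ i`. -/
def expSum (D : ℕ) (c : ℕ → ℂ) : ℕ → ℂ
  | 0 => c 0
  | j + 1 => D * expSum D c j + c (j + 1)

theorem expSum_mul_left (D : ℕ) (ε : ℂ) (c : ℕ → ℂ) (j : ℕ) :
    expSum D (fun i => ε * c i) j = ε * expSum D c j := by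
  induction j with
  | zero => rfl
  | succ j ih => simp only [expSum, ih]; ring

theorem norm_expSum_le {D : ℕ} (hD : 2 ≤ D) {c : ℕ → ℂ} (hc : ∀ j, ‖c j‖ ≤ 1) (j : ℕ) :
    ‖expSum D c j‖ ≤ 2 * D ^ j := by
  have hD' : (2 : ℝ) ≤ D := by exact_mod_cast hD
  suffices ‖expSum D c j‖ ≤ 2 * D ^ j - 1 by linarith
  induction j with
  | zero => simpa [expSum] using (by linarith [hc 0] : ‖c 0‖ ≤ 2 - 1)
  | succ j ih =>
    have h1 := norm_add_le (D * expSum D c j) (c (j + 1))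
    rw [norm_mul, Complex.norm_natCast] at h1
    have h2 := mul_le_mul_of_nonneg_left ih (by linarith : (0 : ℝ) ≤ D)
    rw [expSum, pow_succ]
    linarith [hc (j + 1)]

theorem le_norm_expSum {D : ℕ} (hD : 4 ≤ D) {c : ℕ → ℂ} (hc : ∀ j, ‖c j‖ ≤ 1) (h0 : ‖c 0‖ = 1)
    (j : ℕ) : (2 / 3 : ℝ) * D ^ j ≤ ‖expSum D c j‖ := by
  have hD' : (4 : ℝ) ≤ D := by exact_mod_cast hD
  suffices h : ‖expSum D c j - c 0 * D ^ j‖ ≤ (D ^ j - 1) / 3 by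
    have h1 := norm_sub_norm_le (c 0 * D ^ j) (expSum D c j)
    rw [norm_sub_rev, norm_mul, h0, norm_pow, Complex.norm_natCast] at h1
    linarith
  induction j with
  | zero => simp [expSum]
  | succ j ih =>
    have h1 := norm_add_le (D * (expSum D c j - c 0 * D ^ j)) (c (j + 1))
    rw [norm_mul, Complex.norm_natCast] at h1
    have h2 := mul_le_mul_of_nonneg_left ih (by linarith : (0 : ℝ) ≤ D)
    have e : expSum D c (j + 1) - c 0 * (D : ℂ) ^ (j + 1) =
        D * (expSum D c j - c 0 * D ^ j) + c (j + 1) := by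
      rw [expSum, pow_succ]; ring
    rw [e, pow_succ]
    linarith [hc (j + 1)]

/-- If `ψ j (τ, s, m) = s + c j κ(τ) m + O(|m| (|s| + |m|))`, then the orbit `renorm` is given
to first order by `expSum`, as long as it stays small. -/
theorem exists_renorm_estimate {D : ℕ} (hD : 2 ≤ D) {τ : ℂ} {r C K : ℝ} (hr : 0 < r) (hC : 0 ≤ C)
    (hK : 0 ≤ K) :
    ∃ R > 0, ∃ C' : ℝ, 0 ≤ C' ∧ ∀ (ψ : ℕ → ℂ × ℂ × ℂ → ℂ) (κ : ℂ → ℂ) (c : ℕ → ℂ),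
      (∀ j, ‖c j‖ ≤ 1) → (∀ t, dist t τ < r → ‖κ t‖ ≤ K) →
      (∀ j x, x ∈ Metric.ball (τ, (0 : ℂ), (0 : ℂ)) r →
        ‖ψ j x - x.2.1 - c j * κ x.1 * x.2.2‖ ≤ C * (‖x.2.2‖ * (‖x.2.1‖ + ‖x.2.2‖))) →
      ∀ (N : ℕ) (t m : ℂ), dist t τ < r → ‖m‖ * D ^ N ≤ R →
      ‖renorm D ψ t m N - m * κ t * expSum D c N‖ ≤ C' * ((N + 1) * ‖m‖ ^ 2 * D ^ N) ∧
      (t, 0, m) ∈ Metric.ball (τ, (0 : ℂ), (0 : ℂ)) r ∧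
      ∀ j < N, (t, D * renorm D ψ t m j, m) ∈ Metric.ball (τ, (0 : ℂ), (0 : ℂ)) r := by
  have hD' : (2 : ℝ) ≤ D := by exact_mod_cast hD
  set L := 2 * K + 1 with hL
  set C' := C * (L + 1) with hC'
  have hC'0 : 0 ≤ C' := by positivity
  refine ⟨min (1 / (C' + 1)) (r / (L + 1)), by positivity, C', hC'0,
    fun ψ κ c hc hκ hψ N t m ht hm => ?_⟩
  have hm1 := hm.trans (min_le_left _ _)
  have hm2 := hm.trans (min_le_right _ _)
  rw [le_div_iff₀ (by positivity)] at hm1 hm2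
  have hDN : ∀ j ≤ N, ‖m‖ * (D : ℝ) ^ j ≤ ‖m‖ * D ^ N := fun j hj => by
    gcongr
    linarith
  have hmem : ∀ s : ℂ, ‖s‖ < r → (t, s, m) ∈ Metric.ball (τ, (0 : ℂ), (0 : ℂ)) r := by
    intro s hs
    have h1 := hDN 0 (Nat.zero_le N)
    rw [pow_zero, mul_one] at h1
    have h2 : ‖m‖ < r := by
      nlinarith [norm_nonneg m]
    simp [Prod.dist_eq, ht, hs, h2]
  -- The error estimate gives a bound for the orbit itself
  have hsize : ∀ j ≤ N,
      ‖renorm D ψ t m j - m * κ t * expSum D c j‖ ≤ C' * ((j + 1) * ‖m‖ ^ 2 * D ^ j) →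
      ‖renorm D ψ t m j‖ ≤ L * (‖m‖ * D ^ j) := by
    intro j hj h
    have h1 : ‖m * κ t * expSum D c j‖ ≤ ‖m‖ * K * (2 * D ^ j) := by
      rw [norm_mul, norm_mul]
      gcongr
      · exact hκ t ht
      · exact norm_expSum_le hD hc j
    have h2 : ((j : ℝ) + 1) ≤ D ^ j := by
      have h3 : j + 1 ≤ D ^ j := (Nat.lt_two_pow_self).trans_le (Nat.pow_le_pow_left hD j)
      exact_mod_cast h3
    have h3 : C' * ((j + 1) * ‖m‖) ≤ 1 := by
      have h4 : ((j : ℝ) + 1) * ‖m‖ ≤ ‖m‖ * D ^ N := by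
        rw [mul_comm]
        exact (mul_le_mul_of_nonneg_left h2 (norm_nonneg m)).trans (hDN j hj)
      have h5 := mul_le_mul_of_nonneg_left h4 hC'0
      have h6 : 0 ≤ ‖m‖ * (D : ℝ) ^ N := by positivity
      linarith
    have h4 : C' * ((j + 1) * ‖m‖ ^ 2 * D ^ j) ≤ ‖m‖ * D ^ j := by
      have := mul_le_mul_of_nonneg_right h3 (by positivity : 0 ≤ ‖m‖ * (D : ℝ) ^ j)
      calc _ = C' * ((j + 1) * ‖m‖) * (‖m‖ * D ^ j) := by ring
        _ ≤ _ := by linarith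
    have h5 := norm_le_norm_add_norm_sub' (renorm D ψ t m j) (m * κ t * expSum D c j)
    rw [hL]
    linarith
  have hstep : ∀ j < N, ‖renorm D ψ t m j‖ ≤ L * (‖m‖ * D ^ j) →
      (t, D * renorm D ψ t m j, m) ∈ Metric.ball (τ, (0 : ℂ), (0 : ℂ)) r := by
    intro j hj h
    apply hmem
    rw [norm_mul, Complex.norm_natCast]
    have h1 := hDN (j + 1) hj
    rw [pow_succ] at h1
    have h2 := mul_le_mul_of_nonneg_left h (by linarith : (0 : ℝ) ≤ D)
    have h3 : L * (‖m‖ * (D ^ j * D)) ≤ L * (‖m‖ * D ^ N) :=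
      mul_le_mul_of_nonneg_left h1 (by positivity)
    by_cases h0 : ‖m‖ * (D : ℝ) ^ N = 0
    · rw [h0] at h3
      linarith
    · have : 0 < ‖m‖ * (D : ℝ) ^ N := lt_of_le_of_ne (by positivity) (Ne.symm h0)
      linarith
  have main : ∀ j ≤ N,
      ‖renorm D ψ t m j - m * κ t * expSum D c j‖ ≤ C' * ((j + 1) * ‖m‖ ^ 2 * D ^ j) := by
    intro j
    induction j with
    | zero =>
      intro _
      have h1 := hψ 0 _ (hmem 0 (by simpa using hr))
      simp only [norm_zero, zero_add, sub_zero] at h1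
      simp only [renorm, expSum, Nat.cast_zero, zero_add, one_mul, pow_zero, mul_one]
      calc _ = ‖ψ 0 (t, 0, m) - c 0 * κ t * m‖ := by congr 1; ring
        _ ≤ C * (‖m‖ * ‖m‖) := h1
        _ ≤ _ := by rw [hC', pow_two]; gcongr; nlinarith
    | succ j ih =>
      intro hj
      have hj' : j ≤ N := (Nat.le_succ j).trans hj
      have h1 := ih hj'
      have h2 := hsize j hj' h1
      have h3 := hψ (j + 1) _ (hstep j hj h2)
      simp only [norm_mul, Complex.norm_natCast] at h3
      have h4 : (D : ℝ) * ‖renorm D ψ t m j‖ + ‖m‖ ≤ (L + 1) * (‖m‖ * D ^ (j + 1)) := by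
        have h5 := mul_le_mul_of_nonneg_left h2 (by linarith : (0 : ℝ) ≤ D)
        have h6 : ‖m‖ * 1 ≤ ‖m‖ * (D : ℝ) ^ (j + 1) := by
          gcongr
          exact one_le_pow₀ (by linarith)
        rw [pow_succ] at h6 ⊢
        linarith
      have h5 := mul_le_mul_of_nonneg_left (mul_le_mul_of_nonneg_left h4 (norm_nonneg m)) hC
      have h6 := mul_le_mul_of_nonneg_left h1 (by linarith : (0 : ℝ) ≤ D)
      have e : renorm D ψ t m (j + 1) - m * κ t * expSum D c (j + 1) =
          (ψ (j + 1) (t, D * renorm D ψ t m j, m) - D * renorm D ψ t m j - c (j + 1) * κ t * m) +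
            D * (renorm D ψ t m j - m * κ t * expSum D c j) := by
        rw [renorm, expSum]; ring
      rw [e]
      refine (norm_add_le _ _).trans ?_
      rw [norm_mul, Complex.norm_natCast]
      refine (add_le_add (h3.trans h5) h6).trans (le_of_eq ?_)
      rw [hC']; push_cast; ring
  exact ⟨main N le_rfl, hmem 0 (by simpa using hr),
    fun j hj => hstep j hj (hsize j hj.le (main j hj.le))⟩

theorem differentiableAt_renorm {D : ℕ} {ψ : ℕ → ℂ × ℂ × ℂ → ℂ} {U : Set (ℂ × ℂ × ℂ)}
    (hψ : ∀ j, ∀ x ∈ U, DifferentiableAt ℂ (ψ j) x) {q : ℂ × ℂ} {N : ℕ} (h0 : (q.1, 0, q.2) ∈ U)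
    (h : ∀ j < N, (q.1, D * renorm D ψ q.1 q.2 j, q.2) ∈ U) :
    DifferentiableAt ℂ (fun q : ℂ × ℂ => renorm D ψ q.1 q.2 N) q := by
  induction N with
  | zero =>
    exact DifferentiableAt.comp (g := ψ 0) (f := fun q : ℂ × ℂ => (q.1, (0 : ℂ), q.2)) q
      (hψ 0 _ h0) (by fun_prop)
  | succ N ih =>
    have h1 := ih fun j hj => h j (hj.trans N.lt_succ_self)
    exact DifferentiableAt.comp (g := ψ (N + 1))
      (f := fun q : ℂ × ℂ => (q.1, D * renorm D ψ q.1 q.2 N, q.2)) q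
      (hψ (N + 1) _ (h N N.lt_succ_self))
      (differentiableAt_fst.prodMk ((h1.const_mul _).prodMk differentiableAt_snd))


/-! ### Lifting orbits near the half-periods -/

/-- The orbit of the half-period `(p + q τ) / 2` under `z ↦ a z + k / 2`, given by its integer
coordinates. -/
def halfOrbit (a : ℕ) (k : ℤ) (e : ℤ × ℤ) : ℕ → ℤ × ℤ
  | 0 => e
  | j + 1 => (a * (halfOrbit a k e j).1 + k, a * (halfOrbit a k e j).2)

/-- The half-period with coordinates `e`. -/
def halfPt (τ : ℂ) (e : ℤ × ℤ) : ℂ := (e.1 + e.2 * τ) / 2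

theorem halfOrbit_add (a : ℕ) (k : ℤ) (e : ℤ × ℤ) (i j : ℕ) :
    halfOrbit a k (halfOrbit a k e i) j = halfOrbit a k e (i + j) := by
  induction j with
  | zero => rfl
  | succ j ih => rw [halfOrbit, ih, ← add_assoc, halfOrbit]

theorem mul_halfPt_add (τ : ℂ) {a : ℕ} {k : ℤ} {b : ℂ} (hb : 2 * b = k) (e : ℤ × ℤ)
    (j : ℕ) (v : ℂ) :
    a * (halfPt τ (halfOrbit a k e j) + v) + b = halfPt τ (halfOrbit a k e (j + 1)) + a * v := by
  have hb' : b = k / 2 := by rw [← hb]; ring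
  rw [halfPt, halfPt, halfOrbit, hb']
  push_cast
  ring

theorem proj_halfPt_sub {τ : ℂ} (hτ : 0 < τ.im) (e : ℤ × ℤ) (v : ℂ) :
    proj τ (halfPt τ e - v) = proj τ (halfPt τ e + v) :=
  (proj_eq_iff hτ).2 (Or.inl ⟨e.1, e.2, by rw [halfPt]; ring⟩)

/-- The value of `z ↦ proj τ z` at `halfPt τ e + u` depends only on the square of `u`. -/
theorem proj_halfPt_congr {τ : ℂ} (hτ : 0 < τ.im) (e : ℤ × ℤ) {u v : ℂ} (h : u ^ 2 = v ^ 2) :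
    proj τ (halfPt τ e + u) = proj τ (halfPt τ e + v) := by
  rcases sq_eq_sq_iff_eq_or_eq_neg.1 h with rfl | rfl
  · rfl
  · rw [← sub_eq_add_neg, proj_halfPt_sub hτ]

/-- `Ψ` lifts, near the half-period `e`, the multiplication by `exp m` on the sphere to the
coordinate `s`, at the point `x = (τ, s, m)`. -/
def LiftsAt (e : ℤ × ℤ) (Ψ : ℂ × ℂ × ℂ → ℂ) (x : ℂ × ℂ × ℂ) : Prop :=
  ∀ u u', u ^ 2 = x.2.1 → u' ^ 2 = Ψ x →
    expGL x.2.2 • proj x.1 (halfPt x.1 e + u) = proj x.1 (halfPt x.1 e + u')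

/-- A lift near all half-periods, composed from lifts near the half-periods `e` with
`e.2` even and odd. -/
def signedGerm (E O : ℂ × ℂ × ℂ → ℂ) (e : ℤ × ℤ) (x : ℂ × ℂ × ℂ) : ℂ :=
  (if Odd e.2 then O else E) (x.1, x.2.1, (-1) ^ e.1 * x.2.2)

theorem neg_one_zpow_mul_self (p : ℤ) : ((-1) ^ p * (-1) ^ p : ℂ) = 1 := by
  rcases Int.even_or_odd p with h | h
  · rw [h.neg_one_zpow]; norm_num
  · rw [h.neg_one_zpow]; norm_num

theorem norm_neg_one_zpow (p : ℤ) : ‖((-1) ^ p : ℂ)‖ = 1 := by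
  simp

/-- A property of the germs `E` and `O` that holds near `m = 0` holds after a change of the
sign of `m`. -/
theorem eventually_signed {τ s : ℂ} {Q : ℂ × ℂ × ℂ → Prop} (h : ∀ᶠ x in 𝓝 (τ, s, (0 : ℂ)), Q x) :
    ∀ᶠ x in 𝓝 (τ, s, (0 : ℂ)), ∀ p : ℤ, Q (x.1, x.2.1, (-1) ^ p * x.2.2) := by
  have hc : Continuous fun x : ℂ × ℂ × ℂ => (x.1, x.2.1, -x.2.2) := by fun_prop
  have ht : Tendsto (fun x : ℂ × ℂ × ℂ => (x.1, x.2.1, -x.2.2)) (𝓝 (τ, s, 0))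
      (𝓝 (τ, s, 0)) := by simpa using hc.tendsto (τ, s, 0)
  filter_upwards [h, ht.eventually h] with x h1 h2 p
  rcases Int.even_or_odd p with hp | hp
  · simpa [hp.neg_one_zpow] using h1
  · simpa [hp.neg_one_zpow] using h2

theorem liftsAt_signedGerm {E O : ℂ × ℂ × ℂ → ℂ} {e : ℤ × ℤ} {x : ℂ × ℂ × ℂ}
    (hE : ∀ q, Even q → Lifts q E (x.1, x.2.1, (-1) ^ e.1 * x.2.2))
    (hO : ∀ q, Odd q → Lifts q O (x.1, x.2.1, (-1) ^ e.1 * x.2.2)) :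
    LiftsAt e (signedGerm E O e) x := by
  intro u u' hu hu'
  have key : ∀ Ψ : ℂ × ℂ × ℂ → ℂ, u' ^ 2 = Ψ (x.1, x.2.1, (-1) ^ e.1 * x.2.2) →
      Lifts e.2 Ψ (x.1, x.2.1, (-1) ^ e.1 * x.2.2) →
      expGL x.2.2 • proj x.1 (halfPt x.1 e + u) = proj x.1 (halfPt x.1 e + u') := by
    intro Ψ h1 h2
    have h3 := h2 e.1 e.2 (by simp) u u' hu h1
    simp only [← mul_assoc, neg_one_zpow_mul_self, one_mul] at h3
    exact h3
  rw [signedGerm] at hu'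
  split_ifs at hu' with h
  · exact key O hu' (hO _ h)
  · exact key E hu' (hE _ (Int.not_odd_iff_even.1 h))

theorem differentiableAt_signedGerm {E O : ℂ × ℂ × ℂ → ℂ} {e : ℤ × ℤ} {x : ℂ × ℂ × ℂ}
    (hE : DifferentiableAt ℂ E (x.1, x.2.1, (-1) ^ e.1 * x.2.2))
    (hO : DifferentiableAt ℂ O (x.1, x.2.1, (-1) ^ e.1 * x.2.2)) :
    DifferentiableAt ℂ (signedGerm E O e) x := by
  refine DifferentiableAt.comp (g := if Odd e.2 then O else E)
    (f := fun x : ℂ × ℂ × ℂ => (x.1, x.2.1, (-1) ^ e.1 * x.2.2)) x ?_ (by fun_prop)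
  split_ifs
  · exact hO
  · exact hE

theorem exists_norm_sub_le_of_eq {Ψ : ℂ × ℂ × ℂ → ℂ} {τ s : ℂ} (hΨ : ContDiffAt ℂ 2 Ψ (τ, s, 0))
    (h0 : ∀ᶠ x in 𝓝 (τ, s, (0 : ℂ)), Ψ (x.1, x.2.1, 0) = x.2.1) :
    ∃ L : ℝ, 0 ≤ L ∧ ∀ᶠ x in 𝓝 (τ, s, (0 : ℂ)), ‖Ψ x - x.2.1‖ ≤ L * ‖x.2.2‖ := by
  obtain ⟨K, t, ht, hK⟩ := (hΨ.of_le (by norm_num : (1 : WithTop ℕ∞) ≤ 2)).exists_lipschitzOnWith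
  refine ⟨K, K.2, ?_⟩
  have hc : Continuous fun x : ℂ × ℂ × ℂ => (x.1, x.2.1, (0 : ℂ)) := by fun_prop
  have ht' : ∀ᶠ x in 𝓝 (τ, s, (0 : ℂ)), (x.1, x.2.1, (0 : ℂ)) ∈ t :=
    (hc.tendsto (τ, s, (0 : ℂ))).eventually ht
  filter_upwards [ht, ht', h0] with x h1 h2 h3
  have := hK.dist_le_mul _ h1 _ h2
  rw [dist_eq_norm, h3] at this
  simpa [Prod.dist_eq, Prod.norm_def] using this

theorem eventually_differentiableAt {Ψ : ℂ × ℂ × ℂ → ℂ} {x : ℂ × ℂ × ℂ}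
    (hΨ : ContDiffAt ℂ 2 Ψ x) : ∀ᶠ y in 𝓝 x, DifferentiableAt ℂ Ψ y := by
  filter_upwards [hΨ.eventually (by simp)] with y hy using hy.differentiableAt (by simp)

/-- Simultaneous lifts near all half-periods, away from the critical points of `proj τ`. -/
theorem exists_liftsAt {τ v : ℂ} (hτ : 0 < τ.im) (hv : 2 * v ∉ lat τ) :
    ∃ (Ψ : ℤ × ℤ → ℂ × ℂ × ℂ → ℂ) (L : ℝ), 0 ≤ L ∧ ∀ᶠ x in 𝓝 (τ, v ^ 2, (0 : ℂ)), ∀ e,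
      DifferentiableAt ℂ (Ψ e) x ∧ ‖Ψ e x - x.2.1‖ ≤ L * ‖x.2.2‖ ∧ LiftsAt e (Ψ e) x := by
  obtain ⟨E, hE1, hE2, hE3, -⟩ := exists_lifts_of_even hτ (Or.inr hv)
  obtain ⟨O, hO1, hO2, hO3, -⟩ := exists_lifts_of_odd hτ (Or.inr hv)
  obtain ⟨L, hL, hE4⟩ := exists_norm_sub_le_of_eq hE1 hE2
  obtain ⟨L', hL', hO4⟩ := exists_norm_sub_le_of_eq hO1 hO2
  refine ⟨signedGerm E O, max L L', le_max_of_le_left hL, ?_⟩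
  filter_upwards [eventually_signed hE3, eventually_signed hO3, eventually_signed hE4,
    eventually_signed hO4, eventually_signed (eventually_differentiableAt hE1),
    eventually_signed (eventually_differentiableAt hO1)] with x e3 o3 e4 o4 e1 o1 e
  refine ⟨differentiableAt_signedGerm (e1 _) (o1 _), ?_, liftsAt_signedGerm (e3 _) (o3 _)⟩
  have h1 := e4 e.1
  have h2 := o4 e.1
  rw [norm_mul, norm_neg_one_zpow, one_mul] at h1 h2
  rw [signedGerm]
  split_ifs
  · exact h2.trans (by gcongr; exact le_max_right _ _)
  · exact h1.trans (by gcongr; exact le_max_left _ _)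

/-- The coefficient of `m` in the lift of multiplication by `exp m` near the
half-period `e`, in units of its value at `τ / 2`. It is `0` over the values `∞` and `0`, which are
fixed by this multiplication. -/
def liftSign (e : ℤ × ℤ) : ℂ := if Odd e.2 then (-1) ^ e.1 else 0

theorem norm_liftSign_le (e : ℤ × ℤ) : ‖liftSign e‖ ≤ 1 := by
  rw [liftSign]
  split_ifs
  · rw [norm_neg_one_zpow]
  · simp

/-- Simultaneous lifts near all half-periods, at the critical points of `proj τ`: the
critical values `∞` and `0` of `proj τ` are fixed by multiplication by `exp m`, while the other
two critical values are moved with nonzero speed. -/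
theorem exists_liftsAt_zero {τ : ℂ} (hτ : 0 < τ.im) :
    ∃ (Ψ : ℤ × ℤ → ℂ × ℂ × ℂ → ℂ) (κ : ℂ → ℂ) (C : ℝ), 0 ≤ C ∧ ContDiffAt ℂ 1 κ τ ∧ κ τ ≠ 0 ∧
      ∀ᶠ x in 𝓝 (τ, (0 : ℂ), (0 : ℂ)), ∀ e, DifferentiableAt ℂ (Ψ e) x ∧
        ‖Ψ e x - x.2.1 - liftSign e * κ x.1 * x.2.2‖ ≤
          C * (‖x.2.2‖ * (‖x.2.1‖ + ‖x.2.2‖)) ∧ LiftsAt e (Ψ e) x := by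
  obtain ⟨E, hE1, hE2, hE3, hE5⟩ := exists_lifts_of_even hτ (Or.inl rfl)
  obtain ⟨O, hO1, hO2, hO3, hO5⟩ := exists_lifts_of_odd hτ (Or.inl rfl)
  rw [zero_pow two_ne_zero] at hE1 hE2 hE3 hE5 hO1 hO2 hO3 hO5
  obtain ⟨C, hC, hE4⟩ := exists_norm_sub_le_of_contDiffAt hE1 hE2
  obtain ⟨C', hC', hO4⟩ := exists_norm_sub_le_of_contDiffAt hO1 hO2
  have hc : Continuous fun t : ℂ => (t, (0 : ℂ), (0 : ℂ)) := by fun_prop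
  have hκE : ∀ᶠ x in 𝓝 (τ, (0 : ℂ), (0 : ℂ)), fderiv ℂ E (x.1, 0, 0) (0, 0, 1) = 0 := by
    have hc' : Continuous fun x : ℂ × ℂ × ℂ => (x.1, (0 : ℂ), (0 : ℂ)) := by fun_prop
    have h1 := (hc'.tendsto (τ, (0 : ℂ), (0 : ℂ))).eventually
      (eventually_eventually_nhds.2 hE5)
    have h2 := (hc'.tendsto (τ, (0 : ℂ), (0 : ℂ))).eventually
      (eventually_differentiableAt hE1)
    filter_upwards [h1, h2] with x h1 h2
    have hl : HasDerivAt (fun m : ℂ => (x.1, (0 : ℂ), m)) ((0 : ℂ), (0 : ℂ), (1 : ℂ)) 0 :=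
      (hasDerivAt_const _ _).prodMk ((hasDerivAt_const _ _).prodMk (hasDerivAt_id 0))
    have h3 := HasFDerivAt.comp_hasDerivAt (l := E) (f := fun m : ℂ => (x.1, (0 : ℂ), m)) 0
      h2.hasFDerivAt hl
    have h4 : (fun m : ℂ => E (x.1, (0 : ℂ), m)) =ᶠ[𝓝 0] fun _ => 0 := by
      filter_upwards [(show Tendsto (fun m : ℂ => (x.1, (0 : ℂ), m)) (𝓝 0) (𝓝 (x.1, 0, 0)) from
        hl.continuousAt).eventually h1] with m hm using hm rfl
    exact (h3.congr_of_eventuallyEq h4.symm).unique (hasDerivAt_const _ _)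
  refine ⟨signedGerm E O, fun t => fderiv ℂ O (t, 0, 0) (0, 0, 1), max C C',
    le_max_of_le_left hC, ?_, hO5 rfl, ?_⟩
  · have h1 : ContDiffAt ℂ 1 (fderiv ℂ O) (τ, 0, 0) := hO1.fderiv_right (by norm_num)
    have h2 : ContDiffAt ℂ 1 (fun t : ℂ => fderiv ℂ O (t, 0, 0)) τ :=
      ContDiffAt.comp (g := fderiv ℂ O) (f := fun t : ℂ => (t, (0 : ℂ), (0 : ℂ))) τ h1
        (by fun_prop)
    exact h2.clm_apply contDiffAt_const
  filter_upwards [eventually_signed hE3, eventually_signed hO3, eventually_signed hE4,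
    eventually_signed hO4, eventually_signed (eventually_differentiableAt hE1),
    eventually_signed (eventually_differentiableAt hO1), hκE] with x e3 o3 e4 o4 e1 o1 hκ e
  refine ⟨differentiableAt_signedGerm (e1 _) (o1 _), ?_, liftsAt_signedGerm (e3 _) (o3 _)⟩
  have h1 := e4 e.1
  have h2 := o4 e.1
  rw [norm_mul, norm_neg_one_zpow, one_mul] at h1 h2
  rw [signedGerm, liftSign]
  split_ifs
  · refine le_trans (le_of_eq ?_) (h2.trans (by gcongr; exact le_max_right _ _))
    congr 1; ring
  · refine le_trans (le_of_eq ?_) (h1.trans (by gcongr; exact le_max_left _ _))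
    simp only [hκ]
    congr 1; ring

/-- The functional equation of the perturbed map with parameters `τ` and `m`, without the
regularity and size conditions of `IsPerturbed`. -/
def IsPerturbation (F : OnePoint ℂ → OnePoint ℂ) (τ : ℂ) (a : ℕ) (b m : ℂ) : Prop :=
  ∀ z, F (proj τ z) = expGL m • proj τ (a * z + b)

/-- One step of the perturbed map, from one half-period to the next, is multiplication by `a ^ 2`
followed by `Ψ` in the coordinate `s`. -/
theorem LiftsAt.apply_proj {F : OnePoint ℂ → OnePoint ℂ} {τ b m s : ℂ} {a : ℕ} {k : ℤ}
    (hF : IsPerturbation F τ a b m) (hb : 2 * b = k) {e : ℤ × ℤ} {j : ℕ} {Ψ : ℂ × ℂ × ℂ → ℂ}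
    (hΨ : LiftsAt (halfOrbit a k e (j + 1)) Ψ (τ, ((a * a : ℕ) : ℂ) * s, m)) {u u' : ℂ}
    (hu : u ^ 2 = s) (hu' : u' ^ 2 = Ψ (τ, ((a * a : ℕ) : ℂ) * s, m)) :
    F (proj τ (halfPt τ (halfOrbit a k e j) + u)) =
      proj τ (halfPt τ (halfOrbit a k e (j + 1)) + u') := by
  rw [hF, mul_halfPt_add τ hb]
  exact hΨ _ _ (by rw [mul_pow, hu]; push_cast; ring) hu'

/-- The orbit of a critical value of the perturbed map, as long as the lifts are defined. -/
theorem iterate_eq_proj_renorm {F : OnePoint ℂ → OnePoint ℂ} {τ b m : ℂ} {a : ℕ} {k : ℤ}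
    (hF : IsPerturbation F τ a b m) (hb : 2 * b = k) {e : ℤ × ℤ} {Ψ : ℤ × ℤ → ℂ × ℂ × ℂ → ℂ} {N : ℕ}
    (h0 : LiftsAt e (Ψ e) (τ, 0, m))
    (h : ∀ j < N, LiftsAt (halfOrbit a k e (j + 1)) (Ψ (halfOrbit a k e (j + 1)))
      (τ, ((a * a : ℕ) : ℂ) * renorm (a * a) (fun j => Ψ (halfOrbit a k e j)) τ m j, m))
    {u : ℂ} (hu : u ^ 2 = renorm (a * a) (fun j => Ψ (halfOrbit a k e j)) τ m N) :
    F^[N] (expGL m • proj τ (halfPt τ e)) = proj τ (halfPt τ (halfOrbit a k e N) + u) := by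
  induction N generalizing u with
  | zero =>
    have := h0 0 u (by simp) hu
    rwa [add_zero] at this
  | succ N ih =>
    rw [Function.iterate_succ_apply', ih (fun j hj => h j (hj.trans N.lt_succ_self))
      (cpow_half_sq _)]
    exact (h N N.lt_succ_self).apply_proj hF hb (cpow_half_sq _) hu

/-- A fixed number `P` of further iterations, near a point that is not a half-period. -/
theorem exists_lift_iterate {τ : ℂ} (hτ : 0 < τ.im) {a : ℕ} {b : ℂ} {k : ℤ} (hb : 2 * b = k) {v : ℂ}
    (P : ℕ) (hv : ∀ i, 1 ≤ i → i ≤ P → 2 * (a ^ i * v) ∉ lat τ) :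
    ∃ (Ξ : ℤ × ℤ → ℂ × ℂ × ℂ → ℂ) (L : ℝ), 0 ≤ L ∧ ∀ᶠ x in 𝓝 (τ, v ^ 2, (0 : ℂ)), ∀ e,
      DifferentiableAt ℂ (Ξ e) x ∧ ‖Ξ e x - ((a * a : ℕ) : ℂ) ^ P * x.2.1‖ ≤ L * ‖x.2.2‖ ∧
      ∀ F, IsPerturbation F x.1 a b x.2.2 → ∀ u u', u ^ 2 = x.2.1 → u' ^ 2 = Ξ e x →
        F^[P] (proj x.1 (halfPt x.1 e + u)) = proj x.1 (halfPt x.1 (halfOrbit a k e P) + u') := by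
  induction P with
  | zero =>
    refine ⟨fun _ x => x.2.1, 0, le_rfl, ?_⟩
    have hpos := eventually_im_pos hτ (v ^ 2) 0
    filter_upwards [hpos] with x hx e
    refine ⟨by fun_prop, by simp, fun F _ u u' hu hu' => ?_⟩
    exact proj_halfPt_congr hx e (hu.trans hu'.symm)
  | succ P ih =>
    obtain ⟨Ξ, L, hL, hΞ⟩ := ih fun i h1 h2 => hv i h1 (h2.trans P.le_succ)
    obtain ⟨Ψ, L', hL', hΨ⟩ := exists_liftsAt hτ (hv (P + 1) P.succ_pos le_rfl)
    set D : ℂ := ((a * a : ℕ) : ℂ) with hD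
    have hbase : (a ^ (P + 1) * v) ^ 2 = D ^ (P + 1) * v ^ 2 := by
      rw [hD]; push_cast; ring
    rw [hbase] at hΨ
    obtain ⟨δ, hδ, hball⟩ := Metric.eventually_nhds_iff_ball.1 hΨ
    refine ⟨fun e x => Ψ (halfOrbit a k e (P + 1)) (x.1, D * Ξ e x, x.2.2), L' + ‖D‖ * L,
      by positivity, ?_⟩
    -- The lifted point stays in the domain of the last lift, uniformly in `e`
    have hsmall : ∀ᶠ x in 𝓝 (τ, v ^ 2, (0 : ℂ)),
        dist x.1 τ < δ ∧ ‖x.2.2‖ < δ ∧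
          ‖D‖ * (L * ‖x.2.2‖) + ‖D ^ (P + 1) * (x.2.1 - v ^ 2)‖ < δ := by
      have c1 : ContinuousAt (fun x : ℂ × ℂ × ℂ => dist x.1 τ) (τ, v ^ 2, 0) := by fun_prop
      have c2 : ContinuousAt (fun x : ℂ × ℂ × ℂ => ‖x.2.2‖) (τ, v ^ 2, 0) := by fun_prop
      have c3 : ContinuousAt (fun x : ℂ × ℂ × ℂ =>
        ‖D‖ * (L * ‖x.2.2‖) + ‖D ^ (P + 1) * (x.2.1 - v ^ 2)‖) (τ, v ^ 2, 0) := by fun_prop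
      refine (c1.eventually_lt continuousAt_const (by simpa using hδ)).and
        ((c2.eventually_lt continuousAt_const (by simpa using hδ)).and
          (c3.eventually_lt continuousAt_const (by simpa using hδ)))
    filter_upwards [hΞ, hsmall] with x hx hx' e
    obtain ⟨d1, d2, d3⟩ := hx e
    have hin : (x.1, D * Ξ e x, x.2.2) ∈ Metric.ball (τ, D ^ (P + 1) * v ^ 2, (0 : ℂ)) δ := by
      have : ‖D * Ξ e x - D ^ (P + 1) * v ^ 2‖ < δ := by
        refine lt_of_le_of_lt ?_ hx'.2.2
        have e1 : D * Ξ e x - D ^ (P + 1) * v ^ 2 =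
            D * (Ξ e x - D ^ P * x.2.1) + D ^ (P + 1) * (x.2.1 - v ^ 2) := by ring
        rw [e1]
        refine (norm_add_le _ _).trans ?_
        rw [norm_mul D]
        gcongr
      simp only [Metric.mem_ball, Prod.dist_eq, dist_zero_right, max_lt_iff]
      exact ⟨hx'.1, by rwa [dist_eq_norm], hx'.2.1⟩
    obtain ⟨f1, f2, f3⟩ := hball _ hin (halfOrbit a k e (P + 1))
    refine ⟨?_, ?_, fun F hF u u' hu hu' => ?_⟩
    · exact DifferentiableAt.comp (g := Ψ (halfOrbit a k e (P + 1)))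
        (f := fun x : ℂ × ℂ × ℂ => (x.1, D * Ξ e x, x.2.2)) x f1
        (differentiableAt_fst.prodMk ((d1.const_mul D).prodMk differentiableAt_snd.snd))
    · have e1 : Ψ (halfOrbit a k e (P + 1)) (x.1, D * Ξ e x, x.2.2) - D ^ (P + 1) * x.2.1 =
          (Ψ (halfOrbit a k e (P + 1)) (x.1, D * Ξ e x, x.2.2) - D * Ξ e x) +
            D * (Ξ e x - D ^ P * x.2.1) := by ring
      rw [e1]
      refine (norm_add_le _ _).trans ?_
      rw [norm_mul D, add_mul, mul_assoc]
      exact add_le_add f2 (mul_le_mul_of_nonneg_left d2 (norm_nonneg D))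
    · rw [Function.iterate_succ_apply', d3 F hF u _ hu (cpow_half_sq _)]
      exact f3.apply_proj hF hb (cpow_half_sq _) hu'


/-! ### Renormalized critical orbits -/

theorem halfOrbit_one (a : ℕ) (k p : ℤ) (j : ℕ) :
    halfOrbit a k (p, 1) j = (a ^ j * p + (halfOrbit a k (0, 1) j).1, (a : ℤ) ^ j) := by
  induction j with
  | zero => simp [halfOrbit]
  | succ j ih => simp only [halfOrbit, ih]; ext <;> simp only <;> ring

/-- The two critical values that are not fixed by multiplication by `exp m` move in opposite
directions along the whole orbit. -/
theorem liftSign_halfOrbit (a : ℕ) (k p : ℤ) (j : ℕ) :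
    liftSign (halfOrbit a k (p, 1) j) = (-1) ^ p * liftSign (halfOrbit a k (0, 1) j) := by
  have h2 : (halfOrbit a k (0, 1) j).2 = (a : ℤ) ^ j := by rw [halfOrbit_one]
  rw [halfOrbit_one a k p, liftSign, liftSign, h2]
  by_cases h : Odd ((a : ℤ) ^ j)
  · simp only [h, if_true]
    rw [zpow_add₀ (by norm_num), zpow_mul, h.neg_one_zpow]
  · simp [h]

/-- The parameter `m` for which the critical orbits arrive, after `N` steps, at positions close to
`± w / D ^ P` in the coordinate `s` around a half-period. Here `q = (τ, w)`, and `κ τ * M N` is the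
derivative of the position with respect to `m`. -/
def renormParam (D : ℕ) (κ : ℂ → ℂ) (M : ℕ → ℂ) (P N : ℕ) (q : ℂ × ℂ) : ℂ :=
  q.2 / (D ^ P * (κ q.1 * M N))

/-- `expSum` of the signs along the orbit of `τ / 2`. -/
def orbitSum (a : ℕ) (k : ℤ) (N : ℕ) : ℂ :=
  expSum (a * a) (fun j => liftSign (halfOrbit a k (0, 1) j)) N

theorem le_norm_orbitSum {a : ℕ} (ha : 2 ≤ a) (k : ℤ) (N : ℕ) :
    (2 / 3 : ℝ) * ((a * a : ℕ) : ℝ) ^ N ≤ ‖orbitSum a k N‖ :=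
  le_norm_expSum (Nat.mul_le_mul ha ha) (fun _ => norm_liftSign_le _)
    (by simp [halfOrbit, liftSign]) N

theorem tendsto_succ_div_pow {d : ℝ} (hd : 1 < d) (c : ℝ) :
    Tendsto (fun N : ℕ => c * ((N + 1) / d ^ N)) atTop (𝓝 0) := by
  have h0 : (0 : ℝ) ≤ d⁻¹ := by positivity
  have h1 : d⁻¹ < 1 := inv_lt_one_of_one_lt₀ hd
  have h2 := (tendsto_self_mul_const_pow_of_lt_one h0 h1).add
    (tendsto_pow_atTop_nhds_zero_of_lt_one h0 h1)
  have h3 := h2.const_mul c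
  rw [add_zero, mul_zero] at h3
  refine h3.congr fun N => ?_
  rw [inv_pow]
  field_simp

/-- After `N + P` steps the two moving critical values of the perturbed map are at positions `± w`
in the coordinate `s = v ^ 2` around a half-period, up to an error that tends to `0` as `N → ∞`. -/
theorem exists_renormalized_orbit {a : ℕ} (ha : 2 ≤ a) {b : ℂ} {k : ℤ} (hb : 2 * b = k) {τ : ℂ}
    (hτ : 0 < τ.im) :
    ∃ (κ : ℂ → ℂ) (R : ℝ), 0 < R ∧ ContinuousAt κ τ ∧ κ τ ≠ 0 ∧
      ∀ (P : ℕ) (p : ℤ) (σ w : ℂ), σ ^ 2 = (-1) ^ p * w →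
      (∀ i, 1 ≤ i → i ≤ P → 2 * (a ^ i * (σ / a ^ P)) ∉ lat τ) →
      ‖w‖ < R * ((a * a : ℕ) : ℝ) ^ P →
      ∃ ρ > 0, ∃ S : ℕ → ℂ × ℂ → ℂ,
        (∀ᶠ N in atTop, ∀ q ∈ Metric.ball (τ, w) ρ, DifferentiableAt ℂ (S N) q ∧
          ∀ F, IsPerturbation F q.1 a b (renormParam (a * a) κ (orbitSum a k) P N q) →
          ∀ u, u ^ 2 = S N q →
            F^[P + N] (expGL (renormParam (a * a) κ (orbitSum a k) P N q) •
              proj q.1 (halfPt q.1 (p, 1))) =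
              proj q.1 (halfPt q.1 (halfOrbit a k (p, 1) (N + P)) + u)) ∧
        ∀ δ > 0, ∀ᶠ N in atTop, ∀ q ∈ Metric.ball (τ, w) ρ,
          ‖renormParam (a * a) κ (orbitSum a k) P N q‖ < δ ∧ ‖S N q - (-1) ^ p * q.2‖ ≤ δ := by
  set D : ℕ := a * a with hD
  have hD4 : 4 ≤ D := Nat.mul_le_mul ha ha
  have hD2 : 2 ≤ D := le_trans (by norm_num) hD4
  have hDr : (4 : ℝ) ≤ D := by exact_mod_cast hD4
  have hDc : (D : ℂ) ≠ 0 := by exact_mod_cast (by omega : D ≠ 0)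
  have hac : (a : ℂ) ≠ 0 := by exact_mod_cast (by omega : a ≠ 0)
  obtain ⟨Ψ, κ, C, hC, hκc, hκ0, hΨ⟩ := exists_liftsAt_zero hτ
  have hκn : 0 < ‖κ τ‖ := norm_pos_iff.2 hκ0
  have hκd : ∀ᶠ t in 𝓝 τ, DifferentiableAt ℂ κ t ∧ ‖κ τ‖ / 2 < ‖κ t‖ ∧ ‖κ t‖ < 2 * ‖κ τ‖ := by
    have h1 : ∀ᶠ t in 𝓝 τ, ContDiffAt ℂ 1 κ t := hκc.eventually (by simp)
    have h2 := hκc.continuousAt.norm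
    filter_upwards [h1, h2.eventually_const_lt (show ‖κ τ‖ / 2 < ‖κ τ‖ by linarith),
      h2.eventually_lt_const (show ‖κ τ‖ < 2 * ‖κ τ‖ by linarith)] with t h1 h2 h3
    exact ⟨h1.differentiableAt (by simp), h2, h3⟩
  obtain ⟨r₁, hr₁, hΨ⟩ := Metric.eventually_nhds_iff_ball.1 hΨ
  obtain ⟨r₂, hr₂, hκd⟩ := Metric.eventually_nhds_iff_ball.1 hκd
  set r := min r₁ r₂ with hr
  have hr0 : 0 < r := lt_min hr₁ hr₂
  obtain ⟨R, hR, C', hC', hest⟩ := exists_renorm_estimate hD2 (τ := τ) hr0 hC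
    (by positivity : 0 ≤ 2 * ‖κ τ‖)
  refine ⟨κ, R * (‖κ τ‖ / 2) * (2 / 3), by positivity, hκc.continuousAt, hκ0,
    fun P p σ w hσ hv hw => ?_⟩
  have hDP : (1 : ℝ) ≤ (D : ℝ) ^ P := one_le_pow₀ (by linarith)
  have hDPc : (D : ℂ) ^ P ≠ 0 := pow_ne_zero P hDc
  obtain ⟨Ξ, L, hL, hΞ⟩ := exists_lift_iterate hτ hb P hv
  have hbase : (σ / a ^ P) ^ 2 = (-1) ^ p * w / (D : ℂ) ^ P := by
    rw [div_pow, hσ, hD]; push_cast; ring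
  rw [hbase] at hΞ
  obtain ⟨δ₀, hδ₀, hΞ⟩ := Metric.eventually_nhds_iff_ball.1 hΞ
  set μ := renormParam D κ (orbitSum a k) P with hμ
  set ψ : ℕ → ℂ × ℂ × ℂ → ℂ := fun j => Ψ (halfOrbit a k (p, 1) j) with hψ
  obtain ⟨ρ₁, hρ₁, hwball⟩ := Metric.eventually_nhds_iff_ball.1
    ((continuous_norm (E := ℂ)).continuousAt.eventually_lt_const hw)
  set ρ := min (min r δ₀) (min (δ₀ / 2) ρ₁) with hρ
  have hρ0 : 0 < ρ := lt_min (lt_min hr0 hδ₀) (lt_min (half_pos hδ₀) hρ₁)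
  -- First consequences of `q` being close to the base point
  have hq : ∀ q ∈ Metric.ball (τ, w) ρ, dist q.1 τ < r ∧ dist q.1 τ < δ₀ ∧ ‖q.2 - w‖ < δ₀ / 2 ∧
      ‖q.2‖ < R * (‖κ τ‖ / 2) * (2 / 3) * (D : ℝ) ^ P := by
    intro q hq
    rw [Metric.mem_ball, Prod.dist_eq, max_lt_iff] at hq
    refine ⟨hq.1.trans_le ((min_le_left _ _).trans (min_le_left _ _)),
      hq.1.trans_le ((min_le_left _ _).trans (min_le_right _ _)), ?_, hwball _ ?_⟩
    · rw [← dist_eq_norm]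
      exact hq.2.trans_le ((min_le_right _ _).trans (min_le_left _ _))
    · exact Metric.mem_ball.2 (hq.2.trans_le ((min_le_right _ _).trans (min_le_right _ _)))
  have hκq : ∀ t, dist t τ < r → DifferentiableAt ℂ κ t ∧ ‖κ τ‖ / 2 < ‖κ t‖ ∧ ‖κ t‖ < 2 * ‖κ τ‖ :=
    fun t ht => hκd t (Metric.mem_ball.2 (ht.trans_le (min_le_right _ _)))
  have hκne : ∀ t, dist t τ < r → κ t ≠ 0 := fun t ht h => by
    have := (hκq t ht).2.1
    rw [h, norm_zero] at this
    linarith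
  have hΨr : ∀ x ∈ Metric.ball (τ, (0 : ℂ), (0 : ℂ)) r, ∀ e, DifferentiableAt ℂ (Ψ e) x ∧
      ‖Ψ e x - x.2.1 - liftSign e * κ x.1 * x.2.2‖ ≤ C * (‖x.2.2‖ * (‖x.2.1‖ + ‖x.2.2‖)) ∧
      LiftsAt e (Ψ e) x := fun x hx => hΨ x (Metric.ball_subset_ball (min_le_left _ _) hx)
  have hM : ∀ N, orbitSum a k N ≠ 0 := fun N h => by
    have h1 := le_norm_orbitSum ha k N
    rw [h, norm_zero, ← hD] at h1
    have : 0 < (D : ℝ) ^ N := by positivity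
    linarith
  have hμle : ∀ N, ∀ q ∈ Metric.ball (τ, w) ρ, ‖μ N q‖ * (D : ℝ) ^ N ≤ R := by
    intro N q hqb
    -- `R` was scaled by the lower bounds `‖κ τ‖ / 2` and `2 / 3 * D ^ N` for the denominator of `μ`
    obtain ⟨q1, -, -, q4⟩ := hq q hqb
    have h1 := (hκq _ q1).2.1
    have h2 := le_norm_orbitSum ha k N
    rw [← hD] at h2
    have hDN : 0 < (D : ℝ) ^ N := by positivity
    have h3 : 0 < ‖orbitSum a k N‖ := norm_pos_iff.2 (hM N)
    have h4 : 0 < ‖κ q.1‖ := by linarith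
    rw [hμ, renormParam, norm_div, norm_mul, norm_mul, norm_pow, Complex.norm_natCast,
      div_mul_eq_mul_div, div_le_iff₀ (by positivity)]
    calc ‖q.2‖ * (D : ℝ) ^ N ≤ R * (‖κ τ‖ / 2) * (2 / 3) * (D : ℝ) ^ P * (D : ℝ) ^ N := by gcongr
      _ = R * ((D : ℝ) ^ P * ((‖κ τ‖ / 2) * (2 / 3 * (D : ℝ) ^ N))) := by ring
      _ ≤ _ := by gcongr
  have hμ' : ∀ N, ∀ q ∈ Metric.ball (τ, w) ρ, ‖μ N q‖ ≤ R / (D : ℝ) ^ N := fun N q hqb => by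
    rw [le_div_iff₀ (by positivity)]
    exact hμle N q hqb
  set s : ℕ → ℂ × ℂ → ℂ := fun N q => renorm D ψ q.1 (μ N q) N with hs
  set η : ℕ → ℝ := fun N => C' * R ^ 2 * ((N + 1) / (D : ℝ) ^ N) with hη
  have hηt : Tendsto η atTop (𝓝 0) := tendsto_succ_div_pow (by linarith) _
  have hRt : Tendsto (fun N : ℕ => R / (D : ℝ) ^ N) atTop (𝓝 0) :=
    tendsto_const_nhds.div_atTop (tendsto_pow_atTop_atTop_of_one_lt (by linarith))
  have hren : ∀ N, ∀ q ∈ Metric.ball (τ, w) ρ,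
      ‖s N q - (-1) ^ p * q.2 / (D : ℂ) ^ P‖ ≤ η N ∧
      (q.1, 0, μ N q) ∈ Metric.ball (τ, (0 : ℂ), (0 : ℂ)) r ∧
      ∀ j < N, (q.1, D * renorm D ψ q.1 (μ N q) j, μ N q) ∈
        Metric.ball (τ, (0 : ℂ), (0 : ℂ)) r := by
    intro N q hqb
    obtain ⟨q1, -⟩ := hq q hqb
    obtain ⟨h1, h2, h3⟩ := hest ψ κ (fun j => liftSign (halfOrbit a k (p, 1) j))
      (fun _ => norm_liftSign_le _) (fun t ht => (hκq t ht).2.2.le)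
      (fun j x hx => (hΨr x hx _).2.1) N q.1 (μ N q) q1 (hμle N q hqb)
    refine ⟨?_, h2, h3⟩
    have e1 : expSum D (fun j => liftSign (halfOrbit a k (p, 1) j)) N =
        (-1) ^ p * orbitSum a k N := by
      rw [funext fun j => liftSign_halfOrbit a k p j, expSum_mul_left, orbitSum]
    have e2 : μ N q * κ q.1 * ((-1) ^ p * orbitSum a k N) = (-1) ^ p * q.2 / (D : ℂ) ^ P := by
      have := hκne _ q1
      have := hM N
      rw [hμ, renormParam]
      field_simp
    rw [e1, e2] at h1
    refine h1.trans ?_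
    have hDN : 0 < (D : ℝ) ^ N := by positivity
    have h4 : ‖μ N q‖ ^ 2 * (D : ℝ) ^ N ≤ R ^ 2 / (D : ℝ) ^ N := by
      have := pow_le_pow_left₀ (norm_nonneg _) (hμ' N q hqb) 2
      calc _ ≤ (R / (D : ℝ) ^ N) ^ 2 * (D : ℝ) ^ N := by gcongr
        _ = _ := by field_simp
    calc C' * ((N + 1) * ‖μ N q‖ ^ 2 * (D : ℝ) ^ N)
        = C' * ((N + 1) * (‖μ N q‖ ^ 2 * (D : ℝ) ^ N)) := by ring
      _ ≤ C' * ((N + 1) * (R ^ 2 / (D : ℝ) ^ N)) := by gcongr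
      _ = _ := by rw [hη]; ring
  have hin : ∀ᶠ N in atTop, ∀ q ∈ Metric.ball (τ, w) ρ, (q.1, s N q, μ N q) ∈
      Metric.ball (τ, (-1) ^ p * w / (D : ℂ) ^ P, (0 : ℂ)) δ₀ := by
    filter_upwards [hηt.eventually_lt_const (half_pos hδ₀), hRt.eventually_lt_const hδ₀]
      with N h1 h2 q hqb
    obtain ⟨-, q2, q3, -⟩ := hq q hqb
    simp only [Metric.mem_ball, Prod.dist_eq, dist_zero_right, max_lt_iff]
    refine ⟨q2, ?_, (hμ' N q hqb).trans_lt h2⟩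
    have e : s N q - (-1) ^ p * w / (D : ℂ) ^ P = (s N q - (-1) ^ p * q.2 / (D : ℂ) ^ P) +
        (-1) ^ p * (q.2 - w) / (D : ℂ) ^ P := by ring
    have h3 : ‖(-1) ^ p * (q.2 - w) / (D : ℂ) ^ P‖ ≤ ‖q.2 - w‖ := by
      rw [norm_div, norm_mul, norm_neg_one_zpow, one_mul, norm_pow, Complex.norm_natCast]
      exact div_le_self (norm_nonneg _) hDP
    rw [dist_eq_norm, e]
    refine (norm_add_le _ _).trans_lt ?_
    linarith [(hren N q hqb).1]
  refine ⟨ρ, hρ0, fun N q => Ξ (halfOrbit a k (p, 1) N) (q.1, s N q, μ N q), ?_, ?_⟩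
  · filter_upwards [hin] with N hN q hqb
    obtain ⟨q1, -⟩ := hq q hqb
    obtain ⟨-, h2, h3⟩ := hren N q hqb
    obtain ⟨f1, -, f3⟩ := hΞ _ (hN q hqb) (halfOrbit a k (p, 1) N)
    have hμd : DifferentiableAt ℂ (μ N) q := by
      have h4 : DifferentiableAt ℂ (fun q : ℂ × ℂ => κ q.1) q :=
        (hκq _ q1).1.comp q differentiableAt_fst
      have h5 : DifferentiableAt ℂ (fun q : ℂ × ℂ => (D : ℂ) ^ P * (κ q.1 * orbitSum a k N)) q :=
        (h4.mul_const _).const_mul _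
      have h6 : DifferentiableAt ℂ (fun q : ℂ × ℂ => q.2) q := differentiableAt_snd
      have h7 := h6.fun_mul (h5.fun_inv (mul_ne_zero hDPc (mul_ne_zero (hκne _ q1) (hM N))))
      simp only [← div_eq_mul_inv] at h7
      exact h7
    have hsd : DifferentiableAt ℂ (s N) q :=
      DifferentiableAt.comp (g := fun q : ℂ × ℂ => renorm D ψ q.1 q.2 N)
        (f := fun q : ℂ × ℂ => (q.1, μ N q)) q
        (differentiableAt_renorm (fun j x hx => (hΨr x hx _).1) h2 h3)
        (differentiableAt_fst.prodMk hμd)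
    refine ⟨DifferentiableAt.comp (g := Ξ (halfOrbit a k (p, 1) N))
      (f := fun q : ℂ × ℂ => (q.1, s N q, μ N q)) q f1
      (differentiableAt_fst.prodMk (hsd.prodMk hμd)), fun F hF u hu => ?_⟩
    rw [Function.iterate_add_apply, iterate_eq_proj_renorm hF hb (Ψ := Ψ) (hΨr _ h2 _).2.2
      (fun j hj => (hΨr _ (h3 j hj) _).2.2) (cpow_half_sq _), f3 F hF _ u (cpow_half_sq _) hu,
      halfOrbit_add]
  · intro δ hδ
    have ht : Tendsto (fun N => L * (R / (D : ℝ) ^ N) + (D : ℝ) ^ P * η N) atTop (𝓝 0) := by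
      simpa using (hRt.const_mul L).add (hηt.const_mul ((D : ℝ) ^ P))
    filter_upwards [hin, ht.eventually_lt_const hδ, hRt.eventually_lt_const hδ]
      with N hN hlt hlt' q hqb
    refine ⟨(hμ' N q hqb).trans_lt hlt', ?_⟩
    obtain ⟨-, f2, -⟩ := hΞ _ (hN q hqb) (halfOrbit a k (p, 1) N)
    have e : Ξ (halfOrbit a k (p, 1) N) (q.1, s N q, μ N q) - (-1) ^ p * q.2 =
        (Ξ (halfOrbit a k (p, 1) N) (q.1, s N q, μ N q) - (D : ℂ) ^ P * s N q) +
          (D : ℂ) ^ P * (s N q - (-1) ^ p * q.2 / (D : ℂ) ^ P) := by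
      field_simp
      ring
    rw [e]
    refine (norm_add_le _ _).trans (le_trans ?_ hlt.le)
    rw [norm_mul ((D : ℂ) ^ P), norm_pow, Complex.norm_natCast]
    exact add_le_add (f2.trans (mul_le_mul_of_nonneg_left (hμ' N q hqb) hL))
      (mul_le_mul_of_nonneg_left (hren N q hqb).1 (by positivity))


/-! ### Targets for the critical orbits -/

/-- Points `σ` such that `a σ` is a half-period and `σ` is not: the positions, relative to the
half-periods on the critical orbits, of points that `z ↦ a z + b` sends to a half-period over `∞`
or `0`. The shift by `1 / (2 a)` is in the direction of `τ` if `a` is odd, when the critical orbits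
stay at half-periods outside `½ ℤ + ℤ τ`, and in the direction of `1` otherwise. -/
def targetPt (a : ℕ) (A B : ℤ) (τ : ℂ) : ℂ :=
  if Odd a then A + (1 / (2 * a) + B) * τ else (1 / (2 * a) + A) + B * τ

theorem two_mul_targetPt_div_notMem {a : ℕ} (ha : 2 ≤ a) {τ : ℂ} (hτ : 0 < τ.im) (A B : ℤ) (j : ℕ) :
    2 * (targetPt a A B τ / a ^ j) ∉ lat τ := by
  have ha0 : (a : ℝ) ≠ 0 := by exact_mod_cast (by omega : a ≠ 0)
  have ha0' : (a : ℂ) ≠ 0 := by exact_mod_cast (by omega : a ≠ 0)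
  have key : ∀ C m : ℤ, 2 * (1 / (2 * (a : ℝ)) + C) / a ^ j ≠ m := by
    intro C m h
    have h1 : (1 + 2 * a * C : ℝ) = m * a ^ (j + 1) := by
      field_simp at h
      rw [pow_succ]
      linarith
    have h2 : (1 + 2 * a * C : ℤ) = m * a ^ (j + 1) := by exact_mod_cast h1
    have h3 : (a : ℤ) ∣ 1 := by
      have h4 : (a : ℤ) ∣ m * a ^ (j + 1) := (dvd_pow_self _ j.succ_ne_zero).mul_left m
      rw [← h2] at h4
      exact (Int.dvd_add_left ⟨2 * C, by ring⟩).1 h4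
    have := Int.le_of_dvd one_pos h3
    omega
  intro h
  rw [targetPt] at h
  split_ifs at h
  · have e : 2 * ((A + (1 / (2 * a) + B) * τ) / a ^ j : ℂ) =
      ((2 * A / a ^ j : ℝ) : ℂ) + ((2 * (1 / (2 * (a : ℝ)) + B) / a ^ j : ℝ) : ℂ) * τ := by
      push_cast; ring
    rw [e, real_mem_lat_iff hτ] at h
    obtain ⟨-, m, hm⟩ := h
    exact key B m hm
  · have e : 2 * (((1 / (2 * a) + A) + B * τ) / a ^ j : ℂ) =
      ((2 * (1 / (2 * (a : ℝ)) + A) / a ^ j : ℝ) : ℂ) + ((2 * B / a ^ j : ℝ) : ℂ) * τ := by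
      push_cast; ring
    rw [e, real_mem_lat_iff hτ] at h
    obtain ⟨⟨m, hm⟩, -⟩ := h
    exact key A m hm

theorem two_mul_halfPt_add_targetPt_notMem {a : ℕ} (ha : 2 ≤ a) {τ : ℂ} (hτ : 0 < τ.im) (A B : ℤ)
    (e : ℤ × ℤ) : 2 * (halfPt τ e + targetPt a A B τ) ∉ lat τ := by
  intro h
  refine two_mul_targetPt_div_notMem ha hτ A B 0 ?_
  have h1 : 2 * halfPt τ e ∈ lat τ := ⟨e.1, e.2, by rw [halfPt]; ring⟩
  have := sub_mem h h1
  rw [pow_zero, div_one]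
  ring_nf at this ⊢
  exact this

/-- The points at the targets are mapped to half-periods over `∞` or `0`. The parity of the
half-period `halfOrbit a k (p, 1) j` decides which targets have this property: its second coordinate
is a power of `a`. -/
theorem exists_mul_halfPt_add_targetPt {a : ℕ} (ha : a ≠ 0) (τ : ℂ) {b : ℂ} {k : ℤ} (hb : 2 * b = k)
    (A B p : ℤ) (j : ℕ) :
    ∃ l : ℤ, a * (halfPt τ (halfOrbit a k (p, 1) j) + targetPt a A B τ) + b - l / 2 ∈ lat τ := by
  have ha0 : (a : ℂ) ≠ 0 := by exact_mod_cast ha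
  rw [mul_halfPt_add τ hb]
  set e := halfOrbit a k (p, 1) (j + 1) with he
  have he2 : e.2 = (a : ℤ) ^ (j + 1) := by rw [he, halfOrbit_one]
  rw [targetPt, halfPt]
  split_ifs with h
  · have h1 : Odd e.2 := by rw [he2]; exact ((Int.odd_coe_nat a).2 h).pow
    obtain ⟨c, hc⟩ := h1
    refine ⟨e.1, a * A, c + 1 + a * B, ?_⟩
    rw [hc]
    push_cast
    field_simp
    ring
  · have h1 : Even e.2 := by
      rw [he2]
      exact ((Int.even_coe_nat a).2 (Nat.not_odd_iff_even.1 h)).pow_of_ne_zero j.succ_ne_zero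
    obtain ⟨c, hc⟩ := h1
    refine ⟨e.1 + 1, a * A, c + a * B, ?_⟩
    rw [hc]
    push_cast
    field_simp
    ring

theorem exists_targetPt_eq (a : ℕ) :
    ∃ α β : ℝ, 0 ≤ β ∧ ∀ A B τ, targetPt a A B τ = (α + A) + (β + B) * τ := by
  by_cases h : Odd a
  · refine ⟨0, 1 / (2 * a), by positivity, fun A B τ => ?_⟩
    rw [targetPt, if_pos h]; push_cast; ring
  · refine ⟨1 / (2 * a), 0, le_rfl, fun A B τ => ?_⟩
    rw [targetPt, if_neg h]; push_cast; ring

/-- A modulus `τ` close to a given one for which the ratio of two targets is `I`, so that their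
squares are opposite. -/
theorem exists_targetPt_eq_I_mul {a : ℕ} {τ₀ : ℂ} {ε : ℝ} (hε : 0 < ε) :
    ∃ (τ : ℂ) (A B A' B' : ℤ), ‖τ - τ₀‖ < ε ∧ 0 < B ∧
      targetPt a A' B' τ = Complex.I * targetPt a A B τ := by
  obtain ⟨α, β, hβ, hαβ⟩ := exists_targetPt_eq a
  -- For `B' = 0` and `B = n` the equation is `δ τ = I (α + A) - (α + A')`. Rounding gives `A`, `A'`
  -- for which the right-hand side differs from `δ τ₀` by at most `1`, while `‖δ‖ ≥ n`.
  obtain ⟨n, hn⟩ := exists_nat_gt (1 / ε)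
  have hn0 : (0 : ℝ) < n := lt_trans (by positivity) hn
  set δ : ℂ := β - Complex.I * (β + n) with hδ
  have hδn : (n : ℝ) ≤ ‖δ‖ := by
    refine le_trans ?_ (Complex.abs_im_le_norm δ)
    simp only [hδ, Complex.sub_im, Complex.ofReal_im, Complex.mul_im, Complex.I_re, Complex.I_im,
      Complex.add_re, Complex.ofReal_re, Complex.natCast_re, zero_mul, one_mul, zero_add, zero_sub,
      abs_neg]
    rw [abs_of_nonneg (by positivity)]
    linarith
  have hδ0 : δ ≠ 0 := norm_pos_iff.1 (hn0.trans_le hδn)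
  set A := round ((δ * τ₀).im - α)
  set A' := round (-(δ * τ₀).re - α)
  have h1 := abs_sub_round ((δ * τ₀).im - α)
  have h2 := abs_sub_round (-(δ * τ₀).re - α)
  set τ : ℂ := (Complex.I * (α + A) - (α + A')) / δ with hτ
  refine ⟨τ, A, n, A', 0, ?_, by exact_mod_cast hn0, ?_⟩
  · have e : τ - τ₀ = (Complex.I * (α + A) - (α + A') - δ * τ₀) / δ := by
      rw [hτ]; field_simp
    have h3 : ‖Complex.I * (α + A) - (α + A') - δ * τ₀‖ ≤ 1 := by
      refine (Complex.norm_le_abs_re_add_abs_im _).trans ?_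
      have e1 : (Complex.I * (α + A) - (α + A') - δ * τ₀).re = -(δ * τ₀).re - α - A' := by
        simp; ring
      have e2 : (Complex.I * (α + A) - (α + A') - δ * τ₀).im = -((δ * τ₀).im - α - A) := by
        simp; ring
      rw [e1, e2, abs_neg]
      linarith
    rw [e, norm_div, div_lt_iff₀ (hn0.trans_le hδn)]
    refine h3.trans_lt ?_
    rw [div_lt_iff₀ hε] at hn
    nlinarith
  · rw [hαβ, hαβ]
    have e : δ * τ = Complex.I * (α + A) - (α + A') := by rw [hτ]; field_simp
    rw [hδ] at e
    push_cast
    linear_combination e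

theorem SepHolOn.of_differentiableAt {f : ℂ × ℂ → ℂ} {U : Set (ℂ × ℂ)} (hU : IsOpen U)
    (hf : ∀ q ∈ U, DifferentiableAt ℂ f q) : SepHolOn f U where
  isOpen := hU
  bdd p hp := ⟨‖f p‖ + 1, ((hf p hp).continuousAt.norm.eventually_lt continuousAt_const
    (lt_add_one _)).mono fun _ h => h.le⟩
  fst p hp := DifferentiableAt.comp (g := f) (f := fun x => (x, p.2)) p.1 (hf p hp)
    (differentiableAt_id.prodMk (differentiableAt_const _))
  snd p hp := DifferentiableAt.comp (g := f) (f := fun x => (p.1, x)) p.2 (hf p hp)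
    ((differentiableAt_const _).prodMk differentiableAt_id)

/-- The limit equations for the two critical orbits have a nondegenerate zero. -/
theorem exists_equiv_hasStrictFDerivAt {σ σ' : ℂ → ℂ} {y y' τ w : ℂ} (h : HasStrictDerivAt σ y τ)
    (h' : HasStrictDerivAt σ' y' τ) (hne : σ τ * y + σ' τ * y' ≠ 0) :
    ∃ T : (ℂ × ℂ) ≃L[ℂ] (ℂ × ℂ), HasStrictFDerivAt
      (fun q : ℂ × ℂ => (q.2 - σ q.1 ^ 2, -q.2 - σ' q.1 ^ 2)) (T : (ℂ × ℂ) →L[ℂ] (ℂ × ℂ))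
      (τ, w) := by
  have hs : ∀ {g : ℂ → ℂ} {d : ℂ}, HasStrictDerivAt g d τ →
      HasStrictFDerivAt (fun q : ℂ × ℂ => g q.1 ^ 2)
        ((2 * g τ * d) • ContinuousLinearMap.fst ℂ ℂ ℂ) (τ, w) := by
    intro g d hg
    have h1 := hg.fun_pow 2
    have h2 := HasStrictDerivAt.comp_hasStrictFDerivAt (h₂ := fun t => g t ^ 2)
      (f := Prod.fst) (τ, w) h1 (hasStrictFDerivAt_fst (𝕜 := ℂ) (F := ℂ))
    simpa only [Nat.cast_ofNat, Nat.add_one_sub_one, pow_one] using! h2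
  have h1 := (hasStrictFDerivAt_snd (𝕜 := ℂ) (p := (τ, w))).fun_sub (hs h)
  have h2 := (hasStrictFDerivAt_snd (𝕜 := ℂ) (p := (τ, w))).fun_neg.fun_sub (hs h')
  have h3 := h1.prodMk h2
  set T := (ContinuousLinearMap.snd ℂ ℂ ℂ - (2 * σ τ * y) • ContinuousLinearMap.fst ℂ ℂ ℂ).prod
    (-ContinuousLinearMap.snd ℂ ℂ ℂ - (2 * σ' τ * y') • ContinuousLinearMap.fst ℂ ℂ ℂ) with hT
  have hinj : Function.Injective (T : (ℂ × ℂ) →ₗ[ℂ] (ℂ × ℂ)) := by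
    refine (injective_iff_map_eq_zero _).2 fun x hx => ?_
    simp only [hT, ContinuousLinearMap.coe_coe, ContinuousLinearMap.prod_apply,
      sub_apply, neg_apply, smul_apply,
      ContinuousLinearMap.coe_fst', ContinuousLinearMap.coe_snd', smul_eq_mul,
      Prod.mk_eq_zero] at hx
    have h4 : (σ τ * y + σ' τ * y') * x.1 = 0 := by
      linear_combination (-1 / 2) * hx.1 - 1 / 2 * hx.2
    have h5 : x.1 = 0 := (mul_eq_zero.1 h4).resolve_left hne
    have h6 : x.2 = 0 := by
      have := hx.1
      rw [h5] at this
      simpa using this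
    exact Prod.ext h5 h6
  refine ⟨(LinearEquiv.ofInjectiveEndo _ hinj).toContinuousLinearEquiv, ?_⟩
  have e : ((LinearEquiv.ofInjectiveEndo _ hinj).toContinuousLinearEquiv :
      (ℂ × ℂ) →L[ℂ] (ℂ × ℂ)) = T := ContinuousLinearMap.ext fun _ => rfl
  rw [e]
  exact h3

/-- Arbitrarily small perturbations for which both moving critical values are preperiodic to the
critical values `∞` and `0` of `proj τ`, after passing through a critical point. -/
theorem exists_parameters {a : ℕ} (ha : 2 ≤ a) {b : ℂ} {k : ℤ} (hb : 2 * b = k) {τ₀ : ℂ}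
    (hτ₀ : 0 < τ₀.im) {ε : ℝ} (hε : 0 < ε) :
    ∃ τ m : ℂ, 0 < τ.im ∧ ‖τ - τ₀‖ < ε ∧ ‖m‖ < ε ∧ ∀ F, IsPerturbation F τ a b m →
      ∀ p : ℤ, p = 0 ∨ p = 1 → ∃ (n : ℕ) (z : ℂ),
        F^[n] (expGL m • proj τ (halfPt τ (p, 1))) = proj τ z ∧ 2 * z ∉ lat τ ∧
          ∃ l : ℤ, a * z + b - l / 2 ∈ lat τ := by
  set ε' := min ε τ₀.im with hε'
  have hε'0 : 0 < ε' := lt_min hε hτ₀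
  have him : ∀ τ, ‖τ - τ₀‖ < ε' → 0 < τ.im := by
    intro τ h
    have h2 := (Complex.abs_im_le_norm (τ - τ₀)).trans_lt (h.trans_le (min_le_right _ _))
    have h3 := (abs_lt.1 h2).1
    rw [Complex.sub_im] at h3
    linarith
  obtain ⟨τ, A, B, A', B', hτε, hB, hI⟩ :=
    exists_targetPt_eq_I_mul (a := a) (τ₀ := τ₀) (half_pos hε'0)
  have hτ : 0 < τ.im := him τ (by linarith)
  have ha0 : a ≠ 0 := by omega
  have hac : (a : ℂ) ≠ 0 := by exact_mod_cast ha0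
  obtain ⟨κ, R, hR, -, -, hmain⟩ := exists_renormalized_orbit ha hb hτ
  set w := targetPt a A B τ ^ 2 with hw
  have hw' : targetPt a A' B' τ ^ 2 = -w := by
    rw [hI, mul_pow, Complex.I_sq, hw]; ring
  -- `P` further steps carry the domain of the first-order estimate to a neighbourhood of `w`.
  obtain ⟨P, hP⟩ : ∃ P : ℕ, ‖w‖ < R * ((a * a : ℕ) : ℝ) ^ P := by
    have h1 : (1 : ℝ) < ((a * a : ℕ) : ℝ) := by
      exact_mod_cast (by nlinarith : 1 < a * a)
    obtain ⟨P, hP⟩ := pow_unbounded_of_one_lt (‖w‖ / R) h1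
    refine ⟨P, ?_⟩
    rwa [div_lt_iff₀ hR, mul_comm] at hP
  have hv : ∀ A B i, 1 ≤ i → i ≤ P → 2 * (a ^ i * (targetPt a A B τ / a ^ P)) ∉ lat τ := by
    intro A B i _ hi
    have := two_mul_targetPt_div_notMem ha hτ A B (P - i)
    have e : (a : ℂ) ^ P = a ^ i * a ^ (P - i) := by rw [← pow_add, Nat.add_sub_cancel' hi]
    rw [e]
    convert this using 2
    field_simp
  obtain ⟨ρ, hρ, S, hS, hSl⟩ := hmain P 0 (targetPt a A B τ) w (by simp [hw]) (hv A B) hP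
  obtain ⟨ρ', hρ', S', hS', hSl'⟩ := hmain P 1 (targetPt a A' B' τ) w (by simp [hw']) (hv A' B') hP
  set r := min ρ ρ' with hr
  have hr0 : 0 < r := lt_min hρ hρ'
  have hb1 : ∀ q ∈ Metric.ball (τ, w) r, q ∈ Metric.ball (τ, w) ρ := fun q hq =>
    Metric.ball_subset_ball (min_le_left _ _) hq
  have hb2 : ∀ q ∈ Metric.ball (τ, w) r, q ∈ Metric.ball (τ, w) ρ' := fun q hq =>
    Metric.ball_subset_ball (min_le_right _ _) hq
  have hd : ∃ y y' : ℂ, HasStrictDerivAt (targetPt a A B) y τ ∧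
      HasStrictDerivAt (targetPt a A' B') y' τ ∧ y + Complex.I * y' ≠ 0 := by
    obtain ⟨α, β, hβ, hαβ⟩ := exists_targetPt_eq a
    have hder : ∀ A B : ℤ, HasStrictDerivAt (targetPt a A B) (β + B) τ := by
      intro A B
      rw [funext (hαβ A B)]
      simpa using ((hasStrictDerivAt_id τ).const_mul ((β : ℂ) + B)).const_add ((α : ℂ) + A)
    refine ⟨_, _, hder A B, hder A' B', fun h => ?_⟩
    have h1 := congrArg Complex.re h
    have h2 : (0 : ℝ) < B := by exact_mod_cast hB
    simp only [Complex.add_re, Complex.ofReal_re, Complex.intCast_re, Complex.mul_re,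
      Complex.I_re, Complex.I_im, Complex.add_im, Complex.ofReal_im, Complex.intCast_im,
      Complex.zero_re] at h1
    linarith
  obtain ⟨y, y', hy, hy', hyy⟩ := hd
  have hσ0 : targetPt a A B τ ≠ 0 := by
    intro h
    have := two_mul_targetPt_div_notMem ha hτ A B 0
    rw [h] at this
    simp at this
  obtain ⟨T, hT⟩ := exists_equiv_hasStrictFDerivAt (w := w) hy hy' (by
    rw [hI]
    have : targetPt a A B τ * y + Complex.I * targetPt a A B τ * y' =
      targetPt a A B τ * (y + Complex.I * y') := by ring
    rw [this]
    exact mul_ne_zero hσ0 hyy)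
  have hex := exists_zero_of_nondegenerate hT (by simp [hw', hw])
    (g₁ := fun N q => S N q - (-1) ^ (0 : ℤ) * q.2)
    (g₂ := fun N q => S' N q - (-1) ^ (1 : ℤ) * q.2) hr0
    (hS.mono fun N hN => SepHolOn.of_differentiableAt Metric.isOpen_ball fun q hq =>
      (hN q (hb1 q hq)).1.fun_sub (by fun_prop))
    (hS'.mono fun N hN => SepHolOn.of_differentiableAt Metric.isOpen_ball fun q hq =>
      (hN q (hb2 q hq)).1.fun_sub (by fun_prop))
    (fun δ hδ => (hSl δ hδ).mono fun N hN q hq => (hN q (hb1 q hq)).2)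
    (fun δ hδ => (hSl' δ hδ).mono fun N hN q hq => (hN q (hb2 q hq)).2)
    (ε := min r (ε' / 2)) (lt_min hr0 (half_pos hε'0))
  obtain ⟨N, ⟨q, hq, hq0⟩, hN1, hN2, hN3⟩ :=
    (hex.and (hS.and (hS'.and (hSl ε hε)))).exists
  have hqr : q ∈ Metric.ball (τ, w) r := Metric.ball_subset_ball (min_le_left _ _) hq
  have hqτ : ‖q.1 - τ₀‖ < ε' := by
    have h1 := Metric.ball_subset_ball (min_le_right _ _) hq
    rw [Metric.mem_ball, Prod.dist_eq, max_lt_iff, dist_eq_norm] at h1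
    have h2 := norm_add_le (q.1 - τ) (τ - τ₀)
    rw [sub_add_sub_cancel] at h2
    linarith [h1.1]
  have hqim := him _ hqτ
  simp only [Prod.mk_add_mk, Prod.mk_eq_zero] at hq0
  refine ⟨q.1, renormParam (a * a) κ (orbitSum a k) P N q, hqim, hqτ.trans_le (min_le_left _ _),
    (hN3 q (hb1 q hqr)).1, fun F hF p hp => ?_⟩
  rcases hp with rfl | rfl
  · refine ⟨P + N, _, (hN1 q (hb1 q hqr)).2 F hF (targetPt a A B q.1) ?_,
      two_mul_halfPt_add_targetPt_notMem ha hqim _ _ _,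
      exists_mul_halfPt_add_targetPt ha0 q.1 hb _ _ _ _⟩
    have := hq0.1
    rw [zpow_zero, one_mul] at this
    linear_combination -this
  · refine ⟨P + N, _, (hN2 q (hb2 q hqr)).2 F hF (targetPt a A' B' q.1) ?_,
      two_mul_halfPt_add_targetPt_notMem ha hqim _ _ _,
      exists_mul_halfPt_add_targetPt ha0 q.1 hb _ _ _ _⟩
    have := hq0.2
    rw [zpow_one] at this
    linear_combination -this


/-! ### Approximation of flexible Lattès maps -/

theorem norm_exp_le_two {m : ℂ} (h : ‖m‖ < Real.log 2) : ‖Complex.exp m‖ ≤ 2 := by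
  refine (Complex.norm_exp_le_exp_norm m).trans ?_
  rw [← Real.exp_log (by norm_num : (0 : ℝ) < 2)]
  exact Real.exp_le_exp.2 h.le

/-- A perturbation whose two moving critical values are mapped to half-periods, after passing
through a critical point, is strictly postcritically finite and not a Lattès map. -/
theorem strictlyPCF_and_not_isLattes {D a : ℕ} (ha : 2 ≤ a) {b : ℂ} {k : ℤ} (hb : 2 * b = k)
    {τ m : ℂ} (hτ : 0 < τ.im) (hm : ‖m‖ < Real.log 2) {A : GL (Fin 2) ℂ} {g : RatSpace D}
    (hg : ∀ z, g.toFun (A • proj τ z) = A • expGL m • proj τ (a * z + b))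
    (h : ∀ F, IsPerturbation F τ a b m → ∀ p : ℤ, p = 0 ∨ p = 1 → ∃ (n : ℕ) (z : ℂ),
        F^[n] (expGL m • proj τ (halfPt τ (p, 1))) = proj τ z ∧ 2 * z ∉ lat τ ∧
          ∃ l : ℤ, a * z + b - l / 2 ∈ lat τ) :
    IsStrictlyPostcriticallyFinite g ∧ ¬ IsLattes g := by
  set F : OnePoint ℂ → OnePoint ℂ := fun x => A⁻¹ • g.toFun (A • x) with hF
  have hFp : IsPerturbation F τ a b m := fun z => by simp only [hF, hg, inv_smul_smul]
  have hFhol : ∀ x, SphHol F x := fun x => by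
    have := SphHol.conj (G := g.toFun) (x := x) A⁻¹ (g.sphHol _)
    simpa only [inv_inv] using this
  have hFP : IsPerturbed F τ a b m :=
    ⟨hτ, ha, ⟨k, hb⟩, hFhol, hFp, norm_exp_le_two hm, norm_exp_le_two (by rwa [norm_neg])⟩
  have e0 : halfPt τ (0, 1) = τ / 2 := by simp [halfPt]
  have e1 : halfPt τ (1, 1) = τ / 2 + 1 / 2 := by simp [halfPt]; ring
  have hfin : ∀ w z : ℂ, ∀ n : ℕ, ∀ l : ℤ, F^[n] (expGL m • proj τ w) = proj τ z →
      a * z + b - l / 2 ∈ lat τ → F^[n + 1] (expGL m • proj τ w) = ∞ ∨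
        F^[n + 1] (expGL m • proj τ w) = ((0 : ℂ) : OnePoint ℂ) := by
    intro w z n l h1 h2
    rw [Function.iterate_succ_apply', h1, hFp, proj_congr hτ h2]
    rcases proj_int_half hτ l with h3 | h3
    · left; rw [h3, expGL_smul_infty]
    · right; rw [h3, expGL_smul_coe, mul_zero]
  obtain ⟨n, z, h1, h2, l, h3⟩ := h F hFp 0 (Or.inl rfl)
  obtain ⟨n', z', h1', -, l', h3'⟩ := h F hFp 1 (Or.inr rfl)
  rw [e0] at h1
  rw [e1] at h1'
  have hPCF : StrictlyPCF F := hFP.strictlyPCF ⟨n + 1, hfin _ _ _ _ h1 h3⟩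
    ⟨n' + 1, hfin _ _ _ _ h1' h3'⟩
  refine ⟨?_, fun hL => ?_⟩
  · have h4 := hPCF.conj hFhol A
    simpa only [hF, smul_inv_smul] using! h4
  · obtain ⟨Λ, α, β, Θ, hΘ⟩ := exists_isTorusSemiconj_of_isLattes hL (A := A) (F := F)
      fun x => by simp only [hF, smul_inv_smul]
    exact hFP.not_isTorusSemiconj h1 h2 h3 hΘ

theorem IsFlexibleLattes.exists_tendsto {D : ℕ} (hD : 2 ≤ D) {f : RatSpace D}
    (hf : IsFlexibleLattes f) : ∃ g : ℕ → RatSpace D,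
      (∀ k, IsStrictlyPostcriticallyFinite (g k) ∧ ¬ IsLattes (g k)) ∧
        Tendsto g atTop (𝓝 f) := by
  obtain ⟨a, b, τ₀, A, ha, rfl, hb, hτ₀, hf⟩ := hf.exists_normal_form hD
  obtain ⟨k, hk⟩ : ∃ k : ℤ, 2 * b = k := by
    rcases hb with rfl | rfl
    · exact ⟨0, by simp⟩
    · exact ⟨1, by norm_num⟩
  obtain ⟨G, hGc, hG⟩ := exists_family A (by omega : a ≠ 0) ⟨k, hk⟩ hτ₀
  have hG0 : G (τ₀, 0) = f := by
    apply RatSpace.toFun_injective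
    funext x
    obtain ⟨z, hz⟩ := proj_surjective hτ₀ (A⁻¹ • x)
    rw [← smul_inv_smul A x, ← hz, hG _ hτ₀, hf, expGL_zero_smul]
  have hlog : 0 < Real.log 2 := Real.log_pos (by norm_num)
  choose τ m hτ hτε hmε hgood using fun n : ℕ => exists_parameters ha hk hτ₀
    (lt_min hlog (by positivity : (0 : ℝ) < 1 / (n + 1)))
  refine ⟨fun n => G (τ n, m n), fun n => ?_, ?_⟩
  · exact strictlyPCF_and_not_isLattes ha hk (hτ n) ((hmε n).trans_le (min_le_left _ _))
      (hG (τ n, m n) (hτ n)) (hgood n)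
  · have h1 : Tendsto τ atTop (𝓝 τ₀) := by
      rw [tendsto_iff_norm_sub_tendsto_zero]
      exact squeeze_zero (fun _ => norm_nonneg _)
        (fun n => ((hτε n).trans_le (min_le_right _ _)).le) tendsto_one_div_add_atTop_nhds_zero_nat
    have h2 : Tendsto m atTop (𝓝 0) :=
      squeeze_zero_norm (fun n => ((hmε n).trans_le (min_le_right _ _)).le)
        tendsto_one_div_add_atTop_nhds_zero_nat
    rw [← hG0]
    exact hGc.tendsto.comp (h1.prodMk_nhds h2)

end LattesMaps

end

theorem mainTheorem1 (D : ℕ) (hD : 2 ≤ D) (f : LattesMaps.RatSpace D)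
    (hf : LattesMaps.IsFlexibleLattes f) :
    ∃ g : ℕ → LattesMaps.RatSpace D,
      (∀ k, LattesMaps.IsStrictlyPostcriticallyFinite (g k) ∧ ¬ LattesMaps.IsLattes (g k)) ∧
        Filter.Tendsto g Filter.atTop (nhds f) :=
  hf.exists_tendsto hD
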